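/- **Theorem (Consistency).** Let $0\le t_a\le t_s$ with $t_a<n/3$ and $t_a+2t_s<n$. Let $\mathsf{ABA}$ be any message-driven Byzantine agreement protocol for $n$ parties that is $t_a$-secure (valid, consistent, terminating) in an asynchronous network, and let $\mathsf{Bcast}$ be either any message-driven reliable broadcast protocol that is $t_s$-valid and $t_a$-consistent in an asynchronous network, or Bracha's broadcast with threshold $t_s$ described below. Then the protocol $\Pi_{\mathsf{SMR}}$ below is $t_a$-consistent when run in an asynchronous network, and $t_s$-consistent when run in a synchronous network. *Model.* $n$ parties communicate over authenticated point-to-point channels, with ideal (unforgeable) signatures valid only in the context (slot, sub-instance, iteration) in which they are made. An unbounded adaptive adversary sees all messages and the states of corrupted parties, schedules deliveries, gives the parties their inputs, and makes corrupted parties behave arbitrarily; a party is honest if it is never corrupted. Synchronous with bound $\Delta>0$: all parties start together, their (discrete) clocks tick together, every message sent by a party while honest is delivered within time $\Delta$. Asynchronous: every such message is eventually delivered, and local clocks tick forever but are otherwise arbitrary. An ideal leader election picks, for each key, an independent uniform leader as soon as a majority of the parties have called it with that key; in the synchronous case all parties get the answer at once. *Consistency.* $\Pi$ is $t$-consistent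 in a network if there is a negligible $\varepsilon(\kappa)$ such that for all $\kappa$, all $\Delta>0$, every adversary and every slot $k$, the following event has probability at most $\varepsilon(\kappa)$: at most $t$ parties are corrupted, the network behaves as specified, and some honest party outputs a block $B$ in slot $k$ while some honest party never outputs $B$ in slot $k$. The security properties of $\mathsf{ABA}$ and $\mathsf{Bcast}$ are likewise required with overwhelming probability, uniformly over adversaries, in executions with eventual delivery in which every honest party begins at some time: BA validity (if all honest inputs equal $v$, all honest parties output $v$), BA consistency (all honest parties output the same bit), BA termination (all honest parties output); broadcast validity (if the sender is honest with input $v$, all honest parties output $v$), broadcast consistency (no honest party outputs, or all honest parties output the same value). *Bracha's broadcast.* The sender sends $v^*$ to all. A party that receives $v^*$ from the sender (for the first time) sends $(\mathsf{echo},v^*)$ to all; on $(\mathsf{echo},v)$ from $n-t_s$ parties or $(\mathsf{ready},v)$ from $t_s+1$ parties it sends $(\mathsf{ready},v)$ to all, once; on $(\mathsf{ready},v)$ from $n-t_s$ parties it outputs $v$. Having output does not keep a party from echoing. *$\Pi_{\mathsf{ACS}}$ with inputs $v_i$.* Run $\mathsf{Bcast}_i$ with sender $P_i$ and input $v_i$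 for all $i$. When $\mathsf{Bcast}_i$ outputs, run $\mathsf{ABA}_i$ with input $1$ if not yet begun. Let $S^*=\{i:\mathsf{ABA}_i\text{ output }1\}$. When $|S^*|\ge n-t_a$, run all remaining $\mathsf{ABA}_i$ with input $0$. $C_1(v)$: at least $n-t_s$ broadcasts output $v$. $C_2(v)$: $|S^*|\ge n-t_a$, all $\mathsf{ABA}_i$ terminated, and a majority of $\{\mathsf{Bcast}_i\}_{i\in S^*}$ output $v$. $C_3$: $|S^*|\ge n-t_a$, all $\mathsf{ABA}_i$ terminated, and all $\{\mathsf{Bcast}_i\}_{i\in S^*}$ have output. Output $\{v\}$ if $C_1(v)$; else $\{v\}$ if $C_2(v)$; else, if $C_3$, the set of outputs of $\{\mathsf{Bcast}_i\}_{i\in S^*}$. Once $C_1(v)$ holds for some $v$, stop taking part in the $\mathsf{ABA}_i$. *Block agreement $\Pi_{\mathsf{BLA}}$.* A pair $(B,\Sigma)$ of a block and a set of signed buffers is valid if $\Sigma$ contains buffers signed by more than $t_s$ distinct parties, all of them subsets of $B$. A $k$-vote on $(B,\Sigma)$ is a tuple $(k,B,\Sigma,C)$ with $(B,\Sigma)$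 valid and $k=0$ or $C$ a set of signatures of a majority of the parties on $(\mathsf{Commit},k',B,\Sigma)$ with $k'\ge k$. A party starts with $(k^*,B^*,\Sigma^*,C^*)=(0,B,\Sigma,\emptyset)$. Iteration $k=1,\dots,\kappa$ starts at time $5(k-1)\Delta$; relative to its start: at time $0$, for every proposer $P_p$, send the signed status $(k^*,B^*,\Sigma^*,C^*)$ to $P_p$; at $\Delta$, as proposer, on correct statuses (votes) from a majority send them as one signed proposal to all; at $2\Delta$, for each $p$, if a correct proposal $m$ was received from $P_p$, forward it to all (otherwise the result for $p$ is $\bot$); at $3\Delta$ the result for $p$ is $\bot$ if a correct proposal of $P_p$ other than $m$ was received from anyone, and otherwise the pair in the status of $m$ with maximal $k$ (lowest index on ties); then call the leader election for $k$ and, if the result $(B_\ell,\Sigma_\ell)$ for the leader $\ell$ is not $\bot$, send a signed $(\mathsf{Commit},k,B_\ell,\Sigma_\ell)$ to all; at $4\Delta$, on such commits on the party's own $(B_\ell,\Sigma_\ell)$ from a majority, form the certificate $C$ from them, send $(\mathsf{Notify},k,B_\ell,\Sigma_\ell,C)$ to all, and take $(B_\ell,\Sigma_\ell,C)$ with grade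 $2$; at $5\Delta$, without grade $2$, take grade $1$ and $(B,\Sigma,C)$ from a correct notify message, if any. At the end of the iteration, with positive grade set $(k^*,B^*,\Sigma^*,C^*):=(k,B,\Sigma,C)$; with grade $2$ output $(B,\Sigma)$ (the first output counts; parties continue after an output). *$\Pi_{\mathsf{SMR}}$.* Each $P_i$ holds a buffer $\mathsf{buf}_i$ of transactions to which transactions are added arbitrarily. For $k=1,2,\dots$, starting at local time $T_k=(\Delta+\kappa\Delta)(k-1)$: (1) enter epoch $k$; (2) send the signed $\mathsf{buf}_i$ to all; (3) while $|\Sigma|\le t_s$, on the first signed buffer $\mathsf{buf}_j$ from $P_j$ add it to $B$ (union) and to $\Sigma$; (4) at time $T_k+\Delta$ run $\Pi_{\mathsf{BLA}}$ on $(B,\Sigma)$; (5) if it gives an output with a valid pair $(B^*,\Sigma^*)$, use that; otherwise at time $T_k+\Delta+\kappa\Delta$ abandon it and set $(B^*,\Sigma^*):=(B,\Sigma)$; steps (4), (5) wait for the end of step (3) if necessary; (6) run $\Pi_{\mathsf{ACS}}$ with input $B^*$; (7) on its output $S$, output the block $\bigcup_{\hat B\in S}\hat B$ in slot $k$ and remove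 it from $\mathsf{buf}_i$. -/

import Mathlib

open MeasureTheory

namespace NetSMR

noncomputable section

open scoped Classical

/-! ## Protocols and their executions -/

/-- What a party can react to: an external input, a message received over the authenticated channel
from party `j`, a tick of its own clock, or an answer `l` of the leader-election mechanism to the
call with key `k`. -/
inductive Event (n : ℕ) (In Msg LKey : Type) : Type
  | input (x : In)
  | recv (j : Fin n) (m : Msg)
  | tick
  | leader (k : LKey) (l : Fin n)

/-- A protocol for `n` parties. Party `i` is a state machine with access to private random coins; coin
`c` is uniform on `faces c + 1` values. One step of party `i` returns the new state, the messages
to be sent (with their recipients), and the calls to the leader-election mechanism.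
Signatures are ideal: `sigs m` is the set of signatures that occur in the message `m`, and
`signer σ` is the party whose signature `σ` is. -/
structure Protocol (n : ℕ) (In Out : Type) where
  State : Type
  Msg : Type
  Sig : Type
  LKey : Type
  Coin : Type
  faces : Coin → ℕ
  signer : Sig → Fin n
  sigs : Msg → Set Sig
  init : Fin n → State
  output : State → Out
  step : Fin n → ((c : Coin) → Fin (faces c + 1)) → State → Event n In Msg LKey →
    State × List (Fin n × Msg) × List LKey

section Execution

variable {n : ℕ} {In Out : Type}

/-- All the randomness of an execution: the coins of every party, and the leaders. -/
abbrev Protocol.Rand (P : Protocol n In Out) : Type :=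
  ((x : Fin n × P.Coin) → Fin (P.faces x.2 + 1)) × (P.LKey → Fin n)

/-- Independent uniform coins and independent uniform leaders. -/
def Protocol.law [NeZero n] (P : Protocol n In Out) : Measure P.Rand :=
  (Measure.infinitePi fun x : Fin n × P.Coin =>
    (PMF.uniformOfFintype (Fin (P.faces x.2 + 1))).toMeasure).prod
  (Measure.infinitePi fun _ : P.LKey => (PMF.uniformOfFintype (Fin n)).toMeasure)

/-- A message in the network, with the time at which it was sent. -/
structure Packet (P : Protocol n In Out) where
  src : Fin n
  dst : Fin n
  msg : P.Msg
  sentAt : ℕ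

/-- A global configuration. `net` lists all messages that were sent by parties while they were honest,
`delivered` the positions in that list of those already delivered, `time` counts the clock ticks,
`requests k` is the set of parties that called the leader election with key `k`, and `led` tells
which answers of the leader election have reached which party. -/
structure Config (P : Protocol n In Out) where
  state : Fin n → P.State
  corrupted : Finset (Fin n)
  net : List (Packet P)
  delivered : Finset ℕ
  time : ℕ
  requests : P.LKey → Finset (Fin n)
  led : Set (Fin n × P.LKey)

/-- The leader for key `k` is chosen as soon as a majority of the parties have called with `k`. -/
def Config.leader {P : Protocol n In Out} (ω : P.Rand) (c : Config P) (k : P.LKey) :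
    Option (Fin n) :=
  if n < 2 * (c.requests k).card then some (ω.2 k) else none

/-- What the adversary can do in one step: give an input to an honest party, deliver the message at
position `idx` of the network, send a message in the name of a corrupted party, corrupt a party,
let the clocks of the parties in `S` tick simultaneously, let the answer of the leader election
reach a party, call the leader election in the name of a corrupted party, or nothing. -/
inductive Action (P : Protocol n In Out) : Type
  | input (i : Fin n) (x : In)
  | deliver (idx : ℕ)
  | inject (src dst : Fin n) (m : P.Msg)
  | corrupt (i : Fin n)
  | tick (S : Finset (Fin n))
  | leader (i : Fin n) (k : P.LKey)
  | request (i : Fin n) (k : P.LKey)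
  | idle

/-- The honest parties in `S` simultaneously process the event `e`. -/
def Config.activate {P : Protocol n In Out} (ω : P.Rand) (c : Config P) (S : Finset (Fin n))
    (e : Event n In P.Msg P.LKey) : Config P :=
  let H := S \ c.corrupted
  let r := fun i => P.step i (fun a => ω.1 (i, a)) (c.state i) e
  { c with
    state := fun i => if i ∈ H then (r i).1 else c.state i
    net := c.net ++ (List.finRange n).flatMap fun i =>
      if i ∈ H then (r i).2.1.map fun x => ⟨i, x.1, x.2, c.time⟩ else []
    requests := fun k => c.requests k ∪ H.filter fun i => k ∈ (r i).2.2 }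

/-- The effect of an action; impossible actions have no effect. A message sent in the name of a
corrupted party may contain signatures of corrupted parties, and signatures of other parties only
if they were contained in a message that was sent by a party while it was honest. -/
def Config.apply {P : Protocol n In Out} (ω : P.Rand) (c : Config P) : Action P → Config P
  | .input i x => c.activate ω {i} (.input x)
  | .deliver idx =>
    match c.net[idx]? with
    | none => c
    | some p =>
      if idx ∈ c.delivered then c
      else { c with delivered := insert idx c.delivered }.activate ω {p.dst} (.recv p.src p.msg)
  | .inject src dst m =>
    if src ∈ c.corrupted ∧
        ∀ σ ∈ P.sigs m, P.signer σ ∈ c.corrupted ∨ ∃ p ∈ c.net, σ ∈ P.sigs p.msg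
    then c.activate ω {dst} (.recv src m) else c
  | .corrupt i => { c with corrupted := insert i c.corrupted }
  | .tick S => { c with time := c.time + 1 }.activate ω S .tick
  | .leader i k =>
    match c.leader ω k with
    | none => c
    | some l =>
      if (i, k) ∈ c.led then c
      else { c with led := insert (i, k) c.led }.activate ω {i} (.leader k l)
  | .request i k =>
    if i ∈ c.corrupted
    then { c with requests := Function.update c.requests k (insert i (c.requests k)) } else c
  | .idle => c

/-- What the adversary sees of a configuration: all messages, the leaders chosen so far, the outputs,
and the internal states of the corrupted parties. -/
structure View (P : Protocol n In Out) where
  corrupted : Finset (Fin n)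
  net : List (Packet P)
  delivered : Finset ℕ
  time : ℕ
  requests : P.LKey → Finset (Fin n)
  leader : P.LKey → Option (Fin n)
  output : Fin n → Out
  revealed : Fin n → Option P.State

def Config.view {P : Protocol n In Out} (ω : P.Rand) (c : Config P) : View P where
  corrupted := c.corrupted
  net := c.net
  delivered := c.delivered
  time := c.time
  requests := c.requests
  leader := c.leader ω
  output := fun i => P.output (c.state i)
  revealed := fun i => if i ∈ c.corrupted then some (c.state i) else none

/-- An adversary (of unbounded power) chooses its next action from everything that it has seen, the
most recent view first. It also controls the network and the external inputs. The failure
probability of a randomized adversary is an average of those of deterministic ones. -/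
abbrev Adversary (P : Protocol n In Out) : Type := List (View P) → Action P

/-- The configuration after `t` steps, and the views of the adversary up to then. -/
def Protocol.exec (P : Protocol n In Out) (A : Adversary P) (ω : P.Rand) :
    ℕ → Config P × List (View P)
  | 0 =>
    let c : Config P := ⟨P.init, ∅, [], ∅, 0, fun _ => ∅, ∅⟩
    (c, [c.view ω])
  | t + 1 =>
    let h := P.exec A ω t
    let c := h.1.apply ω (A h.2)
    (c, c.view ω :: h.2)

abbrev Protocol.cfg (P : Protocol n In Out) (A : Adversary P) (ω : P.Rand) (t : ℕ) : Config P :=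
  (P.exec A ω t).1

/-- The action taken in configuration number `t`. -/
def Protocol.act (P : Protocol n In Out) (A : Adversary P) (ω : P.Rand) (t : ℕ) : Action P :=
  A (P.exec A ω t).2

/-- The output state of party `i` after `t` steps. -/
def Protocol.out (P : Protocol n In Out) (A : Adversary P) (ω : P.Rand) (t : ℕ) (i : Fin n) : Out :=
  P.output ((P.cfg A ω t).state i)

/-- Party `i` is never corrupted. -/
def Protocol.Honest (P : Protocol n In Out) (A : Adversary P) (ω : P.Rand) (i : Fin n) : Prop :=
  ∀ t, i ∉ (P.cfg A ω t).corrupted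

/-- At most `b` parties are corrupted during the whole execution. -/
def Protocol.AtMost (P : Protocol n In Out) (b : ℕ) (A : Adversary P) (ω : P.Rand) : Prop :=
  ∀ t, (P.cfg A ω t).corrupted.card ≤ b

/-- Every message is eventually delivered. -/
def Protocol.EventualDelivery (P : Protocol n In Out) (A : Adversary P) (ω : P.Rand) : Prop :=
  ∀ t idx p, (P.cfg A ω t).net[idx]? = some p → P.Honest A ω p.dst →
    ∃ t', idx ∈ (P.cfg A ω t').delivered

/-- An asynchronous network: messages are eventually delivered, and the local clocks, although
unrelated to each other and to the delivery of messages, do not stop. -/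
def Protocol.Async (P : Protocol n In Out) (A : Adversary P) (ω : P.Rand) : Prop :=
  P.EventualDelivery A ω ∧
  ∀ i, P.Honest A ω i → ∀ N, ∃ t ≥ N, ∃ S, P.act A ω t = .tick S ∧ i ∈ S

/-- A synchronous network with delay bound `Δ` (in ticks): all clocks tick together forever, a message
is delivered before the clocks have ticked `Δ` times since it was sent, and the answers of the
leader-election mechanism reach the parties before the next tick. -/
def Protocol.Sync (P : Protocol n In Out) (Δ : ℕ) (A : Adversary P) (ω : P.Rand) : Prop :=
  (∀ t S, P.act A ω t = .tick S →
    S = Finset.univ ∧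
    (∀ idx p, (P.cfg A ω t).net[idx]? = some p → p.dst ∉ (P.cfg A ω t).corrupted →
      p.sentAt + Δ ≤ (P.cfg A ω t).time + 1 → idx ∈ (P.cfg A ω t).delivered) ∧
    (∀ i k, i ∉ (P.cfg A ω t).corrupted → ((P.cfg A ω t).leader ω k).isSome →
      (i, k) ∈ (P.cfg A ω t).led)) ∧
  ∀ N, ∃ t ≥ N, ∃ S, P.act A ω t = .tick S

end Execution

/-- A function of the security parameter that tends to zero faster than every inverse polynomial. -/
def Negligible (ε : ℕ → ℝ) : Prop :=
  Asymptotics.SuperpolynomialDecay Filter.atTop (fun κ : ℕ => (κ : ℝ)) ε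

/-! ## Asynchronous protocols: reliable broadcast and Byzantine agreement -/

/-- A message-driven protocol without clocks. Each activation of a party (by its input, `Sum.inl x`, or
by a message, `Sum.inr (j, m)`) uses one fresh coin, uniform on `coins + 1` values, and may produce
an output. The machine itself has to hold back the messages that arrive before its input, if it
wants to. A party terminates by producing output; afterwards its machine may still answer messages. -/
structure AsyncProtocol (n : ℕ) (I O : Type) where
  State : Type
  Msg : Type
  Sig : Type
  coins : ℕ
  signer : Sig → Fin n
  sigs : Msg → Set Sig
  init : Fin n → State
  step : Fin n → Fin (coins + 1) → State → I ⊕ (Fin n × Msg) →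
    State × List (Fin n × Msg) × Option O

section AsyncProtocols

variable {n : ℕ} {I O : Type}

/-- A running instance at one party: the state of the machine, the input (once the party has begun),
the number of activations so far, and the output (write-once). -/
structure Inst (P : AsyncProtocol n I O) where
  st : P.State
  inp : Option I
  cnt : ℕ
  out : Option O

def Inst.new (P : AsyncProtocol n I O) (i : Fin n) : Inst P := ⟨P.init i, none, 0, none⟩

/-- One activation; a second input is ignored. -/
def Inst.step {P : AsyncProtocol n I O} (i : Fin n) (coin : ℕ → Fin (P.coins + 1)) (s : Inst P)
    (e : I ⊕ (Fin n × P.Msg)) : Inst P × List (Fin n × P.Msg) :=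
  let r := P.step i (coin s.cnt) s.st e
  match e with
  | .inl x =>
    match s.inp with
    | some _ => (s, [])
    | none => (⟨r.1, some x, s.cnt + 1, s.out <|> r.2.2⟩, r.2.1)
  | .inr _ => (⟨r.1, s.inp, s.cnt + 1, s.out <|> r.2.2⟩, r.2.1)

/-- A message-driven protocol run on its own; the visible output of a party is its input together with
its output, as far as they exist. -/
def AsyncProtocol.alone (P : AsyncProtocol n I O) : Protocol n I (Option I × Option O) where
  State := Inst P
  Msg := P.Msg
  Sig := P.Sig
  LKey := Empty
  Coin := ℕ
  faces := fun _ => P.coins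
  signer := P.signer
  sigs := P.sigs
  init := Inst.new P
  output := fun s => (s.inp, s.out)
  step := fun i ω s e =>
    match e with
    | .input x => let r := s.step i ω (.inl x); (r.1, r.2, [])
    | .recv j m => let r := s.step i ω (.inr (j, m)); (r.1, r.2, [])
    | .tick => (s, [], [])
    | .leader _ _ => (s, [], [])

/-- Party `i` at some time begins with input `x`. -/
def AsyncProtocol.Begins (P : AsyncProtocol n I O) (A : Adversary P.alone) (ω : P.alone.Rand)
    (i : Fin n) (x : I) : Prop :=
  ∃ t, (P.alone.out A ω t i).1 = some x

/-- Party `i` at some time outputs `v`. -/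
def AsyncProtocol.Outputs (P : AsyncProtocol n I O) (A : Adversary P.alone) (ω : P.alone.Rand)
    (i : Fin n) (v : O) : Prop :=
  ∃ t, (P.alone.out A ω t i).2 = some v

/-- An execution in an asynchronous network with at most `b` corrupted parties, in which every honest
party begins at some time. -/
def AsyncProtocol.Runs (P : AsyncProtocol n I O) (b : ℕ) (A : Adversary P.alone)
    (ω : P.alone.Rand) : Prop :=
  P.alone.AtMost b A ω ∧ P.alone.EventualDelivery A ω ∧
    ∀ i, P.alone.Honest A ω i → ∃ x, P.Begins A ω i x

/-- Byzantine agreement, validity: if every honest party's input is `v`, then every honest party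
outputs `v`. -/
def BAValid [NeZero n] (b : ℕ) (P : ℕ → AsyncProtocol n Bool Bool) : Prop :=
  ∃ ε, Negligible ε ∧ ∀ κ (A : Adversary (P κ).alone),
    (P κ).alone.law {ω | (P κ).Runs b A ω ∧
      ¬ ∀ v, (∀ i, (P κ).alone.Honest A ω i → (P κ).Begins A ω i v) →
        ∀ i, (P κ).alone.Honest A ω i → (P κ).Outputs A ω i v} ≤ ENNReal.ofReal (ε κ)

/-- Byzantine agreement, consistency: every honest party outputs the same value. -/
def BAConsistent [NeZero n] (b : ℕ) (P : ℕ → AsyncProtocol n Bool Bool) : Prop :=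
  ∃ ε, Negligible ε ∧ ∀ κ (A : Adversary (P κ).alone),
    (P κ).alone.law {ω | (P κ).Runs b A ω ∧
      ¬ ∃ v, ∀ i, (P κ).alone.Honest A ω i → (P κ).Outputs A ω i v} ≤ ENNReal.ofReal (ε κ)

/-- Byzantine agreement, termination: every honest party terminates with some output. -/
def BATerminating [NeZero n] (b : ℕ) (P : ℕ → AsyncProtocol n Bool Bool) : Prop :=
  ∃ ε, Negligible ε ∧ ∀ κ (A : Adversary (P κ).alone),
    (P κ).alone.law {ω | (P κ).Runs b A ω ∧
      ¬ ∀ i, (P κ).alone.Honest A ω i → ∃ v, (P κ).Outputs A ω i v} ≤ ENNReal.ofReal (ε κ)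

/-- `b`-secure Byzantine agreement in an asynchronous network; the protocol may depend on the security
parameter. -/
def BASecure [NeZero n] (b : ℕ) (P : ℕ → AsyncProtocol n Bool Bool) : Prop :=
  BAValid b P ∧ BAConsistent b P ∧ BATerminating b P

variable {V : Type}

/-- Executions of a broadcast protocol with sender `p`: exactly the sender begins with a value. -/
def BcastRuns (P : AsyncProtocol n (Option V) V) (p : Fin n) (b : ℕ) (A : Adversary P.alone)
    (ω : P.alone.Rand) : Prop :=
  P.Runs b A ω ∧ ∀ i x, P.Begins A ω i x → (x.isSome ↔ i = p)

/-- Reliable broadcast, validity, for a family `P` of protocols indexed by the security parameter and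
the sender: if the sender is honest, every honest party outputs the sender's value. -/
def BcastValid [NeZero n] (b : ℕ) (P : ℕ → Fin n → AsyncProtocol n (Option V) V) : Prop :=
  ∃ ε, Negligible ε ∧ ∀ κ p (A : Adversary (P κ p).alone),
    (P κ p).alone.law {ω | BcastRuns (P κ p) p b A ω ∧
      ¬ ∀ v, (P κ p).alone.Honest A ω p → (P κ p).Begins A ω p (some v) →
        ∀ i, (P κ p).alone.Honest A ω i → (P κ p).Outputs A ω i v} ≤ ENNReal.ofReal (ε κ)

/-- Reliable broadcast, consistency: either no honest party outputs anything, or all honest parties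
output the same value. -/
def BcastConsistent [NeZero n] (b : ℕ) (P : ℕ → Fin n → AsyncProtocol n (Option V) V) : Prop :=
  ∃ ε, Negligible ε ∧ ∀ κ p (A : Adversary (P κ p).alone),
    (P κ p).alone.law {ω | BcastRuns (P κ p) p b A ω ∧
      ¬ ((∀ i v, (P κ p).alone.Honest A ω i → ¬ (P κ p).Outputs A ω i v) ∨
        ∃ v, ∀ i, (P κ p).alone.Honest A ω i → (P κ p).Outputs A ω i v)} ≤ ENNReal.ofReal (ε κ)

end AsyncProtocols

/-- Send `m` to every party. -/
def toAll {n : ℕ} {M : Type} (m : M) : List (Fin n × M) := (List.finRange n).map fun j => (j, m)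

/-! ## Bracha's reliable broadcast with threshold `ts` -/

section Bracha

variable {n : ℕ} {V : Type}

inductive BMsg (V : Type) : Type
  | val (v : V)
  | echo (v : V)
  | ready (v : V)

def BMsg.value : BMsg V → V
  | .val v => v
  | .echo v => v
  | .ready v => v

/-- `log` holds the received messages in order, `ready` the values on which ready was sent. -/
structure BState (n : ℕ) (V : Type) where
  started : Bool
  log : List (Fin n × BMsg V)
  echoed : Bool
  ready : Finset V

/-- The number of distinct parties from which the message `m` was received. -/
def BState.count (s : BState n V) (m : BMsg V) : ℕ :=
  (Finset.univ.filter fun j : Fin n => (j, m) ∈ s.log).card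

/-- The first value received from the sender `p`. -/
def BState.fromSender (p : Fin n) (s : BState n V) : Option V :=
  s.log.findSome? fun x =>
    match x.2 with
    | .val v => if x.1 = p then some v else none
    | _ => none

/-- Apply the rules of the protocol to everything received so far. -/
def BState.rules (ts : ℕ) (p : Fin n) (s : BState n V) :
    BState n V × List (Fin n × BMsg V) × Option V :=
  let echoes : List (Fin n × BMsg V) :=
    match s.echoed, s.fromSender p with
    | false, some v => toAll (.echo v)
    | _, _ => []
  let new : List V := (s.log.map fun x => x.2.value).dedup.filter fun v =>
    decide ((n - ts ≤ s.count (.echo v) ∨ ts + 1 ≤ s.count (.ready v)) ∧ v ∉ s.ready)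
  ( { s with
      echoed := s.echoed || (s.fromSender p).isSome
      ready := s.ready ∪ new.toFinset },
    echoes ++ new.flatMap (fun v => toAll (.ready v)),
    if h : ∃ v, n - ts ≤ s.count (.ready v) then some h.choose else none )

/-- Bracha's broadcast with sender `p`. Messages that arrive before the party begins are kept. An
output does not keep a party from echoing the sender's value when that value arrives later. -/
def bracha (n : ℕ) (V : Type) (ts : ℕ) (p : Fin n) : AsyncProtocol n (Option V) V where
  State := BState n V
  Msg := BMsg V
  Sig := Empty
  coins := 0
  signer := Empty.elim
  sigs := fun _ => ∅
  init := fun _ => ⟨false, [], false, ∅⟩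
  step := fun i _ s e =>
    match e with
    | .inl x =>
      let first : List (Fin n × BMsg V) :=
        match x with
        | some v => if i = p then toAll (.val v) else []
        | none => []
      let r := { s with started := true }.rules ts p
      (r.1, first ++ r.2.1, r.2.2)
    | .inr y =>
      let s' := { s with log := s.log ++ [y] }
      if s.started then s'.rules ts p else (s', [], none)

end Bracha

/-! ## Block agreement -/

section BlockAgreement

variable {n : ℕ} {Tx : Type}

/-- A pair `(B, Σ)` of a block and a set of signed buffers; `(j, b) ∈ Σ` stands for the buffer `b` with
a signature of party `j`. -/
abbrev SPair (n : ℕ) (Tx : Type) : Type := Finset Tx × Finset (Fin n × Finset Tx)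

/-- The pair is `t`-valid. -/
def Valid (t : ℕ) (q : SPair n Tx) : Prop :=
  t < (q.2.image Prod.fst).card ∧ ∀ x ∈ q.2, x.2 ⊆ q.1

/-- A tuple `(k, B, Σ, C)`; `(j, k') ∈ C` stands for a signature of party `j` on
`(Commit, k', B, Σ)`. -/
structure Vote (n : ℕ) (Tx : Type) where
  k : ℕ
  pair : SPair n Tx
  cert : Finset (Fin n × ℕ)

/-- The tuple is a `k`-vote, where pairs are required to be `s`-valid. -/
def Vote.Good (s : ℕ) (v : Vote n Tx) : Prop :=
  Valid s v.pair ∧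
    (v.k = 0 ∨ ((∀ x ∈ v.cert, v.k ≤ x.2) ∧ n < 2 * (v.cert.image Prod.fst).card))

/-- `C` is a `k`-certificate: signatures of a majority of the parties with index `k`. -/
def IsCert (k : ℕ) (C : Finset (Fin n × ℕ)) : Prop :=
  (∀ x ∈ C, x.2 = k) ∧ n < 2 * (C.image Prod.fst).card

/-- The content of a proposal: the status of each party from which the proposer received one. -/
abbrev Proposal (n : ℕ) (Tx : Type) : Type := Fin n → Option (Vote n Tx)

/-- A correctly formed proposal contains correctly formed statuses of a majority of the parties. -/
def GoodProposal (s : ℕ) (m : Proposal n Tx) : Prop :=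
  (∀ j v, m j = some v → v.Good s) ∧ n < 2 * (Finset.univ.filter fun j => (m j).isSome).card

/-- The pair in the status with maximal `k` (that of the party with the lowest index, if tied). -/
def Proposal.best (m : Proposal n Tx) : Option (SPair n Tx) :=
  (((List.finRange n).filterMap m).argmax Vote.k).map Vote.pair

/-- Messages of block agreement, all with the number `k` of the iteration. `status k p i v` is signed
by `i` and meant for the proposer `p`; `propose k p m` is signed by the proposer `p`;
`commit k i q` is signed by `i`; `notify k q C` is not signed. -/
inductive BlaMsg (n : ℕ) (Tx : Type) : Type
  | status (k : ℕ) (p i : Fin n) (v : Vote n Tx)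
  | propose (k : ℕ) (p : Fin n) (m : Proposal n Tx)
  | commit (k : ℕ) (i : Fin n) (q : SPair n Tx)
  | notify (k : ℕ) (q : SPair n Tx) (C : Finset (Fin n × ℕ))

/-- The state of one party in block agreement: `start` is the local time at which it began, `cur` is
`(k*, B*, Σ*, C*)`, `log` holds the received messages, and `out` is the output (write-once). The
data of the current iteration are: `prop p`, the proposal of `p` accepted at time `2Δ`; `res p`, the
output of the proposal protocol with proposer `p`; `called`, whether the leader election was called;
`graded`, the certificate output with grade 2. Finally `known k` is the leader of iteration `k`. -/
structure BlaState (n : ℕ) (Tx : Type) where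
  start : Option ℕ
  cur : Vote n Tx
  log : List (Fin n × BlaMsg n Tx)
  iter : ℕ
  prop : Fin n → Option (Proposal n Tx)
  res : Fin n → Option (SPair n Tx)
  called : Bool
  graded : Option (Vote n Tx)
  known : ℕ → Option (Fin n)
  out : Option (SPair n Tx)

def BlaState.new : BlaState n Tx :=
  ⟨none, ⟨0, (∅, ∅), ∅⟩, [], 0, fun _ => none, fun _ => none, false, none, fun _ => none, none⟩

/-- The first correctly formed status of party `j` received for proposer `p` in iteration `k`. -/
def BlaState.statusOf (s : ℕ) (b : BlaState n Tx) (k : ℕ) (p j : Fin n) : Option (Vote n Tx) :=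
  b.log.findSome? fun x =>
    match x.2 with
    | .status k' p' i v => if k' = k ∧ p' = p ∧ i = j ∧ x.1 = j ∧ v.Good s then some v else none
    | _ => none

/-- The first correctly formed proposal of `p` received from `p` itself in iteration `k`. -/
def BlaState.proposalOf (s : ℕ) (b : BlaState n Tx) (k : ℕ) (p : Fin n) : Option (Proposal n Tx) :=
  b.log.findSome? fun x =>
    match x.2 with
    | .propose k' p' m => if k' = k ∧ p' = p ∧ x.1 = p ∧ GoodProposal s m then some m else none
    | _ => none

/-- The certificate in the first correctly formed notification received in iteration `k`. -/
def BlaState.notified (s : ℕ) (b : BlaState n Tx) (k : ℕ) : Option (Vote n Tx) :=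
  b.log.findSome? fun x =>
    match x.2 with
    | .notify k' q C => if k' = k ∧ Valid s q ∧ IsCert k C then some ⟨k, q, C⟩ else none
    | _ => none

/-- The pair output by the proposal protocol of the leader, if the leader is known. -/
def BlaState.leaderPair (b : BlaState n Tx) : Option (SPair n Tx) :=
  (b.known b.iter).bind b.res

/-- The commit message, if there is one to be sent. -/
def BlaState.commits (i : Fin n) (b : BlaState n Tx) : List (Fin n × BlaMsg n Tx) :=
  match b.leaderPair with
  | some q => toAll (.commit b.iter i q)
  | none => []

/-- The end of the current iteration, at time `5kΔ`. -/
def BlaState.finish (s : ℕ) (b : BlaState n Tx) : BlaState n Tx :=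
  match b.graded with
  | some v => { b with cur := v, out := b.out <|> some v.pair }
  | none =>
    match b.notified s b.iter with
    | some v => { b with cur := v }
    | none => b

/-- What party `i` does at time `5(k-1)Δ + rΔ` of block agreement (`r = 0, …, 4`), in iteration `k`.
The last component says whether the leader election is called (with index `k`). -/
def BlaState.phase (s : ℕ) (i : Fin n) (b : BlaState n Tx) (k r : ℕ) :
    BlaState n Tx × List (Fin n × BlaMsg n Tx) × Bool :=
  match r with
  | 0 =>
    ({ b with
        iter := k, prop := fun _ => none, res := fun _ => none, called := false, graded := none },
      (List.finRange n).map (fun p => (p, .status k p i b.cur)), false)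
  | 1 =>
    let m : Proposal n Tx := fun j => b.statusOf s k i j
    (b, if GoodProposal s m then toAll (.propose k i m) else [], false)
  | 2 =>
    let pr : Fin n → Option (Proposal n Tx) := fun p => b.proposalOf s k p
    ({ b with prop := pr },
      (List.finRange n).flatMap (fun p =>
        match pr p with
        | some m => toAll (.propose k p m)
        | none => []), false)
  | 3 =>
    let b' := { b with
      called := true
      res := fun p =>
        match b.prop p with
        | none => none
        | some m =>
          if ∃ j m', (j, BlaMsg.propose k p m') ∈ b.log ∧ GoodProposal s m' ∧ m' ≠ m then none
          else m.best }
    (b', b'.commits i, true)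
  | 4 =>
    match b.leaderPair with
    | none => (b, [], false)
    | some q =>
      let J := Finset.univ.filter fun j : Fin n => (j, BlaMsg.commit k j q) ∈ b.log
      let C := J.image fun j => (j, k)
      if n < 2 * J.card ∧ Valid s q then
        ({ b with graded := some ⟨k, q, C⟩ }, toAll (.notify k q C), false)
      else (b, [], false)
  | _ => (b, [], false)

/-- What party `i` does when its clock reads `τ`: iterations `1, …, κ` of block agreement, abandoned at
local time `deadline`. The last component is the list of calls to the leader election. -/
def BlaState.tick (s Δ κ deadline : ℕ) (i : Fin n) (b : BlaState n Tx) (τ : ℕ) :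
    BlaState n Tx × List (Fin n × BlaMsg n Tx) × List ℕ :=
  match b.start with
  | none => (b, [], [])
  | some t₀ =>
    let q := (τ - t₀) / Δ
    if Δ ∣ τ - t₀ ∧ τ ≤ deadline then
      let b' := if q % 5 = 0 ∧ 0 < q ∧ q ≤ 5 * κ then b.finish s else b
      if τ < deadline ∧ q < 5 * κ then
        let r := b'.phase s i (q / 5 + 1) (q % 5)
        (r.1, r.2.1, if r.2.2 then [q / 5 + 1] else [])
      else (b', [], [])
    else (b, [], [])

/-- The answer `l` of the leader election for iteration `k` arrives. -/
def BlaState.onLeader (i : Fin n) (b : BlaState n Tx) (k : ℕ) (l : Fin n) :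
    BlaState n Tx × List (Fin n × BlaMsg n Tx) :=
  if b.known k = none then
    let b' := { b with known := Function.update b.known k (some l) }
    (b', if b.called ∧ b.iter = k then b'.commits i else [])
  else (b, [])

end BlockAgreement

/-! ## State machine replication -/

section SMR

variable {n : ℕ} {Tx : Type}

/-- The thresholds, the security parameter, and the delay bound. -/
structure Params where
  ta : ℕ
  ts : ℕ
  κ : ℕ
  Δ : ℕ

variable (Bc : Fin n → AsyncProtocol n (Option (Finset Tx)) (Finset Tx))
  (Ba : AsyncProtocol n Bool Bool)

/-- Messages, tagged with the slot; the messages of the `j`th broadcast and of the `j`th Byzantine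
agreement of a slot also with `j`. The message `buf k i b` is signed by `i`. -/
inductive Msg : Type
  | buf (k : ℕ) (i : Fin n) (b : Finset Tx)
  | bla (k : ℕ) (m : BlaMsg n Tx)
  | bc (k : ℕ) (j : Fin n) (m : (Bc j).Msg)
  | ba (k : ℕ) (j : Fin n) (m : Ba.Msg)

/-- Signatures, each in the context (slot, iteration, proposer, instance) in which it is valid. -/
inductive Sig : Type
  | buf (k : ℕ) (i : Fin n) (b : Finset Tx)
  | status (k l : ℕ) (p i : Fin n) (v : Vote n Tx)
  | propose (k l : ℕ) (p : Fin n) (m : Proposal n Tx)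
  | commit (k l : ℕ) (i : Fin n) (q : SPair n Tx)
  | bc (k : ℕ) (j : Fin n) (σ : (Bc j).Sig)
  | ba (k : ℕ) (j : Fin n) (σ : Ba.Sig)

variable {Bc Ba}

def Sig.signer : Sig Bc Ba → Fin n
  | .buf _ i _ => i
  | .status _ _ _ i _ => i
  | .propose _ _ p _ => p
  | .commit _ _ i _ => i
  | .bc _ j σ => (Bc j).signer σ
  | .ba _ _ σ => Ba.signer σ

/-- The signatures in a pair `(B, Σ)` in slot `k`. -/
def pairSigs (k : ℕ) (q : SPair n Tx) : Set (Sig Bc Ba) := {σ | ∃ x ∈ q.2, σ = .buf k x.1 x.2}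

/-- The signatures in a set of commit signatures on `q` in slot `k`. -/
def certSigs (k : ℕ) (q : SPair n Tx) (C : Finset (Fin n × ℕ)) : Set (Sig Bc Ba) :=
  {σ | ∃ x ∈ C, σ = .commit k x.2 x.1 q}

def voteSigs (k : ℕ) (v : Vote n Tx) : Set (Sig Bc Ba) :=
  pairSigs k v.pair ∪ certSigs k v.pair v.cert

def blaSigs (k : ℕ) : BlaMsg n Tx → Set (Sig Bc Ba)
  | .status l p i v => insert (.status k l p i v) (voteSigs k v)
  | .propose l p m => insert (.propose k l p m)
      {σ | ∃ j v, m j = some v ∧ (σ = .status k l p j v ∨ σ ∈ voteSigs k v)}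
  | .commit l i q => insert (.commit k l i q) (pairSigs k q)
  | .notify _ q C => pairSigs k q ∪ certSigs k q C

def Msg.sigs : Msg Bc Ba → Set (Sig Bc Ba)
  | .buf k i b => {.buf k i b}
  | .bla k m => blaSigs k m
  | .bc k j m => {σ | ∃ σ' ∈ (Bc j).sigs m, σ = .bc k j σ'}
  | .ba k j m => {σ | ∃ σ' ∈ Ba.sigs m, σ = .ba k j σ'}

/-- The state of one party in one slot. `pair` is `(B, Σ)`; `star` is `B*`, the input to the common
subset protocol, which has begun once `star` is set; `bc j` and `ba j` are the `j`th broadcast and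
the `j`th Byzantine agreement of that protocol, and `acs` is its output. -/
structure SlotState (Bc : Fin n → AsyncProtocol n (Option (Finset Tx)) (Finset Tx))
    (Ba : AsyncProtocol n Bool Bool) where
  entered : Bool
  pair : SPair n Tx
  bla : BlaState n Tx
  star : Option (Finset Tx)
  bc : (j : Fin n) → Inst (Bc j)
  ba : Fin n → Inst Ba
  acs : Option (Finset (Finset Tx))
  block : Option (Finset Tx)

/-- The private coins of a party: one for each activation of each broadcast and each Byzantine
agreement in each slot. -/
abbrev CoinKey (n : ℕ) : Type := (ℕ × Fin n × ℕ) ⊕ (ℕ × Fin n × ℕ)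

variable (Bc Ba) in
abbrev coinFaces (c : CoinKey n) : ℕ :=
  match c with
  | .inl x => (Bc x.2.1).coins
  | .inr _ => Ba.coins

variable (Bc Ba) in
abbrev Tape : Type := (c : CoinKey n) → Fin (coinFaces Bc Ba c + 1)

variable (Bc Ba) in
/-- Messages to be sent, and calls `(slot, iteration)` to the leader election. -/
abbrev Effects : Type := List (Fin n × Msg Bc Ba) × List (ℕ × ℕ)

def SlotState.new (i : Fin n) : SlotState Bc Ba :=
  ⟨false, (∅, ∅), BlaState.new, none, fun j => Inst.new (Bc j) i, fun _ => Inst.new Ba i,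
    none, none⟩

/-- Activate the `j`th broadcast of slot `k`. -/
def SlotState.bcStep (i : Fin n) (ω : Tape Bc Ba) (k : ℕ) (x : SlotState Bc Ba) (j : Fin n)
    (e : Option (Finset Tx) ⊕ (Fin n × (Bc j).Msg)) :
    SlotState Bc Ba × List (Fin n × Msg Bc Ba) :=
  let r := (x.bc j).step i (fun c => ω (.inl (k, j, c))) e
  ({ x with bc := Function.update x.bc j r.1 }, r.2.map fun y => (y.1, .bc k j y.2))

/-- Activate the `j`th Byzantine agreement of slot `k`. -/
def SlotState.baStep (i : Fin n) (ω : Tape Bc Ba) (k : ℕ) (x : SlotState Bc Ba) (j : Fin n)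
    (e : Bool ⊕ (Fin n × Ba.Msg)) : SlotState Bc Ba × List (Fin n × Msg Bc Ba) :=
  let r := (x.ba j).step i (fun c => ω (.inr (k, j, c))) e
  ({ x with ba := Function.update x.ba j r.1 }, r.2.map fun y => (y.1, .ba k j y.2))

/-- `f` applied for one party after the other, collecting the messages. -/
def forAll (f : SlotState Bc Ba → Fin n → SlotState Bc Ba × List (Fin n × Msg Bc Ba))
    (x : SlotState Bc Ba) : SlotState Bc Ba × List (Fin n × Msg Bc Ba) :=
  (List.finRange n).foldl (fun a j => let r := f a.1 j; (r.1, a.2 ++ r.2)) (x, [])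

/-- The set `S*` of those Byzantine agreements that have output 1. -/
def SlotState.ones (x : SlotState Bc Ba) : Finset (Fin n) :=
  Finset.univ.filter fun j => (x.ba j).out = some true

def SlotState.C1v (ts : ℕ) (x : SlotState Bc Ba) (v : Finset Tx) : Prop :=
  n - ts ≤ (Finset.univ.filter fun j => (x.bc j).out = some v).card

def SlotState.C1 (ts : ℕ) (x : SlotState Bc Ba) : Prop := ∃ v, x.C1v ts v

def SlotState.C2v (ta : ℕ) (x : SlotState Bc Ba) (v : Finset Tx) : Prop :=
  n - ta ≤ x.ones.card ∧ (∀ j, (x.ba j).out.isSome) ∧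
    x.ones.card < 2 * (x.ones.filter fun j => (x.bc j).out = some v).card

def SlotState.C2 (ta : ℕ) (x : SlotState Bc Ba) : Prop := ∃ v, x.C2v ta v

def SlotState.C3 (ta : ℕ) (x : SlotState Bc Ba) : Prop :=
  n - ta ≤ x.ones.card ∧ (∀ j, (x.ba j).out.isSome) ∧ ∀ j ∈ x.ones, (x.bc j).out.isSome

/-- The output of the common subset protocol according to its three exits. -/
def SlotState.exit (pa : Params) (x : SlotState Bc Ba) : Option (Finset (Finset Tx)) :=
  if h : x.C1 pa.ts then some {h.choose}
  else if h : x.C2 pa.ta then some {h.choose}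
  else if x.C3 pa.ta then
    some (x.ones.biUnion fun j => (x.bc j).out.toFinset)
  else none

/-- Steps of the common subset protocol that are due, once it has begun: Byzantine agreements are
begun with input 1 when the corresponding broadcast has output, and with input 0 when `n - ta` of
them have output 1 (unless `C1` holds: then a party takes no more part in them); the exits are
checked, and the block is the union of the output set. -/
def SlotState.settle (pa : Params) (i : Fin n) (ω : Tape Bc Ba) (k : ℕ) (x : SlotState Bc Ba) :
    SlotState Bc Ba × List (Fin n × Msg Bc Ba) :=
  let r₁ := if x.C1 pa.ts then (x, []) else
    forAll (fun y j =>
      if (y.bc j).out.isSome ∧ (y.ba j).inp = none then y.baStep i ω k j (.inl true)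
      else (y, [])) x
  let r₂ := if r₁.1.C1 pa.ts ∨ r₁.1.ones.card < n - pa.ta then (r₁.1, []) else
    forAll (fun y j =>
      if (y.ba j).inp = none then y.baStep i ω k j (.inl false) else (y, [])) r₁.1
  let acs := r₂.1.acs <|> r₂.1.exit pa
  ({ r₂.1 with acs := acs, block := acs.map fun S => S.biUnion id }, r₁.2 ++ r₂.2)

/-- Begin the common subset protocol with input `B`: begin all broadcasts, as the sender in the
`i`th one. -/
def SlotState.beginACS (pa : Params) (i : Fin n) (ω : Tape Bc Ba) (k : ℕ) (x : SlotState Bc Ba)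
    (B : Finset Tx) : SlotState Bc Ba × List (Fin n × Msg Bc Ba) :=
  let r₁ := forAll (fun y j => y.bcStep i ω k j (.inl (if j = i then some B else none)))
    { x with star := some B }
  let r₂ := r₁.1.settle pa i ω k
  (r₂.1, r₁.2 ++ r₂.2)

/-- The time at which slot `k` begins (slots are counted from 0). -/
def Params.T (pa : Params) (k : ℕ) : ℕ := (pa.Δ + pa.κ * pa.Δ) * k

/-- What party `i` does for slot `k` when its clock reads `τ`. Block agreement begins at time
`T k + Δ`, or later if `ts + 1` signed buffers are only received later; the common subset protocol
begins when block agreement gives a `ts`-valid output, or else at time `T k + Δ + κΔ`, or later if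
`ts + 1` signed buffers are only received later. -/
def SlotState.tick (pa : Params) (i : Fin n) (ω : Tape Bc Ba) (k : ℕ) (buf : Finset Tx) (τ : ℕ)
    (x : SlotState Bc Ba) : SlotState Bc Ba × Effects Bc Ba :=
  let deadline := pa.T k + pa.Δ + pa.κ * pa.Δ
  let m₁ : List (Fin n × Msg Bc Ba) := if τ = pa.T k then toAll (.buf k i buf) else []
  let x₁ := if τ = pa.T k then { x with entered := true } else x
  let ready : Prop := x₁.entered = true ∧ pa.ts < x₁.pair.2.card
  let x₂ :=
    if ready ∧ x₁.bla.start = none ∧ x₁.star = none ∧ pa.T k + pa.Δ ≤ τ ∧ τ < deadline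
    then { x₁ with bla := { x₁.bla with start := some τ, cur := ⟨0, x₁.pair, ∅⟩ } } else x₁
  let r := x₂.bla.tick pa.ts pa.Δ pa.κ deadline i τ
  let x₃ := { x₂ with bla := r.1 }
  let B : Option (Finset Tx) :=
    match x₃.star, x₃.bla.out.filter fun q => decide (Valid pa.ts q) with
    | some _, _ => none
    | none, some q => some q.1
    | none, none => if ready ∧ deadline ≤ τ then some x₃.pair.1 else none
  let r₄ :=
    match B with
    | some B => x₃.beginACS pa i ω k B
    | none => (x₃, [])
  (r₄.1, m₁ ++ r.2.1.map (fun y => (y.1, .bla k y.2)) ++ r₄.2, r.2.2.map fun l => (k, l))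

/-- Settle the common subset protocol if it has begun. -/
def SlotState.after (pa : Params) (i : Fin n) (ω : Tape Bc Ba) (k : ℕ)
    (r : SlotState Bc Ba × List (Fin n × Msg Bc Ba)) : SlotState Bc Ba × Effects Bc Ba :=
  if r.1.star.isSome then
    let r' := r.1.settle pa i ω k
    (r'.1, r.2 ++ r'.2, [])
  else (r.1, r.2, [])

/-- The state of a party: the number of ticks of its clock, its buffer, and its slots. -/
structure PState (Bc : Fin n → AsyncProtocol n (Option (Finset Tx)) (Finset Tx))
    (Ba : AsyncProtocol n Bool Bool) where
  clock : ℕ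
  buf : Finset Tx
  slot : ℕ → SlotState Bc Ba

/-- Do something in slot `k`; if this yields the block of the slot, the block is removed from the
buffer. -/
def PState.onSlot (s : PState Bc Ba) (k : ℕ)
    (f : SlotState Bc Ba → SlotState Bc Ba × Effects Bc Ba) : PState Bc Ba × Effects Bc Ba :=
  let r := f (s.slot k)
  ({ s with
      slot := Function.update s.slot k r.1
      buf :=
        match (s.slot k).block, r.1.block with
        | none, some b => s.buf \ b
        | _, _ => s.buf }, r.2)

/-- The reaction of party `i` to a message from party `j`. -/
def PState.recv (pa : Params) (i : Fin n) (ω : Tape Bc Ba) (s : PState Bc Ba) (j : Fin n) :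
    Msg Bc Ba → PState Bc Ba × Effects Bc Ba
  | .buf k i' b => s.onSlot k fun x =>
    if i' = j ∧ x.pair.2.card ≤ pa.ts ∧ j ∉ x.pair.2.image Prod.fst then
      ({ x with pair := (x.pair.1 ∪ b, insert (j, b) x.pair.2) }, [], [])
    else (x, [], [])
  | .bla k m => s.onSlot k fun x =>
    ({ x with bla := { x.bla with log := x.bla.log ++ [(j, m)] } }, [], [])
  | .bc k l m => s.onSlot k fun x => SlotState.after pa i ω k (x.bcStep i ω k l (.inr (j, m)))
  | .ba k l m => s.onSlot k fun x =>
    if x.star.isSome ∧ x.C1 pa.ts then (x, [], [])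
    else SlotState.after pa i ω k (x.baStep i ω k l (.inr (j, m)))

/-- The protocol for state machine replication. Inputs are transactions; the output of a party is the
array of its blocks. The first tick of a clock is that at time 0. -/
def smr (pa : Params) (Bc : Fin n → AsyncProtocol n (Option (Finset Tx)) (Finset Tx))
    (Ba : AsyncProtocol n Bool Bool) : Protocol n Tx (ℕ → Option (Finset Tx)) where
  State := PState Bc Ba
  Msg := Msg Bc Ba
  Sig := Sig Bc Ba
  LKey := ℕ × ℕ
  Coin := CoinKey n
  faces := coinFaces Bc Ba
  signer := Sig.signer
  sigs := Msg.sigs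
  init := fun i => ⟨0, ∅, fun _ => SlotState.new i⟩
  output := fun s k => (s.slot k).block
  step := fun i ω s e =>
    match e with
    | .input tx => ({ s with buf := insert tx s.buf }, [], [])
    | .recv j m => s.recv pa i ω j m
    | .tick =>
      let r := (List.range (s.clock + 1)).foldl (fun (a : PState Bc Ba × Effects Bc Ba) k =>
        let r := a.1.onSlot k (SlotState.tick pa i ω k a.1.buf s.clock)
        (r.1, a.2.1 ++ r.2.1, a.2.2 ++ r.2.2)) (s, [], [])
      ({ r.1 with clock := s.clock + 1 }, r.2)
    | .leader kl l => s.onSlot kl.1 fun x =>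
      let r := x.bla.onLeader i kl.2 l
      ({ x with bla := r.1 }, r.2.map (fun y => (y.1, .bla kl.1 y.2)), [])

/-- Consistency of slot `k` in an execution: if an honest party outputs a block `B` in slot `k`, then
all honest parties output `B` in slot `k`. -/
def SlotConsistent (P : Protocol n Tx (ℕ → Option (Finset Tx))) (A : Adversary P) (ω : P.Rand)
    (k : ℕ) : Prop :=
  ∀ i B, P.Honest A ω i → (∃ t, P.out A ω t i k = some B) →
    ∀ j, P.Honest A ω j → ∃ t, P.out A ω t j k = some B

/-- `b`-consistency in an asynchronous network, of a protocol that depends on the security parameter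
`κ` and on a number `Δ`: every slot is consistent with overwhelming probability. -/
def ConsistentAsync [NeZero n] (b : ℕ)
    (P : ℕ → ℕ → Protocol n Tx (ℕ → Option (Finset Tx))) : Prop :=
  ∃ ε, Negligible ε ∧ ∀ κ Δ, 0 < Δ → ∀ (A : Adversary (P κ Δ)) (k : ℕ),
    (P κ Δ).law {ω | (P κ Δ).AtMost b A ω ∧ (P κ Δ).Async A ω ∧
      ¬ SlotConsistent (P κ Δ) A ω k} ≤ ENNReal.ofReal (ε κ)

/-- `b`-consistency in a synchronous network with delay bound `Δ`. -/
def ConsistentSync [NeZero n] (b : ℕ)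
    (P : ℕ → ℕ → Protocol n Tx (ℕ → Option (Finset Tx))) : Prop :=
  ∃ ε, Negligible ε ∧ ∀ κ Δ, 0 < Δ → ∀ (A : Adversary (P κ Δ)) (k : ℕ),
    (P κ Δ).law {ω | (P κ Δ).AtMost b A ω ∧ (P κ Δ).Sync Δ A ω ∧
      ¬ SlotConsistent (P κ Δ) A ω k} ≤ ENNReal.ofReal (ε κ)

end SMR

end

end NetSMR

open MeasureTheory

namespace NetSMR

noncomputable section

open scoped Classical

open Config Protocol SlotState PState Function Inst Finset Option List
open _root_.IsLocallyConstant (iff_eventually_eq of_discrete)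

section Executions

variable {n : ℕ} {In Out : Type} {P : Protocol n In Out}

/-- The configuration in which the activation caused by an action takes place. -/
def Config.base (ω : P.Rand) (c : Config P) : Action P → Config P
  | .deliver idx => if (c.net[idx]?).isSome then { c with delivered := insert idx c.delivered } else c
  | .corrupt i => { c with corrupted := insert i c.corrupted }
  | .tick _ => { c with time := c.time + 1 }
  | .leader i k => if (c.leader ω k).isSome then { c with led := insert (i, k) c.led } else c
  | .request i k =>
    if i ∈ c.corrupted
    then { c with requests := update c.requests k (insert i (c.requests k)) } else c
  | _ => c

/-- A message may be injected in the name of `src`. -/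
def Config.Injectable (c : Config P) (src : Fin n) (m : P.Msg) : Prop :=
  src ∈ c.corrupted ∧ ∀ σ ∈ P.sigs m, P.signer σ ∈ c.corrupted ∨ ∃ p ∈ c.net, σ ∈ P.sigs p.msg

/-- The parties that an action activates, and the event that they process. -/
def Config.event (ω : P.Rand) (c : Config P) : Action P → Finset (Fin n) × Event n In P.Msg P.LKey
  | .input i x => ({i}, .input x)
  | .deliver idx =>
    match c.net[idx]? with
    | none => (∅, .tick)
    | some p => if idx ∈ c.delivered then (∅, .tick) else ({p.dst}, .recv p.src p.msg)
  | .inject src dst m => if c.Injectable src m then ({dst}, .recv src m) else (∅, .tick)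
  | .tick S => (S, .tick)
  | .leader i k =>
    match c.leader ω k with
    | none => (∅, .tick)
    | some l => if (i, k) ∈ c.led then (∅, .tick) else ({i}, .leader k l)
  | _ => (∅, .tick)

theorem Config.activate_empty (ω : P.Rand) (c : Config P) (e : Event n In P.Msg P.LKey) :
    c.activate ω ∅ e = c := by
  cases c
  simp [activate]

theorem Config.apply_eq (ω : P.Rand) (c : Config P) (a : Action P) :
    c.apply ω a = (c.base ω a).activate ω (c.event ω a).1 (c.event ω a).2 := by
  cases a with
  | deliver idx =>
    simp only [apply, base, event]
    cases h : c.net[idx]? with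
    | none => simp [activate_empty]
    | some p =>
      by_cases h' : idx ∈ c.delivered
      · simp [h', activate_empty]
      · simp [h']
  | inject src dst m =>
    by_cases h : c.Injectable src m
    · simp [event, if_pos h]
      exact if_pos h
    · simp [event, if_neg h, activate_empty]
      exact if_neg h
  | leader i k =>
    simp [apply, base, event]
    cases h : c.leader ω k with
    | none => simp [activate_empty]
    | some p =>
      by_cases h' : (i, k) ∈ c.led
      · simp [h', activate_empty]
      · simp [h']
  | _ => simp [apply, base, event, activate_empty]

variable (ω : P.Rand) (c : Config P) (a : Action P)

@[simp] theorem Config.base_state : (c.base ω a).state = c.state := by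
  cases a <;> simp [base] <;> split_ifs <;> rfl

@[simp] theorem Config.base_net : (c.base ω a).net = c.net := by
  cases a <;> simp [base] <;> split_ifs <;> rfl

theorem Config.base_corrupted_subset : c.corrupted ⊆ (c.base ω a).corrupted := by
  cases a <;> simp only [base] <;> (try split_ifs) <;> simp

def Config.react (i : Fin n) (e : Event n In P.Msg P.LKey) : P.State × List (Fin n × P.Msg) × List P.LKey :=
  P.step i (fun x => ω.1 (i, x)) (c.state i) e

theorem Config.apply_corrupted : (c.apply ω a).corrupted = (c.base ω a).corrupted := by
  rw [c.apply_eq]; rfl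

def Config.Active (i : Fin n) : Prop := i ∈ (c.event ω a).1 ∧ i ∉ c.corrupted

/-- An action that activates somebody corrupts nobody. -/
theorem Config.base_corrupted_of_active {i} (h : i ∈ (c.event ω a).1) :
    (c.base ω a).corrupted = c.corrupted := by
  cases a <;> simp only [base, event, notMem_empty] at h ⊢ <;> split_ifs <;> rfl

theorem Config.mem_sdiff_base {i} :
    i ∈ (c.event ω a).1 \ (c.base ω a).corrupted ↔ c.Active ω a i := by grind [Active, base_corrupted_of_active]

theorem Config.apply_state (i) : (c.apply ω a).state i =
    if c.Active ω a i then (c.react ω i (c.event ω a).2).1 else c.state i := by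
  rw [c.apply_eq]
  simp only [activate, mem_sdiff_base, base_state]
  rfl

theorem Config.apply_net : (c.apply ω a).net = c.net ++ (finRange n).flatMap fun i =>
    if c.Active ω a i then (c.react ω i (c.event ω a).2).2.1.map
      fun x => ⟨i, x.1, x.2, (c.base ω a).time⟩ else [] := by
  rw [c.apply_eq]
  simp only [activate, mem_sdiff_base, base_state, base_net]
  rfl

theorem Config.apply_requests (k : P.LKey) : (c.apply ω a).requests k =
    (c.base ω a).requests k ∪ Finset.univ.filter fun i =>
      c.Active ω a i ∧ k ∈ (c.react ω i (c.event ω a).2).2.2 := by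
  rw [c.apply_eq]
  ext i
  simp only [activate, Finset.mem_union, Finset.mem_filter, mem_sdiff_base,
    base_state, Finset.mem_univ, true_and]
  rfl

theorem Config.apply_delivered : (c.apply ω a).delivered = (c.base ω a).delivered := by
  rw [c.apply_eq]; rfl

theorem Config.apply_time : (c.apply ω a).time = (c.base ω a).time := by
  rw [c.apply_eq]; rfl

theorem Config.apply_led : (c.apply ω a).led = (c.base ω a).led := by
  rw [c.apply_eq]; rfl

theorem Config.corrupted_subset_apply : c.corrupted ⊆ (c.apply ω a).corrupted := by
  rw [apply_corrupted]
  exact c.base_corrupted_subset ω a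

variable {c} in
theorem Config.apply_state_of_corrupted {i} (h : i ∈ c.corrupted) : (c.apply ω a).state i = c.state i := by
  rw [apply_state, if_neg fun h' => h'.2 h]

variable {ω c a} in
theorem Config.mem_apply_net {p} : p ∈ (c.apply ω a).net ↔ p ∈ c.net ∨
    ∃ i, c.Active ω a i ∧ ∃ x ∈ (c.react ω i (c.event ω a).2).2.1,
      p = ⟨i, x.1, x.2, (c.base ω a).time⟩ := by
  rw [apply_net, mem_append, mem_flatMap]
  refine or_congr_right ⟨?_, ?_⟩
  · grind
  simp_all

variable (A : Adversary P)

theorem Protocol.cfg_succ (t) : P.cfg A ω (t + 1) = (P.cfg A ω t).apply ω (P.act A ω t) := rfl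

theorem Protocol.corrupted_mono {s t} (h : s ≤ t) : (P.cfg A ω s).corrupted ⊆ (P.cfg A ω t).corrupted := by
  induction t, h using Nat.le_induction with
  | base => simp_all
  | succ t _ ih => exact ih.trans (corrupted_subset_apply _ _ _)

theorem Protocol.net_prefix {s t} (h : s ≤ t) : (P.cfg A ω s).net <+: (P.cfg A ω t).net := by
  induction t, h using Nat.le_induction with
  | base => simp_all
  | succ t _ ih =>
    grind [cfg_succ, apply_net]

theorem Config.delivered_subset_apply : c.delivered ⊆ (c.apply ω a).delivered := by
  rw [apply_delivered]
  cases a <;> simp only [base] <;> (try split_ifs) <;> simp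

theorem Protocol.delivered_mono {s t} (h : s ≤ t) : (P.cfg A ω s).delivered ⊆ (P.cfg A ω t).delivered := by
  induction t, h using Nat.le_induction with
  | base => simp_all
  | succ t _ ih => exact ih.trans (delivered_subset_apply _ _ _)

def Protocol.drive (P : Protocol n In Out) (act : ℕ → Action P) (ω : P.Rand) : ℕ → Config P × List (View P)
  | 0 =>
    let c : Config P := ⟨P.init, ∅, [], ∅, 0, fun _ => ∅, ∅⟩
    (c, [c.view ω])
  | t + 1 =>
    let h := P.drive act ω t
    let c := h.1.apply ω (act t)
    (c, c.view ω :: h.2)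

theorem Protocol.length_drive (act t) : (P.drive act ω t).2.length = t + 1 := by
  induction t with
  | zero => rfl
  | succ t ih => simp [drive, ih]

theorem Protocol.exec_eq_drive (t) : P.exec A ω t = P.drive (P.act A ω) ω t := by
  induction t with
  | zero => rfl
  | succ t ih => rw [exec, drive, ← ih]; rfl

theorem Protocol.drive_tail {Ω : Type*} {act : Ω → ℕ → Action P} {f : Ω → P.Rand} {x y : Ω} {s t}
    (hst : s ≤ t) (h : (P.drive (act x) (f x) t).2 = (P.drive (act y) (f y) t).2) :
    (P.drive (act x) (f x) s).2 = (P.drive (act y) (f y) s).2 := by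
  induction t, hst using Nat.le_induction with
  | base => exact h
  | succ t _ ih => exact ih (cons.inj h).2

/-- Actions that depend only on what the adversary has seen are the actions of an adversary. -/
theorem Protocol.exists_adversary {Ω : Type*} (f : Ω → P.Rand) (act : Ω → ℕ → Action P)
    (h : ∀ x y t, (P.drive (act x) (f x) t).2 = (P.drive (act y) (f y) t).2 → act x t = act y t) :
    ∃ A : Adversary P, ∀ x t, P.exec A (f x) t = P.drive (act x) (f x) t := by
  refine ⟨fun l => if hl : ∃ x t, (P.drive (act x) (f x) t).2 = l
    then act hl.choose hl.choose_spec.choose else .idle, fun x t => ?_⟩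
  induction t with
  | zero => rfl
  | succ t ih =>
    rw [exec, drive, ih]
    have hl : ∃ y s, (P.drive (act y) (f y) s).2 = (P.drive (act x) (f x) t).2 := ⟨x, t, rfl⟩
    have hs := hl.choose_spec.choose_spec
    have ht : hl.choose_spec.choose = t := by grind [length_drive]
    have : act hl.choose hl.choose_spec.choose = act x t := by grind
    simp_all

end Executions

/-! ## Executions are locally constant in the randomness -/

section Local

variable {α β γ : Type*} [TopologicalSpace α]

theorem isLocallyConstant_bind {f : β → α → γ} {g : α → β} (hf : ∀ b, IsLocallyConstant (f b))
    (hg : IsLocallyConstant g) : IsLocallyConstant fun a => f (g a) a := by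
  rw [iff_eventually_eq] at hg ⊢
  intro a
  filter_upwards [hg a, (iff_eventually_eq _).1 (hf (g a)) a] with b h h'
  rw [h, h']

theorem IsLocallyConstant.measurable_prop [MeasurableSpace α] [OpensMeasurableSpace α]
    {g : α → β} (hg : IsLocallyConstant g) (p : β → Prop) : Measurable fun a => p (g a) :=
  measurableSet_setOfPred.1 (hg {b | p b}).measurableSet

theorem isLocallyConstant_pair {f : α → β} {g : α → γ} (hf : IsLocallyConstant f)
    (hg : IsLocallyConstant g) : IsLocallyConstant fun a => (f a, g a) := by
  rw [iff_eventually_eq] at *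
  simp_all

end Local

/-! ## Product measures -/

section Product

variable {ι : Type*} {X : ι → Type*} [∀ i, MeasurableSpace (X i)] (μ : (i : ι) → Measure (X i))
  [∀ i, IsProbabilityMeasure (μ i)]

/-- Replacing the coordinates in `R` by independent copies does not change a product measure. -/
theorem infinitePi_resample (R : Set ι) : ((Measure.infinitePi μ).prod (Measure.infinitePi μ)).map
      (fun p i => if i ∈ R then p.2 i else p.1 i) = Measure.infinitePi μ := by
  have hm : Measurable (fun (p : ((i : ι) → X i) × ((i : ι) → X i)) i =>
      if i ∈ R then p.2 i else p.1 i) := by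
    refine measurable_pi_lambda _ fun i => ?_
    by_cases h : i ∈ R
    · simp [h]
      exact (measurable_pi_apply i).comp measurable_snd
    · simp [h]
      exact (measurable_pi_apply i).comp measurable_fst
  refine Measure.eq_infinitePi μ fun s t ht => ?_
  rw [Measure.map_apply hm (MeasurableSet.pi s.countable_toSet fun i _ => ht i)]
  have : (fun (p : ((i : ι) → X i) × ((i : ι) → X i)) i => if i ∈ R then p.2 i else p.1 i) ⁻¹'
      ((s : Set ι).pi t) = (((s.filter (· ∉ R) : Finset ι) : Set ι).pi t) ×ˢ
        (((s.filter (· ∈ R) : Finset ι) : Set ι).pi t) := by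
    ext p
    simp only [Set.mem_preimage, Set.mem_pi, Set.mem_prod, coe_filter]
    constructor
    · intro h
      refine ⟨fun i hi => ?_, fun i hi => ?_⟩
      · have := h i hi.1
        simp_all
      · have := h i hi.1
        simp_all
    grind
  grind [Measure.prod_prod, Measure.infinitePi_pi, prod_filter_mul_prod_filter_not]

theorem infinitePi_reindex {κ : Type*} (e : κ → ι) (he : Injective e) :
    (Measure.infinitePi μ).map (fun x k => x (e k)) = Measure.infinitePi fun k => μ (e k) := by
  have hm : Measurable (fun (x : (i : ι) → X i) (k : κ) => x (e k)) :=
    measurable_pi_lambda _ fun k => measurable_pi_apply (e k)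
  refine Measure.eq_infinitePi _ fun s t ht => ?_
  rw [Measure.map_apply hm (MeasurableSet.pi s.countable_toSet fun i _ => ht i)]
  let T : (i : ι) → Set (X i) := fun i => {x | ∀ k (h : e k = i), x ∈ h ▸ t k}
  have hT : ∀ k, T (e k) = t k := by grind
  have : (fun (x : (i : ι) → X i) (k : κ) => x (e k)) ⁻¹' ((s : Set κ).pi t) =
      ((s.image e : Finset ι) : Set ι).pi T := by
    ext x
    simp_all
  rw [this, Measure.infinitePi_pi, prod_image fun a _ b _ h => he h]
  · simp_all
  simp_all

end Product

section Law

variable {n : ℕ} [NeZero n] {In Out : Type} (P : Protocol n In Out)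

instance Protocol.isProbabilityMeasure_law : IsProbabilityMeasure P.law := by
  unfold law
  infer_instance

def Protocol.shift (a : P.LKey) (d : Fin n) (ω : P.Rand) : P.Rand :=
  (ω.1, fun k => if k = a then ω.2 k + d else ω.2 k)

theorem map_uniform_equiv {α : Type*} [Fintype α] [Nonempty α] [MeasurableSpace α]
    [MeasurableSingletonClass α] (e : α ≃ α) :
    (PMF.uniformOfFintype α).toMeasure.map e = (PMF.uniformOfFintype α).toMeasure := by
  have he : Measurable e := Measurable.of_discrete
  refine Measure.ext_of_singleton fun x => ?_
  rw [Measure.map_apply he (measurableSet_singleton x),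
    PMF.toMeasure_apply_singleton _ _ (measurableSet_singleton x)]
  have : e ⁻¹' {x} = {e.symm x} := by grind
  simp_all

theorem Protocol.measurePreserving_shift (a d) : MeasurePreserving (P.shift a d) P.law P.law := by
  unfold law
  refine (MeasurePreserving.id _).prod (g := fun (x : P.LKey → Fin n) k => if k = a then x k + d else x k) ⟨?_, ?_⟩
  · exact measurable_pi_lambda _ fun k => by
      split_ifs
      · exact (Measurable.of_discrete (f := fun x : Fin n => x + d)).comp (measurable_pi_apply k)
      · exact measurable_pi_apply k
  · have := Measure.infinitePi_map_pi (μ := fun _ : P.LKey => (PMF.uniformOfFintype (Fin n)).toMeasure)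
      (f := fun k x => if k = a then x + d else x) (fun k => Measurable.of_discrete)
    refine this.trans ?_
    congr 1
    funext k
    split_ifs
    · exact map_uniform_equiv (Equiv.addRight d)
    simp_all

/-- A uniform leader lies in an independent set of at most `b` parties with conditional probability
at most `b / n`. -/
theorem Protocol.law_leader_mem_le (a : P.LKey) {F : Set P.Rand} {D : P.Rand → Finset (Fin n)}
    {b} (hF : MeasurableSet F) (hD : MeasurableSet {ω : P.Rand | ω.2 a ∈ D ω})
    (hFi : ∀ d ω, P.shift a d ω ∈ F ↔ ω ∈ F) (hDi : ∀ d ω, D (P.shift a d ω) = D ω)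
    (hb : ∀ ω, (D ω).card ≤ b) :
    (n : ENNReal) * P.law (F ∩ {ω | ω.2 a ∈ D ω}) ≤ b * P.law F := by
  set G : Set P.Rand := {ω | ω.2 a ∈ D ω} with hG
  have h1 : ∀ d, P.law (F ∩ P.shift a d ⁻¹' G) = P.law (F ∩ G) := by
    intro d
    rw [← (P.measurePreserving_shift a d).measure_preimage (hF.inter hD).nullMeasurableSet]
    congr 1
    grind
  have hmeas := fun d =>
    (P.measurePreserving_shift a d).measurable hD
  calc (n : ENNReal) * P.law (F ∩ G) = ∑ d : Fin n, P.law (F ∩ P.shift a d ⁻¹' G) := by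
        simp [h1]
    _ = ∑ d : Fin n, ∫⁻ ω in F, (P.shift a d ⁻¹' G).indicator 1 ω ∂P.law := by grind [lintegral_indicator_one, Measure.restrict_apply]
    _ = ∫⁻ ω in F, ∑ d : Fin n, (P.shift a d ⁻¹' G).indicator 1 ω ∂P.law :=
        (lintegral_finsetSum _ fun d _ => measurable_one.indicator (hmeas d)).symm
    _ ≤ ∫⁻ _ in F, (b : ENNReal) ∂P.law := by
        refine lintegral_mono fun ω => ?_
        have : ∑ d : Fin n, (P.shift a d ⁻¹' G).indicator (1 : P.Rand → ENNReal) ω =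
            ((Finset.univ.filter fun d : Fin n => ω.2 a + d ∈ D ω).card : ENNReal) := by
          rw [card_filter, Nat.cast_sum]
          refine sum_congr rfl fun d _ => ?_
          have : ω ∈ P.shift a d ⁻¹' G ↔ ω.2 a + d ∈ D ω := by grind [shift]
          by_cases h : ω.2 a + d ∈ D ω
          · simp_all
          simp_all
        have hle : (Finset.univ.filter fun d : Fin n => ω.2 a + d ∈ D ω).card ≤ (D ω).card :=
          Finset.card_le_card_of_injOn (fun d => ω.2 a + d) (fun d hd => (Finset.mem_filter.1 hd).2)
            fun x _ y _ h => add_left_cancel h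
        grind [Nat.cast_le]
    _ = b * P.law F := by simp_all

end Law

/-! ## Message-driven protocols run inside other protocols -/

section Guests

variable {n : ℕ} {In Out I O : Type}

abbrev Protocol.Tape (H : Protocol n In Out) : Type := (c : H.Coin) → Fin (H.faces c + 1)

/-- How an instance of the message-driven protocol `P` is part of the protocol `H`: the state of the
instance, its messages, signatures, and coins; whether a message is passed on to the instance;
and which states are the same up to the part of the instance that is not visible. -/
structure Guest (H : Protocol n In Out) (P : AsyncProtocol n I O) where
  inst : H.State → Inst P
  proj : H.Msg → Option P.Msg
  sig : P.Sig → H.Sig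
  coin : ℕ → H.Coin
  accepts : H.State → H.Msg → Prop
  same : H.State → H.State → Prop
  faces_coin : ∀ c, H.faces (coin c) = P.coins

/-- The visible results of two activations agree. -/
def Vis {P : AsyncProtocol n I O} (r r' : Inst P × List (Fin n × P.Msg)) : Prop :=
  r.1.inp = r'.1.inp ∧ r.1.out = r'.1.out ∧ r.2 = r'.2

namespace Guest

variable {H : Protocol n In Out} {P : AsyncProtocol n I O} (G : Guest H P)

def tape (ω : H.Tape) : ℕ → Fin (P.coins + 1) := fun c =>
  Fin.cast (by rw [G.faces_coin]) (ω (G.coin c))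

/-- The instance after a message has been passed on to it. -/
def heard (i : Fin n) (ω : H.Tape) (s : H.State) (e : Event n In H.Msg H.LKey) :
    Inst P × List (Fin n × P.Msg) :=
  match e with
  | .recv j m =>
    match G.proj m with
    | some m' =>
      if G.accepts s m then (G.inst s).step i (G.tape ω) (.inr (j, m')) else (G.inst s, [])
    | none => (G.inst s, [])
  | _ => (G.inst s, [])

def given (i : Fin n) (ω : H.Tape) (s : H.State) (e : Event n In H.Msg H.LKey) : Option I :=
  if (G.inst s).inp = none then (G.inst (H.step i ω s e).1).inp else none

/-- The instance after it has received a message and an input. -/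
def begun (i : Fin n) (ω : H.Tape) (s : H.State) (e : Event n In H.Msg H.LKey) :
    Inst P × List (Fin n × P.Msg) :=
  match G.given i ω s e with
  | some x => (G.heard i ω s e).1.step i (G.tape ω) (.inl x)
  | none => ((G.heard i ω s e).1, [])

/-- The instance starts afresh, and the host hides its state and handles its signatures honestly. -/
structure Regular : Prop where
  coin_injective : Injective G.coin
  inst_init : ∀ i, G.inst (H.init i) = new P i
  signer_sig : ∀ σ, H.signer (G.sig σ) = P.signer σ
  sig_mem : ∀ m m', G.proj m = some m' → ∀ σ ∈ P.sigs m', G.sig σ ∈ H.sigs m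
  of_sig_mem : ∀ m σ, G.sig σ ∈ H.sigs m → ∃ m', G.proj m = some m' ∧ σ ∈ P.sigs m'
  same_init : ∀ i, G.same (H.init i) (H.init i)
  same_output : ∀ {s s'}, G.same s s' → H.output s = H.output s'
  same_eq : ∀ {s s'}, G.same s s' → G.inst s = G.inst s' → s = s'
  same_accepts : ∀ {s s'} m, G.same s s' → (G.accepts s m ↔ G.accepts s' m)

/-- In one step of the host the instance at most receives one message and then possibly its input.
The host treats the instance as a black box. -/
structure Lawful : Prop extends G.Regular where
  step_inst : ∀ i ω s e, G.inst (H.step i ω s e).1 = (G.begun i ω s e).1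
  step_msgs : ∀ i ω s e, (H.step i ω s e).2.1.filterMap
    (fun x => (G.proj x.2).map fun m => (x.1, m)) = (G.heard i ω s e).2 ++ (G.begun i ω s e).2
  flow_given : ∀ i ω ω' s s' e, (∀ c, c ∉ Set.range G.coin → ω c = ω' c) → G.same s s' →
    Vis (G.heard i ω s e) (G.heard i ω' s' e) → G.given i ω s e = G.given i ω' s' e
  flow : ∀ i ω ω' s s' e, (∀ c, c ∉ Set.range G.coin → ω c = ω' c) → G.same s s' →
    Vis (G.heard i ω s e) (G.heard i ω' s' e) → Vis (G.begun i ω s e) (G.begun i ω' s' e) →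
    G.same (H.step i ω s e).1 (H.step i ω' s' e).1 ∧ (H.step i ω s e).2 = (H.step i ω' s' e).2

theorem heard_inp (i ω s e) : (G.heard i ω s e).1.inp = (G.inst s).inp := by
  unfold heard
  split
  · split
    · split_ifs <;> rfl
    · rfl
  · rfl

def packet (p : Packet H) : Option (Packet P.alone) := (G.proj p.msg).map fun m => ⟨p.src, p.dst, m, 0⟩

theorem packet_of_proj {p m} (h : G.proj p.msg = some m) : G.packet p = some ⟨p.src, p.dst, m, 0⟩ := by
  rw [packet, h]
  rfl

theorem isSome_packet {p} : (G.packet p).isSome = (G.proj p.msg).isSome := isSome_map ..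

def net (l : List (Packet H)) : List (Packet P.alone) := l.filterMap G.packet

def pos (l : List (Packet H)) (idx : ℕ) : ℕ := (G.net (l.take idx)).length

theorem net_append (l l') : G.net (l ++ l') = G.net l ++ G.net l' := filterMap_append

theorem getElem?_net_pos {l idx p p'}
    (h : l[idx]? = some p) (h' : G.packet p = some p') : (G.net l)[G.pos l idx]? = some p' := by
  obtain ⟨hlt, rfl⟩ := List.getElem?_eq_some_iff.1 h
  have : G.net l = G.net (l.take idx) ++ p' :: G.net (l.drop (idx + 1)) := by
    conv_lhs => rw [← List.take_append_drop idx l, List.drop_eq_getElem_cons hlt, net_append]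
    simp only [net, filterMap_cons, h']
  rw [this, pos]
  simp

theorem pos_append {l l' idx} (h : idx ≤ l.length) : G.pos (l ++ l') idx = G.pos l idx := by
  rw [pos, pos, take_append_of_le_length h]

theorem pos_lt {l a b p} (h : l[a]? = some p)
    (h' : (G.packet p).isSome) (hab : a < b) : G.pos l a < G.pos l b := by
  obtain ⟨p', hp'⟩ := Option.isSome_iff_exists.1 h'
  obtain ⟨hlt, rfl⟩ := List.getElem?_eq_some_iff.1 h
  have h1 : (l.take b)[a]? = some l[a] := by simp_all
  have h2 := G.getElem?_net_pos h1 hp'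
  have h3 := (List.getElem?_eq_some_iff.1 h2).1
  have : G.pos (l.take b) a = G.pos l a := by
    rw [pos, pos, take_take, min_eq_left hab.le]
  rwa [this] at h3

theorem length_net_le_pos (l l') {idx} (h : l.length ≤ idx) : (G.net l).length ≤ G.pos (l ++ l') idx := by
  rw [pos, take_append, take_of_length_le h, net_append, length_append]
  omega

theorem pos_injective {l a b p q} (ha : l[a]? = some p)
    (hb : l[b]? = some q) (hp : (G.packet p).isSome) (hq : (G.packet q).isSome)
    (h : G.pos l a = G.pos l b) : a = b := by
  rcases lt_trichotomy a b with hab | hab | hab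
  · exact absurd h (G.pos_lt ha hp hab).ne
  · exact hab
  · exact absurd h (G.pos_lt hb hq hab).ne'

theorem exists_net_pos {l k p'} (h : (G.net l)[k]? = some p') :
    ∃ idx p, l[idx]? = some p ∧ G.packet p = some p' ∧ G.pos l idx = k := by
  induction l generalizing k with
  | nil => simp [net] at h
  | cons q l ih =>
    cases hq : G.packet q with
    | none =>
      have : G.net (q :: l) = G.net l := by simp [net, hq]
      rw [this] at h
      obtain ⟨idx, p, h1, h2, h3⟩ := ih h
      refine ⟨idx + 1, p, by simp_all, h2, ?_⟩
      rw [← h3]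
      simp [pos, net, hq]
    | some q' =>
      have : G.net (q :: l) = q' :: G.net l := by simp [net, hq]
      cases k with
      | zero =>
        refine ⟨0, q, rfl, ?_, by simp [pos, net]⟩
        simp_all
      | succ k =>
        obtain ⟨idx, p, h1, h2, h3⟩ := ih (k := k) (by simp_all)
        refine ⟨idx + 1, p, by simp_all, h2, ?_⟩
        rw [← h3]
        simp [pos, net, hq]

/-- The coins of the instance among the coins of the host. -/
def sub (ω : H.Rand) : P.alone.Rand :=
  (fun x => Fin.cast (congrArg (· + 1) (G.faces_coin x.2)) (ω.1 (x.1, G.coin x.2)), fun k => k.elim)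

/-- The action on the instance when the host takes action `a`, apart from inputs. -/
def first (c : Config H) : Action H → Action P.alone
  | .corrupt i => .corrupt i
  | .deliver idx =>
    match c.net[idx]? with
    | some p =>
      if idx ∉ c.delivered ∧ p.dst ∉ c.corrupted ∧ (G.proj p.msg).isSome ∧ G.accepts (c.state p.dst) p.msg
      then .deliver (G.pos c.net idx) else .idle
    | none => .idle
  | .inject src dst m =>
    match G.proj m with
    | some m' =>
      if c.Injectable src m ∧ dst ∉ c.corrupted ∧ G.accepts (c.state dst) m
      then .inject src dst m' else .idle
    | none => .idle
  | _ => .idle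

/-- The input given to the instance at party `i` when the host goes from `c` to `c'`. -/
def second (c c' : Config H) (i : Fin n) : Action P.alone :=
  match (G.inst (c.state i)).inp, (G.inst (c'.state i)).inp with
  | none, some x => .input i x
  | _, _ => .idle

/-- The actions on the instance: `n + 1` for each action of the host. -/
def act (A : Adversary H) (ω : H.Rand) (s : ℕ) : Action P.alone := let t := s / (n + 1)
  if s % (n + 1) = 0 then G.first (H.cfg A ω t) (H.act A ω t)
  else if h : s % (n + 1) - 1 < n
    then G.second (H.cfg A ω t) (H.cfg A ω (t + 1)) ⟨s % (n + 1) - 1, h⟩ else .idle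

def cfg (A : Adversary H) (ω : H.Rand) (s : ℕ) : Config P.alone := (P.alone.drive (G.act A ω) (G.sub ω) s).1

theorem cfg_succ (A ω s) : G.cfg A ω (s + 1) = (G.cfg A ω s).apply (G.sub ω) (G.act A ω s) := rfl

theorem act_first (A ω t) : G.act A ω ((n + 1) * t) = G.first (H.cfg A ω t) (H.act A ω t) := by
  simp [act]

theorem act_second (A : Adversary H) (ω : H.Rand) (t : ℕ) (i : Fin n) :
    G.act A ω ((n + 1) * t + 1 + i) = G.second (H.cfg A ω t) (H.cfg A ω (t + 1)) i := by
  have h1 : ((n + 1) * t + 1 + i) % (n + 1) = i + 1 := by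
    rw [add_assoc, Nat.mul_add_mod, add_comm 1]
    simp_all
  have h2 : ((n + 1) * t + 1 + i) / (n + 1) = t := by
    rw [add_assoc, Nat.mul_add_div (Nat.succ_pos n), Nat.div_eq_of_lt (by omega), add_zero]
  simp [act, h1, h2]

/-- The configuration `d` of the instance corresponds to the configuration `c` of the host. -/
structure Sim (c : Config H) (d : Config P.alone) : Prop where
  state : ∀ i, d.state i = G.inst (c.state i)
  corrupted : d.corrupted = c.corrupted
  net : d.net = G.net c.net
  time : d.time = 0
  delivered : ∀ idx p, c.net[idx]? = some p → (G.packet p).isSome →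
    G.pos c.net idx ∈ d.delivered → idx ∈ c.delivered
  delivered_lt : ∀ k ∈ d.delivered, k < d.net.length

def heardAt (ω : H.Rand) (c : Config H) (a : Action H) (i : Fin n) : Inst P × List (Fin n × P.Msg) :=
  if c.Active ω a i then G.heard i (fun x => ω.1 (i, x)) (c.state i) (c.event ω a).2
  else (G.inst (c.state i), [])

def begunAt (ω : H.Rand) (c : Config H) (a : Action H) (i : Fin n) : Inst P × List (Fin n × P.Msg) :=
  if c.Active ω a i then G.begun i (fun x => ω.1 (i, x)) (c.state i) (c.event ω a).2
  else (G.inst (c.state i), [])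

def packets (i : Fin n) (l : List (Fin n × P.Msg)) : List (Packet P.alone) :=
  l.map fun x => ⟨i, x.1, x.2, 0⟩

theorem apply_idle (ω : P.alone.Rand) (d : Config P.alone) : d.apply ω .idle = d := rfl

/-- The instance either is not concerned by an action of the host, or receives a message. -/
theorem first_cases (hG : G.Lawful) (ω) {c d} (h : G.Sim c d) (a) :
    ((∀ i, G.heardAt ω c a i = (G.inst (c.state i), [])) ∧
      ((G.first c a = .idle ∧ (c.base ω a).corrupted = c.corrupted) ∨
        ∃ i, a = .corrupt i ∧ G.first c a = .corrupt i)) ∨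
    ∃ j dst m m', c.event ω a = ({dst}, .recv j m) ∧ dst ∉ c.corrupted ∧ G.proj m = some m' ∧
      G.accepts (c.state dst) m ∧ d.event (G.sub ω) (G.first c a) = ({dst}, .recv j m') ∧
      (d.base (G.sub ω) (G.first c a)).corrupted = d.corrupted ∧
      (d.base (G.sub ω) (G.first c a)).time = d.time ∧
      (c.base ω a).corrupted = c.corrupted := by
  have hrecv : ∀ j dst m, c.event ω a = ({dst}, .recv j m) →
      ¬ (dst ∉ c.corrupted ∧ (G.proj m).isSome ∧ G.accepts (c.state dst) m) →
      ∀ i, G.heardAt ω c a i = (G.inst (c.state i), []) := by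
    intro j dst m hev hn i
    unfold heardAt
    split_ifs with hact
    · rw [Active, hev, Finset.mem_singleton] at hact
      obtain ⟨rfl, hi⟩ := hact
      rw [hev]
      simp only [heard]
      grind
    · rfl
  have hnone : c.event ω a = (∅, .tick) → ∀ i, G.heardAt ω c a i = (G.inst (c.state i), []) := by
    intro hev i
    unfold heardAt
    rw [if_neg]
    simp [Active, hev]
  cases a with
  | corrupt i => exact .inl ⟨hnone rfl, .inr ⟨i, rfl, rfl⟩⟩
  | deliver idx =>
    cases hp : c.net[idx]? with
    | none =>
      refine .inl ⟨hnone (by simp [event, hp]), .inl ⟨by simp [first, hp], ?_⟩⟩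
      simp [base, hp]
    | some p =>
      have hb : (c.base ω (.deliver idx)).corrupted = c.corrupted := by simp [base, hp]
      by_cases hd : idx ∈ c.delivered
      · exact .inl ⟨hnone (by simp [event, hp, hd]), .inl ⟨by simp [first, hp, hd], hb⟩⟩
      · have hev : c.event ω (.deliver idx) = ({p.dst}, .recv p.src p.msg) := by
          simp [event, hp, hd]
        by_cases hn : p.dst ∉ c.corrupted ∧ (G.proj p.msg).isSome ∧ G.accepts (c.state p.dst) p.msg
        · obtain ⟨m', hm'⟩ := isSome_iff_exists.1 hn.2.1
          have hpk : G.packet p = some ⟨p.src, p.dst, m', 0⟩ := G.packet_of_proj hm'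
          have hf : G.first c (.deliver idx) = .deliver (G.pos c.net idx) := by
            simp only [first, hp]
            simp_all
          have hnet := G.getElem?_net_pos hp hpk
          rw [← h.net] at hnet
          have hnd : G.pos c.net idx ∉ d.delivered := fun h' =>
            hd (h.delivered idx p hp (by simp [hpk]) h')
          exact .inr ⟨p.src, p.dst, p.msg, m', hev, hn.1, hm', hn.2.2, by grind [event], by grind [base],
            by grind [base], hb⟩
        · refine .inl ⟨hrecv _ _ _ hev hn, .inl ⟨?_, hb⟩⟩
          simp only [first, hp]
          simp_all
  | inject src dst m =>
    by_cases hi : c.Injectable src m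
    · have hev : c.event ω (.inject src dst m) = ({dst}, .recv src m) := by
        simp [event, hi]
      by_cases hn : dst ∉ c.corrupted ∧ (G.proj m).isSome ∧ G.accepts (c.state dst) m
      · obtain ⟨m', hm'⟩ := isSome_iff_exists.1 hn.2.1
        have hf : G.first c (.inject src dst m) = .inject src dst m' := by
          simp only [first, hm']
          simp_all
        have hinj : d.Injectable src m' := by
          refine ⟨h.corrupted ▸ hi.1, fun σ hσ => ?_⟩
          refine (hi.2 _ (hG.sig_mem _ _ hm' σ hσ)).imp (fun h1 => ?_) ?_
          · have := hG.signer_sig σ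
            rw [this] at h1
            rw [h.corrupted]
            exact h1
          · rintro ⟨p, hp, hσp⟩
            obtain ⟨m'', hm'', hσ''⟩ := hG.of_sig_mem _ _ hσp
            refine ⟨⟨p.src, p.dst, m'', 0⟩, ?_, hσ''⟩
            rw [h.net]
            exact mem_filterMap.2 ⟨p, hp, G.packet_of_proj hm''⟩
        exact .inr ⟨src, dst, m, m', hev, hn.1, hm', hn.2.2,
          by grind [event], by rw [hf]; rfl, by rw [hf]; rfl, rfl⟩
      · refine .inl ⟨hrecv _ _ _ hev hn, .inl ⟨?_, rfl⟩⟩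
        simp only [first]
        cases hp : G.proj m with
        | none => rfl
        | some m' =>
          simp_all
    · refine .inl ⟨hnone (by simp [event, hi]), .inl ⟨?_, rfl⟩⟩
      simp only [first]
      cases hp : G.proj m with
      | none => rfl
      | some m' => simp_all
  | leader i k =>
    refine .inl ⟨?_, .inl ⟨rfl, ?_⟩⟩
    · intro i'
      unfold heardAt
      split_ifs with h'
      · simp only [event]
        split
        · rfl
        · split_ifs <;> rfl
      · rfl
    grind [base]
  | request i k => exact .inl ⟨hnone rfl, .inl ⟨rfl, by grind [base]⟩⟩
  | idle => exact .inl ⟨hnone rfl, .inl ⟨rfl, rfl⟩⟩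
  | input i x =>
    refine .inl ⟨fun i' => ?_, .inl ⟨rfl, rfl⟩⟩
    unfold heardAt
    split_ifs <;> rfl
  | tick S =>
    refine .inl ⟨fun i' => ?_, .inl ⟨rfl, rfl⟩⟩
    unfold heardAt
    split_ifs <;> rfl

/-- The messages sent when the instance receives a message. -/
theorem first_apply (hG : G.Lawful) (ω) {c d}
    (h : G.Sim c d) (a) :
    (∀ i, (d.apply (G.sub ω) (G.first c a)).state i = (G.heardAt ω c a i).1) ∧
    (d.apply (G.sub ω) (G.first c a)).corrupted = (c.apply ω a).corrupted ∧
    (d.apply (G.sub ω) (G.first c a)).time = 0 ∧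
    (d.apply (G.sub ω) (G.first c a)).net =
      d.net ++ (finRange n).flatMap fun i => packets i (G.heardAt ω c a i).2 := by
  rcases G.first_cases hG ω h a with ⟨h1, h2⟩ | ⟨j, dst, m, m', hev, hdst, hm, hacc, hev', hb1, hb2, hb3⟩
  · simp [h1]
    have hnil : ((finRange n).flatMap fun i =>
        packets i ([] : List (Fin n × P.Msg))) = [] := by simp [packets]
    rw [hnil, append_nil]
    rcases h2 with ⟨h2, h3⟩ | ⟨i, rfl, h2⟩
    · rw [h2, apply_idle, apply_corrupted, h3]
      exact ⟨h.state, h.corrupted, h.time, rfl⟩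
    · exact ⟨h.state, congrArg (insert i) h.corrupted, h.time, rfl⟩
  · have hact : ∀ i, d.Active (G.sub ω) (G.first c a) i ↔ i = dst := by grind [Active, Sim.corrupted]
    have hact' : ∀ i, c.Active ω a i ↔ i = dst := by grind [Active]
    have hreact : G.heardAt ω c a dst =
        (G.inst (c.state dst)).step dst (G.tape fun x => ω.1 (dst, x)) (.inr (j, m')) := by
      rw [heardAt, if_pos ((hact' dst).2 rfl), hev]
      simp [heard, hm, hacc]
    have hreact' : d.react (G.sub ω) dst (d.event (G.sub ω) (G.first c a)).2 =
        ((G.heardAt ω c a dst).1, (G.heardAt ω c a dst).2, []) := by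
      rw [hreact, hev', react, h.state]
      rfl
    refine ⟨fun i => ?_, ?_, ?_, ?_⟩
    · rw [apply_state]
      split_ifs with hi
      · grind
      · rw [heardAt, if_neg fun h' => hi ((hact i).2 ((hact' i).1 h')), h.state]
    · grind [apply_corrupted, Sim.corrupted]
    · rw [apply_time, hb2, h.time]
    · rw [apply_net]
      congr 1
      congr 1
      funext i
      split_ifs with hi
      · obtain rfl := (hact i).1 hi
        rw [hreact', hb2, h.time]
        rfl
      · rw [heardAt, if_neg fun h' => hi ((hact i).2 ((hact' i).1 h'))]
        rfl

theorem begunAt_of_not_active {ω c a i}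
    (h : ¬ c.Active ω a i) : G.begunAt ω c a i = (G.inst (c.state i), []) := if_neg h

theorem heardAt_of_not_active {ω c a i}
    (h : ¬ c.Active ω a i) : G.heardAt ω c a i = (G.inst (c.state i), []) := if_neg h

/-- The input that the instance at party `i` gets. -/
def givenAt (ω : H.Rand) (c : Config H) (a : Action H) (i : Fin n) : Option I :=
  if c.Active ω a i then G.given i (fun x => ω.1 (i, x)) (c.state i) (c.event ω a).2 else none

theorem second_eq (ω c a i) : G.second c (c.apply ω a) i = match G.givenAt ω c a i with
      | some x => .input i x
      | none => .idle := by
  rw [second, givenAt, apply_state]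
  split_ifs with h
  · rw [given]
    cases h1 : (G.inst (c.state i)).inp with
    | some x => simp
    | none =>
      simp [react]
      grind
  simp_all

theorem inp_of_givenAt {ω c a i x}
    (h : G.givenAt ω c a i = some x) : (G.inst (c.state i)).inp = none ∧ c.Active ω a i := by
  rw [givenAt] at h
  rw [given] at h
  simp_all

theorem begunAt_eq (ω c a i) : G.begunAt ω c a i = match G.givenAt ω c a i with
      | some x => (G.heardAt ω c a i).1.step i (G.tape fun x => ω.1 (i, x)) (.inl x)
      | none => ((G.heardAt ω c a i).1, []) := by
  rw [begunAt, givenAt, heardAt]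
  split_ifs <;> rfl

theorem second_apply (ω : H.Rand) {c : Config H} {d : Config P.alone} (a : Action H) (i)
    (hs : d.state i = (G.heardAt ω c a i).1) (hc : d.corrupted = (c.apply ω a).corrupted)
    (ht : d.time = 0) :
    (d.apply (G.sub ω) (G.second c (c.apply ω a) i)).state i = (G.begunAt ω c a i).1 ∧
    (∀ i' ≠ i, (d.apply (G.sub ω) (G.second c (c.apply ω a) i)).state i' = d.state i') ∧
    (d.apply (G.sub ω) (G.second c (c.apply ω a) i)).corrupted = d.corrupted ∧
    (d.apply (G.sub ω) (G.second c (c.apply ω a) i)).time = 0 ∧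
    (d.apply (G.sub ω) (G.second c (c.apply ω a) i)).net = d.net ++ packets i (G.begunAt ω c a i).2 := by
  rw [second_eq, begunAt_eq]
  cases h : G.givenAt ω c a i with
  | none =>
    exact ⟨hs, fun i' _ => rfl, rfl, ht, by simp [packets, apply_idle]⟩
  | some x =>
    obtain ⟨-, hact⟩ := G.inp_of_givenAt h
    have hic : i ∉ d.corrupted := by
      rw [hc, apply_corrupted, c.base_corrupted_of_active ω a hact.1]
      exact hact.2
    have hact' : ∀ i', d.Active (G.sub ω) (.input i x) i' ↔ i' = i := by grind [Active, event]
    have hr : d.react (G.sub ω) i (.input x) =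
        (((G.heardAt ω c a i).1.step i (G.tape fun x => ω.1 (i, x)) (.inl x)).1,
         ((G.heardAt ω c a i).1.step i (G.tape fun x => ω.1 (i, x)) (.inl x)).2, []) := by
      rw [react, hs]
      rfl
    refine ⟨?_, fun i' hi => ?_, rfl, ht, ?_⟩
    · rw [apply_state, if_pos ((hact' i).2 rfl)]
      exact congrArg (·.1) hr
    · rw [apply_state, if_neg fun h => hi ((hact' i').1 h)]
    · rw [apply_net]
      simp [hact']
      have : ∀ l : List (Fin n), l.Nodup → (l.flatMap fun i' => if i' = i then
          (d.react (G.sub ω) i' (d.event (G.sub ω) (.input i x)).2).2.1.map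
            (fun y => (⟨i', y.1, y.2, (d.base (G.sub ω) (.input i x)).time⟩ : Packet P.alone))
          else []) = if i ∈ l then packets i
            ((G.heardAt ω c a i).1.step i (G.tape fun x => ω.1 (i, x)) (.inl x)).2 else [] := by
        intro l hl
        induction l with
        | nil => rfl
        | cons b l ih =>
          rw [flatMap_cons, ih (nodup_cons.1 hl).2]
          have hb := (nodup_cons.1 hl).1
          by_cases hbi : b = i
          · subst hbi
            rw [if_pos rfl, if_neg hb, if_pos List.mem_cons_self, List.append_nil]
            have : d.react (G.sub ω) b (d.event (G.sub ω) (.input b x)).2 = _ := hr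
            rw [this]
            simp [base, ht]
            rfl
          · rw [if_neg hbi, nil_append]
            simp [Ne.symm hbi]
      rw [this _ (nodup_finRange n), if_pos (mem_finRange i)]

/-- The configuration of the instance after `r` of its inputs. -/
theorem mid (ω : H.Rand) (A : Adversary H) (t) (hG : G.Lawful)
    (h : G.Sim (H.cfg A ω t) (G.cfg A ω ((n + 1) * t))) (r) (hr : r ≤ n) :
    let c := H.cfg A ω t
    let a := H.act A ω t
    let d := G.cfg A ω ((n + 1) * t + 1 + r)
    (∀ i, d.state i = if i.val < r then (G.begunAt ω c a i).1 else (G.heardAt ω c a i).1) ∧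
    d.corrupted = (c.apply ω a).corrupted ∧ d.time = 0 ∧
    d.net = G.net c.net ++ ((finRange n).flatMap fun i => packets i (G.heardAt ω c a i).2) ++
      (((finRange n).take r).flatMap fun i => packets i (G.begunAt ω c a i).2) := by
  intro c a
  induction r with
  | zero =>
    grind [first_apply, Sim.net, cfg_succ, act_first]
  | succ r ih =>
    obtain ⟨h1, h2, h3, h4⟩ := ih (by omega)
    have hlt : r < n := by omega
    have h5 := G.second_apply ω (c := c) a ⟨r, hlt⟩ (by rw [h1]; exact if_neg (lt_irrefl _)) h2 h3
    rw [← Protocol.cfg_succ, ← act_second, ← cfg_succ] at h5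
    obtain ⟨h5, h5', h6, h7, h8⟩ := h5
    rw [← add_assoc]
    refine ⟨fun i => ?_, h6.trans h2, h7, ?_⟩
    · by_cases hi : i = ⟨r, hlt⟩
      · subst hi
        exact h5.trans (if_pos (Nat.lt_succ_self r)).symm
      · have : i.val ≠ r := fun h => hi (Fin.ext h)
        rw [h5' i hi, h1]
        by_cases hlt' : i.val < r
        · exact (if_pos hlt').trans (if_pos (by omega)).symm
        · exact (if_neg hlt').trans (if_neg (by omega)).symm
    grind [take_add_one]

theorem apply_delivered_second (ω : H.Rand) (c c' : Config H) (d : Config P.alone) (i) :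
    (d.apply (G.sub ω) (G.second c c' i)).delivered = d.delivered := by
  unfold second
  split <;> rfl

theorem mid_delivered (ω : H.Rand) (A : Adversary H) (t r) (hr : r ≤ n) :
    (G.cfg A ω ((n + 1) * t + 1 + r)).delivered = (G.cfg A ω ((n + 1) * t + 1)).delivered := by
  induction r with
  | zero => rfl
  | succ r ih =>
    have h := G.act_second A ω t ⟨r, by omega⟩
    grind [cfg_succ, apply_delivered_second]

theorem net_apply (hG : G.Lawful) (ω c a) : G.net (c.apply ω a).net =
      G.net c.net ++ ((finRange n).flatMap fun i => packets i (G.heardAt ω c a i).2) ++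
      ((finRange n).flatMap fun i => packets i (G.begunAt ω c a i).2) := by
  rw [apply_net, net_append, append_assoc]
  have h1 : G.net ((finRange n).flatMap fun i =>
      if c.Active ω a i then (c.react ω i (c.event ω a).2).2.1.map
        fun x => (⟨i, x.1, x.2, (c.base ω a).time⟩ : Packet H) else []) =
      (finRange n).flatMap fun i =>
        packets i (G.heardAt ω c a i).2 ++ packets i (G.begunAt ω c a i).2 := by
    unfold net
    rw [filterMap_flatMap]
    congr 1
    funext i
    split_ifs with hi
    · rw [filterMap_map, heardAt, if_pos hi, begunAt, if_pos hi]
      have := congrArg (packets (P := P) i) (hG.step_msgs i (fun x => ω.1 (i, x)) (c.state i)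
        (c.event ω a).2)
      rw [packets, map_filterMap] at this
      rw [packets, packets, ← map_append]
      refine Eq.trans ?_ this
      simp
      rfl
    · rw [G.heardAt_of_not_active hi, G.begunAt_of_not_active hi]
      rfl
  rw [h1]
  have h2 : (∀ i, (G.heardAt ω c a i).2 = []) ∨ ∃ dst, ∀ i, i ≠ dst → ¬ c.Active ω a i := by
    cases a with
    | input i x => exact .inr ⟨i, fun i' hi' h' => hi' (by simpa [event] using h'.1)⟩
    | deliver idx =>
      cases hp : c.net[idx]? with
      | none => exact .inl fun i => by rw [heardAt, if_neg]; simp [Active, event, hp]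
      | some p =>
        refine .inr ⟨p.dst, fun i' hi' h' => hi' ?_⟩
        have := h'.1
        grind [event]
    | inject src dst m =>
      refine .inr ⟨dst, fun i' hi' h' => hi' ?_⟩
      have := h'.1
      grind [event]
    | tick S =>
      refine .inl fun i => ?_
      unfold heardAt
      split_ifs <;> rfl
    | leader i k =>
      refine .inr ⟨i, fun i' hi' h' => hi' ?_⟩
      have := h'.1
      grind [event]
    | _ => exact .inl fun i => by rw [heardAt, if_neg]; simp [Active, event]
  rcases h2 with h2 | ⟨dst, h2⟩
  · simp [h2, packets]
  · have key : ∀ l : List (Fin n), l.Nodup → (l.flatMap fun i =>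
        packets i (G.heardAt ω c a i).2 ++ packets i (G.begunAt ω c a i).2) =
        (l.flatMap fun i => packets i (G.heardAt ω c a i).2) ++
          (l.flatMap fun i => packets i (G.begunAt ω c a i).2) := by
      have hz : ∀ i, i ≠ dst → (G.heardAt ω c a i).2 = [] ∧ (G.begunAt ω c a i).2 = [] := by grind [heardAt_of_not_active, begunAt_of_not_active]
      intro l hl
      induction l with
      | nil => rfl
      | cons b l ih =>
        simp only [flatMap_cons]
        rw [ih (nodup_cons.1 hl).2]
        by_cases hb : b = dst
        · have hl' : ∀ i ∈ l, i ≠ dst := fun i hi h => (nodup_cons.1 hl).1 (hb ▸ h ▸ hi)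
          have h3 : (l.flatMap fun i => packets i (G.heardAt ω c a i).2) = [] :=
            flatMap_eq_nil_iff.2 fun i hi => by rw [(hz i (hl' i hi)).1]; rfl
          grind
        · rw [(hz b hb).1, (hz b hb).2]
          simp [packets]
    grind [nodup_finRange]

theorem deliver_mem (ω) {c d} (h : G.Sim c d) (a k) :
    k ∈ (d.apply (G.sub ω) (G.first c a)).delivered ↔ k ∈ d.delivered ∨
      ∃ idx p, a = .deliver idx ∧ c.net[idx]? = some p ∧ (G.packet p).isSome ∧
        k = G.pos c.net idx ∧ idx ∉ c.delivered ∧ p.dst ∉ c.corrupted ∧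
        G.accepts (c.state p.dst) p.msg := by
  cases a with
  | deliver idx =>
    cases hp : c.net[idx]? with
    | none => simp [first, hp, apply_idle]
    | some p =>
      by_cases hn : idx ∉ c.delivered ∧ p.dst ∉ c.corrupted ∧ (G.proj p.msg).isSome ∧
          G.accepts (c.state p.dst) p.msg
      · have hf : G.first c (.deliver idx) = .deliver (G.pos c.net idx) := by
          simp only [first, hp]
          simp_all
        obtain ⟨m', hm'⟩ := isSome_iff_exists.1 hn.2.2.1
        have hnet := G.getElem?_net_pos hp (G.packet_of_proj hm')
        rw [← h.net] at hnet
        rw [hf, apply_delivered]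
        simp only [base, hnet, isSome_some, if_true, mem_insert]
        rw [or_comm]
        refine or_congr_right ⟨fun hk => ⟨idx, p, rfl, hp, ?_, hk, hn.1, hn.2.1, hn.2.2.2⟩, ?_⟩
        · grind [packet_of_proj]
        simp_all
      · have hf : G.first c (.deliver idx) = .idle := by
          simp only [first, hp]
          simp_all
        rw [hf, apply_idle]
        refine (or_iff_left ?_).symm
        grind [isSome_packet]
  | inject src dst m =>
    have : (d.apply (G.sub ω) (G.first c (.inject src dst m))).delivered = d.delivered := by
      rw [apply_delivered]
      simp only [first]
      split
      · split_ifs <;> rfl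
      · rfl
    simp [this]
  | _ =>
    rw [apply_delivered]
    simp [first, base]

theorem sim_succ (hG : G.Lawful) (ω A t) (h : G.Sim (H.cfg A ω t) (G.cfg A ω ((n + 1) * t))) :
    G.Sim (H.cfg A ω (t + 1)) (G.cfg A ω ((n + 1) * (t + 1))) := by
  have hn : (n + 1) * (t + 1) = (n + 1) * t + 1 + n := by ring
  obtain ⟨h1, h2, h3, h4⟩ := G.mid ω A t hG h n le_rfl
  rw [hn]
  refine ⟨fun i => ?_, h2, ?_, h3, ?_, ?_⟩
  · rw [h1, if_pos i.2, Protocol.cfg_succ, Config.apply_state, begunAt]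
    split_ifs
    · exact (hG.step_inst _ _ _ _).symm
    · rfl
  · grind [Protocol.cfg_succ, take_of_length_le, Guest.net_apply]
  · intro idx p hp hpk hmem
    rw [G.mid_delivered ω A t n le_rfl, cfg_succ, act_first, G.deliver_mem ω h] at hmem
    have hpre := H.net_prefix ω A (Nat.le_succ t)
    obtain ⟨l, hl⟩ := hpre
    rcases hmem with hmem | ⟨idx', p', hidx, hp', hpk', hk, -⟩
    · have hlt : idx < (H.cfg A ω t).net.length := by
        by_contra hge
        push Not at hge
        have h5 := h.delivered_lt _ hmem
        grind [length_net_le_pos, Sim.net]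
      rw [← hl] at hp hmem
      rw [List.getElem?_append_left hlt] at hp
      rw [G.pos_append hlt.le] at hmem
      exact H.delivered_mono ω A (Nat.le_succ t) (h.delivered idx p hp hpk hmem)
    · have hlt : idx' < (H.cfg A ω t).net.length := (List.getElem?_eq_some_iff.1 hp').1
      have hp'' : (H.cfg A ω (t + 1)).net[idx']? = some p' := by grind
      grind [Protocol.cfg_succ, Config.apply_delivered, Config.base, Guest.pos_injective, Guest.pos_append]
  · intro k hk
    rw [G.mid_delivered ω A t n le_rfl, cfg_succ, act_first, G.deliver_mem ω h] at hk
    rw [h4, append_assoc, length_append, ← h.net]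
    refine Nat.lt_add_right _ ?_
    rcases hk with hk | ⟨idx, p, -, hp, hpk, rfl, -⟩
    · exact h.delivered_lt k hk
    grind [isSome_iff_exists, Sim.net, getElem?_net_pos]

theorem sim (hG : G.Lawful) (ω A t) : G.Sim (H.cfg A ω t) (G.cfg A ω ((n + 1) * t)) := by
  induction t with
  | zero =>
    refine ⟨fun i => (hG.inst_init i).symm, rfl, rfl, rfl, ?_, ?_⟩
    · intro idx p hp
      exact absurd hp (by simp [Protocol.cfg, Protocol.exec])
    · intro k hk
      exact absurd hk (by simp [cfg, Protocol.drive])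
  | succ t ih => exact G.sim_succ hG ω A t ih

/-- The configurations are the same, except for what is not visible of the instance. -/
structure SameCfg (c c' : Config H) : Prop where
  corrupted : c.corrupted = c'.corrupted
  net : c.net = c'.net
  delivered : c.delivered = c'.delivered
  time : c.time = c'.time
  requests : c.requests = c'.requests
  led : c.led = c'.led
  same : ∀ i, G.same (c.state i) (c'.state i)
  revealed : ∀ i ∈ c.corrupted, c.state i = c'.state i

/-- All randomness agrees, except for the coins of the instance. -/
def Agree (x y : H.Rand) : Prop := x.2 = y.2 ∧ ∀ i c, c ∉ Set.range G.coin → x.1 (i, c) = y.1 (i, c)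

variable {G}

theorem SameCfg.leader {c c'} (h : G.SameCfg c c') {x y} (hxy : x.2 = y.2) : c.leader x = c'.leader y := by
  funext k
  rw [Config.leader, Config.leader, h.requests, hxy]

theorem SameCfg.view {c c'} (hG : G.Lawful) (h : G.SameCfg c c') {x y}
    (hxy : x.2 = y.2) : c.view x = c'.view y := by
  have h1 : (fun i => H.output (c.state i)) = fun i => H.output (c'.state i) :=
    funext fun i => hG.same_output (h.same i)
  grind [view, SameCfg.corrupted, SameCfg.revealed, SameCfg.leader, SameCfg.net, SameCfg.delivered, SameCfg.time, SameCfg.requests]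

theorem SameCfg.injectable {c c'} (h : G.SameCfg c c') (src m) :
    c.Injectable src m ↔ c'.Injectable src m := by
  unfold Injectable
  rw [h.corrupted, h.net]

theorem SameCfg.event {c c'} (h : G.SameCfg c c') {x y} (hxy : x.2 = y.2)
    (a) : c.event x a = c'.event y a := by
  have h1 := h.leader hxy
  cases a <;> simp only [Config.event, h.injectable, h1, h.net, h.delivered, h.led]

theorem SameCfg.base {c c'} (h : G.SameCfg c c') {x y} (hxy : x.2 = y.2)
    (a) : (c.base x a).corrupted = (c'.base y a).corrupted ∧
      (c.base x a).delivered = (c'.base y a).delivered ∧ (c.base x a).time = (c'.base y a).time ∧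
      (c.base x a).requests = (c'.base y a).requests ∧ (c.base x a).led = (c'.base y a).led := by
  have h1 := h.leader hxy
  cases a <;> simp only [Config.base, h1, h.corrupted, h.net, h.delivered, h.led, h.time,
    h.requests] <;> (try split_ifs) <;> simp [h.corrupted, h.delivered, h.led, h.time, h.requests]

theorem SameCfg.active {c c'} (h : G.SameCfg c c') {x y} (hxy : x.2 = y.2)
    (a i) : c.Active x a i ↔ c'.Active y a i := by
  rw [Active, Active, h.event hxy, h.corrupted]

theorem SameCfg.first {c c'} (hG : G.Lawful) (h : G.SameCfg c c') (a) : G.first c a = G.first c' a := by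
  cases a with
  | deliver idx =>
    grind [Guest.first, SameCfg.net, SameCfg.delivered, SameCfg.corrupted, hG.same_accepts, SameCfg.same]
  | inject src dst m =>
    simp [Guest.first, h.injectable, h.corrupted, hG.same_accepts m (h.same dst)]
  | _ => rfl

theorem filter_packets (f : Fin n → List (Fin n × P.Msg)) (i : Fin n) :
    (((finRange n).flatMap fun i => packets i (f i)).filter fun p => decide (p.src = i)) =
      packets i (f i) := by
  have : ∀ l : List (Fin n), l.Nodup → ((l.flatMap fun i => packets i (f i)).filter
      fun p => decide (p.src = i)) = if i ∈ l then packets i (f i) else [] := by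
    intro l hl
    induction l with
    | nil => rfl
    | cons b l ih =>
      rw [flatMap_cons, filter_append, ih (nodup_cons.1 hl).2]
      have hb := (nodup_cons.1 hl).1
      by_cases hbi : b = i
      · subst hbi
        rw [if_neg hb, if_pos List.mem_cons_self, List.append_nil, List.filter_eq_self]
        intro p hp
        obtain ⟨x, -, rfl⟩ := List.mem_map.1 hp
        simp
      · have : (packets b (f b)).filter (fun p => decide (p.src = i)) = [] := by
          rw [filter_eq_nil_iff]
          intro p hp
          obtain ⟨x, -, rfl⟩ := List.mem_map.1 hp
          simp_all
        rw [this, nil_append]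
        simp [Ne.symm hbi]
  rw [this _ (nodup_finRange n), if_pos (mem_finRange i)]

theorem packets_injective (i) : Injective (packets i : List (Fin n × P.Msg) → List (Packet P.alone)) := by
  refine map_injective_iff.2 fun x y h => ?_
  grind

theorem packets_cancel {f f' : Fin n → List (Fin n × P.Msg)}
    (h : ((finRange n).flatMap fun i => packets i (f i)) =
      (finRange n).flatMap fun i => packets i (f' i)) : f = f' := by
  funext i
  apply packets_injective i
  rw [← filter_packets f i, ← filter_packets f' i, h]

theorem drive_view {Q : Protocol n In Out} (act : ℕ → Action Q) (ω : Q.Rand) (s) :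
    (Q.drive act ω s).2.head? = some ((Q.drive act ω s).1.view ω) := by
  cases s <;> rfl

/-- What the adversary has seen of the instance after `s` of its steps. -/
abbrev hist (G : Guest H P) (A : Adversary H) (ω : H.Rand) (s : ℕ) : List (View P.alone) :=
  (P.alone.drive (G.act A ω) (G.sub ω) s).2

section Flow

variable {A : Adversary H} {x y : H.Rand} {s t : ℕ}

theorem hist_mono (hst : s ≤ t) (h : G.hist A x t = G.hist A y t) : G.hist A x s = G.hist A y s :=
  drive_tail (act := G.act A) (f := G.sub) hst h

theorem view_eq_of_hist (h : G.hist A x s = G.hist A y s) :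
    (G.cfg A x s).view (G.sub x) = (G.cfg A y s).view (G.sub y) := by
  have := (drive_view (Q := P.alone) (G.act A x) (G.sub x) s).symm.trans
    ((congrArg head? h).trans (drive_view (Q := P.alone) (G.act A y) (G.sub y) s))
  exact some.inj this

theorem net_eq_of_hist (h : G.hist A x s = G.hist A y s) : (G.cfg A x s).net = (G.cfg A y s).net :=
  congrArg View.net (view_eq_of_hist h)

theorem inst_eq_of_hist (h : G.hist A x s = G.hist A y s) (i) {u u'}
    (hu : (G.cfg A x s).state i = u) (hu' : (G.cfg A y s).state i = u') :
    u.inp = u'.inp ∧ u.out = u'.out := by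
  have := congrFun (congrArg View.output (view_eq_of_hist h)) i
  subst hu hu'
  exact Prod.ext_iff.1 this

theorem revealed_eq_of_hist (h : G.hist A x s = G.hist A y s) {i}
    (hi : i ∈ (G.cfg A x s).corrupted) : (G.cfg A x s).state i = (G.cfg A y s).state i := by
  have h1 := congrFun (congrArg View.revealed (view_eq_of_hist h)) i
  have h2 := congrArg View.corrupted (view_eq_of_hist h)
  simp [view] at h1 h2
  simp_all

theorem heardAt_vis (hG : G.Lawful) (hs : G.SameCfg (H.cfg A x t) (H.cfg A y t))
    (h : G.hist A x ((n + 1) * t + 1) = G.hist A y ((n + 1) * t + 1))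
    (i) : Vis (G.heardAt x (H.cfg A x t) (H.act A x t) i) (G.heardAt y (H.cfg A y t) (H.act A y t) i) := by
  obtain ⟨h1, -, -, h4⟩ := G.mid x A t hG (G.sim hG x A t) 0 (Nat.zero_le _)
  obtain ⟨h1', -, -, h4'⟩ := G.mid y A t hG (G.sim hG y A t) 0 (Nat.zero_le _)
  have hnet := net_eq_of_hist h
  rw [h4, h4', hs.net] at hnet
  simp at hnet
  have hmsg := congrFun (packets_cancel hnet) i
  have hout := inst_eq_of_hist h i (h1 i) (h1' i)
  exact ⟨hout.1, hout.2, hmsg⟩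

theorem begunAt_vis (hG : G.Lawful) (hs : G.SameCfg (H.cfg A x t) (H.cfg A y t))
    (h : G.hist A x ((n + 1) * t + 1 + n) = G.hist A y ((n + 1) * t + 1 + n))
    (i) : Vis (G.begunAt x (H.cfg A x t) (H.act A x t) i) (G.begunAt y (H.cfg A y t) (H.act A y t) i) := by
  obtain ⟨h1, -, -, h4⟩ := G.mid x A t hG (G.sim hG x A t) n le_rfl
  obtain ⟨h1', -, -, h4'⟩ := G.mid y A t hG (G.sim hG y A t) n le_rfl
  have hnet := net_eq_of_hist h
  have hheard : (fun i => (G.heardAt x (H.cfg A x t) (H.act A x t) i).2) =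
      fun i => (G.heardAt y (H.cfg A y t) (H.act A y t) i).2 :=
    funext fun i => (heardAt_vis hG hs (hist_mono (Nat.le_add_right _ _) h) i).2.2
  have hheard' : ((finRange n).flatMap fun i =>
      packets i (G.heardAt x (H.cfg A x t) (H.act A x t) i).2) =
      (finRange n).flatMap fun i =>
        packets i (G.heardAt y (H.cfg A y t) (H.act A y t) i).2 := by
    congr 1
    funext i
    rw [congrFun hheard i]
  rw [h4, h4', hs.net, hheard', append_cancel_left_eq, take_of_length_le (by simp)] at hnet
  have hmsg := congrFun (packets_cancel hnet) i
  have hout := inst_eq_of_hist h i (h1 i) (h1' i)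
  simp at hout
  exact ⟨hout.1, hout.2, hmsg⟩

theorem givenAt_eq (hG : G.Lawful) (hxy : G.Agree x y) (hs : G.SameCfg (H.cfg A x t) (H.cfg A y t))
    (ha : H.act A x t = H.act A y t) (h : G.hist A x ((n + 1) * t + 1) = G.hist A y ((n + 1) * t + 1))
    (i) : G.givenAt x (H.cfg A x t) (H.act A x t) i = G.givenAt y (H.cfg A y t) (H.act A y t) i := by
  have hv := heardAt_vis hG hs h i
  have hact := hs.active hxy.1 (H.act A x t) i
  rw [ha] at hact hv ⊢
  rw [givenAt, givenAt]
  by_cases hi : (H.cfg A x t).Active x (H.act A y t) i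
  · rw [if_pos hi, if_pos (hact.1 hi)]
    rw [heardAt, heardAt, if_pos hi, if_pos (hact.1 hi), ← hs.event hxy.1] at hv
    rw [← hs.event hxy.1]
    exact hG.flow_given i _ _ _ _ _ (hxy.2 i) (hs.same i) hv
  simp_all

theorem SameCfg.succ (hG : G.Lawful) (hxy : G.Agree x y)
    (hs : G.SameCfg (H.cfg A x t) (H.cfg A y t)) (ha : H.act A x t = H.act A y t)
    (h : G.hist A x ((n + 1) * (t + 1)) = G.hist A y ((n + 1) * (t + 1))) :
    G.SameCfg (H.cfg A x (t + 1)) (H.cfg A y (t + 1)) := by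
  have hn : (n + 1) * (t + 1) = (n + 1) * t + 1 + n := by ring
  have h' := h
  rw [hn] at h'
  have hflow : ∀ i, (H.cfg A x t).Active x (H.act A x t) i →
      G.same ((H.cfg A x t).react x i ((H.cfg A x t).event x (H.act A x t)).2).1
        ((H.cfg A y t).react y i ((H.cfg A y t).event y (H.act A y t)).2).1 ∧
      ((H.cfg A x t).react x i ((H.cfg A x t).event x (H.act A x t)).2).2 =
        ((H.cfg A y t).react y i ((H.cfg A y t).event y (H.act A y t)).2).2 := by
    intro i hi
    have hv := heardAt_vis hG hs (hist_mono (Nat.le_add_right _ _) h') i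
    have hv' := begunAt_vis hG hs h' i
    have hact := (hs.active hxy.1 (H.act A x t) i).1 hi
    rw [ha] at hact hv hv' hi ⊢
    rw [heardAt, heardAt, if_pos hi, if_pos hact, ← hs.event hxy.1] at hv
    rw [begunAt, begunAt, if_pos hi, if_pos hact, ← hs.event hxy.1] at hv'
    rw [← hs.event hxy.1]
    exact hG.flow i _ _ _ _ _ (hxy.2 i) (hs.same i) hv hv'
  have hact := hs.active hxy.1 (H.act A x t)
  obtain ⟨hb1, hb2, hb3, hb4, hb5⟩ := hs.base hxy.1 (H.act A x t)
  have hsame : ∀ i, G.same ((H.cfg A x (t + 1)).state i) ((H.cfg A y (t + 1)).state i) := by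
    intro i
    rw [Protocol.cfg_succ, Protocol.cfg_succ, Config.apply_state, Config.apply_state]
    by_cases hi : (H.cfg A x t).Active x (H.act A x t) i
    · simp_all
    · rw [if_neg hi, if_neg fun h => hi ((hact i).2 (ha ▸ h))]
      exact hs.same i
  refine ⟨?_, ?_, ?_, ?_, ?_, ?_, hsame, ?_⟩
  · grind [Protocol.cfg_succ, Config.apply_corrupted]
  · rw [Protocol.cfg_succ, Protocol.cfg_succ, Config.apply_net, Config.apply_net, hs.net]
    simp_all
  · grind [Protocol.cfg_succ, Config.apply_delivered]
  · grind [Protocol.cfg_succ, Config.apply_time]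
  · grind [Protocol.cfg_succ, Config.apply_requests]
  · grind [Protocol.cfg_succ, Config.apply_led]
  · intro i hi
    have hx := G.sim hG x A (t + 1)
    have hy := G.sim hG y A (t + 1)
    refine hG.same_eq (hsame i) ?_
    rw [← hx.state, ← hy.state]
    exact revealed_eq_of_hist h (hx.corrupted ▸ hi)

theorem same_of_hist (hG : G.Lawful) (hxy : G.Agree x y) (t)
    (h : G.hist A x ((n + 1) * t) = G.hist A y ((n + 1) * t)) :
    G.SameCfg (H.cfg A x t) (H.cfg A y t) ∧ (H.exec A x t).2 = (H.exec A y t).2 := by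
  induction t with
  | zero =>
    have : G.SameCfg (H.cfg A x 0) (H.cfg A y 0) :=
      ⟨rfl, rfl, rfl, rfl, rfl, rfl, hG.same_init, fun _ _ => rfl⟩
    exact ⟨this, congrArg (· :: []) (this.view hG hxy.1)⟩
  | succ t ih =>
    obtain ⟨ih1, ih2⟩ := ih (hist_mono (Nat.mul_le_mul_left _ (Nat.le_succ t)) h)
    have hs := ih1.succ hG hxy (congrArg A ih2) h
    refine ⟨hs, ?_⟩
    have : ∀ z : H.Rand, (H.exec A z (t + 1)).2 =
        (H.cfg A z (t + 1)).view z :: (H.exec A z t).2 := fun z => rfl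
    rw [this, this, ih2, hs.view hG hxy.1]

theorem act_eq_of_hist (hG : G.Lawful) (hxy : G.Agree x y) (s)
    (h : G.hist A x s = G.hist A y s) : G.act A x s = G.act A y s := by
  have hle := Nat.mul_div_le s (n + 1)
  obtain ⟨hs, hh⟩ := same_of_hist hG hxy _ (hist_mono hle h)
  have ha : H.act A x (s / (n + 1)) = H.act A y (s / (n + 1)) := congrArg A hh
  unfold act
  dsimp only
  split_ifs with h1 h2
  · rw [ha, hs.first hG]
  · have hle' : (n + 1) * (s / (n + 1)) + 1 ≤ s := by grind [Nat.div_add_mod]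
    grind [Protocol.cfg_succ, Guest.second_eq, Guest.givenAt_eq, Guest.hist_mono]
  · rfl

end Flow

/-- For fixed other randomness, the instance is attacked by an adversary of its own. -/
theorem exists_adversary (hG : G.Lawful) (A x) :
    ∃ A' : Adversary P.alone, ∀ y, G.Agree x y → ∀ s, P.alone.cfg A' (G.sub y) s = G.cfg A y s := by
  obtain ⟨A', hA'⟩ := Protocol.exists_adversary (P := P.alone)
    (fun y : {y // G.Agree x y} => G.sub y.1) (fun y => G.act A y.1) (by
      intro y z t h
      refine act_eq_of_hist hG ⟨y.2.1.symm.trans z.2.1, fun i c hc => ?_⟩ t h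
      exact (y.2.2 i c hc).symm.trans (z.2.2 i c hc))
  exact ⟨A', fun y hy s => congrArg Prod.fst (hA' ⟨y, hy⟩ s)⟩

end Guest
end Guests

open Guest

section LocalExec

open Filter Topology

variable {n : ℕ} {In Out : Type}

/-- In each step, a party reads only finitely many coins. -/
def Protocol.Local (H : Protocol n In Out) : Prop :=
  ∀ i s e, IsLocallyConstant fun ω : H.Tape => H.step i ω s e

variable {H : Protocol n In Out}

theorem Protocol.Local.react (hH : H.Local) (c : Config H) (i)
    (e : Event n In H.Msg H.LKey) (ω : H.Rand) : ∀ᶠ ω' in 𝓝 ω, c.react ω' i e = c.react ω i e := by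
  have hc : Continuous fun ω : H.Rand => (fun x => ω.1 (i, x) : H.Tape) := by fun_prop
  exact (iff_eventually_eq _).1 ((hH i (c.state i) e).comp_continuous hc) ω

theorem Config.leader_eventually (c : Config H) (ω : H.Rand) (k : H.LKey) :
    ∀ᶠ ω' in 𝓝 ω, c.leader ω' k = c.leader ω k := by
  have hc : Continuous fun ω : H.Rand => ω.2 k := by fun_prop
  have := (iff_eventually_eq _).1 ((of_discrete id).comp_continuous hc) ω
  filter_upwards [this] with ω' h
  grind [leader]

theorem Protocol.Local.apply (hH : H.Local) (c : Config H) (a : Action H) (ω : H.Rand) :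
    ∀ᶠ ω' in 𝓝 ω, c.apply ω' a = c.apply ω a := by
  have h1 : ∀ᶠ ω' in 𝓝 ω, c.base ω' a = c.base ω a ∧ c.event ω' a = c.event ω a := by
    cases a with
    | leader i k =>
      filter_upwards [c.leader_eventually ω k] with ω' h
      simp [Config.base, Config.event, h]
    | _ => exact Eventually.of_forall fun ω' => ⟨rfl, rfl⟩
  have h2 := eventually_all.2 fun i => hH.react (c.base ω a) i (c.event ω a).2 ω
  filter_upwards [h1, h2] with ω' h1 h2
  rw [Config.apply_eq, Config.apply_eq, h1.1, h1.2]
  have h3 := funext h2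
  unfold Config.react at h3
  simp [Config.activate]
  simp [funext_iff] at h3
  simp_all

theorem Config.view_eventually (c : Config H) (hc : {k | (c.requests k).Nonempty}.Finite)
    (ω : H.Rand) : ∀ᶠ ω' in 𝓝 ω, c.view ω' = c.view ω := by
  have h : ∀ᶠ ω' in 𝓝 ω, ∀ k ∈ {k | (c.requests k).Nonempty}, c.leader ω' k = c.leader ω k :=
    (eventually_all_finite hc).2 fun k _ => c.leader_eventually ω k
  filter_upwards [h] with ω' h
  have : c.leader ω' = c.leader ω := by grind [not_nonempty_iff_eq_empty, leader]
  grind [view]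

theorem Config.finite_requests_apply (c : Config H) (hc : {k | (c.requests k).Nonempty}.Finite)
    (ω : H.Rand) (a : Action H) : {k | ((c.apply ω a).requests k).Nonempty}.Finite := by
  have h1 : {k | ((c.base ω a).requests k).Nonempty}.Finite := by
    cases a with
    | request i k =>
      refine (hc.union (Set.finite_singleton k)).subset fun k' hk' => ?_
      simp [base] at hk'
      split_ifs at hk'
      · grind
      simp_all
    | _ =>
      grind [base]
  have h2 : (⋃ i : Fin n, {k | k ∈ (c.react ω i (c.event ω a).2).2.2}).Finite :=
    Set.finite_iUnion fun i => finite_toSet _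
  refine (h1.union h2).subset fun k hk => ?_
  grind [apply_requests, Set.mem_iUnion]

/-- Executions with prescribed actions are locally constant, if the actions are. -/
theorem Protocol.Local.drive (hH : H.Local) {α : Type*} [TopologicalSpace α] (f : α → H.Rand)
    (hf : Continuous f) (act : α → ℕ → Action H)
    (hact : ∀ t, (∀ s ≤ t, IsLocallyConstant fun x => H.drive (act x) (f x) s) →
      IsLocallyConstant fun x => act x t) (t) :
    ∀ s ≤ t, IsLocallyConstant fun x => H.drive (act x) (f x) s := by
  have hfin : ∀ x s, {k | ((H.drive (act x) (f x) s).1.requests k).Nonempty}.Finite := by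
    intro x s
    induction s with
    | zero => simp [Protocol.drive]
    | succ s ih => exact Config.finite_requests_apply _ ih _ _
  induction t with
  | zero =>
    intro s hs
    refine (iff_eventually_eq _).2 fun x => ?_
    have := hf.continuousAt.eventually (view_eventually
      (⟨H.init, ∅, [], ∅, 0, fun _ => ∅, ∅⟩ : Config H) (by simp) (f x))
    grind [Protocol.drive]
  | succ t ih =>
    intro s hs
    rcases Nat.le_succ_iff.1 hs with hs | rfl
    · simp_all
    · refine (iff_eventually_eq _).2 fun x => ?_
      have h1 := (iff_eventually_eq _).1 (ih t le_rfl) x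
      have h2 := (iff_eventually_eq _).1 (hact t ih) x
      have h3 := hf.continuousAt.eventually (hH.apply (H.drive (act x) (f x) t).1 (act x t) (f x))
      have h4 := hf.continuousAt.eventually (view_eventually _ (hfin x (t + 1)) (f x))
      filter_upwards [h1, h2, h3, h4] with y h1 h2 h3 h4
      grind [Protocol.drive]

theorem Protocol.Local.exec (hH : H.Local) (A t) : IsLocallyConstant fun ω => H.exec A ω t := by
  have := hH.drive id continuous_id (fun ω => H.act A ω) (fun t h => by
    have := h t le_rfl
    simp [← exec_eq_drive] at this
    exact this.comp fun c => A c.2) t t le_rfl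
  grind [exec_eq_drive]

theorem Protocol.Local.cfg (hH : H.Local) (A t) :
    IsLocallyConstant fun ω => H.cfg A ω t := (hH.exec A t).comp Prod.fst

theorem Protocol.Local.act (hH : H.Local) (A t) :
    IsLocallyConstant fun ω => H.act A ω t := (hH.exec A t).comp fun c => A c.2

theorem AsyncProtocol.local_alone {I O : Type} (P : AsyncProtocol n I O) : P.alone.Local := by
  intro i s e
  have h : ∀ m : ℕ, IsLocallyConstant fun ω : ℕ → Fin (P.coins + 1) => ω m := fun m =>
    (of_discrete id).comp_continuous (continuous_apply m)
  cases e with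
  | input x =>
    exact (h s.cnt).comp fun a =>
      ((s.step i (fun _ => a) (.inl x)).1, (s.step i (fun _ => a) (.inl x)).2, [])
  | recv j m =>
    exact (h s.cnt).comp fun a =>
      ((s.step i (fun _ => a) (.inr (j, m))).1, (s.step i (fun _ => a) (.inr (j, m))).2, [])
  | tick => exact IsLocallyConstant.const _
  | leader k l => exact IsLocallyConstant.const _

end LocalExec

section Guests

variable {n : ℕ} {In Out I O : Type}
namespace Guest
variable {H : Protocol n In Out} {P : AsyncProtocol n I O} (G : Guest H P)

theorem isLocallyConstant_cfg (hH : H.Local) (A : Adversary H) (s) :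
    IsLocallyConstant fun ω => G.cfg A ω s := by
  have hsub : Continuous G.sub := by
    refine Continuous.prodMk (continuous_pi fun x => ?_) continuous_const
    exact (continuous_of_discreteTopology (f := Fin.cast _)).comp ((continuous_apply _).comp continuous_fst)
  have := P.local_alone.drive G.sub hsub (fun ω => G.act A ω) (fun t _ => by
    have h := isLocallyConstant_pair (hH.cfg A (t / (n + 1))) (isLocallyConstant_pair
      (hH.act A (t / (n + 1))) (hH.cfg A (t / (n + 1) + 1)))
    exact h.comp fun x => if t % (n + 1) = 0 then G.first x.1 x.2.1
      else if h : t % (n + 1) - 1 < n then G.second x.1 x.2.2 ⟨t % (n + 1) - 1, h⟩ else .idle)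
    s s le_rfl
  exact this.comp Prod.fst

theorem map_cast_uniform {a b} (h : a = b) :
    (PMF.uniformOfFintype (Fin (a + 1))).toMeasure.map (Fin.cast (congrArg (· + 1) h)) =
      (PMF.uniformOfFintype (Fin (b + 1))).toMeasure := by
  subst h
  simp_all

/-- The coins of the instance are uniform and independent. -/
theorem map_sub_coins (hG : G.Lawful) : (Measure.infinitePi fun x : Fin n × H.Coin =>
      (PMF.uniformOfFintype (Fin (H.faces x.2 + 1))).toMeasure).map (fun x (y : Fin n × ℕ) =>
          Fin.cast (congrArg (· + 1) (G.faces_coin y.2)) (x (y.1, G.coin y.2))) =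
    Measure.infinitePi fun _ : Fin n × ℕ =>
      (PMF.uniformOfFintype (Fin (P.coins + 1))).toMeasure := by
  have h1 := infinitePi_reindex (fun x : Fin n × H.Coin =>
      (PMF.uniformOfFintype (Fin (H.faces x.2 + 1))).toMeasure)
    (fun y : Fin n × ℕ => (y.1, G.coin y.2)) (fun y z h => by grind [Regular.coin_injective, hG.toRegular])
  have h2 := Measure.infinitePi_map_pi
    (μ := fun y : Fin n × ℕ => (PMF.uniformOfFintype (Fin (H.faces (G.coin y.2) + 1))).toMeasure)
    (f := fun y => Fin.cast (congrArg (· + 1) (G.faces_coin y.2))) (fun _ => Measurable.of_discrete)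
  have hc : (fun y : Fin n × ℕ =>
      (PMF.uniformOfFintype (Fin (H.faces (G.coin y.2) + 1))).toMeasure.map
        (Fin.cast (congrArg (· + 1) (G.faces_coin y.2)))) =
      fun _ => (PMF.uniformOfFintype (Fin (P.coins + 1))).toMeasure :=
    funext fun y => map_cast_uniform (G.faces_coin y.2)
  rw [hc] at h2
  rw [← h2, ← h1, Measure.map_map]
  · rfl
  · exact measurable_pi_lambda _ fun y =>
      (Measurable.of_discrete (f := Fin.cast (congrArg (· + 1) (G.faces_coin y.2)))).comp
        (measurable_pi_apply y)
  · exact measurable_pi_lambda _ fun y => measurable_pi_apply _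

/-- What fails with small probability for the instance on its own also fails with small probability
for the instance inside the host. -/
theorem transfer [NeZero n] (hG : G.Lawful) (A) (Φ : (ℕ → Config P.alone) → Prop)
    (hΦ : MeasurableSet {ω : H.Rand | Φ (G.cfg A ω)}) (ε)
    (h : ∀ A' : Adversary P.alone, P.alone.law {ω | Φ (P.alone.cfg A' ω)} ≤ ε) :
    H.law {ω | Φ (G.cfg A ω)} ≤ ε := by
  set S : Set H.Rand := {ω | Φ (G.cfg A ω)} with hS
  let R : Set (Fin n × H.Coin) := {p | p.2 ∈ Set.range G.coin}
  let M := Measure.infinitePi fun x : Fin n × H.Coin =>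
    (PMF.uniformOfFintype (Fin (H.faces x.2 + 1))).toMeasure
  let L := Measure.infinitePi fun _ : H.LKey => (PMF.uniformOfFintype (Fin n)).toMeasure
  let res : ((x : Fin n × H.Coin) → Fin (H.faces x.2 + 1)) ×
      ((x : Fin n × H.Coin) → Fin (H.faces x.2 + 1)) → (x : Fin n × H.Coin) → Fin (H.faces x.2 + 1) :=
    fun p i => if i ∈ R then p.2 i else p.1 i
  have hres : Measurable res := by
    refine measurable_pi_lambda _ fun i => ?_
    by_cases hi : i ∈ R
    · simp [res, hi]
      exact (measurable_pi_apply i).comp measurable_snd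
    · simp [res, hi]
      exact (measurable_pi_apply i).comp measurable_fst
  have key : ∀ b a, M {x | (res (a, x), b) ∈ S} ≤ ε := by
    intro b a
    obtain ⟨A', hA'⟩ := G.exists_adversary hG A (a, b)
    let sub1 : ((x : Fin n × H.Coin) → Fin (H.faces x.2 + 1)) → Fin n × ℕ → Fin (P.coins + 1) :=
      fun x y => Fin.cast (congrArg (· + 1) (G.faces_coin y.2)) (x (y.1, G.coin y.2))
    have hsub1 : Measurable sub1 := measurable_pi_lambda _ fun y =>
      (Measurable.of_discrete (f := Fin.cast (congrArg (· + 1) (G.faces_coin y.2)))).comp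
        (measurable_pi_apply _)
    let T : Set (Fin n × ℕ → Fin (P.coins + 1)) :=
      {y | Φ (P.alone.cfg A' ((y, fun k => k.elim) : P.alone.Rand))}
    have h1 : {x | (res (a, x), b) ∈ S} = sub1 ⁻¹' T := by
      ext x
      have hagree : G.Agree ((a, b) : H.Rand) (res (a, x), b) := ⟨rfl, fun i c hc => (if_neg hc).symm⟩
      have hsub : G.sub ((res (a, x), b) : H.Rand) = (sub1 x, fun k => k.elim) := by
        refine Prod.ext (funext fun y => ?_) rfl
        have : ((y.1, G.coin y.2) : Fin n × H.Coin) ∈ R := ⟨y.2, rfl⟩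
        simp [sub, res]
        rw [if_pos this]
        rfl
      exact iff_of_eq (congrArg Φ
        ((congrArg (P.alone.cfg A') hsub).symm.trans (funext (hA' _ hagree))).symm)
    have h2 : P.alone.law {ω | Φ (P.alone.cfg A' ω)} = (Measure.infinitePi fun _ : Fin n × ℕ =>
          (PMF.uniformOfFintype (Fin (P.coins + 1))).toMeasure) T := by
      have : {ω : P.alone.Rand | Φ (P.alone.cfg A' ω)} = T ×ˢ Set.univ := by
        ext ω
        have h3 : ((ω.1, fun k => k.elim) : P.alone.Rand) = ω := Prod.ext rfl (funext fun k => k.elim)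
        have h4 := congrArg (fun o => Φ (P.alone.cfg A' o)) h3
        exact ⟨fun h => ⟨h4.mpr h, trivial⟩, fun h => h4.mp h.1⟩
      rw [this]
      refine (Measure.prod_prod _ _).trans ?_
      rw [measure_univ, mul_one]
      rfl
    rw [h1]
    refine (Measure.le_map_apply hsub1.aemeasurable T).trans ?_
    rw [G.map_sub_coins hG, ← h2]
    exact h A'
  have hlaw : H.law S = ∫⁻ b, M {a | (a, b) ∈ S} ∂L := Measure.prod_apply_symm hΦ
  rw [hlaw]
  refine (lintegral_mono (g := fun _ => ε) fun b => ?_).trans (by simp)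
  have hSb : MeasurableSet {a | (a, b) ∈ S} := measurable_prodMk_right hΦ
  have hM : M = (M.prod M).map res := (infinitePi_resample _ R).symm
  rw [hM, Measure.map_apply hres hSb, Measure.prod_apply (hres hSb)]
  exact (lintegral_mono fun a => key b a).trans (by simp)

end Guest
end Guests

/-! ## Runs of message-driven protocols -/

section AloneRuns

variable {n : ℕ} {I O : Type} {P : AsyncProtocol n I O}

def instAt (c : Config P.alone) (i : Fin n) : Inst P := c.state i

/-- The run `R` of an instance: party `i` is never corrupted. -/
def RHonest (R : ℕ → Config P.alone) (i : Fin n) : Prop := ∀ t, i ∉ (R t).corrupted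

def RBegins (R : ℕ → Config P.alone) (i : Fin n) (x : I) : Prop := ∃ t, (instAt (R t) i).inp = some x

def ROutputs (R : ℕ → Config P.alone) (i : Fin n) (v : O) : Prop := ∃ t, (instAt (R t) i).out = some v

def RRuns (b : ℕ) (R : ℕ → Config P.alone) : Prop := (∀ t, (R t).corrupted.card ≤ b) ∧
  (∀ t idx p, (R t).net[idx]? = some p → RHonest R p.dst → ∃ t', idx ∈ (R t').delivered) ∧
  ∀ i, RHonest R i → ∃ x, RBegins R i x

abbrev RAgree (R : ℕ → Config P.alone) : Prop := ∃ v, ∀ i, RHonest R i → ROutputs R i v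

abbrev RConsistent (R : ℕ → Config P.alone) : Prop := (∀ i v, RHonest R i → ¬ ROutputs R i v) ∨ RAgree R

abbrev RSender {P : AsyncProtocol n (Option I) O} (R : ℕ → Config P.alone) (p : Fin n) : Prop :=
  ∀ i x, RBegins R i x → (x.isSome ↔ i = p)

abbrev RValid {P : AsyncProtocol n (Option O) O} (R : ℕ → Config P.alone) (p : Fin n) : Prop :=
  ∀ v, RHonest R p → RBegins R p (some v) → ∀ i, RHonest R i → ROutputs R i v

theorem Inst.step_inp {s : Inst P} {i} {ω : ℕ → Fin (P.coins + 1)}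
    {e : I ⊕ (Fin n × P.Msg)} {x : I} (h : s.inp = some x) : (s.step i ω e).1.inp = some x := by grind [step]

theorem Inst.step_out {s : Inst P} {i} {ω : ℕ → Fin (P.coins + 1)}
    {e : I ⊕ (Fin n × P.Msg)} {v : O} (h : s.out = some v) : (s.step i ω e).1.out = some v := by grind [step]

theorem Inst.step_inl_inp (s : Inst P) (i) (ω : ℕ → Fin (P.coins + 1)) (x : I) :
    (s.step i ω (.inl x)).1.inp = some (s.inp.getD x) := by grind [step]

theorem alone_step_cases (i ω s e) : ∃ s' : Inst P, (P.alone.step i ω s e).1 = s' ∧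
      (s' = s ∨ ∃ e', s' = (s.step i ω e').1 ∧ ∀ x, e' = .inl x → e = .input x) := by
  cases e with
  | input x => exact ⟨_, rfl, .inr ⟨.inl x, rfl, fun y h => by simp_all⟩⟩
  | recv j m => exact ⟨_, rfl, .inr ⟨.inr (j, m), rfl, fun y h => by cases h⟩⟩
  | tick => exact ⟨_, rfl, .inl rfl⟩
  | leader k l => exact k.elim

theorem instAt_apply (ω : P.alone.Rand) (c : Config P.alone) (a : Action P.alone) (i) :
    instAt (c.apply ω a) i = instAt c i ∨ ∃ e tape, instAt (c.apply ω a) i =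
      ((instAt c i).step i tape e).1 ∧ ∀ x, e = .inl x → a = .input i x := by
  by_cases h : c.Active ω a i
  · obtain ⟨s', h1, h2⟩ := alone_step_cases i (fun x => ω.1 (i, x)) (c.state i) (c.event ω a).2
    have h3 : instAt (c.apply ω a) i = s' := by rwa [instAt, apply_state, if_pos h]
    rcases h2 with h2 | ⟨e, h2, h4⟩
    · exact .inl (h3.trans h2)
    · refine .inr ⟨e, _, h3.trans h2, fun x hx => ?_⟩
      have h5 := h4 x hx
      have h6 := h.1
      cases a with
      | input i' x' =>
        grind [event]
      | deliver idx =>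
        grind [event]
      | inject src dst m =>
        grind [event]
      | leader i k => exact k.elim
      | _ => cases h5
  · refine .inl ?_
    rw [instAt, apply_state, if_neg h]
    rfl

theorem inp_apply (ω : P.alone.Rand) {c : Config P.alone} (a : Action P.alone) {i} {x : I}
    (h : (instAt c i).inp = some x) : (instAt (c.apply ω a) i).inp = some x := by grind [instAt_apply, step_inp]

theorem out_apply (ω : P.alone.Rand) {c : Config P.alone} (a : Action P.alone) {i} {v : O}
    (h : (instAt c i).out = some v) : (instAt (c.apply ω a) i).out = some v := by grind [instAt_apply, step_out]

/-- A sequence of configurations in which each arises from the one before by some action. -/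
def IsRun {Q : Protocol n I (Option I × Option O)} (ω : Q.Rand) (R : ℕ → Config Q) : Prop :=
  ∀ t, ∃ a, R (t + 1) = (R t).apply ω a

variable {ω : P.alone.Rand} {R : ℕ → Config P.alone} {s t : ℕ}

theorem IsRun.inp (hR : IsRun ω R) (hst : s ≤ t) {i x}
    (h : (instAt (R s) i).inp = some x) : (instAt (R t) i).inp = some x := by
  induction t, hst using Nat.le_induction with
  | base => exact h
  | succ t _ ih =>
    obtain ⟨a, ha⟩ := hR t
    grind [inp_apply]

theorem IsRun.out (hR : IsRun ω R) (hst : s ≤ t) {i v}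
    (h : (instAt (R s) i).out = some v) : (instAt (R t) i).out = some v := by
  induction t, hst using Nat.le_induction with
  | base => exact h
  | succ t _ ih =>
    obtain ⟨a, ha⟩ := hR t
    grind [out_apply]

theorem IsRun.corrupted (hR : IsRun ω R) (hst : s ≤ t) : (R s).corrupted ⊆ (R t).corrupted := by
  induction t, hst using Nat.le_induction with
  | base => simp_all
  | succ t _ ih =>
    obtain ⟨a, ha⟩ := hR t
    grind [corrupted_subset_apply]

theorem IsRun.net (hR : IsRun ω R) (hst : s ≤ t) : (R s).net <+: (R t).net := by
  induction t, hst using Nat.le_induction with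
  | base => simp_all
  | succ t _ ih =>
    obtain ⟨a, ha⟩ := hR t
    grind [apply_net]

theorem isRun_cfg (A ω) : IsRun ω (P.alone.cfg A ω) := fun _ => ⟨_, rfl⟩

end AloneRuns

/-! ## Byzantine agreement: an output needs an honest input -/

section Extension

variable {n : ℕ} (P : AsyncProtocol n Bool Bool)

/-- Corrupt `D`, let everybody else begin with input 0, and deliver all messages. -/
def finale (D : Finset (Fin n)) (k : ℕ) : Action P.alone :=
  if h : k < n then (if (⟨k, h⟩ : Fin n) ∈ D then .corrupt ⟨k, h⟩ else .idle)
  else if h : k - n < n then .input ⟨k - n, h⟩ false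
  else .deliver (k - 2 * n).unpair.1

/-- Follow `A` until `q` outputs 1. -/
def extend (A : Adversary P.alone) (q : Fin n) (D : Finset (Fin n)) : Adversary P.alone := fun l =>
  match l.countP (fun w => decide ((w.output q).2 = some true)) with
  | 0 => A l
  | k + 1 => finale P D k

variable {P}

theorem extend_exec {A q D ω t₀} (h : ∀ t < t₀, (instAt (P.alone.cfg A ω t) q).out ≠ some true) :
    ∀ t ≤ t₀, P.alone.exec (extend P A q D) ω t = P.alone.exec A ω t ∧
      (t < t₀ → (P.alone.exec A ω t).2.countP (fun w => decide ((w.output q).2 = some true)) = 0) := by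
  intro t ht
  induction t with
  | zero =>
    refine ⟨rfl, fun h0 => ?_⟩
    rw [countP_eq_zero]
    intro w hw
    obtain rfl := List.mem_singleton.1 hw
    exact fun hw => h 0 h0 (of_decide_eq_true hw)
  | succ t ih =>
    obtain ⟨ih1, ih2⟩ := ih (by omega)
    have ih2 := ih2 (by omega)
    have : extend P A q D (P.alone.exec A ω t).2 = A (P.alone.exec A ω t).2 := by grind [extend]
    refine ⟨?_, fun h1 => ?_⟩
    · grind [exec]
    · rw [exec]
      rw [countP_cons, ih2, zero_add, if_neg]
      exact fun hw => h (t + 1) h1 (of_decide_eq_true hw)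

theorem extend_act {A q D ω t₀} (h : ∀ t < t₀, (instAt (P.alone.cfg A ω t) q).out ≠ some true)
    (h0 : (instAt (P.alone.cfg A ω t₀) q).out = some true) (k) :
    P.alone.act (extend P A q D) ω (t₀ + k) = finale P D k := by
  have hq : ∀ k, (instAt (P.alone.cfg (extend P A q D) ω (t₀ + k)) q).out = some true := by
    intro k
    refine (isRun_cfg _ ω).out (Nat.le_add_right t₀ k) ?_
    rwa [Protocol.cfg, (extend_exec h t₀ le_rfl).1]
  have hcount : (P.alone.exec (extend P A q D) ω (t₀ + k)).2.countP
      (fun w => decide ((w.output q).2 = some true)) = k + 1 := by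
    induction k with
    | zero =>
      rw [add_zero, (extend_exec h t₀ le_rfl).1]
      cases t₀ with
      | zero =>
        have : (P.alone.exec A ω 0).2 = [(P.alone.cfg A ω 0).view ω] := rfl
        rw [this, countP_singleton, if_pos]
        exact decide_eq_true h0
      | succ t =>
        have : (P.alone.exec A ω (t + 1)).2 =
          (P.alone.cfg A ω (t + 1)).view ω :: (P.alone.exec A ω t).2 := rfl
        rw [this, countP_cons, ((extend_exec (D := D) h t (Nat.le_succ t)).2 (Nat.lt_succ_self t)), if_pos]
        exact decide_eq_true h0
    | succ k ih =>
      have : (P.alone.exec (extend P A q D) ω (t₀ + (k + 1))).2 =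
        (P.alone.cfg (extend P A q D) ω (t₀ + (k + 1))).view ω ::
          (P.alone.exec (extend P A q D) ω (t₀ + k)).2 := rfl
      rw [this, countP_cons, ih, if_pos]
      exact decide_eq_true (hq (k + 1))
  rw [Protocol.act, extend, hcount]

/-- If some party outputs 1 although no party outside `D` has begun with input 1, then validity can be
violated by corrupting `D`. -/
theorem extend_bad {A q D b ω} (hb : D.card ≤ b) (hq : q ∉ D) {t}
    (hc : (P.alone.cfg A ω t).corrupted ⊆ D) (ho : (instAt (P.alone.cfg A ω t) q).out = some true)
    (hi : ∀ i ∉ D, (instAt (P.alone.cfg A ω t) i).inp ≠ some true) :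
    P.Runs b (extend P A q D) ω ∧ ¬ ∀ v, (∀ i, P.alone.Honest (extend P A q D) ω i →
      P.Begins (extend P A q D) ω i v) → ∀ i, P.alone.Honest (extend P A q D) ω i →
        P.Outputs (extend P A q D) ω i v := by
  have hex : ∃ t, (instAt (P.alone.cfg A ω t) q).out = some true := ⟨t, ho⟩
  obtain ⟨t₀, h0, hmin⟩ : ∃ t₀, (instAt (P.alone.cfg A ω t₀) q).out = some true ∧
      ∀ t < t₀, (instAt (P.alone.cfg A ω t) q).out ≠ some true :=
    ⟨Nat.find hex, Nat.find_spec hex, fun t ht => Nat.find_min hex ht⟩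
  have ht : t₀ ≤ t := by grind
  have hA := isRun_cfg A ω
  set R := P.alone.cfg (extend P A q D) ω with hR
  have hrun : IsRun ω R := isRun_cfg _ ω
  have hact : ∀ k, R (t₀ + k + 1) = (R (t₀ + k)).apply ω (finale P D k) := fun k => by grind [Protocol.cfg_succ, extend_act]
  have heq : R t₀ = P.alone.cfg A ω t₀ := congrArg Prod.fst (extend_exec hmin t₀ le_rfl).1
  have hcor : ∀ k, (R (t₀ + k)).corrupted ⊆ D := by
    intro k
    induction k with
    | zero =>
      rw [add_zero, heq]
      exact (hA.corrupted ht).trans hc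
    | succ k ih =>
      grind [apply_corrupted, finale, base]
  have hsub := fun t =>
    (hrun.corrupted (Nat.le_add_left t t₀)).trans (hcor t)
  have hD : ∀ i ∈ D, i ∈ (R (t₀ + i + 1)).corrupted := by
    intro i hi
    rw [hact, apply_corrupted]
    have : finale P D i = .corrupt i := by
      rw [finale, dif_pos i.2, if_pos hi]
    rw [this]
    exact mem_insert_self _ _
  have hhon : ∀ i, P.alone.Honest (extend P A q D) ω i ↔ i ∉ D :=
    fun i => ⟨fun h h' => h _ (hD i h'), fun h t h' => h (hsub t h')⟩
  have hinp : ∀ i ∉ D, ∀ k, (instAt (R (t₀ + k)) i).inp ≠ some true := by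
    intro i hiD k
    induction k with
    | zero =>
      grind [IsRun.inp]
    | succ k ih =>
      rw [← add_assoc, hact]
      rcases instAt_apply ω (R (t₀ + k)) (finale P D k) i with h | ⟨e, tape, h, he⟩
      · simp_all
      · rw [h]
        cases e with
        | inr y => exact ih
        | inl x =>
          rw [step_inl_inp]
          have h2 := he x rfl
          have hx : x = false := by
            unfold finale at h2
            split_ifs at h2
            simp_all
          cases h4 : (instAt (R (t₀ + k)) i).inp with
          | none => simp_all
          | some y =>
            simp_all
  have hbeg : ∀ i ∉ D, P.Begins (extend P A q D) ω i false := by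
    intro i hiD
    refine ⟨t₀ + (n + i) + 1, ?_⟩
    change (instAt (R (t₀ + (n + i) + 1)) i).inp = some false
    have h1 : finale P D (n + i) = .input i false := by
      rw [finale, dif_neg (by omega), dif_pos (by omega)]
      simp_all
    have h2 : ∃ x, (instAt (R (t₀ + (n + i) + 1)) i).inp = some x := by
      rw [hact, h1]
      have hstate : (R (t₀ + (n + i))).Active ω (.input i false) i :=
        ⟨Finset.mem_singleton_self i, fun h => hiD (hsub _ h)⟩
      rw [instAt, apply_state, if_pos hstate]
      have : (((R (t₀ + (n + i))).react ω i (.input false)).1 : Inst P) =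
        ((instAt (R (t₀ + (n + i))) i).step i (fun x => ω.1 (i, x)) (.inl false)).1 := rfl
      exact ⟨_, (congrArg inp this).trans (step_inl_inp _ _ _ _)⟩
    have := hinp i hiD (n + i + 1)
    rw [← add_assoc] at this
    simp_all
  refine ⟨⟨fun t => (card_le_card (hsub t)).trans hb, ?_, fun i h => ⟨_, hbeg i ((hhon i).1 h)⟩⟩,
    fun h => ?_⟩
  · intro t idx p hp _
    let m := Nat.pair idx t
    have hm : t ≤ t₀ + (2 * n + m) := by grind [Nat.right_le_pair]
    have h1 : finale P D (2 * n + m) = .deliver idx := by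
      rw [finale, dif_neg (by omega), dif_neg (by omega), Nat.add_sub_cancel_left, Nat.unpair_pair]
    grind [apply_delivered, base, IsRun.net]
  · obtain ⟨t', ht'⟩ := h false (fun i hi => hbeg i ((hhon i).1 hi)) q ((hhon q).2 hq)
    have h1 := hrun.out (Nat.le_add_right t₀ t') (show (instAt (R t₀) q).out = some true by simp_all)
    have h2 := hrun.out (Nat.le_add_left t' t₀) (show (instAt (R t') q).out = some false from ht')
    simp_all

/-- An output 1 needs an input 1 of a party that is not going to be corrupted. -/
theorem law_output_without_input_le [NeZero n] {b ε}
    (h : ∀ A : Adversary P.alone, P.alone.law {ω | P.Runs b A ω ∧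
      ¬ ∀ v, (∀ i, P.alone.Honest A ω i → P.Begins A ω i v) →
        ∀ i, P.alone.Honest A ω i → P.Outputs A ω i v} ≤ ε)
    {q D} (hb : D.card ≤ b) (hq : q ∉ D) (A) :
    P.alone.law {ω | ∃ t, (P.alone.cfg A ω t).corrupted ⊆ D ∧
      (instAt (P.alone.cfg A ω t) q).out = some true ∧
      ∀ i ∉ D, (instAt (P.alone.cfg A ω t) i).inp ≠ some true} ≤ ε :=
  by
  refine (measure_mono fun ω hω => ?_).trans (h (extend P A q D))
  grind [extend_bad]

end Extension

section GuestRuns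

variable {n : ℕ} {In Out I O : Type}
namespace Guest
variable {H : Protocol n In Out} {P : AsyncProtocol n I O} (G : Guest H P)

theorem isRun (A ω) : IsRun (G.sub ω) (G.cfg A ω) := fun _ => ⟨_, rfl⟩

variable {G} {A : Adversary H} {ω : H.Rand}

theorem instAt_cfg (hG : G.Lawful) (t i) :
    instAt (G.cfg A ω ((n + 1) * t)) i = G.inst ((H.cfg A ω t).state i) := (G.sim hG ω A t).state i

theorem le_mul_succ (s) : s ≤ (n + 1) * s := Nat.le_mul_of_pos_left s n.succ_pos

theorem rhonest_iff (hG : G.Lawful) (i) : RHonest (G.cfg A ω) i ↔ H.Honest A ω i := by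
  constructor
  · intro h t ht
    refine h ((n + 1) * t) ?_
    rwa [(G.sim hG ω A t).corrupted]
  · intro h s hs
    have := (G.isRun A ω).corrupted (le_mul_succ (n := n) s) hs
    rw [(G.sim hG ω A s).corrupted] at this
    exact h s this

theorem rbegins_iff (hG : G.Lawful) (i x) : RBegins (G.cfg A ω) i x ↔
    ∃ t, (G.inst ((H.cfg A ω t).state i)).inp = some x := by
  constructor
  · rintro ⟨s, hs⟩
    have := (G.isRun A ω).inp (le_mul_succ (n := n) s) hs
    grind [instAt_cfg]
  · rintro ⟨t, ht⟩
    rw [← instAt_cfg hG] at ht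
    exact ⟨_, ht⟩

theorem routputs_iff (hG : G.Lawful) (i v) : ROutputs (G.cfg A ω) i v ↔
    ∃ t, (G.inst ((H.cfg A ω t).state i)).out = some v := by
  constructor
  · rintro ⟨s, hs⟩
    have := (G.isRun A ω).out (le_mul_succ (n := n) s) hs
    grind [instAt_cfg]
  · rintro ⟨t, ht⟩
    rw [← instAt_cfg hG] at ht
    exact ⟨_, ht⟩

/-- If the honest parties pass on all messages, the messages of the instance are delivered. -/
theorem rruns (hG : G.Lawful) {b} (hb : H.AtMost b A ω) (hd : H.EventualDelivery A ω)
    (hacc : ∀ i, H.Honest A ω i → ∀ t m, G.accepts ((H.cfg A ω t).state i) m)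
    (hbeg : ∀ i, H.Honest A ω i → ∃ t x, (G.inst ((H.cfg A ω t).state i)).inp = some x) :
    RRuns b (G.cfg A ω) := by
  refine ⟨fun s => ?_, ?_, fun i hi => ?_⟩
  · have := (G.isRun A ω).corrupted (le_mul_succ (n := n) s)
    rw [(G.sim hG ω A s).corrupted] at this
    exact (card_le_card this).trans (hb s)
  · intro s k p' hp' hdst
    obtain ⟨l, hl⟩ := (G.isRun A ω).net (le_mul_succ (n := n) s)
    have h1 : (G.cfg A ω ((n + 1) * s)).net[k]? = some p' := by grind
    rw [(G.sim hG ω A s).net] at h1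
    obtain ⟨idx, p, hp, hpp, rfl⟩ := G.exists_net_pos h1
    have hpd : p.dst = p'.dst := by
      obtain ⟨m, -, rfl⟩ := map_eq_some_iff.1 hpp
      rfl
    have hhon : H.Honest A ω p.dst := by grind [rhonest_iff]
    have hex := hd s idx p hp hhon
    have h0 : idx ∉ (H.cfg A ω 0).delivered := notMem_empty _
    obtain ⟨t, ht, ht'⟩ : ∃ t, idx ∉ (H.cfg A ω t).delivered ∧ idx ∈ (H.cfg A ω (t + 1)).delivered := by
      have hpos : Nat.find hex ≠ 0 := fun h => h0 (h ▸ Nat.find_spec hex)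
      obtain ⟨t, ht⟩ := Nat.exists_eq_succ_of_ne_zero hpos
      exact ⟨t, Nat.find_min hex (ht ▸ Nat.lt_succ_self t), by grind⟩
    rw [Protocol.cfg_succ, Config.apply_delivered] at ht'
    have hact : H.act A ω t = .deliver idx ∧ ((H.cfg A ω t).net[idx]?).isSome := by
      cases ha : H.act A ω t with
      | deliver idx' =>
        grind [base]
      | _ =>
        grind [base]
    obtain ⟨hact, hsome⟩ := hact
    have hlt : idx < (H.cfg A ω t).net.length := by simp_all
    have hboth : (H.cfg A ω t).net[idx]? = some p ∧
        G.pos (H.cfg A ω t).net idx = G.pos (H.cfg A ω s).net idx := by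
      rcases le_total s t with hst | hst
      · obtain ⟨l, hl⟩ := H.net_prefix ω A hst
        grind [pos_append]
      · obtain ⟨l, hl⟩ := H.net_prefix ω A hst
        rw [← hl] at hp ⊢
        exact ⟨by grind, (G.pos_append hlt.le).symm⟩
    refine ⟨(n + 1) * t + 1, ?_⟩
    rw [cfg_succ, act_first, G.deliver_mem ω (G.sim hG ω A t)]
    exact .inr ⟨idx, p, hact, hboth.1, by simp [hpp], hboth.2.symm, ht, hhon t, hacc _ hhon t _⟩
  · obtain ⟨t, x, h⟩ := hbeg i ((rhonest_iff hG i).1 hi)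
    exact ⟨x, (rbegins_iff hG i x).2 ⟨t, h⟩⟩

end Guest
end GuestRuns

/-! ## Measurability of the failure of a message-driven protocol -/

section Measurability

variable {n : ℕ} {I O V : Type} {α : Type*} [MeasurableSpace α] [TopologicalSpace α]
  [OpensMeasurableSpace α]

section

variable {P : AsyncProtocol n I O} {R : α → ℕ → Config P.alone} (hR : ∀ s, IsLocallyConstant fun x => R x s)
include hR

theorem measurable_one (s) (p : Config P.alone → Prop) : Measurable fun x => p (R x s) :=
  IsLocallyConstant.measurable_prop (hR s) p

theorem measurable_two (s t) (p : Config P.alone → Config P.alone → Prop) :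
    Measurable fun x => p (R x s) (R x t) :=
  IsLocallyConstant.measurable_prop (isLocallyConstant_pair (hR s) (hR t)) fun c => p c.1 c.2

theorem measurable_rhonest (i) : Measurable fun x => RHonest (R x) i :=
  Measurable.forall fun t => measurable_one hR t fun c => i ∉ c.corrupted

theorem measurable_rruns (b) : Measurable fun x => RRuns b (R x) := by
  refine (Measurable.forall fun t => measurable_one hR t fun c => c.corrupted.card ≤ b).and
    (Measurable.and ?_ ?_)
  · have : (fun x => ∀ t idx p, (R x t).net[idx]? = some p → RHonest (R x) p.dst →
        ∃ t', idx ∈ (R x t').delivered) = fun x => ∀ t idx d,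
        (∃ p, (R x t).net[idx]? = some p ∧ p.dst = d) → RHonest (R x) d →
          ∃ t', idx ∈ (R x t').delivered := by simp_all
    rw [this]
    exact Measurable.forall fun t => Measurable.forall fun idx => Measurable.forall fun d =>
      (measurable_one hR t fun c => ∃ p, c.net[idx]? = some p ∧ p.dst = d).imp
        ((measurable_rhonest hR d).imp
          (Measurable.exists fun t' => measurable_one hR t' fun c => idx ∈ c.delivered))
  · have : (fun x => ∀ i, RHonest (R x) i → ∃ y, RBegins (R x) i y) =
        fun x => ∀ i, RHonest (R x) i → ∃ t, ∃ y, (instAt (R x t) i).inp = some y := by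
      funext x
      refine propext (forall_congr' fun i => imp_congr_right fun _ => ?_)
      exact exists_comm
    rw [this]
    exact Measurable.forall fun i => (measurable_rhonest hR i).imp
      (Measurable.exists fun t => measurable_one hR t fun c => ∃ y, (instAt c i).inp = some y)

theorem measurable_routputs (i v) : Measurable fun a => ROutputs (R a) i v :=
  Measurable.exists fun t => measurable_one hR t fun c => (instAt c i).out = some v

end

section

variable {P : AsyncProtocol n (Option V) V} {R : α → ℕ → Config P.alone}
  (hR : ∀ s, IsLocallyConstant fun x => R x s)
include hR

theorem measurable_senders (p) : Measurable fun a => RSender (R a) p := by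
  have : (fun a => RSender (R a) p) =
      fun a => ∀ i t, ∀ x, (instAt (R a t) i).inp = some x → (x.isSome ↔ i = p) := by
    funext a
    refine propext (forall_congr' fun i => ⟨fun h t x hx => h x ⟨t, hx⟩, ?_⟩)
    rintro h x ⟨t, hx⟩
    grind
  rw [this]
  exact Measurable.forall fun i => Measurable.forall fun t => measurable_one hR t
    fun c => ∀ x, (instAt c i).inp = some x → (x.isSome ↔ i = p)

theorem measurable_bcast_valid (p) : Measurable fun a => RValid (R a) p := by
  have : (fun a => RValid (R a) p) = fun a => RHonest (R a) p → ∀ i,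
        RHonest (R a) i → ∀ t, (∃ v, (instAt (R a t) p).inp = some (some v)) →
          ∃ t', ∀ v, (instAt (R a t) p).inp = some (some v) → (instAt (R a t') i).out = some v := by
    funext a
    refine propext ⟨?_, ?_⟩
    · rintro h hp i hi t ⟨v, hv⟩
      obtain ⟨t', ht'⟩ := h v hp ⟨t, hv⟩ i hi
      refine ⟨t', fun v' hv' => ?_⟩
      simp_all
    · rintro h v hp ⟨t, hv⟩ i hi
      obtain ⟨t', ht'⟩ := h hp i hi t ⟨v, hv⟩
      exact ⟨t', ht' v hv⟩
  rw [this]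
  exact (measurable_rhonest hR p).imp (Measurable.forall fun i => (measurable_rhonest hR i).imp
    (Measurable.forall fun t =>
      (measurable_one hR t fun c => ∃ v, (instAt c p).inp = some (some v)).imp
      (Measurable.exists fun t' => measurable_two hR t t' fun c c' =>
        ∀ v, (instAt c p).inp = some (some v) → (instAt c' i).out = some v)))

theorem measurable_bcast_consistent : Measurable fun a =>
    RConsistent (R a) := by
  have : (fun a => RConsistent (R a)) = fun a =>
      (∀ i, RHonest (R a) i → ∀ t, (instAt (R a t) i).out = none) ∨
      ∃ j t, ∀ i, RHonest (R a) i → ∃ t', ∃ v, (instAt (R a t) j).out = some v ∧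
        (instAt (R a t') i).out = some v := by
    funext a
    refine propext ⟨?_, ?_⟩
    · rintro (h | ⟨v, h⟩)
      · refine .inl fun i hi t => ?_
        by_contra h'
        obtain ⟨v, hv⟩ := ne_none_iff_exists'.1 h'
        exact h i v hi ⟨t, hv⟩
      · by_cases hj : ∃ j, RHonest (R a) j
        · obtain ⟨j, hj⟩ := hj
          obtain ⟨t, ht⟩ := h j hj
          refine .inr ⟨j, t, fun i hi => ?_⟩
          obtain ⟨t', ht'⟩ := h i hi
          grind
        simp_all
    · rintro (h | ⟨j, t, h⟩)
      · refine .inl fun i v hi => ?_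
        rintro ⟨t, ht⟩
        simp_all
      · by_cases hj : ∃ i, RHonest (R a) i
        · obtain ⟨i, hi⟩ := hj
          obtain ⟨t', v, hv, -⟩ := h i hi
          refine .inr ⟨v, fun i' hi' => ?_⟩
          obtain ⟨t'', v', hv', h'⟩ := h i' hi'
          rw [hv] at hv'
          obtain rfl := some.inj hv'
          exact ⟨t'', h'⟩
        exact .inl fun i v hi => (hj ⟨i, hi⟩).elim
  rw [this]
  exact (Measurable.forall fun i => (measurable_rhonest hR i).imp
    (Measurable.forall fun t => measurable_one hR t fun c => (instAt c i).out = none)).or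
    (Measurable.exists fun j => Measurable.exists fun t => Measurable.forall fun i =>
      (measurable_rhonest hR i).imp (Measurable.exists fun t' => measurable_two hR t t'
        fun c c' => ∃ v, (instAt c j).out = some v ∧ (instAt c' i).out = some v))

end

end Measurability

/-! ## Failure of an instance inside a host -/

section Failures

variable {n : ℕ} [NeZero n] {In Out V : Type} {H : Protocol n In Out} [Countable H.Coin]
  [Countable H.LKey] {b : ℕ} {ε : ENNReal}

section

variable {P : AsyncProtocol n Bool Bool} {G : Guest H P} (hG : G.Lawful) (hH : H.Local) (A : Adversary H)
include hG hH

theorem Guest.law_ba_consistent (h : ∀ A : Adversary P.alone, P.alone.law {ω | P.Runs b A ω ∧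
      ¬ ∃ v, ∀ i, P.alone.Honest A ω i → P.Outputs A ω i v} ≤ ε) :
    H.law {ω | RRuns b (G.cfg A ω) ∧ ¬ RAgree (G.cfg A ω)} ≤ ε := by
  have hR := G.isLocallyConstant_cfg hH A
  refine G.transfer hG A (fun R => RRuns b R ∧ ¬ RAgree R) (measurableSet_setOfPred.2 ?_) ε h
  exact (measurable_rruns hR b).and (Measurable.not (Measurable.exists fun v =>
    (Measurable.forall fun i => (measurable_rhonest hR i).imp (measurable_routputs hR i v))))

theorem Guest.law_ba_input (h : ∀ A : Adversary P.alone, P.alone.law {ω | P.Runs b A ω ∧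
      ¬ ∀ v, (∀ i, P.alone.Honest A ω i → P.Begins A ω i v) →
        ∀ i, P.alone.Honest A ω i → P.Outputs A ω i v} ≤ ε)
    {q D} (hb : D.card ≤ b) (hq : q ∉ D) :
    H.law {ω | ∃ t, (G.cfg A ω t).corrupted ⊆ D ∧ (instAt (G.cfg A ω t) q).out = some true ∧
      ∀ i ∉ D, (instAt (G.cfg A ω t) i).inp ≠ some true} ≤ ε := by
  have hR := G.isLocallyConstant_cfg hH A
  refine G.transfer hG A (fun R => ∃ t, (R t).corrupted ⊆ D ∧ (instAt (R t) q).out = some true ∧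
      ∀ i ∉ D, (instAt (R t) i).inp ≠ some true)
    (measurableSet_setOfPred.2 ?_) ε (law_output_without_input_le h hb hq)
  exact Measurable.exists fun t => measurable_one hR t fun c => c.corrupted ⊆ D ∧
    (instAt c q).out = some true ∧ ∀ i ∉ D, (instAt c i).inp ≠ some true

end

section

variable {P : AsyncProtocol n (Option V) V} {G : Guest H P} (hG : G.Lawful) (hH : H.Local)
  (A : Adversary H) {p : Fin n}
include hG hH

theorem Guest.law_bcast_valid (h : ∀ A : Adversary P.alone, P.alone.law {ω | BcastRuns P p b A ω ∧
      ¬ ∀ v, P.alone.Honest A ω p → P.Begins A ω p (some v) →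
        ∀ i, P.alone.Honest A ω i → P.Outputs A ω i v} ≤ ε) :
    H.law {ω | (RRuns b (G.cfg A ω) ∧ RSender (G.cfg A ω) p) ∧ ¬ RValid (G.cfg A ω) p} ≤ ε := by
  have hR := G.isLocallyConstant_cfg hH A
  refine G.transfer hG A (fun R => (RRuns b R ∧ RSender R p) ∧ ¬ RValid R p)
    (measurableSet_setOfPred.2 ?_) ε h
  exact ((measurable_rruns hR b).and (measurable_senders hR p)).and
    (Measurable.not (measurable_bcast_valid hR p))

theorem Guest.law_bcast_consistent (h : ∀ A : Adversary P.alone, P.alone.law {ω | BcastRuns P p b A ω ∧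
      ¬ ((∀ i v, P.alone.Honest A ω i → ¬ P.Outputs A ω i v) ∨
        ∃ v, ∀ i, P.alone.Honest A ω i → P.Outputs A ω i v)} ≤ ε) :
    H.law {ω | (RRuns b (G.cfg A ω) ∧ RSender (G.cfg A ω) p) ∧ ¬ RConsistent (G.cfg A ω)} ≤ ε := by
  have hR := G.isLocallyConstant_cfg hH A
  refine G.transfer hG A (fun R => (RRuns b R ∧ RSender R p) ∧ ¬ RConsistent R)
    (measurableSet_setOfPred.2 ?_) ε h
  exact ((measurable_rruns hR b).and (measurable_senders hR p)).and
    (Measurable.not (measurable_bcast_consistent hR))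

end

end Failures

/-! ## Operations that treat an instance as a black box -/

section Watching

variable {n : ℕ} {I O S T M L : Type} {P : AsyncProtocol n I O}

/-- An instance of `P` inside a state of type `S`. -/
structure Watch (S T M : Type) (P : AsyncProtocol n I O) where
  get : S → Inst P
  same : S → S → Prop
  tape : T → ℕ → Fin (P.coins + 1)
  agree : T → T → Prop
  proj : M → Option P.Msg
  same_get : ∀ {s s'}, same s s' → (get s).inp = (get s').inp ∧ (get s).out = (get s').out

def Watch.filter (W : Watch S T M P) (l : List (Fin n × M)) : List (Fin n × P.Msg) :=
  l.filterMap fun x => (W.proj x.2).map fun m => (x.1, m)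

theorem Watch.filter_append (W : Watch S T M P) (l l' : List (Fin n × M)) :
    W.filter (l ++ l') = W.filter l ++ W.filter l' := filterMap_append

def feed (i : Fin n) (ω : ℕ → Fin (P.coins + 1)) (u : Inst P) : Option I → Inst P × List (Fin n × P.Msg)
  | none => (u, [])
  | some x => u.step i ω (.inl x)

theorem feed_inp {i} {ω : ℕ → Fin (P.coins + 1)} {u : Inst P} {x : Option I}
    (h : x.isSome → u.inp = none) : (feed i ω u x).1.inp = (x <|> u.inp) := by
  cases x with
  | none => rfl
  | some x => simp [feed, step_inl_inp, h rfl]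

/-- The operation at most gives the instance its input, and does not look inside it. -/
def Feeds (W : Watch S T M P) (i : Fin n) (op : T → S → S × List (Fin n × M) × List L) : Prop :=
  ∃ g : T → S → Option I, (∀ ω s, (g ω s).isSome → (W.get s).inp = none) ∧
    (∀ ω s, W.get (op ω s).1 = (feed i (W.tape ω) (W.get s) (g ω s)).1 ∧
      W.filter (op ω s).2.1 = (feed i (W.tape ω) (W.get s) (g ω s)).2) ∧
    ∀ ω ω' s s', W.agree ω ω' → W.same s s' → g ω s = g ω' s' ∧
      (Vis (feed i (W.tape ω) (W.get s) (g ω s)) (feed i (W.tape ω') (W.get s') (g ω' s')) →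
        W.same (op ω s).1 (op ω' s').1 ∧ (op ω s).2 = (op ω' s').2)

def seqOp (o₁ o₂ : T → S → S × List (Fin n × M) × List L) (ω : T) (s : S) : S × List (Fin n × M) × List L :=
  let r₁ := o₁ ω s
  let r₂ := o₂ ω r₁.1
  (r₂.1, r₁.2.1 ++ r₂.2.1, r₁.2.2 ++ r₂.2.2)

variable {W : Watch S T M P} {i : Fin n} {o₁ o₂ : T → S → S × List (Fin n × M) × List L}

theorem vis_feed_none {s s' ω ω'} (h : W.same s s') :
    Vis (feed i (W.tape ω) (W.get s) none) (feed i (W.tape ω') (W.get s') none) :=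
  ⟨(W.same_get h).1, (W.same_get h).2, rfl⟩

theorem Feeds.of_passive (h₁ : ∀ ω s, W.get (o₁ ω s).1 = W.get s ∧ W.filter (o₁ ω s).2.1 = [])
    (h₂ : ∀ ω ω' s s', W.agree ω ω' → W.same s s' →
      W.same (o₁ ω s).1 (o₁ ω' s').1 ∧ (o₁ ω s).2 = (o₁ ω' s').2) : Feeds W i o₁ :=
  ⟨fun _ _ => none, fun _ _ h => by simp at h, h₁, fun ω ω' s s' ha hs => ⟨rfl, fun _ =>
    h₂ ω ω' s s' ha hs⟩⟩

theorem Feeds.of_eq (h : Feeds W i o₁) (h' : ∀ ω s, o₂ ω s = o₁ ω s) : Feeds W i o₂ := by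
  rwa [show o₂ = o₁ from funext fun ω => funext (h' ω)]

theorem Feeds.skip : Feeds W i (fun _ s => (s, [], []) : T → S → S × List (Fin n × M) × List L) :=
  Feeds.of_passive (fun _ _ => ⟨rfl, rfl⟩) fun _ _ _ _ _ h => ⟨h, rfl⟩

theorem Feeds.seq (h₁ : Feeds W i o₁) (h₂ : Feeds W i o₂) : Feeds W i (seqOp o₁ o₂) := by
  obtain ⟨g₁, hi₁, hg₁, hs₁⟩ := h₁
  obtain ⟨g₂, hi₂, hg₂, hs₂⟩ := h₂
  have key : ∀ ω s, (g₁ ω s).isSome → g₂ ω (o₁ ω s).1 = none := by grind [isSome_iff_ne_none, feed_inp]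
  refine ⟨fun ω s => g₁ ω s <|> g₂ ω (o₁ ω s).1, fun ω s h => ?_, fun ω s => ?_, fun ω ω' s s' ha hs => ?_⟩
  · cases h1 : g₁ ω s with
    | some x => grind
    | none =>
      have := (hg₁ ω s).1
      dsimp only at h
      rw [h1] at this h
      rw [show W.get s = W.get (o₁ ω s).1 from this.symm]
      grind
  · obtain ⟨a1, a2⟩ := hg₁ ω s
    obtain ⟨b1, b2⟩ := hg₂ ω (o₁ ω s).1
    simp [seqOp, Watch.filter_append]
    cases h1 : g₁ ω s with
    | some x =>
      grind [feed]
    | none =>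
      rw [h1] at a1 a2
      have a1' := a1
      rw [a1'] at b1 b2
      exact ⟨b1, by rw [a2, b2]; rfl⟩
  · obtain ⟨a1, a2⟩ := hs₁ ω ω' s s' ha hs
    dsimp only
    cases h1 : g₁ ω s with
    | some x =>
      have h1' : g₁ ω' s' = some x := by simp_all
      have h2 := key ω s (by simp [h1])
      have h2' := key ω' s' (by simp [h1'])
      grind [vis_feed_none, seqOp]
    | none =>
      have h1' : g₁ ω' s' = none := by simp_all
      rw [h1, h1'] at a2
      obtain ⟨c1, c2⟩ := a2 (vis_feed_none hs)
      obtain ⟨d1, d2⟩ := hs₂ ω ω' _ _ ha c1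
      have e := (hg₁ ω s).1
      have e' := (hg₁ ω' s').1
      rw [h1] at e
      rw [h1'] at e'
      rw [show W.get (o₁ ω s).1 = W.get s from e, show W.get (o₁ ω' s').1 = W.get s' from e'] at d2
      grind [seqOp]

theorem Feeds.ite {p : S → Prop} [DecidablePred p] (hp : ∀ s s', W.same s s' → (p s ↔ p s'))
    (h₁ : Feeds W i o₁) (h₂ : Feeds W i o₂) :
    Feeds W i fun ω s => if p s then o₁ ω s else o₂ ω s := by
  obtain ⟨g₁, hi₁, hg₁, hs₁⟩ := h₁
  obtain ⟨g₂, hi₂, hg₂, hs₂⟩ := h₂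
  refine ⟨fun ω s => if p s then g₁ ω s else g₂ ω s, fun ω s => ?_, fun ω s => ?_,
    fun ω ω' s s' ha hs => ?_⟩
  · by_cases h : p s
    · simpa [if_pos h] using hi₁ ω s
    · simpa [if_neg h] using hi₂ ω s
  · by_cases h : p s
    · simp_all
    simp_all
  · by_cases h : p s
    · simpa [if_pos h, if_pos ((hp s s' hs).1 h)] using hs₁ ω ω' s s' ha hs
    · simpa [if_neg h, if_neg (mt (hp s s' hs).2 h)] using hs₂ ω ω' s s' ha hs

theorem Feeds.bind {α : Type} (a : S → α) (ha : ∀ s s', W.same s s' → a s = a s')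
    {o : α → T → S → S × List (Fin n × M) × List L} (h : ∀ x, Feeds W i (o x)) :
    Feeds W i fun ω s => o (a s) ω s := by
  choose g hi hg hs using h
  refine ⟨fun ω s => g (a s) ω s, fun ω s => hi _ ω s, fun ω s => hg _ ω s, fun ω ω' s s' hag hss => ?_⟩
  grind

def seqList {γ : Type} (o : γ → T → S → S × List (Fin n × M) × List L) :
    List γ → T → S → S × List (Fin n × M) × List L
  | [] => fun _ s => (s, [], [])
  | c :: l => seqOp (o c) (seqList o l)

theorem Feeds.list {γ : Type} {o : γ → T → S → S × List (Fin n × M) × List L}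
    (h : ∀ c, Feeds W i (o c)) (l) : Feeds W i (seqList o l) := by
  induction l with
  | nil => exact Feeds.skip
  | cons c l ih => exact (h c).seq ih

theorem foldl_eq_seqList {γ : Type} (o : γ → T → S → S × List (Fin n × M) × List L) (ω l a) :
    l.foldl (fun a c => let r := o c ω a.1; (r.1, a.2.1 ++ r.2.1, a.2.2 ++ r.2.2)) a =
      ((seqList o l ω a.1).1, a.2.1 ++ (seqList o l ω a.1).2.1, a.2.2 ++ (seqList o l ω a.1).2.2) := by
  induction l generalizing a with
  | nil => simp [seqList]
  | cons c l ih =>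
    rw [foldl_cons, ih]
    simp [seqList, seqOp]

def quiet (o : T → S → S × List (Fin n × M)) (ω : T) (s : S) : S × List (Fin n × M) × List L :=
  ((o ω s).1, (o ω s).2, [])

/-- A step of the host consists in passing on a message, followed by an operation that treats the
instance as a black box. -/
def Guest.Splits {In Out : Type} {H : Protocol n In Out} (G : Guest H P)
    (W : Watch H.State H.Tape H.Msg P) (i : Fin n) (e : Event n In H.Msg H.LKey) : Prop :=
  ∃ (pre : H.Tape → H.State → H.State × List (Fin n × H.Msg))
    (op : H.Tape → H.State → H.State × List (Fin n × H.Msg) × List H.LKey), Feeds W i op ∧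
    (∀ ω s, G.inst (pre ω s).1 = (G.heard i ω s e).1 ∧ W.filter (pre ω s).2 = (G.heard i ω s e).2) ∧
    (∀ ω ω' s s', W.agree ω ω' → G.same s s' → Vis (G.heard i ω s e) (G.heard i ω' s' e) →
      G.same (pre ω s).1 (pre ω' s').1 ∧ (pre ω s).2 = (pre ω' s').2) ∧
    ∀ ω s, H.step i ω s e = ((op ω (pre ω s).1).1, (pre ω s).2 ++ (op ω (pre ω s).1).2.1,
      (op ω (pre ω s).1).2.2)

theorem Guest.splits_of_feeds {In Out : Type} {H : Protocol n In Out} {G : Guest H P}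
    {W : Watch H.State H.Tape H.Msg P} {i} {e : Event n In H.Msg H.LKey}
    (h1 : ∀ ω s, G.heard i ω s e = (G.inst s, [])) (h2 : Feeds W i fun ω s => H.step i ω s e) :
    G.Splits W i e :=
  ⟨fun _ s => (s, []), fun ω s => H.step i ω s e, h2, fun ω s => by rw [h1]; exact ⟨rfl, rfl⟩,
    fun _ _ _ _ _ hs _ => ⟨hs, rfl⟩, fun _ _ => rfl⟩

/-- A guest is lawful if the host first passes on a message and then treats it as a black box. -/
theorem Guest.lawful_of_feeds {In Out : Type} {H : Protocol n In Out} {G : Guest H P}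
    {W : Watch H.State H.Tape H.Msg P} (hget : W.get = G.inst) (hsame : W.same = G.same)
    (htape : W.tape = G.tape) (hproj : W.proj = G.proj)
    (hagree : ∀ ω ω', W.agree ω ω' ↔ ∀ c, c ∉ Set.range G.coin → ω c = ω' c)
    (hr : G.Regular) (step : ∀ i e, G.Splits W i e) : G.Lawful := by
  have hstep : ∀ i e, ∃ (pre : H.Tape → H.State → H.State × List (Fin n × H.Msg))
      (op : H.Tape → H.State → H.State × List (Fin n × H.Msg) × List H.LKey)
      (g : H.Tape → H.State → Option I),
      (∀ ω s, G.given i ω s e = g ω (pre ω s).1) ∧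
      (∀ ω s, G.begun i ω s e = feed i (G.tape ω) (G.inst (pre ω s).1) (g ω (pre ω s).1)) ∧
      (∀ ω s, G.inst (op ω (pre ω s).1).1 = (G.begun i ω s e).1 ∧
        W.filter (op ω (pre ω s).1).2.1 = (G.begun i ω s e).2 ∧
        W.filter (pre ω s).2 = (G.heard i ω s e).2) ∧
      (∀ ω ω' s s', W.agree ω ω' → G.same s s' → Vis (G.heard i ω s e) (G.heard i ω' s' e) →
        g ω (pre ω s).1 = g ω' (pre ω' s').1 ∧ (pre ω s).2 = (pre ω' s').2 ∧
        (Vis (G.begun i ω s e) (G.begun i ω' s' e) → G.same (op ω (pre ω s).1).1 (op ω' (pre ω' s').1).1 ∧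
          (op ω (pre ω s).1).2 = (op ω' (pre ω' s').1).2)) ∧
      ∀ ω s, H.step i ω s e = ((op ω (pre ω s).1).1, (pre ω s).2 ++ (op ω (pre ω s).1).2.1,
        (op ω (pre ω s).1).2.2) := by
    intro i e
    obtain ⟨pre, op, ⟨g, hi, hg, hs⟩, h2, h3, h4⟩ := step i e
    rw [hget] at hi hg hs
    rw [htape] at hg hs
    have hgiven : ∀ ω s, G.given i ω s e = g ω (pre ω s).1 := by
      intro ω s
      have h5 := (hg ω (pre ω s).1).1
      have h6 : (G.inst (pre ω s).1).inp = (G.inst s).inp := by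
        rw [(h2 ω s).1, G.heard_inp]
      have h7 : (G.inst (H.step i ω s e).1).inp = (g ω (pre ω s).1 <|> (G.inst s).inp) := by
        rw [h4, ← h6]
        exact (congrArg inp h5).trans (feed_inp (hi ω _))
      rw [given, h7]
      split_ifs with h8
      · grind
      · by_contra h9
        exact h8 (h6 ▸ hi ω _ (isSome_iff_ne_none.2 (Ne.symm h9)))
    have hbegun : ∀ ω s, G.begun i ω s e = feed i (G.tape ω) (G.inst (pre ω s).1) (g ω (pre ω s).1) := by
      intro ω s
      rw [begun, hgiven, (h2 ω s).1]
      cases g ω (pre ω s).1 <;> rfl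
    refine ⟨pre, op, g, hgiven, hbegun, fun ω s => ?_, fun ω ω' s s' ha hss hv => ?_, h4⟩
    · grind
    grind
  have hfil : ∀ l, l.filterMap (fun x : Fin n × H.Msg => (G.proj x.2).map fun m => (x.1, m)) =
      W.filter l := by grind [Watch.filter]
  refine ⟨hr, fun i ω s e => ?_, fun i ω s e => ?_, fun i ω ω' s s' e ha hss hv => ?_,
    fun i ω ω' s s' e ha hss hv hv' => ?_⟩ <;>
  · obtain ⟨pre, op, g, h1, h2, h3, h4, h5⟩ := hstep i e
    grind

end Watching

section Delivery

variable {n : ℕ} {In Out : Type} {P : Protocol n In Out} {A : Adversary P} {ω : P.Rand}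

theorem Protocol.net_getElem_congr {s t idx : ℕ} {p p' : Packet P}
    (h : (P.cfg A ω s).net[idx]? = some p) (h' : (P.cfg A ω t).net[idx]? = some p') : p = p' := by
  wlog hst : s ≤ t generalizing s t p p'
  · exact (this h' h (le_of_not_ge hst)).symm
  obtain ⟨l, hl⟩ := P.net_prefix ω A hst
  grind

/-- A delivered message has been processed. -/
theorem Protocol.exists_event_of_delivered {s t idx : ℕ} {p : Packet P}
    (h : idx ∈ (P.cfg A ω t).delivered) (hp : (P.cfg A ω s).net[idx]? = some p) :
    ∃ t' < t, (P.cfg A ω t').event ω (P.act A ω t') = ({p.dst}, .recv p.src p.msg) := by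
  induction t with
  | zero => exact absurd h (notMem_empty _)
  | succ t ih =>
    by_cases h' : idx ∈ (P.cfg A ω t).delivered
    · grind
    · refine ⟨t, t.lt_succ_self, ?_⟩
      rw [cfg_succ, apply_delivered] at h
      cases ha : P.act A ω t with
      | deliver idx' =>
        rw [ha] at h
        simp only [base] at h
        split_ifs at h with hs
        · obtain rfl := (mem_insert.1 h).resolve_right h'
          obtain ⟨p', hp'⟩ := isSome_iff_exists.1 hs
          simp [event, hp', if_neg h', net_getElem_congr hp hp']
        simp_all
      | _ =>
        grind [base]

theorem Protocol.EventualDelivery.exists_event (h : P.EventualDelivery A ω) {s p}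
    (hp : p ∈ (P.cfg A ω s).net) (hd : P.Honest A ω p.dst) :
    ∃ t, (P.cfg A ω t).event ω (P.act A ω t) = ({p.dst}, .recv p.src p.msg) := by
  obtain ⟨idx, hidx⟩ := mem_iff_getElem?.1 hp
  obtain ⟨t', ht'⟩ := h s idx p hidx hd
  grind [exists_event_of_delivered]

theorem Config.event_tick {ω : P.Rand} {c : Config P} {a : Action P} {i}
    (hi : i ∈ (c.event ω a).1) (h : (c.event ω a).2 = .tick) : ∃ S, a = .tick S ∧ i ∈ S := by
  cases a with
  | tick S => exact ⟨S, rfl, hi⟩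
  | deliver idx =>
    grind [event]
  | inject src dst m =>
    grind [event]
  | leader j k =>
    grind [event]
  | _ => simp [event] at h hi

theorem card_honest  {b} (h : P.AtMost b A ω) :
    ∃ t₀, (∀ i, i ∉ (P.cfg A ω t₀).corrupted → P.Honest A ω i) := by
  by_contra! hne
  have : ∀ m : ℕ, ∃ t, m ≤ (P.cfg A ω t).corrupted.card := by
    intro m
    induction m with
    | zero => simp_all
    | succ m ih =>
      obtain ⟨t, ht⟩ := ih
      obtain ⟨i, hi, hi'⟩ := hne t
      unfold Honest at hi'
      push Not at hi'
      obtain ⟨t', ht'⟩ := hi'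
      refine ⟨max t t', Nat.succ_le_of_lt (ht.trans_lt (Finset.card_lt_card ?_))⟩
      refine Finset.ssubset_iff_subset_ne.2 ⟨P.corrupted_mono ω A (le_max_left _ _), fun heq => ?_⟩
      exact hi (heq ▸ P.corrupted_mono ω A (le_max_right _ _) ht')
  obtain ⟨t, ht⟩ := this (b + 1)
  exact absurd (h t) (not_le.2 ht)

theorem honest_card  {b} (h : P.AtMost b A ω) : n ≤ b + (univ.filter (P.Honest A ω)).card := by
  obtain ⟨t₀, ht₀⟩ := card_honest h
  have h1 := fun i hi =>
    mem_filter.2 ⟨mem_univ i, ht₀ i (mem_compl.1 hi)⟩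
  have h2 := card_le_card h1
  rw [card_compl, Fintype.card_fin] at h2
  have := h t₀
  omega

end Delivery

/-! ## Synchronous executions -/

section Synchrony

variable {n : ℕ} {In Out : Type} {P : Protocol n In Out} {A : Adversary P} {ω : P.Rand} {Δ : ℕ}

theorem Config.time_apply (c : Config P) (a : Action P) :
    (∃ S, a = .tick S) ∧ (c.apply ω a).time = c.time + 1 ∨
      (∀ S, a ≠ .tick S) ∧ (c.apply ω a).time = c.time := by
  rw [apply_time]
  cases a <;> simp only [base] <;> (try split_ifs) <;> simp

theorem Protocol.time_mono {s t} (h : s ≤ t) : (P.cfg A ω s).time ≤ (P.cfg A ω t).time := by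
  induction t, h using Nat.le_induction with
  | base => exact le_rfl
  | succ t _ ih =>
    rw [cfg_succ]
    rcases time_apply (ω := ω) (P.cfg A ω t) (P.act A ω t) with h | h <;> omega

/-- The step in which the clocks tick at time `τ`. -/
def Protocol.tickAt (P : Protocol n In Out) (A : Adversary P) (ω : P.Rand) (τ : ℕ) : ℕ :=
  sInf {t | τ < (P.cfg A ω (t + 1)).time}

namespace Protocol.Sync

variable (h : P.Sync Δ A ω)
include h

theorem lt_time_iff (τ t) : τ < (P.cfg A ω t).time ↔ P.tickAt A ω τ < t := by
  have hne : ∀ τ, ∃ t, τ < (P.cfg A ω (t + 1)).time := by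
    intro τ
    induction τ with
    | zero =>
      obtain ⟨t, -, S, hS⟩ := h.2 0
      refine ⟨t, ?_⟩
      rw [cfg_succ, hS, apply_time]
      exact Nat.succ_pos _
    | succ τ ih =>
      obtain ⟨s, hs⟩ := ih
      obtain ⟨t, ht, S, hS⟩ := h.2 (s + 1)
      refine ⟨t, ?_⟩
      rw [cfg_succ, hS, apply_time]
      exact Nat.succ_lt_succ (hs.trans_le (time_mono ht))
  refine ⟨fun ht => ?_, fun ht => (Nat.sInf_mem (s := {t | τ < (P.cfg A ω (t + 1)).time}) (hne τ)).trans_le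
    (time_mono ht)⟩
  cases t with
  | zero => exact absurd ht (Nat.not_lt_zero _)
  | succ t => exact Nat.lt_succ_of_le (Nat.sInf_le ht)

theorem time_tickAt (τ) : (P.cfg A ω (P.tickAt A ω τ)).time = τ ∧
    P.act A ω (P.tickAt A ω τ) = .tick univ ∧ (P.cfg A ω (P.tickAt A ω τ + 1)).time = τ + 1 := by
  have h1 := (h.lt_time_iff τ _).not.2 (lt_irrefl (P.tickAt A ω τ))
  have h2 := (h.lt_time_iff τ _).2 (Nat.lt_succ_self _)
  rw [cfg_succ] at h2 ⊢
  rcases time_apply (ω := ω) (P.cfg A ω (P.tickAt A ω τ)) (P.act A ω (P.tickAt A ω τ)) with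
    ⟨⟨S, hS⟩, h3⟩ | h3
  · refine ⟨by omega, hS.trans ?_, by omega⟩
    rw [(h.1 _ S hS).1]
  · omega

theorem eq_tickAt {t S} (ht : P.act A ω t = .tick S) : t = P.tickAt A ω (P.cfg A ω t).time := by
  have h1 := (h.lt_time_iff (P.cfg A ω t).time t).not.1 (lt_irrefl _)
  have h2 := (h.lt_time_iff (P.cfg A ω t).time (t + 1)).1 (by
    rw [cfg_succ, ht, apply_time]
    exact Nat.lt_succ_self _)
  omega

theorem tickAt_lt {τ τ'} (hτ : τ < τ') : P.tickAt A ω τ < P.tickAt A ω τ' :=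
  (h.lt_time_iff _ _).1 (by rwa [(h.time_tickAt τ').1])

theorem tickAt_le {τ τ'} (hτ : τ ≤ τ') : P.tickAt A ω τ ≤ P.tickAt A ω τ' :=
  hτ.eq_or_lt.elim (fun e => e ▸ le_rfl) fun hτ => (h.tickAt_lt hτ).le

theorem delivered {τ t p} (hp : p ∈ (P.cfg A ω t).net) (ht : t ≤ P.tickAt A ω τ)
    (hs : p.sentAt + Δ ≤ τ + 1) (hd : p.dst ∉ (P.cfg A ω (P.tickAt A ω τ)).corrupted) :
    ∃ s < P.tickAt A ω τ, (P.cfg A ω s).event ω (P.act A ω s) = ({p.dst}, .recv p.src p.msg) := by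
  obtain ⟨idx, hidx⟩ := mem_iff_getElem?.1 ((P.net_prefix ω A ht).subset hp)
  obtain ⟨h1, h2, -⟩ := h.time_tickAt τ
  exact exists_event_of_delivered ((h.1 _ _ h2).2.1 idx p hidx hd (by rwa [h1])) hidx

theorem async : P.Async A ω := by
  refine ⟨fun t idx p hp hd => ?_, fun i _ N => ?_⟩
  · obtain ⟨h1, h2, -⟩ := h.time_tickAt (p.sentAt + Δ + (P.cfg A ω t).time)
    have ht : t ≤ P.tickAt A ω (p.sentAt + Δ + (P.cfg A ω t).time) :=
      not_lt.1 ((h.lt_time_iff _ _).not.1 (by omega))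
    obtain ⟨l, hl⟩ := P.net_prefix ω A ht
    refine ⟨_, (h.1 _ _ h2).2.1 idx p ?_ (hd _) (by omega)⟩
    rw [← hl]
    exact (List.getElem?_append_left (List.getElem?_eq_some_iff.1 hp).1).trans hp
  · obtain ⟨t, ht, S, hS⟩ := h.2 N
    exact ⟨t, ht, S, hS, by rw [(h.1 t S hS).1]; simp_all⟩

end Protocol.Sync

/-- Leaders are announced as they were chosen. -/
theorem Config.event_leader {c : Config P} {a : Action P} {i} {k : P.LKey} {l}
    (hi : i ∈ (c.event ω a).1) (h : (c.event ω a).2 = .leader k l) :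
    l = ω.2 k ∧ n < 2 * (c.requests k).card := by
  cases a with
  | leader j k' =>
    grind [event, leader]
  | deliver idx =>
    grind [event]
  | inject src dst m =>
    grind [event]
  | _ => simp [event] at h hi

theorem Config.mem_apply_requests {c : Config P} (a : Action P) {i} (hi : i ∉ c.corrupted)
    (k : P.LKey) : i ∈ (c.apply ω a).requests k ↔ i ∈ c.requests k ∨
      c.Active ω a i ∧ k ∈ (c.react ω i (c.event ω a).2).2.2 := by
  rw [apply_requests, Finset.mem_union, Finset.mem_filter]
  refine or_congr ?_ (and_iff_right (Finset.mem_univ i))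
  cases a with
  | request j k' =>
    simp [base]
    split_ifs with hj
    · by_cases hk : k = k'
      · grind
      simp_all
    · rfl
  | _ => grind [base]

/-- An answer that has been announced has been processed. -/
theorem Protocol.exists_event_of_led {t i k} (h : (i, k) ∈ (P.cfg A ω t).led) :
    ∃ s < t, (P.cfg A ω s).event ω (P.act A ω s) = ({i}, .leader k (ω.2 k)) := by
  induction t with
  | zero => exact absurd h (Set.notMem_empty _)
  | succ t ih =>
    by_cases h' : (i, k) ∈ (P.cfg A ω t).led
    · exact (ih h').imp fun s h => ⟨h.1.trans t.lt_succ_self, h.2⟩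
    · rw [cfg_succ, apply_led] at h
      cases ha : P.act A ω t with
      | leader j k' =>
        grind [base, event, leader]
      | _ =>
        grind [base]

end Synchrony

/-! ## Bracha's broadcast -/

section Bracha

variable {n : ℕ} {V : Type} {ts : ℕ} {p : Fin n} {A : Adversary (bracha n V ts p).alone}
  {ω : (bracha n V ts p).alone.Rand}

local notation "Br" => AsyncProtocol.alone (bracha n V ts p)
local notation "cb" => Protocol.cfg (AsyncProtocol.alone (bracha n V ts p)) A ω

/-- Ready may be sent on `v`. -/
def BState.Quorum (ts : ℕ) (s : BState n V) (v : V) : Prop :=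
  n - ts ≤ s.count (.echo v) ∨ ts + 1 ≤ s.count (.ready v)

theorem BState.count_mono {s s' : BState n V} (h : s.log ⊆ s'.log) (m : BMsg V) : s.count m ≤ s'.count m :=
  Finset.card_le_card fun j hj =>
    Finset.mem_filter.2 ⟨Finset.mem_univ j, h (Finset.mem_filter.1 hj).2⟩

theorem BState.Quorum.mono {s s' : BState n V} (h : s.log ⊆ s'.log) {v : V} (hv : s.Quorum ts v) :
    s'.Quorum ts v :=
  hv.imp (fun h' => h'.trans (BState.count_mono h _)) fun h' => h'.trans (BState.count_mono h _)

theorem BState.mem_values {s : BState n V} {v : V} (hn : ts < n) (hv : s.Quorum ts v) :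
    v ∈ (s.log.map fun x => x.2.value) := by
  have : 0 < s.count (.echo v) ∨ 0 < s.count (.ready v) := hv.imp (by omega) (by omega)
  rcases this with h | h <;>
  · obtain ⟨j, hj⟩ := Finset.card_pos.1 h
    exact List.mem_map.2 ⟨_, (Finset.mem_filter.1 hj).2, rfl⟩

theorem BState.mem_rules {s : BState n V} (hn : ts < n) (d) (m : BMsg V) :
    (d, m) ∈ (s.rules ts p).2.1 ↔ match m with
      | .val _ => False
      | .echo v => s.echoed = false ∧ s.fromSender p = some v
      | .ready v => s.Quorum ts v ∧ v ∉ s.ready := by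
  have h2 : ∀ l : List V, (d, m) ∈ l.flatMap (fun v => (toAll (.ready v) : List (Fin n × BMsg V)))
      ↔ ∃ v ∈ l, m = .ready v := by
    intro l
    simp [toAll, eq_comm]
  simp only [BState.rules, mem_append, h2]
  have h3 : ∀ v, v ∈ (filter (fun v => decide ((n - ts ≤ s.count (.echo v) ∨
      ts + 1 ≤ s.count (.ready v)) ∧ v ∉ s.ready)) (s.log.map fun x => x.2.value).dedup) ↔
      s.Quorum ts v ∧ v ∉ s.ready := by
    intro v
    rw [mem_filter, mem_dedup, decide_eq_true_eq]
    exact ⟨fun h => h.2, fun h => ⟨BState.mem_values hn h.1, h⟩⟩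
  simp only [h3]
  cases s.echoed <;> cases s.fromSender p <;> cases m <;> simp [toAll, eq_comm]

theorem BState.rules_ready {s : BState n V} (hn : ts < n) (h : ∀ v ∈ s.ready, s.Quorum ts v) (v : V) :
    v ∈ (s.rules ts p).1.ready ↔ s.Quorum ts v := by
  simp only [BState.rules, Finset.mem_union, List.mem_toFinset, List.mem_filter, List.mem_dedup,
    decide_eq_true_eq]
  constructor
  · rintro (h' | h')
    · exact h v h'
    · exact h'.2.1
  · intro h'
    by_cases hv : v ∈ s.ready
    · simp_all
    · exact .inr ⟨BState.mem_values hn h', h', hv⟩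

/-- A running instance, without the number of activations. -/
structure BInst (n : ℕ) (V : Type) where
  st : BState n V
  inp : Option (Option V)
  out : Option V

def BInst.step (ts : ℕ) (p i : Fin n) (s : BInst n V) :
    Option V ⊕ (Fin n × BMsg V) → BInst n V × List (Fin n × BMsg V)
  | .inl x =>
    match s.inp with
    | some _ => (s, [])
    | none =>
      let r := ({ s.st with started := true } : BState n V).rules ts p
      (⟨r.1, some x, s.out <|> r.2.2⟩, (match x with
        | some v => if i = p then toAll (.val v) else []
        | none => []) ++ r.2.1)
  | .inr y =>
    let s' : BState n V := { s.st with log := s.st.log ++ [y] }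
    let r := if s.st.started then s'.rules ts p else (s', [], none)
    (⟨r.1, s.inp, s.out <|> r.2.2⟩, r.2.1)

/-- The state of the machine is determined by its input and the received messages. -/
structure BInst.Ok (ts : ℕ) (p : Fin n) (s : BInst n V) : Prop where
  started : s.st.started = s.inp.isSome
  echoed : s.st.echoed = (s.inp.isSome && (s.st.fromSender p).isSome)
  ready : ∀ v, v ∈ s.st.ready ↔ s.inp.isSome ∧ s.st.Quorum ts v
  out : ∀ v, s.out = some v → n - ts ≤ s.st.count (.ready v)
  out_isSome : s.inp.isSome → (∃ v, n - ts ≤ s.st.count (.ready v)) → s.out.isSome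

def BInst.Says (ts : ℕ) (p i : Fin n) (s : BInst n V) : BMsg V → Prop
  | .val v => i = p ∧ s.inp = some (some v)
  | .echo v => s.inp.isSome ∧ s.st.fromSender p = some v
  | .ready v => s.inp.isSome ∧ s.st.Quorum ts v

theorem BState.fromSender_append {s : BState n V} {y} {v : V} (h : s.fromSender p = some v) :
    BState.fromSender p { s with log := s.log ++ [y] } = some v := by grind [BState.fromSender]

theorem BInst.Ok.rules (hn : ts < n) (i) {s : BInst n V} (hs : s.Ok ts p) (st₀ : BState n V)
    (x : Option V) (h1 : st₀.started = true) (h2 : st₀.echoed = s.st.echoed)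
    (h3 : st₀.ready = s.st.ready) (h4 : s.st.log ⊆ st₀.log)
    (h5 : ∀ v, s.st.fromSender p = some v → st₀.fromSender p = some v) :
    let s' : BInst n V := ⟨(st₀.rules ts p).1, some x, s.out <|> (st₀.rules ts p).2.2⟩
    s'.Ok ts p ∧ ∀ d m, (∀ v, m ≠ .val v) →
      (s'.Says ts p i m ↔ s.Says ts p i m ∨ (d, m) ∈ (st₀.rules ts p).2.1) := by
  have hq := fun v hv =>
    ((hs.ready v).1 (h3 ▸ hv)).2.mono h4
  have hf : (st₀.rules ts p).1.fromSender p = st₀.fromSender p := rfl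
  have hQ : ∀ v, (st₀.rules ts p).1.Quorum ts v ↔ st₀.Quorum ts v := fun v => Iff.rfl
  have he : st₀.echoed = true → ∃ v, s.st.fromSender p = some v ∧ s.inp.isSome := fun h => by
    rw [h2, hs.echoed, Bool.and_eq_true] at h
    grind [isSome_iff_exists]
  refine ⟨⟨h1, ?_, fun v => ?_, fun v hv => ?_, fun _ ⟨v, hv⟩ => ?_⟩, fun d m hm => ?_⟩
  · change (st₀.echoed || (st₀.fromSender p).isSome) = (true && (st₀.fromSender p).isSome)
    grind
  · grind [BState.rules_ready]
  · cases ho : s.out with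
    | some w =>
      rw [ho] at hv
      obtain rfl : w = v := some.inj hv
      exact (hs.out w ho).trans (BState.count_mono h4 _)
    | none =>
      rw [ho] at hv
      have hv : (st₀.rules ts p).2.2 = some v := hv
      simp only [BState.rules] at hv
      split_ifs at hv with hw
      obtain rfl := some.inj hv
      exact hw.choose_spec
  · have : (st₀.rules ts p).2.2.isSome := by
      simp only [BState.rules]
      rw [dif_pos ⟨v, hv⟩]
      rfl
    simp_all
  · rw [BState.mem_rules hn]
    cases m with
    | val v => simp_all
    | echo v =>
      simp [BInst.Says]
      grind
    | ready v =>
      simp [BInst.Says]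
      grind [BInst.Ok.ready]

theorem BInst.step_spec (hn : ts < n) (i) {s : BInst n V} (hs : s.Ok ts p)
    (e : Option V ⊕ (Fin n × BMsg V)) :
    (s.step ts p i e).1.Ok ts p ∧
      (∀ d m, (s.step ts p i e).1.Says ts p i m ↔ s.Says ts p i m ∨ (d, m) ∈ (s.step ts p i e).2) ∧
      (s.step ts p i e).1.st.log = s.st.log ++ (match e with | .inl _ => [] | .inr y => [y]) := by
  obtain ⟨st, inp, out⟩ := s
  cases e with
  | inl x =>
    cases inp with
    | some y => exact ⟨hs, fun d m => by simp [BInst.step], (append_nil _).symm⟩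
    | none =>
      have hval : ∀ d m, (d, m) ∈ (match x with
          | some v => if i = p then toAll (.val v) else []
          | none => [] : List (Fin n × BMsg V)) ↔ ∃ v, m = .val v ∧ i = p ∧ x = some v := by cases x with
        | none => simp
        | some w => by_cases h : i = p <;> simp [h, toAll, eq_comm]
      obtain ⟨k1, k2⟩ := hs.rules hn i { st with started := true } x rfl rfl rfl (fun _ h => h)
        (fun _ h => h)
      refine ⟨k1, fun d m => ?_, (append_nil _).symm⟩
      grind [BInst.step, BInst.Says, BState.mem_rules]
  | inr y =>
    have hsub : st.log ⊆ st.log ++ [y] := subset_append_left _ _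
    cases inp with
    | some x =>
      have hstart : st.started = true := hs.started
      obtain ⟨k1, k2⟩ := hs.rules hn i { st with log := st.log ++ [y] } x hstart rfl rfl hsub
        (fun v h => BState.fromSender_append h)
      simp [BInst.step, hstart] at k1 k2 ⊢
      refine ⟨k1, fun d m => ?_, rfl⟩
      grind [BInst.Says, BState.mem_rules]
    | none =>
      have hstart : st.started = false := hs.started
      have h' : (BInst.step ts p i ⟨st, none, out⟩ (.inr y)) =
          (⟨{ st with log := st.log ++ [y] }, none, out⟩, []) := by
        simp [BInst.step, hstart]
      rw [h']
      refine ⟨⟨hs.started, hs.echoed, fun v => (hs.ready v).trans (by simp), fun v hv =>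
        (hs.out v hv).trans (BState.count_mono hsub _), fun h => nomatch h⟩, fun d m => ?_, rfl⟩
      cases m <;> simp [BInst.Says]

def Inst.view (s : Inst (bracha n V ts p)) : BInst n V := ⟨s.st, s.inp, s.out⟩

theorem Inst.view_step (s : Inst (bracha n V ts p)) (i)
    (coin : ℕ → Fin ((bracha n V ts p).coins + 1)) (e : Option V ⊕ (Fin n × BMsg V)) :
    ((s.step i coin e).1.view, (s.step i coin e).2) = s.view.step ts p i e := by
  obtain ⟨st, inp, cnt, out⟩ := s
  cases e with
  | inl x => cases inp <;> rfl
  | inr y =>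
    have hstep : (bracha n V ts p).step i (coin cnt) st (.inr y) =
        if BState.started st then BState.rules ts p ({ (st : BState n V) with
          log := BState.log st ++ [y] }) else ({ (st : BState n V) with
          log := BState.log st ++ [y] }, [], none) := rfl
    by_cases h : BState.started (st : BState n V) = true
    · refine Prod.ext ?_ ?_
      · refine (congrArg (fun r : BState n V × List (Fin n × BMsg V) × Option V =>
          (⟨r.1, inp, out <|> r.2.2⟩ : BInst n V)) hstep).trans ?_
        simp [BInst.step, view, h]
      · refine (congrArg (fun r : BState n V × List (Fin n × BMsg V) × Option V => r.2.1) hstep).trans ?_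
        simp [BInst.step, view, h]
    · refine Prod.ext ?_ ?_
      · refine (congrArg (fun r : BState n V × List (Fin n × BMsg V) × Option V =>
          (⟨r.1, inp, out <|> r.2.2⟩ : BInst n V)) hstep).trans ?_
        simp [BInst.step, view, h]
      · refine (congrArg (fun r : BState n V × List (Fin n × BMsg V) × Option V => r.2.1) hstep).trans ?_
        simp [BInst.step, view, h]

def bAt (c : Config Br) (i : Fin n) : BInst n V := (instAt c i).view

def Sent (c : Config Br) (i d : Fin n) (m : BMsg V) : Prop := ∃ t, (⟨i, d, m, t⟩ : Packet Br) ∈ c.net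

theorem bAt_apply (ω : (Br).Rand) (c : Config Br)
    (a : Action Br) (i) :
    (bAt (c.apply ω a) i = bAt c i ∧ ∀ d m, Sent (c.apply ω a) i d m ↔ Sent c i d m) ∨
    i ∉ c.corrupted ∧ ∃ e : Option V ⊕ (Fin n × BMsg V),
      bAt (c.apply ω a) i = ((bAt c i).step ts p i e).1 ∧
      (∀ d m, Sent (c.apply ω a) i d m ↔
        Sent c i d m ∨ (d, m) ∈ ((bAt c i).step ts p i e).2) ∧
      ∀ j m, e = .inr (j, m) → i ∈ (c.event ω a).1 ∧ (c.event ω a).2 = .recv j m := by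
  let outs : List (Fin n × BMsg V) := (c.react ω i (c.event ω a).2).2.1
  have hnet : ∀ d m, Sent (c.apply ω a) i d m ↔ Sent c i d m ∨ (c.Active ω a i ∧ (d, m) ∈ outs) := by
    intro d m
    simp only [Sent, mem_apply_net]
    constructor
    · rintro ⟨t, h | ⟨i', hi', x, hx, h⟩⟩
      · grind
      · have h1 := congrArg Packet.src h
        subst h1
        have h2 : (d, m) = x := Prod.ext (congrArg Packet.dst h) (congrArg Packet.msg h)
        exact .inr ⟨hi', h2 ▸ hx⟩
    · rintro (⟨t, h⟩ | ⟨hi, hx⟩)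
      · grind
      · exact ⟨_, .inr ⟨i, hi, (d, m), hx, rfl⟩⟩
  by_cases hact : c.Active ω a i
  · have hst : instAt (c.apply ω a) i = (c.react ω i (c.event ω a).2).1 :=
      (Config.apply_state ω c a i).trans (if_pos hact)
    have step : ∀ e : Option V ⊕ (Fin n × BMsg V), c.react ω i (c.event ω a).2 =
        ((step i (fun x => ω.1 (i, x)) (instAt c i) e).1,
          (step i (fun x => ω.1 (i, x)) (instAt c i) e).2, []) →
        bAt (c.apply ω a) i = ((bAt c i).step ts p i e).1 ∧
        ∀ d m, Sent (c.apply ω a) i d m ↔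
          Sent c i d m ∨ (d, m) ∈ ((bAt c i).step ts p i e).2 := by
      intro e he
      have hv := view_step (instAt c i) i (fun x => ω.1 (i, x)) e
      refine ⟨?_, fun d m => (hnet d m).trans (or_congr_right ?_)⟩
      · rw [bAt, hst, he]
        exact congrArg Prod.fst hv
      · have h2 : outs = ((bAt c i).step ts p i e).2 :=
          (congrArg (fun r => r.2.1) he).trans (congrArg Prod.snd hv)
        simp_all
    have idle : c.react ω i (c.event ω a).2 = (c.state i, [], []) →
        bAt (c.apply ω a) i = bAt c i ∧ ∀ d m, Sent (c.apply ω a) i d m ↔ Sent c i d m := by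
      intro he
      refine ⟨?_, fun d m => ?_⟩
      · rw [bAt, hst, he]
        rfl
      · have h2 : outs = [] := congrArg (fun r => r.2.1) he
        simp_all
    cases hev : (c.event ω a).2 with
    | input x =>
      rw [hev] at step
      exact .inr ⟨hact.2, .inl x, (step (.inl x) rfl).1, (step (.inl x) rfl).2, fun j m h => nomatch h⟩
    | recv j m =>
      rw [hev] at step
      refine .inr ⟨hact.2, .inr (j, m), (step (.inr (j, m)) rfl).1, (step (.inr (j, m)) rfl).2,
        fun j' m' h => ?_⟩
      obtain ⟨rfl, rfl⟩ := Prod.mk.inj (Sum.inr.inj h)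
      exact ⟨hact.1, rfl⟩
    | tick =>
      rw [hev] at idle
      exact .inl (idle rfl)
    | leader k l => exact k.elim
  · refine .inl ⟨?_, fun d m => ?_⟩
    · exact congrArg Inst.view ((Config.apply_state ω c a i).trans (if_neg hact))
    simp_all

/-- A received message was sent by its sender while it was honest, or the sender is corrupted. -/
theorem Config.event_recv {In Out : Type} {P : Protocol n In Out} {ω : P.Rand} {c : Config P}
    {a : Action P} {i j} {m : P.Msg} (hi : i ∈ (c.event ω a).1)
    (h : (c.event ω a).2 = .recv j m) : (∃ q ∈ c.net, q.src = j ∧ q.dst = i ∧ q.msg = m) ∨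
      c.Injectable j m := by
  cases a with
  | deliver idx =>
    simp [event] at h hi
    split at h
    · cases h
    · rename_i q hq
      rw [hq] at hi
      split_ifs at h hi with hd
      cases h
      exact .inl ⟨q, List.mem_of_getElem? hq, rfl, (Finset.mem_singleton.1 hi).symm, rfl⟩
  | inject src dst m' =>
    grind [event]
  | leader j' k =>
    grind [event]
  | _ => simp [event] at h

structure BInv (c : Config Br) : Prop where
  ok : ∀ i, (bAt c i).Ok ts p
  sent : ∀ i d m, Sent c i d m ↔ (bAt c i).Says ts p i m
  heard : ∀ i j m, (j, m) ∈ (bAt c i).st.log → j ∈ c.corrupted ∨ (bAt c j).Says ts p j m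

structure BInst.Le (ts : ℕ) (p i : Fin n) (s s' : BInst n V) : Prop where
  log : s.st.log ⊆ s'.st.log
  mono : ∀ m, s.Says ts p i m → s'.Says ts p i m
  inp : ∀ v, s.inp = some v → s'.inp = some v
  out : ∀ v, s.out = some v → s'.out = some v

theorem BInst.Le.refl (i) (s : BInst n V) : s.Le ts p i s :=
  ⟨fun _ h => h, fun _ h => h, fun _ h => h, fun _ h => h⟩

theorem BInst.Le.trans {i} {s s' s'' : BInst n V} (h : s.Le ts p i s')
    (h' : s'.Le ts p i s'') : s.Le ts p i s'' :=
  ⟨fun _ hx => h'.log (h.log hx), fun m hm => h'.mono m (h.mono m hm),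
    fun m hm => h'.inp m (h.inp m hm), fun m hm => h'.out m (h.out m hm)⟩

theorem BInst.le_step (hn : ts < n) (i) {s : BInst n V} (hs : s.Ok ts p)
    (e : Option V ⊕ (Fin n × BMsg V)) : s.Le ts p i (s.step ts p i e).1 := by
  obtain ⟨-, h2, h3⟩ := s.step_spec hn i hs e
  refine ⟨h3 ▸ subset_append_left _ _, fun m hm => (h2 i m).2 (.inl hm), fun v hv => ?_, fun v hv => ?_⟩ <;>
  · obtain ⟨st, inp, out⟩ := s
    cases hv
    cases e with
    | inl x => first | rfl | (cases inp <;> rfl)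
    | inr y => rfl

theorem BInv.apply (hn : ts < n) {ω : (Br).Rand}
    {c : Config Br} (h : BInv c) (a : Action Br) :
    BInv (c.apply ω a) ∧ (∀ i, (bAt c i).Le ts p i (bAt (c.apply ω a) i)) ∧
      ∀ i j m, (j, m) ∈ (bAt (c.apply ω a) i).st.log → j ∈ c.corrupted ∨ (bAt c j).Says ts p j m := by
  have hle : ∀ i, (bAt c i).Le ts p i (bAt (c.apply ω a) i) := fun i => by
    rcases bAt_apply ω c a i with ⟨h1, -⟩ | ⟨-, e, h1, -, -⟩
    · rw [h1]
      exact .refl i _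
    grind [BInst.le_step, BInv.ok]
  have hlog : ∀ i j m, (j, m) ∈ (bAt (c.apply ω a) i).st.log →
      j ∈ c.corrupted ∨ (bAt c j).Says ts p j m := by
    intro i j m hm
    rcases bAt_apply ω c a i with ⟨h1, -⟩ | ⟨-, e, h1, -, h3⟩
    · grind [BInv.heard]
    · rw [h1, (BInst.step_spec hn i (h.ok i) e).2.2, mem_append] at hm
      rcases hm with hm | hm
      · exact h.heard i j m hm
      · cases e with
        | inl x => cases hm
        | inr y =>
          obtain rfl := List.mem_singleton.1 hm
          obtain ⟨hi, hev⟩ := h3 j m rfl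
          rcases event_recv hi hev with ⟨q, hq, rfl, -, rfl⟩ | hq
          · exact .inr ((h.sent q.src q.dst q.msg).1 ⟨q.sentAt, hq⟩)
          · exact .inl hq.1
  refine ⟨⟨fun i => ?_, fun i d m => ?_, fun i j m hm => ?_⟩, hle, hlog⟩
  · grind [bAt_apply, BInst.step_spec, BInv.ok]
  · grind [bAt_apply, BInst.step_spec, BInv.sent, BInv.ok]
  grind [corrupted_subset_apply, BInst.Le.mono]

open Filter

theorem bInv (hn : ts < n) (A ω t) : BInv ((bracha n V ts p).alone.cfg A ω t) := by
  induction t with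
  | zero =>
    refine ⟨fun i => ⟨rfl, rfl, fun v => ?_, fun v h => (nomatch h), fun h => (nomatch h)⟩,
      fun i d m => ?_, fun i j m h => absurd h not_mem_nil⟩
    · exact iff_of_false (notMem_empty v) fun h => Bool.false_ne_true h.1
    · refine iff_of_false (fun ⟨t, h⟩ => absurd h not_mem_nil) fun h => ?_
      cases m <;> first | exact absurd h.1 Bool.false_ne_true | exact nomatch h.2
  | succ t ih => exact (ih.apply hn _).1

theorem bAt_le (hn : ts < n) (A ω i) {s t} (h : s ≤ t) :
    (bAt ((bracha n V ts p).alone.cfg A ω s) i).Le ts p i (bAt ((bracha n V ts p).alone.cfg A ω t) i) := by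
  induction t, h using Nat.le_induction with
  | base => exact .refl i _
  | succ t _ ih => exact ih.trans (((bInv hn A ω t).apply hn _).2.1 i)

theorem BState.mem_of_fromSender {s : BState n V} {v : V} (h : s.fromSender p = some v) :
    (p, .val v) ∈ s.log := by
  obtain ⟨y, hy, h'⟩ := exists_of_findSome?_eq_some h
  grind

theorem BState.fromSender_of_mem {s : BState n V} {v : V} (h : (p, .val v) ∈ s.log) :
    ∃ w, s.fromSender p = some w := by
  rw [← isSome_iff_exists, BState.fromSender, findSome?_isSome_iff]
  grind

theorem BInv.exists_says {c : Config Br} (h : BInv c) {i} {m : BMsg V}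
    (hc : c.corrupted.card < (bAt c i).st.count m) :
    ∃ j, j ∉ c.corrupted ∧ (bAt c j).Says ts p j m := by
  obtain ⟨j, hj, hj'⟩ := exists_mem_notMem_of_card_lt_card hc
  grind [BInv.heard]

/-- If somebody sends ready, somebody has received enough echoes. -/
theorem echoes_of_ready (hn : ts < n) (hA : (bracha n V ts p).alone.AtMost ts A ω) {t i v} (h : (bAt ((bracha n V ts p).alone.cfg A ω t) i).Says ts p i (.ready v)) :
    ∃ i', n - ts ≤ (bAt ((bracha n V ts p).alone.cfg A ω t) i').st.count (.echo v) := by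
  induction t generalizing i with
  | zero => exact nomatch h.1
  | succ t ih =>
    obtain ⟨-, h2, h3⟩ := (bInv hn A ω t).apply hn (ω := ω) ((bracha n V ts p).alone.act A ω t)
    rcases h.2 with h' | h'
    · grind
    · obtain ⟨j, hj, hj'⟩ := exists_mem_notMem_of_card_lt_card ((hA t).trans_lt (Nat.lt_of_succ_le h'))
      obtain ⟨i', hi'⟩ := ih ((h3 i j _ (Finset.mem_filter.1 hj).2).resolve_left hj')
      exact ⟨i', hi'.trans (BState.count_mono (h2 i').log _)⟩

theorem exists_heard (hn : ts < n) (hd : (bracha n V ts p).alone.EventualDelivery A ω) {i j}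
    (hi : (bracha n V ts p).alone.Honest A ω i) {t m}
    (h : (bAt ((bracha n V ts p).alone.cfg A ω t) j).Says ts p j m) :
    ∀ᶠ t in atTop, (j, m) ∈ (bAt ((bracha n V ts p).alone.cfg A ω t) i).st.log := by
  obtain ⟨s, hs⟩ := ((bInv hn A ω t).sent j i m).2 h
  obtain ⟨t', ht'⟩ := hd.exists_event hs hi
  have hact : ((bracha n V ts p).alone.cfg A ω t').Active ω ((bracha n V ts p).alone.act A ω t') i := by
    refine ⟨?_, hi t'⟩
    simp_all
  have h1 : bAt ((bracha n V ts p).alone.cfg A ω (t' + 1)) i =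
      ((bAt ((bracha n V ts p).alone.cfg A ω t') i).step ts p i (.inr (j, m))).1 := by
    refine Eq.trans ?_ (congrArg Prod.fst (view_step
      (instAt ((bracha n V ts p).alone.cfg A ω t') i) i (fun x => ω.1 (i, x)) (.inr (j, m))))
    refine congrArg Inst.view ((Config.apply_state ω _ _ i).trans ((if_pos hact).trans ?_))
    exact congrArg (fun e : Finset (Fin n) × Event n (Option V) (bracha n V ts p).alone.Msg
      (bracha n V ts p).alone.LKey =>
      (((bracha n V ts p).alone.cfg A ω t').react ω i e.2).1) ht'
  refine eventually_atTop.2 ⟨t' + 1, fun r hr => (bAt_le hn A ω i hr).log ?_⟩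
  grind [BInst.step_spec, bInv, BInv.ok]

theorem eventually_count (hn : ts < n) (hA : (Br).AtMost ts A ω) (hd : (Br).EventualDelivery A ω) {m}
    (h : ∀ j, (Br).Honest A ω j → ∃ t, (bAt (cb t) j).Says ts p j m) {i}
    (hi : (Br).Honest A ω i) :
    ∀ᶠ t in atTop, n - ts ≤ (bAt (cb t) i).st.count m := by
  have : ∀ᶠ t in atTop, ∀ j, (Br).Honest A ω j → (j, m) ∈ (bAt (cb t) i).st.log := by
    refine eventually_all.2 fun j => ?_
    by_cases hj : (Br).Honest A ω j
    · grind [exists_heard]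
    simp_all
  refine this.mono fun t ht => ?_
  have h1 := honest_card hA
  have h2 := card_le_card (monotone_filter_right univ (p := (Br).Honest A ω)
    (q := fun j => (j, m) ∈ (bAt (cb t) i).st.log) fun j _ hj => ht j hj)
  unfold BState.count
  omega

theorem eventually_begun (hn : ts < n) {b} (hr : (bracha n V ts p).Runs b A ω) {i}
    (hi : (bracha n V ts p).alone.Honest A ω i) :
    ∀ᶠ t in atTop, (bAt ((bracha n V ts p).alone.cfg A ω t) i).inp.isSome := by
  obtain ⟨x, t, ht⟩ := hr.2.2 i hi
  refine eventually_atTop.2 ⟨t, fun r hr => ?_⟩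
  rw [(bAt_le hn A ω i hr).inp x ht]
  rfl

/-- If all honest parties send ready on `v`, they output. -/
theorem exists_out (hn : ts < n) {b} (hb : b ≤ ts) (hr : (bracha n V ts p).Runs b A ω) {v}
    (h : ∀ j, (bracha n V ts p).alone.Honest A ω j →
      ∃ t, (bAt ((bracha n V ts p).alone.cfg A ω t) j).Says ts p j (.ready v)) {i}
    (hi : (bracha n V ts p).alone.Honest A ω i) (hts : 2 * ts < n)
    (hv : ∀ w t, (bAt ((bracha n V ts p).alone.cfg A ω t) i).out = some w →
      (∃ i', n - ts ≤ (bAt ((bracha n V ts p).alone.cfg A ω t) i').st.count (.echo w)) → w = v) :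
    (bracha n V ts p).Outputs A ω i v := by
  have hA : (bracha n V ts p).alone.AtMost ts A ω := fun t => (hr.1 t).trans hb
  obtain ⟨t, h1, h2⟩ := ((eventually_count hn hA hr.2.1 h hi).and (eventually_begun hn hr hi)).exists
  have hok := (bInv hn A ω t).ok i
  obtain ⟨w, hw⟩ := isSome_iff_exists.1 (hok.out_isSome h2 ⟨v, h1⟩)
  obtain ⟨j, -, hj⟩ := (bInv hn A ω t).exists_says (i := i) (m := .ready w)
    (lt_of_lt_of_le (lt_of_le_of_lt (hA t) (by omega)) (hok.out w hw))
  exact ⟨t, (hv w t hw (echoes_of_ready hn hA hj)) ▸ hw⟩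

theorem bracha_valid (hts : 2 * ts < n) (hr : (bracha n V ts p).Runs ts A ω) {v : V}
    (hp : (bracha n V ts p).alone.Honest A ω p) (hv : (bracha n V ts p).Begins A ω p (some v))
    {i} (hi : (bracha n V ts p).alone.Honest A ω i) :
    (bracha n V ts p).Outputs A ω i v := by
  have hn : ts < n := by omega
  obtain ⟨t₀, ht₀⟩ := hv
  have ht₀ : (bAt ((bracha n V ts p).alone.cfg A ω t₀) p).inp = some (some v) := ht₀
  have hval : ∀ t j w, (p, .val w) ∈ (bAt ((bracha n V ts p).alone.cfg A ω t) j).st.log → w = v := by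
    intro t j w h
    have h1 := (((bInv hn A ω t).heard j p _ h).resolve_left (hp t)).2
    have h2 := (bAt_le hn A ω p (le_max_left t t₀)).inp _ h1
    rw [(bAt_le hn A ω p (le_max_right t t₀)).inp _ ht₀] at h2
    simp_all
  have hecho : ∀ j, (bracha n V ts p).alone.Honest A ω j →
      ∃ t, (bAt ((bracha n V ts p).alone.cfg A ω t) j).Says ts p j (.echo v) := by
    intro j hj
    have h0 : (bAt ((bracha n V ts p).alone.cfg A ω t₀) p).Says ts p p (.val v) := ⟨rfl, ht₀⟩
    obtain ⟨t, h1, h2⟩ := ((exists_heard hn hr.2.1 hj h0).and (eventually_begun hn hr hj)).exists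
    obtain ⟨w, hw⟩ := BState.fromSender_of_mem h1
    obtain rfl := hval t j w (BState.mem_of_fromSender hw)
    exact ⟨t, h2, hw⟩
  refine exists_out hn le_rfl hr (fun j hj => ?_) hi hts fun w t _ ⟨i', hi'⟩ => ?_
  · obtain ⟨t, h1, h2⟩ := ((eventually_count hn hr.1 hr.2.1 hecho hj).and
      (eventually_begun hn hr hj)).exists
    exact ⟨t, h2, .inl h1⟩
  · obtain ⟨j, -, hj⟩ := (bInv hn A ω t).exists_says (i := i') (m := .echo w)
      (lt_of_lt_of_le (lt_of_le_of_lt (hr.1 t) (by omega)) hi')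
    exact hval t j w (BState.mem_of_fromSender hj.2)

theorem bracha_consistent {ta} (hle : ta ≤ ts) (hts : ta + 2 * ts < n)
    (hr : (bracha n V ts p).Runs ta A ω) {i₀ v}
    (hv : (bracha n V ts p).Outputs A ω i₀ v)
    {i} (hi : (bracha n V ts p).alone.Honest A ω i) :
    (bracha n V ts p).Outputs A ω i v := by
  have hn : ts < n := by omega
  have hA : (bracha n V ts p).alone.AtMost ts A ω := fun t => (hr.1 t).trans hle
  obtain ⟨s, hs⟩ := hv
  obtain ⟨s', hs'⟩ := card_honest hr.1
  set t₀ := max s s'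
  have hout : (bAt ((bracha n V ts p).alone.cfg A ω t₀) i₀).out = some v :=
    (bAt_le hn A ω i₀ (le_max_left s s')).out v hs
  have hcount := ((bInv hn A ω t₀).ok i₀).out v hout
  set J := (univ.filter fun j : Fin n =>
    (j, BMsg.ready v) ∈ (bAt ((bracha n V ts p).alone.cfg A ω t₀) i₀).st.log) with hJ
  set C := ((bracha n V ts p).alone.cfg A ω t₀).corrupted with hC
  have hcard : ts + 1 ≤ (J \ C).card := by
    have h1 := le_card_sdiff C J
    have h2 : C.card ≤ ta := hr.1 t₀
    have h3 : n - ts ≤ J.card := hcount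
    omega
  have hsays : ∀ j ∈ J \ C, (bAt ((bracha n V ts p).alone.cfg A ω t₀) j).Says ts p j (.ready v) :=
    fun j hj => ((bInv hn A ω t₀).heard i₀ j _
      (Finset.mem_filter.1 (Finset.mem_sdiff.1 hj).1).2).resolve_left (Finset.mem_sdiff.1 hj).2
  refine exists_out hn hle hr (fun j hj => ?_) hi (by omega) fun w t _ ⟨i', hi'⟩ => ?_
  · have : ∀ᶠ t in atTop, ∀ l ∈ J \ C,
        (l, BMsg.ready v) ∈ (bAt ((bracha n V ts p).alone.cfg A ω t) j).st.log :=
      (Finset.eventually_all _).2 fun l hl => exists_heard hn hr.2.1 hj (hsays l hl)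
    obtain ⟨t, h1, h2⟩ := (this.and (eventually_begun hn hr hj)).exists
    refine ⟨t, h2, .inr (hcard.trans (Finset.card_le_card fun l hl => ?_))⟩
    simp_all
  · obtain ⟨j, hj⟩ := card_pos.1 (Nat.lt_of_lt_of_le (Nat.succ_pos ts) hcard)
    obtain ⟨i'', hi''⟩ := echoes_of_ready hn hA (hsays j hj)
    obtain ⟨r, hr₁, hr₂⟩ : ∃ r, t ≤ r ∧ t₀ ≤ r := ⟨_, le_max_left _ _, le_max_right _ _⟩
    have h1 := hi'.trans (BState.count_mono (bAt_le hn A ω i' hr₁).log (.echo w))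
    have h2 := hi''.trans (BState.count_mono (bAt_le hn A ω i'' hr₂).log (.echo v))
    have hinter : ((bracha n V ts p).alone.cfg A ω r).corrupted.card < ((univ.filter fun j : Fin n =>
          (j, BMsg.echo w) ∈ (bAt ((bracha n V ts p).alone.cfg A ω r) i').st.log) ∩
        univ.filter fun j : Fin n =>
          (j, BMsg.echo v) ∈ (bAt ((bracha n V ts p).alone.cfg A ω r) i'').st.log).card := by
      have h3 := card_union_add_card_inter (univ.filter fun j : Fin n =>
          (j, BMsg.echo w) ∈ (bAt ((bracha n V ts p).alone.cfg A ω r) i').st.log)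
        (univ.filter fun j : Fin n =>
          (j, BMsg.echo v) ∈ (bAt ((bracha n V ts p).alone.cfg A ω r) i'').st.log)
      have h4 := card_le_univ ((univ.filter fun j : Fin n =>
          (j, BMsg.echo w) ∈ (bAt ((bracha n V ts p).alone.cfg A ω r) i').st.log) ∪
        univ.filter fun j : Fin n =>
          (j, BMsg.echo v) ∈ (bAt ((bracha n V ts p).alone.cfg A ω r) i'').st.log)
      rw [Fintype.card_fin] at h4
      have h5 := hr.1 r
      grind [BState.count]
    obtain ⟨l, hl, hl'⟩ := exists_mem_notMem_of_card_lt_card hinter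
    rw [Finset.mem_inter] at hl
    have h3 := (((bInv hn A ω r).heard i' l _ (Finset.mem_filter.1 hl.1).2).resolve_left hl').2
    have h4 := (((bInv hn A ω r).heard i'' l _ (Finset.mem_filter.1 hl.2).2).resolve_left hl').2
    simp_all

theorem negligible_zero : Negligible 0 := Asymptotics.superpolynomialDecay_zero _ _

theorem bracha_bcastValid [NeZero n] (hts : 2 * ts < n) : BcastValid ts fun _ => bracha n V ts := by
  refine ⟨0, negligible_zero, fun κ p A => (measure_mono_null (fun ω hω => ?_)
    measure_empty).trans_le zero_le⟩
  exact hω.2 fun v hp hv i hi => bracha_valid hts hω.1.1 hp hv hi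

theorem bracha_bcastConsistent [NeZero n] {ta} (hle : ta ≤ ts) (hts : ta + 2 * ts < n) :
    BcastConsistent ta fun _ => bracha n V ts := by
  refine ⟨0, negligible_zero, fun κ p A => (measure_mono_null (fun ω hω => ?_)
    measure_empty).trans_le zero_le⟩
  refine hω.2 ?_
  by_cases h : ∃ i v, (bracha n V ts p).alone.Honest A ω i ∧ (bracha n V ts p).Outputs A ω i v
  · obtain ⟨i₀, v, -, h2⟩ := h
    exact .inr ⟨v, fun i hi => bracha_consistent hle hts hω.1.1 h2 hi⟩
  simp_all

end Bracha

/-! ## Leader election against an adaptive adversary -/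

section Leaders

variable {n : ℕ} {In Out : Type} {P : Protocol n In Out} {a : ℕ → P.LKey} {l L : ℕ}

/-- Executions with the same coins agree as long as no leader is chosen that is different. -/
theorem Protocol.exec_congr {A x y} (h : x.1 = y.1) {t}
    (hk : ∀ s ≤ t, ∀ k, x.2 k ≠ y.2 k → 2 * ((P.cfg A x s).requests k).card ≤ n) :
    P.exec A x t = P.exec A y t := by
  have hl : ∀ s ≤ t, (P.cfg A x s).leader x = (P.cfg A x s).leader y := by
    intro s hs
    funext k
    unfold leader
    by_cases hxy : x.2 k = y.2 k
    · rw [hxy]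
    · rw [if_neg (hk s hs k hxy).not_gt, if_neg (hk s hs k hxy).not_gt]
  have happly : ∀ (c : Config P) (b : Action P), c.leader x = c.leader y → c.apply x b = c.apply y b := by
    intro c b hc
    have h1 : ∀ c : Config P, c.activate x = c.activate y := fun c => by
      unfold activate
      rw [h]
    cases b <;> simp only [Config.apply, h1, hc]
  have hview : ∀ c : Config P, c.leader x = c.leader y → c.view x = c.view y := by grind [Config.view]
  induction t with
  | zero =>
    have h1 := hview _ (hl 0 le_rfl)
    exact Prod.ext rfl (congrArg (· :: []) h1)
  | succ t ih =>
    have ih := ih (fun s hs => hk s (hs.trans t.le_succ)) fun s hs => hl s (hs.trans t.le_succ)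
    have h1 : P.cfg A x (t + 1) = P.cfg A y (t + 1) := by
      rw [cfg_succ, cfg_succ, happly _ _ (hl t t.le_succ), cfg, cfg, act, act, ih]
    refine Prod.ext h1 ?_
    change (P.cfg A x (t + 1)).view x :: (P.exec A x t).2 = (P.cfg A y (t + 1)).view y :: (P.exec A y t).2
    grind

variable [NeZero n]

/-- Forget the leaders with keys `a l`, `l ≥ L`. -/
def Protocol.reset (a : ℕ → P.LKey) (L : ℕ) (ω : P.Rand) : P.Rand :=
  (ω.1, fun k => if ∃ l ≥ L, k = a l then 0 else ω.2 k)

theorem Protocol.reset_shift (hl : L ≤ l) (d ω) : reset a L (P.shift (a l) d ω) = reset a L ω := by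
  refine Prod.ext rfl (funext fun k => ?_)
  simp only [reset, shift]
  split_ifs with h1 h2
  · rfl
  · grind
  · rfl

/-- The parties that are corrupted when the clocks tick at time `τ`. -/
def Protocol.corruptedAt (A : Adversary P) (τ : ℕ) (ω : P.Rand) : Finset (Fin n) :=
  univ.filter fun i => ∃ t, (P.cfg A ω t).time = τ ∧ (∃ S, P.act A ω t = .tick S) ∧
    i ∈ (P.cfg A ω t).corrupted

/-- The parties, at most `b`, that are corrupted at time `τ` if the leaders with keys `a l`, `l ≥ L`,
are not known. -/
def Protocol.caught (A : Adversary P) (a : ℕ → P.LKey) (b τ L : ℕ) (ω : P.Rand) : Finset (Fin n) :=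
  let D := corruptedAt A τ (reset a L ω)
  if D.card ≤ b then D else ∅

theorem Protocol.Sync.caught_eq {Δ b τ A ω} (h : P.Sync Δ A ω)
    (hb : P.AtMost b A ω) (hk : ∀ s ≤ P.tickAt A ω τ, ∀ l ≥ L, 2 * ((P.cfg A ω s).requests (a l)).card ≤ n) :
    caught A a b τ L ω = (P.cfg A ω (P.tickAt A ω τ)).corrupted := by
  have hex : ∀ s ≤ P.tickAt A ω τ, P.exec A ω s = P.exec A (reset a L ω) s := by
    refine fun s hs => exec_congr (x := ω) (y := reset a L ω) rfl fun s' hs' k hne => ?_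
    by_cases h1 : ∃ l ≥ L, k = a l
    · obtain ⟨l, hl, rfl⟩ := h1
      exact hk s' (hs'.trans hs) l hl
    · exact absurd (if_neg h1).symm hne
  obtain ⟨h1, h2, -⟩ := h.time_tickAt τ
  have hD : corruptedAt A τ (reset a L ω) = (P.cfg A ω (P.tickAt A ω τ)).corrupted := by
    ext i
    simp only [corruptedAt, Finset.mem_filter, Finset.mem_univ, true_and]
    have hT := hex _ le_rfl
    have hcfg : P.cfg A (reset a L ω) (P.tickAt A ω τ) = P.cfg A ω (P.tickAt A ω τ) := by
      rw [cfg, ← hT]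
    have hact : P.act A (reset a L ω) (P.tickAt A ω τ) = .tick Finset.univ := by grind [act]
    constructor
    · rintro ⟨t, h3, ⟨S, h4⟩, h5⟩
      rcases lt_trichotomy t (P.tickAt A ω τ) with hlt | rfl | hlt
      · exfalso
        have h6 : (P.cfg A (reset a L ω) (t + 1)).time = τ + 1 := by
          rw [cfg_succ, h4, apply_time]
          exact congrArg (· + 1) h3
        rw [cfg, ← hex _ (Nat.succ_le_of_lt hlt)] at h6
        have h7 := time_mono (A := A) (ω := ω) (Nat.succ_le_of_lt hlt)
        rw [h1] at h7
        exact absurd (h6.symm.trans_le h7) (Nat.not_succ_le_self τ)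
      · simp_all
      · exfalso
        have h6 : (P.cfg A (reset a L ω) (P.tickAt A ω τ + 1)).time = τ + 1 := by
          rw [cfg_succ, hact, apply_time, hcfg]
          exact congrArg (· + 1) h1
        have h7 := time_mono (A := A) (ω := reset a L ω) (Nat.succ_le_of_lt hlt)
        simp_all
    grind
  rw [caught, hD, if_pos (hb _)]

/-- Corrupted parties are rarely elected many times in a row. -/
theorem Protocol.law_caught_le [Countable P.Coin] [Countable P.LKey] (hP : P.Local) (A : Adversary P)
    (ha : Injective a) {b} (hb : 2 * b ≤ n) (τ : ℕ → ℕ) (m) :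
    P.law {ω | ∀ l < m, ω.2 (a l) ∈ caught A a b (τ l) l ω} ≤ (1 / 2) ^ m := by
  have hreset : ∀ l, Continuous (reset (P := P) a l) := by
    intro l
    refine Continuous.prodMk continuous_fst (continuous_pi fun k => ?_)
    split_ifs
    · exact continuous_const
    · exact (continuous_apply k).comp continuous_snd
  have hmem : ∀ l d, Measurable fun ω : P.Rand => d ∈ caught A a b (τ l) l ω := by
    intro l d
    have h1 : ∀ d, Measurable fun ω : P.Rand => d ∈ corruptedAt A (τ l) (reset a l ω) := by
      intro d
      simp only [corruptedAt, Finset.mem_filter, Finset.mem_univ, true_and]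
      refine Measurable.exists fun t => ?_
      have hc := (isLocallyConstant_pair (hP.cfg A t) (hP.act A t)).comp_continuous (hreset l)
      exact IsLocallyConstant.measurable_prop hc fun c => c.1.time = τ l ∧ (∃ S, c.2 = .tick S) ∧
        d ∈ c.1.corrupted
    have h2 : Measurable fun ω : P.Rand => (corruptedAt A (τ l) (reset a l ω)).card ≤ b := by
      have h3 : Measurable fun ω : P.Rand => fun d => d ∈ corruptedAt A (τ l) (reset a l ω) :=
        measurable_pi_lambda _ h1
      have h4 : Measurable fun p : Fin n → Prop => (univ.filter p).card ≤ b := Measurable.of_discrete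
      have h5 := h4.comp h3
      simpa [comp_def] using h5
    have h3 : (fun ω : P.Rand => d ∈ caught A a b (τ l) l ω) = fun ω =>
        d ∈ corruptedAt A (τ l) (reset a l ω) ∧
          (corruptedAt A (τ l) (reset a l ω)).card ≤ b := by grind [caught]
    rw [h3]
    exact (h1 d).and h2
  have hD : ∀ l, MeasurableSet {ω : P.Rand | ω.2 (a l) ∈ caught A a b (τ l) l ω} := by
    intro l
    have : {ω : P.Rand | ω.2 (a l) ∈ caught A a b (τ l) l ω} =
        {ω | ∃ d, ω.2 (a l) = d ∧ d ∈ caught A a b (τ l) l ω} := by simp_all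
    rw [this]
    refine measurableSet_setOfPred.2 (Measurable.exists fun d => Measurable.and ?_ (hmem l d))
    exact (Measurable.of_discrete (f := fun x : Fin n => x = d)).comp
      ((measurable_pi_apply (a l)).comp measurable_snd)
  have hF : ∀ m, MeasurableSet {ω : P.Rand | ∀ l < m, ω.2 (a l) ∈ caught A a b (τ l) l ω} := by
    intro m
    have : {ω : P.Rand | ∀ l < m, ω.2 (a l) ∈ caught A a b (τ l) l ω} =
        ⋂ l, ⋂ _ : l < m, {ω : P.Rand | ω.2 (a l) ∈ caught A a b (τ l) l ω} := by
      ext ω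
      simp
    rw [this]
    exact .iInter fun l => .iInter fun _ => hD l
  have hshift : ∀ l l' d ω, l ≤ l' → caught A a b (τ l) l (P.shift (a l') d ω) =
      caught A a b (τ l) l ω := by grind [caught, reset_shift]
  induction m with
  | zero => simp
  | succ m ih =>
    have h1 : {ω : P.Rand | ∀ l < m + 1, ω.2 (a l) ∈ caught A a b (τ l) l ω} =
        {ω | ∀ l < m, ω.2 (a l) ∈ caught A a b (τ l) l ω} ∩
          {ω | ω.2 (a m) ∈ caught A a b (τ m) m ω} := by
      ext ω
      grind
    have h2 := P.law_leader_mem_le (a m) (hF m) (hD m) (b := b) (fun d ω => ?_)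
      (fun d ω => hshift m m d ω le_rfl) fun ω => ?_
    · rw [h1]
      set F := P.law {ω | ∀ l < m, ω.2 (a l) ∈ caught A a b (τ l) l ω}
      have hn : (n : ENNReal) ≠ 0 := Nat.cast_ne_zero.2 (NeZero.ne n)
      have h3 : (n : ENNReal) * P.law ({ω | ∀ l < m, ω.2 (a l) ∈ caught A a b (τ l) l ω} ∩
          {ω | ω.2 (a m) ∈ caught A a b (τ m) m ω}) ≤ n * (1 / 2 * F) := by
        refine h2.trans ?_
        rw [← mul_assoc]
        gcongr
        rw [one_div, ← div_eq_mul_inv, ENNReal.le_div_iff_mul_le (.inl two_ne_zero) (.inl ENNReal.ofNat_ne_top),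
          mul_comm]
        exact_mod_cast hb
      rw [ENNReal.mul_le_mul_iff_right hn (ENNReal.natCast_ne_top n)] at h3
      rw [pow_succ']
      exact h3.trans (mul_le_mul_right ih _)
    · refine forall₂_congr fun l hl => ?_
      rw [hshift l m d ω hl.le]
      simp only [shift]
      rw [if_neg fun h => hl.ne (ha h)]
    grind [caught]
end Leaders

section Replication

variable {n : ℕ} {Tx : Type} {Bc : Fin n → AsyncProtocol n (Option (Finset Tx)) (Finset Tx)}
  {Ba : AsyncProtocol n Bool Bool} {pa : Params} {A : Adversary (smr pa Bc Ba)}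
  {ω : (smr pa Bc Ba).Rand} {i : Fin n} {k t : ℕ}

local notation "cf" => Protocol.cfg (smr pa Bc Ba) A ω
local notation "tk" => Protocol.tickAt (smr pa Bc Ba) A ω
local notation "SMR" => smr pa Bc Ba
local notation "Slot" => SlotState Bc Ba
local notation "Party" => PState Bc Ba
local notation "Mail" => List (Fin n × Msg Bc Ba)
local notation "SlotWatch" => Watch (SlotState Bc Ba) (Tape Bc Ba) (Msg Bc Ba)

/-! ## The replication protocol reads finitely many coins in each step -/

section SmrLocal

theorem isLocallyConstant_coin (c) : IsLocallyConstant fun ω : Tape Bc Ba => ω c :=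
  (of_discrete id).comp_continuous (continuous_apply c)

theorem isLocallyConstant_bcStep (i k) (x : Slot) (j) (e : Option (Finset Tx) ⊕ (Fin n × (Bc j).Msg)) :
    IsLocallyConstant fun ω : Tape Bc Ba => x.bcStep i ω k j e := by
  have h : IsLocallyConstant fun ω : Tape Bc Ba =>
      (x.bc j).step i (fun c => ω (.inl (k, j, c))) e :=
    (isLocallyConstant_coin (Bc := Bc) (Ba := Ba) (.inl (k, j, (x.bc j).cnt))).comp
      fun a : Fin ((Bc j).coins + 1) => (x.bc j).step i (fun _ => a) e
  exact h.comp fun r => (({ x with bc := update x.bc j r.1 } : Slot),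
    r.2.map fun y => (y.1, (Msg.bc k j y.2 : Msg Bc Ba)))

theorem isLocallyConstant_baStep (i k) (x : Slot) (j) (e : Bool ⊕ (Fin n × Ba.Msg)) :
    IsLocallyConstant fun ω : Tape Bc Ba => x.baStep i ω k j e := by
  have h : IsLocallyConstant fun ω : Tape Bc Ba =>
      (x.ba j).step i (fun c => ω (.inr (k, j, c))) e :=
    (isLocallyConstant_coin (Bc := Bc) (Ba := Ba) (.inr (k, j, (x.ba j).cnt))).comp
      fun a : Fin (Ba.coins + 1) => (x.ba j).step i (fun _ => a) e
  exact h.comp fun r => (({ x with ba := update x.ba j r.1 } : Slot),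
    r.2.map fun y => (y.1, (Msg.ba k j y.2 : Msg Bc Ba)))

variable {α : Type*} [TopologicalSpace α]

theorem isLocallyConstant_forAll {f : α → Slot → Fin n → Slot × Mail}
    (hf : ∀ x j, IsLocallyConstant fun ω => f ω x j) (x) :
    IsLocallyConstant fun ω => forAll (f ω) x := by
  have : ∀ (l : List (Fin n)) a, IsLocallyConstant fun ω => l.foldl (fun (a : Slot × Mail) j =>
        let r := f ω a.1 j; (r.1, a.2 ++ r.2)) a := by
    intro l
    induction l with
    | nil => exact fun a => IsLocallyConstant.const _
    | cons j l ih =>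
      intro a
      exact isLocallyConstant_bind ih ((hf a.1 j).comp fun r => (r.1, a.2 ++ r.2))
  exact this _ _

theorem isLocallyConstant_ite {β : Type*} {f g : α → β} (p : Prop) [Decidable p] (hf : IsLocallyConstant f)
    (hg : IsLocallyConstant g) : IsLocallyConstant fun a => if p then f a else g a := by
  split_ifs
  · exact hf
  · exact hg

theorem isLocallyConstant_settle (pa i k) (x : Slot) :
    IsLocallyConstant fun ω : Tape Bc Ba => x.settle pa i ω k := by
  have h1 : IsLocallyConstant fun ω : Tape Bc Ba => if x.C1 pa.ts then (x, []) else
      forAll (fun y j =>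
        if (y.bc j).out.isSome ∧ (y.ba j).inp = none then y.baStep i ω k j (.inl true)
        else (y, [])) x :=
    isLocallyConstant_ite _ (IsLocallyConstant.const _) (isLocallyConstant_forAll (fun y j =>
      isLocallyConstant_ite _ (isLocallyConstant_baStep i k y j _) (IsLocallyConstant.const _)) x)
  have h2 : ∀ r : Slot × Mail, IsLocallyConstant fun ω : Tape Bc Ba =>
      if r.1.C1 pa.ts ∨ r.1.ones.card < n - pa.ta then (r.1, []) else
      forAll (fun y j =>
        if (y.ba j).inp = none then y.baStep i ω k j (.inl false) else (y, [])) r.1 := fun r =>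
    isLocallyConstant_ite _ (IsLocallyConstant.const _) (isLocallyConstant_forAll (fun y j =>
      isLocallyConstant_ite _ (isLocallyConstant_baStep i k y j _) (IsLocallyConstant.const _)) _)
  exact isLocallyConstant_bind (fun r => (h2 r).comp fun r₂ =>
    (let acs := r₂.1.acs <|> r₂.1.exit pa
     (({ r₂.1 with acs := acs, block := acs.map fun S => S.biUnion id } : Slot), r.2 ++ r₂.2))) h1

theorem isLocallyConstant_beginACS (pa i k) (x : Slot)
    (B : Finset Tx) : IsLocallyConstant fun ω : Tape Bc Ba => x.beginACS pa i ω k B := by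
  have h1 : IsLocallyConstant fun ω : Tape Bc Ba =>
      forAll (fun y j => y.bcStep i ω k j (.inl (if j = i then some B else none)))
        { x with star := some B } :=
    isLocallyConstant_forAll (fun y j => isLocallyConstant_bcStep i k y j _) _
  have h2 : ∀ r : Slot × Mail, IsLocallyConstant fun ω : Tape Bc Ba =>
        ((r.1.settle pa i ω k).1, r.2 ++ (r.1.settle pa i ω k).2) := fun r =>
    (isLocallyConstant_settle pa i k r.1).comp fun r₂ => (r₂.1, r.2 ++ r₂.2)
  have h3 := isLocallyConstant_bind h2 h1
  grind [beginACS]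

theorem isLocallyConstant_tick (pa i k) (buf : Finset Tx) (τ)
    (x : Slot) : IsLocallyConstant fun ω : Tape Bc Ba => x.tick pa i ω k buf τ := by
  have h : ∀ (y : Slot) (B : Option (Finset Tx)) (m : Mail)
      (q : List (ℕ × ℕ)), IsLocallyConstant fun ω : Tape Bc Ba =>
        (((match B with
          | some B => y.beginACS pa i ω k B
          | none => (y, [])).1, m ++ (match B with
          | some B => y.beginACS pa i ω k B
          | none => (y, [])).2, q) : Slot × Effects Bc Ba) := by
    intro y B m q
    cases B with
    | none => exact IsLocallyConstant.const (X := Tape Bc Ba) (y, m ++ [], q)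
    | some B =>
      exact (isLocallyConstant_beginACS pa i k y B).comp fun r => (r.1, m ++ r.2, q)
  exact h _ _ _ _

theorem isLocallyConstant_after (pa i k) (r : Slot × Mail) :
    IsLocallyConstant fun ω : Tape Bc Ba => after pa i ω k r := by
  simp only [SlotState.after]
  exact isLocallyConstant_ite _ ((isLocallyConstant_settle pa i k r.1).comp
    fun r' => (r'.1, r.2 ++ r'.2, [])) (IsLocallyConstant.const _)

theorem isLocallyConstant_onSlot (s : Party) (k) {f : α → Slot → Slot × Effects Bc Ba}
    (hf : ∀ x, IsLocallyConstant fun ω => f ω x) :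
    IsLocallyConstant fun ω => s.onSlot k (f ω) :=
  (hf (s.slot k)).comp fun r =>
    (({ s with
        slot := update s.slot k r.1
        buf := match (s.slot k).block, r.1.block with
          | none, some b => s.buf \ b
          | _, _ => s.buf } : Party), r.2)

theorem isLocallyConstant_foldl {β γ : Type*} {f : α → β → γ → β}
    (hf : ∀ b c, IsLocallyConstant fun a => f a b c) (l : List γ) (b : β) :
    IsLocallyConstant fun a => l.foldl (f a) b := by
  induction l generalizing b with
  | nil => exact IsLocallyConstant.const _
  | cons c l ih => exact isLocallyConstant_bind ih (hf b c)

theorem local_smr (pa) : (smr pa Bc Ba).Local := by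
  intro i s e
  cases e with
  | input tx => exact IsLocallyConstant.const _
  | recv j m =>
    cases m with
    | buf k i' b => exact IsLocallyConstant.const _
    | bla k m => exact IsLocallyConstant.const _
    | bc k l m =>
      exact isLocallyConstant_onSlot (α := Tape Bc Ba) s k fun x =>
        isLocallyConstant_bind (fun r => isLocallyConstant_after pa i k r)
          (isLocallyConstant_bcStep i k x l (.inr (j, m)))
    | ba k l m =>
      exact isLocallyConstant_onSlot (α := Tape Bc Ba) s k fun x =>
        isLocallyConstant_ite _ (IsLocallyConstant.const _)
          (isLocallyConstant_bind (fun r => isLocallyConstant_after pa i k r)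
            (isLocallyConstant_baStep i k x l (.inr (j, m))))
  | tick =>
    have := isLocallyConstant_foldl (α := Tape Bc Ba) (f := fun ω (a : Party × Effects Bc Ba) k =>
        let r := a.1.onSlot k (tick pa i ω k a.1.buf s.clock)
        (r.1, a.2.1 ++ r.2.1, a.2.2 ++ r.2.2))
      (fun a k => (isLocallyConstant_onSlot (α := Tape Bc Ba) a.1 k fun x =>
        isLocallyConstant_tick pa i k a.1.buf s.clock x).comp
          fun r => (r.1, a.2.1 ++ r.2.1, a.2.2 ++ r.2.2))
      (range (s.clock + 1)) (s, [], [])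
    exact this.comp fun r => (({ r.1 with clock := s.clock + 1 } : Party), r.2)
  | leader kl l => exact IsLocallyConstant.const _

instance countable_coin_smr (pa : Params) : Countable (smr pa Bc Ba).Coin :=
  inferInstanceAs (Countable (CoinKey n))

instance countable_lkey_smr (pa : Params) : Countable (smr pa Bc Ba).LKey :=
  inferInstanceAs (Countable (ℕ × ℕ))

end SmrLocal

/-! ## The replication protocol treats its instances as black boxes -/

section SlotOperations

variable {I O : Type} {P : AsyncProtocol n I O}

theorem SlotState.C1v_congr {x x' : Slot} (hbc : ∀ j, (x.bc j).out = (x'.bc j).out)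
    (ts) : x.C1v ts = x'.C1v ts := by
  funext v
  simp [C1v, hbc]

theorem SlotState.ones_congr {x x' : Slot} (hba : ∀ j, (x.ba j).out = (x'.ba j).out) :
    x.ones = x'.ones := by grind [ones]

theorem SlotState.exit_congr {x x' : Slot} (hbc : ∀ j, (x.bc j).out = (x'.bc j).out)
    (hba : ∀ j, (x.ba j).out = (x'.ba j).out) (pa) : x.exit pa = x'.exit pa := by
  have h1 := C1v_congr hbc pa.ts
  have h2 := ones_congr hba
  have h3 : x.C2v pa.ta = x'.C2v pa.ta := by
    funext v
    simp [C2v, hbc, hba, h2]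
  grind [C3, exit, C1, C2]

/-- What a tick does apart from beginning the common subset protocol: the new values of `entered` and
`bla`, the messages, the calls to the leader election, and the input of the common subset
protocol, if it is to begin. -/
def tickCore (pa : Params) (i : Fin n) (k : ℕ) (buf : Finset Tx) (τ : ℕ) (entered : Bool)
    (pair : SPair n Tx) (bla : BlaState n Tx) (star : Option (Finset Tx)) :
    (Bool × BlaState n Tx) × Effects Bc Ba × Option (Finset Tx) :=
  let deadline := pa.T k + pa.Δ + pa.κ * pa.Δ
  let m₁ : Mail := if τ = pa.T k then toAll (.buf k i buf) else []
  let entered' := if τ = pa.T k then true else entered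
  let ready : Prop := entered' = true ∧ pa.ts < pair.2.card
  let bla₁ := if ready ∧ bla.start = none ∧ star = none ∧ pa.T k + pa.Δ ≤ τ ∧ τ < deadline
    then { bla with start := some τ, cur := ⟨0, pair, ∅⟩ } else bla
  let r := bla₁.tick pa.ts pa.Δ pa.κ deadline i τ
  ((entered', r.1), (m₁ ++ r.2.1.map (fun y => (y.1, .bla k y.2)), r.2.2.map fun l => (k, l)),
    match star, r.1.out.filter fun q => decide (Valid pa.ts q) with
    | some _, _ => none
    | none, some q => some q.1
    | none, none => if ready ∧ deadline ≤ τ then some pair.1 else none)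

def beginOp (pa : Params) (i : Fin n) (k : ℕ) (B : Option (Finset Tx)) (ω : Tape Bc Ba)
    (x : Slot) : Slot × Mail :=
  match B with
  | some B => x.beginACS pa i ω k B
  | none => (x, [])

theorem SlotState.tick_eq (pa i ω k) (buf : Finset Tx) (τ) (x : Slot) : x.tick pa i ω k buf τ =
      let c : (Bool × BlaState n Tx) × Effects Bc Ba × Option (Finset Tx) :=
        tickCore pa i k buf τ x.entered x.pair x.bla x.star
      let r := beginOp pa i k c.2.2 ω { x with entered := c.1.1, bla := c.1.2 }
      (r.1, c.2.1.1 ++ r.2, c.2.1.2) := by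
  obtain ⟨entered, pair, bla, star, bc, ba, acs, block⟩ := x
  simp only [tick, tickCore]
  by_cases h1 : τ = pa.T k
  · simp only [if_pos h1]
    split_ifs <;> rfl
  · simp only [if_neg h1]
    split_ifs <;> rfl

/-- The first part of `settle`: Byzantine agreements are begun with input 1. -/
def SlotState.giveOnes (pa : Params) (i : Fin n) (ω : Tape Bc Ba) (k : ℕ) (x : Slot) : Slot × Mail :=
  if x.C1 pa.ts then (x, []) else
    forAll (fun y j =>
      if (y.bc j).out.isSome ∧ (y.ba j).inp = none then y.baStep i ω k j (.inl true)
      else (y, [])) x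

/-- The second part of `settle`: Byzantine agreements are begun with input 0. -/
def SlotState.giveZeros (pa : Params) (i : Fin n) (ω : Tape Bc Ba) (k : ℕ) (x : Slot) : Slot × Mail :=
  if x.C1 pa.ts ∨ x.ones.card < n - pa.ta then (x, []) else
    forAll (fun y j =>
      if (y.ba j).inp = none then y.baStep i ω k j (.inl false) else (y, [])) x

def SlotState.leave (pa : Params) (x : Slot) : Slot := { x with
    acs := x.acs <|> x.exit pa
    block := (x.acs <|> x.exit pa).map fun S => S.biUnion id }

theorem SlotState.settle_eq (pa i ω k) (x : Slot) : x.settle pa i ω k =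
      (((x.giveOnes pa i ω k).1.giveZeros pa i ω k).1.leave pa,
        (x.giveOnes pa i ω k).2 ++ ((x.giveOnes pa i ω k).1.giveZeros pa i ω k).2) := rfl

theorem SlotState.beginACS_eq (pa i ω k) (x : Slot) (B : Finset Tx) : x.beginACS pa i ω k B =
      let r := forAll (fun y j => y.bcStep i ω k j (.inl (if j = i then some B else none)))
        { x with star := some B }
      ((r.1.settle pa i ω k).1, r.2 ++ (r.1.settle pa i ω k).2) := rfl

theorem SlotState.after_eq (pa i ω k) (r : Slot × Mail) : after pa i ω k r =
      ((after pa i ω k (r.1, [])).1, r.2 ++ (after pa i ω k (r.1, [])).2.1,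
        (after pa i ω k (r.1, [])).2.2) := by grind [after]

theorem quiet_ite {T S M L : Type} {n} (p : S → Prop) [DecidablePred p]
    (o₁ o₂ : T → S → S × List (Fin n × M)) :
    quiet (L := L) (fun ω x => if p x then o₁ ω x else o₂ ω x) =
      fun ω x => if p x then quiet o₁ ω x else quiet o₂ ω x := by grind [quiet]

/-- The watched part is an instance of slot `k`, and everything else in the slot is visible. -/
structure Careful (W : SlotWatch P) (i : Fin n) (k : ℕ) : Prop where
  entered : ∀ {x x'}, W.same x x' → x.entered = x'.entered := by
    intro _ _ h; first | (obtain ⟨_, rfl, -⟩ := h; rfl) | (cases h; rfl)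
  pair : ∀ {x x'}, W.same x x' → x.pair = x'.pair := by
    intro _ _ h; first | (obtain ⟨_, rfl, -⟩ := h; rfl) | (cases h; rfl)
  bla : ∀ {x x'}, W.same x x' → x.bla = x'.bla := by
    intro _ _ h; first | (obtain ⟨_, rfl, -⟩ := h; rfl) | (cases h; rfl)
  star : ∀ {x x'}, W.same x x' → x.star = x'.star := by
    intro _ _ h; first | (obtain ⟨_, rfl, -⟩ := h; rfl) | (cases h; rfl)
  acs : ∀ {x x'}, W.same x x' → x.acs = x'.acs := by
    intro _ _ h; first | (obtain ⟨_, rfl, -⟩ := h; rfl) | (cases h; rfl)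
  block : ∀ {x x'}, W.same x x' → x.block = x'.block := by
    intro _ _ h; first | (obtain ⟨_, rfl, -⟩ := h; rfl) | (cases h; rfl)
  bc_out : ∀ {x x'}, W.same x x' → ∀ j, (x.bc j).out = (x'.bc j).out
  ba_inp : ∀ {x x'}, W.same x x' → ∀ j, (x.ba j).inp = (x'.ba j).inp
  ba_out : ∀ {x x'}, W.same x x' → ∀ j, (x.ba j).out = (x'.ba j).out
  get_with : ∀ x e p b s a c, W.get ⟨e, p, b, s, x.bc, x.ba, a, c⟩ = W.get x := by intros; rfl
  same_with : ∀ {x x'} e p b s a c, W.same x x' →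
    W.same ⟨e, p, b, s, x.bc, x.ba, a, c⟩ ⟨e, p, b, s, x'.bc, x'.ba, a, c⟩
  give_bc : ∀ j v, Feeds (L := ℕ × ℕ) W i (quiet fun ω x => x.bcStep i ω k j (.inl v))
  give_ba : ∀ j v, Feeds (L := ℕ × ℕ) W i (quiet fun ω x => x.baStep i ω k j (.inl v))
  recv_bc : ∀ l j m, W.proj (.bc k l m) = none →
    Feeds (L := ℕ × ℕ) W i (quiet fun ω x => x.bcStep i ω k l (.inr (j, m)))
  recv_ba : ∀ l j m, W.proj (.ba k l m) = none →
    Feeds (L := ℕ × ℕ) W i (quiet fun ω x => x.baStep i ω k l (.inr (j, m)))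
  proj_buf : ∀ i b, W.proj (.buf k i b) = none := by intros; rfl
  proj_bla : ∀ m, W.proj (.bla k m) = none := by intros; rfl

theorem forAll_eq (f : Tape Bc Ba → Slot → Fin n → Slot × Mail) :
    quiet (L := ℕ × ℕ) (fun ω x => forAll (f ω) x) =
      seqList (fun j => quiet fun ω x => f ω x j) (finRange n) := by
  funext ω x
  have : ∀ (l : List (Fin n)) (a : Slot × Mail),
      l.foldl (fun a j => let r := f ω a.1 j; (r.1, a.2 ++ r.2)) a =
        ((seqList (L := ℕ × ℕ) (fun j => quiet fun ω x => f ω x j) l ω a.1).1,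
          a.2 ++ (seqList (L := ℕ × ℕ) (fun j => quiet fun ω x => f ω x j) l ω a.1).2.1) ∧
        (seqList (L := ℕ × ℕ) (fun j => quiet fun ω x => f ω x j) l ω a.1).2.2 = [] := by
    intro l
    induction l with
    | nil => grind [seqList]
    | cons j l ih =>
      intro a
      obtain ⟨h1, h2⟩ := ih ((f ω a.1 j).1, a.2 ++ (f ω a.1 j).2)
      refine ⟨h1.trans ?_, h2⟩
      simp [seqList, seqOp, quiet]
  obtain ⟨h1, h2⟩ := this (finRange n) (x, [])
  refine Prod.ext ?_ (Prod.ext ?_ ?_)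
  · have a := congrArg Prod.fst h1
    exact a
  · have a := congrArg Prod.snd h1
    exact a.trans (nil_append _)
  · exact h2.symm

namespace Careful

variable {W : Watch (SlotState Bc Ba) (Tape Bc Ba) (Msg Bc Ba) P} {i : Fin n} {k : ℕ} (hW : Careful W i k)
include hW

theorem settle (pa) : Feeds (L := ℕ × ℕ) W i (quiet fun ω x => x.settle pa i ω k) := by
  have hC1 : ∀ x x', W.same x x' → (x.C1 pa.ts ↔ x'.C1 pa.ts) := fun x x' h => by grind [C1, C1v_congr, Careful.bc_out]
  have h1 : Feeds (L := ℕ × ℕ) W i (quiet fun ω x => x.giveOnes pa i ω k) := by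
    simp only [giveOnes, quiet_ite, forAll_eq]
    refine Feeds.ite hC1 Feeds.skip (Feeds.list (fun j => ?_) _)
    exact Feeds.ite (fun x x' h => by rw [hW.bc_out h, hW.ba_inp h]) (hW.give_ba j true) Feeds.skip
  have h2 : Feeds (L := ℕ × ℕ) W i (quiet fun ω x => x.giveZeros pa i ω k) := by
    simp only [giveZeros, quiet_ite, forAll_eq]
    refine Feeds.ite (fun x x' h => ?_) Feeds.skip (Feeds.list (fun j => ?_) _)
    · rw [hC1 x x' h, ones_congr (hW.ba_out h)]
    · exact Feeds.ite (fun x x' h => by rw [hW.ba_inp h]) (hW.give_ba j false) Feeds.skip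
  have h3 : Feeds (L := ℕ × ℕ) W i fun _ x =>
      (x.leave pa, [], []) := by
    refine Feeds.of_passive (fun _ x => ⟨hW.get_with x _ _ _ _ _ _, rfl⟩) fun _ _ x x' _ h => ⟨?_, rfl⟩
    grind [leave, exit_congr, Careful.entered, Careful.pair, Careful.bla, Careful.star, Careful.acs, Careful.bc_out, Careful.ba_out, Careful.same_with]
  refine ((h1.seq h2).seq h3).of_eq fun ω x => ?_
  grind [quiet, settle_eq, seqOp]

theorem beginACS (pa B) : Feeds (L := ℕ × ℕ) W i (quiet fun ω x => x.beginACS pa i ω k B) := by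
  have h1 : Feeds (L := ℕ × ℕ) W i fun _ x =>
      (({ x with star := some B } : Slot), [], []) := by
    refine Feeds.of_passive (fun _ x => ⟨hW.get_with x _ _ _ _ _ _, rfl⟩) fun _ _ x x' _ h => ⟨?_, rfl⟩
    grind [Careful.entered, Careful.pair, Careful.bla, Careful.block, Careful.acs, Careful.same_with]
  have h2 : Feeds (L := ℕ × ℕ) W i (quiet fun ω x =>
      forAll (fun y j => y.bcStep i ω k j (.inl (if j = i then some B else none))) x) := by
    rw [forAll_eq]
    exact Feeds.list (fun j => hW.give_bc j _) _
  refine ((h1.seq h2).seq (hW.settle pa)).of_eq fun ω x => ?_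
  grind [quiet, beginACS_eq, seqOp]

theorem tick (pa buf τ) :
    Feeds W i fun ω x => x.tick pa i ω k buf τ := by
  let c : Slot → (Bool × BlaState n Tx) × Effects Bc Ba × Option (Finset Tx) :=
    fun x => tickCore pa i k buf τ x.entered x.pair x.bla x.star
  have hc : ∀ x x', W.same x x' → c x = c x' := fun x x' h => by
    simp only [c]
    rw [hW.entered h, hW.pair h, hW.bla h, hW.star h]
  have hfil : ∀ x, W.filter (c x).2.1.1 = [] := by
    intro x
    simp only [c, tickCore, Watch.filter_append]
    refine append_eq_nil_iff.2 ⟨?_, ?_⟩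
    · split_ifs
      · refine filterMap_eq_nil_iff.2 fun y hy => ?_
        obtain ⟨j, -, rfl⟩ := mem_map.1 hy
        simp [hW.proj_buf]
      · rfl
    · refine filterMap_eq_nil_iff.2 fun y hy => ?_
      grind [Careful.proj_bla]
  have h1 : Feeds W i fun _ x =>
      (({ x with entered := (c x).1.1, bla := (c x).1.2 } : Slot), (c x).2.1) := by
    refine Feeds.of_passive (fun _ x => ⟨hW.get_with x _ _ _ _ _ _, hfil x⟩)
      fun _ _ x x' _ h => ?_
    grind [Careful.pair, Careful.star, Careful.acs, Careful.block, Careful.same_with]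
  have h2 : ∀ B, Feeds (L := ℕ × ℕ) W i (quiet (beginOp pa i k B)) := by
    intro B
    cases B with
    | none => exact Feeds.skip
    | some B => exact hW.beginACS pa B
  refine (Feeds.bind (fun x => (c x).2.2) (fun x x' h => by grind)
    fun B => h1.seq (h2 B)).of_eq fun ω x => ?_
  grind [tick_eq, seqOp, quiet]

theorem after (pa) : Feeds W i fun ω x => after pa i ω k (x, []) := by
  refine (Feeds.ite (p := fun x : Slot => x.star.isSome = true)
    (fun x x' h => by rw [hW.star h]) (hW.settle pa) Feeds.skip).of_eq fun ω x => ?_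
  grind [SlotState.after, quiet]

theorem bcRecv (pa) {l j m} (h : W.proj (.bc k l m) = none) :
    Feeds W i fun ω x => SlotState.after pa i ω k (x.bcStep i ω k l (.inr (j, m))) := by
  refine ((hW.recv_bc l j m h).seq (hW.after pa)).of_eq fun ω x => ?_
  grind [SlotState.after_eq, seqOp, quiet]

theorem baRecv (pa) {l j m} (h : W.proj (.ba k l m) = none) :
    Feeds W i fun ω x => if x.star.isSome ∧ x.C1 pa.ts then (x, [], [])
      else SlotState.after pa i ω k (x.baStep i ω k l (.inr (j, m))) := by
  refine Feeds.ite (fun x x' h => ?_) Feeds.skip ?_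
  · rw [SlotState.C1, SlotState.C1, SlotState.C1v_congr (hW.bc_out h), hW.star h]
  refine ((hW.recv_ba l j m h).seq (hW.after pa)).of_eq fun ω x => ?_
  grind [SlotState.after_eq, seqOp, quiet]

end Careful

end SlotOperations

section SlotLift

variable {I O : Type} {P : AsyncProtocol n I O}

/-- A watch that sees everything of a slot to which the instance does not belong. -/
def Watch.blind (W : SlotWatch P) (u : Inst P) : SlotWatch P := { W with
    get := fun _ => u
    same := (· = ·)
    same_get := fun _ => ⟨rfl, rfl⟩ }

theorem Feeds.blind {W : SlotWatch P} {u : Inst P}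
    {i} {f : Tape Bc Ba → Slot → Slot × Effects Bc Ba}
    (h : Feeds (W.blind u) i f) : (∀ ω x, W.filter (f ω x).2.1 = []) ∧
      ∀ ω ω' x, W.agree ω ω' → f ω x = f ω' x := by
  obtain ⟨g, hi, hg, hs⟩ := h
  have hn : ∀ ω x, g ω x = none := by
    intro ω x
    by_contra h'
    have h1 : u.inp = none := hi ω x (isSome_iff_ne_none.2 h')
    have h2 := congrArg inp (hg ω x).1
    obtain ⟨y, hy⟩ := ne_none_iff_exists'.1 h'
    rw [feed_inp (hi ω x), hy] at h2
    have h3 : u.inp = some y := h2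
    simp_all
  refine ⟨fun ω x => ?_, fun ω ω' x ha => ?_⟩
  · have := (hg ω x).2
    rwa [hn] at this
  · have := (hs ω ω' x x ha rfl).2
    rw [hn, hn] at this
    obtain ⟨h1, h2⟩ := this (vis_feed_none (W := W.blind u) rfl)
    exact Prod.ext h1 h2

/-- The watch on the state of a party that belongs to a watch on its slot `k`. -/
def Watch.atSlot (W : SlotWatch P) (k : ℕ) : Watch Party (Tape Bc Ba) (Msg Bc Ba) P where
  get := fun s => W.get (s.slot k)
  same := fun s s' => s.clock = s'.clock ∧ s.buf = s'.buf ∧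
    (∀ k', k' ≠ k → s.slot k' = s'.slot k') ∧ W.same (s.slot k) (s'.slot k)
  tape := W.tape
  agree := W.agree
  proj := W.proj
  same_get := fun h => W.same_get h.2.2.2

def newBuf (buf : Finset Tx) : Option (Finset Tx) → Option (Finset Tx) → Finset Tx
  | none, some b => buf \ b
  | _, _ => buf

theorem PState.onSlot_eq (s : Party) (k) (f : Slot → Slot × Effects Bc Ba) : s.onSlot k f =
      (⟨s.clock, newBuf s.buf (s.slot k).block (f (s.slot k)).1.block,
        update s.slot k (f (s.slot k)).1⟩, (f (s.slot k)).2) := by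
  rw [onSlot]
  cases (s.slot k).block <;> cases (f (s.slot k)).1.block <;> rfl

theorem Feeds.onSlot {W : SlotWatch P} {u : Inst P}
    {i k k'} {f : Tape Bc Ba → Slot → Slot × Effects Bc Ba}
    (hblock : ∀ {x x'}, W.same x x' → x.block = x'.block)
    (hself : k' = k → Feeds W i f) (hother : k' ≠ k → Feeds (W.blind u) i f) :
    Feeds (W.atSlot k) i fun ω s => s.onSlot k' (f ω) := by
  by_cases hk : k' = k
  · subst hk
    obtain ⟨g, hi, hg, hs⟩ := hself rfl
    refine ⟨fun ω s => g ω (s.slot k'), fun ω s => hi ω _, fun ω s => ?_, fun ω ω' s s' ha hss => ?_⟩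
    · refine ⟨?_, (hg ω (s.slot k')).2⟩
      change W.get (update s.slot k' _ k') = _
      rw [update_self]
      exact (hg ω (s.slot k')).1
    · obtain ⟨h1, h2, h3, h4⟩ := hss
      obtain ⟨h5, h6⟩ := hs ω ω' _ _ ha h4
      refine ⟨h5, fun hv => ?_⟩
      obtain ⟨h7, h8⟩ := h6 hv
      simp [onSlot_eq]
      refine ⟨⟨h1, ?_, fun k'' hk'' => ?_, ?_⟩, h8⟩
      · grind
      · simp_all
      simp_all
  · obtain ⟨h1, h2⟩ := (hother hk).blind
    refine Feeds.of_passive (fun ω s => ?_) fun ω ω' s s' ha hss => ?_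
    · refine ⟨?_, h1 ω _⟩
      change W.get (update s.slot k' _ k) = _
      rw [update_of_ne (Ne.symm hk)]
      rfl
    · obtain ⟨h3, h4, h5, h6⟩ := hss
      simp only [onSlot_eq, ← h5 k' hk, h2 ω ω' _ ha]
      refine ⟨⟨h3, by rw [h4], fun k'' hk'' => ?_, ?_⟩, trivial⟩
      · grind
      · simpa [update_of_ne (Ne.symm hk)] using h6

end SlotLift

section SmrFeeds

variable {I O : Type} {P : AsyncProtocol n I O} {W : Watch (SlotState Bc Ba) (Tape Bc Ba) (Msg Bc Ba) P} {u : Inst P}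

theorem feeds_input (pa tx) : Feeds (W.atSlot k) i fun ω s => (smr pa Bc Ba).step i ω s (.input tx) :=
  Feeds.of_passive (fun _ _ => ⟨rfl, rfl⟩)
    (fun _ _ _ _ _ hs => ⟨⟨hs.1, congrArg (insert tx) hs.2.1, hs.2.2⟩, rfl⟩)

variable (hW : Careful W i k) (hother : ∀ k', k' ≠ k → Careful (W.blind u) i k')
include hW hother

/-- Messages that are not for the instance do not concern it. -/
theorem feeds_recv (pa) {j} {m : Msg Bc Ba} (hm : W.proj m = none) :
    Feeds (W.atSlot k) i fun ω s => s.recv pa i ω j m := by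
  cases m with
  | buf k' i' b =>
    refine Feeds.onSlot (u := u) hW.block (fun h => ?_) (fun h => ?_)
    · refine Feeds.of_passive (fun ω x => ?_) (fun ω ω' x x' _ hs => ?_)
      · split_ifs
        · exact ⟨hW.get_with _ _ _ _ _ _ _, rfl⟩
        · exact ⟨rfl, rfl⟩
      grind [Careful.pair, Careful.entered, Careful.bla, Careful.star, Careful.acs, Careful.block, Careful.same_with]
    · refine Feeds.of_passive (fun ω x => ?_) (fun ω ω' x x' _ hs => ?_)
      · split_ifs <;> exact ⟨rfl, rfl⟩
      · obtain rfl : x = x' := hs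
        exact ⟨rfl, rfl⟩
  | bla k' m =>
    refine Feeds.onSlot (u := u) hW.block (fun h => ?_) (fun h => ?_)
    · refine Feeds.of_passive (fun ω x => ⟨hW.get_with _ _ _ _ _ _ _, rfl⟩)
        (fun ω ω' x x' _ hs => ⟨?_, rfl⟩)
      grind [Careful.entered, Careful.pair, Careful.bla, Careful.star, Careful.acs, Careful.block, Careful.same_with]
    · refine Feeds.of_passive (fun ω x => ⟨rfl, rfl⟩) (fun ω ω' x x' _ hs => ?_)
      obtain rfl : x = x' := hs
      exact ⟨rfl, rfl⟩
  | bc k' l m =>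
    exact Feeds.onSlot (u := u) hW.block (fun h => by subst h; exact hW.bcRecv pa hm)
      (fun h => (hother k' h).bcRecv pa hm)
  | ba k' l m =>
    exact Feeds.onSlot (u := u) hW.block (fun h => by subst h; exact hW.baRecv pa hm)
      (fun h => (hother k' h).baRecv pa hm)

theorem feeds_leader (pa) (kl : ℕ × ℕ) (l) :
    Feeds (W.atSlot k) i fun ω s => (smr pa Bc Ba).step i ω s (.leader kl l) := by
  have hpr : ∀ k' (y : List (Fin n × BlaMsg n Tx)), (∀ m, W.proj (.bla k' m) = none) →
      W.filter (y.map fun y => (y.1, Msg.bla k' y.2)) = [] := by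
    intro k' y h
    refine filterMap_eq_nil_iff.2 fun z hz => ?_
    grind
  refine Feeds.onSlot (u := u) hW.block (fun h => ?_) (fun h => ?_)
  · subst h
    refine Feeds.of_passive (fun ω x => ⟨hW.get_with _ _ _ _ _ _ _, hpr _ _ hW.proj_bla⟩)
      (fun ω ω' x x' _ hs => ?_)
    grind [Careful.entered, Careful.pair, Careful.bla, Careful.star, Careful.acs, Careful.block, Careful.same_with]
  · refine Feeds.of_passive (fun ω x => ⟨rfl, hpr _ _ (hother _ h).proj_bla⟩) (fun ω ω' x x' _ hs => ?_)
    obtain rfl : x = x' := hs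
    exact ⟨rfl, rfl⟩

theorem feeds_tick (pa) : Feeds (W.atSlot k) i fun ω s => (smr pa Bc Ba).step i ω s .tick := by
  have h1 := fun τ k' =>
    Feeds.bind (W := W.atSlot k) (fun s : Party => s.buf) (fun s s' h => h.2.1)
      (o := fun b ω s => s.onSlot k' (tick pa i ω k' b τ)) fun b =>
      Feeds.onSlot (u := u) hW.block (fun h => by subst h; exact hW.tick pa b τ)
        (fun h => (hother k' h).tick pa b τ)
  have h3 : ∀ c, Feeds (W.atSlot k) i fun ω (s : Party) =>
      (({ (seqList (fun k' ω (s : Party) =>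
        s.onSlot k' (tick pa i ω k' s.buf c)) (range (c + 1)) ω s).1 with
          clock := c + 1 } : Party),
        (seqList (fun k' ω (s : Party) =>
        s.onSlot k' (tick pa i ω k' s.buf c)) (range (c + 1)) ω s).2) := by
    intro c
    have h4 : Feeds (W.atSlot k) i fun (_ : Tape Bc Ba) (s : Party) =>
        (({ s with clock := c + 1 } : Party), ([] : Mail), ([] : List (ℕ × ℕ))) :=
      Feeds.of_passive (fun _ _ => ⟨rfl, rfl⟩) (fun _ _ s s' _ hs => ⟨⟨rfl, hs.2⟩, rfl⟩)
    refine ((Feeds.list (h1 c) (range (c + 1))).seq h4).of_eq fun ω s => ?_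
    grind [seqOp]
  refine (Feeds.bind (W := W.atSlot k) (fun s : Party => s.clock) (fun s s' h => h.1) h3).of_eq
    fun ω s => ?_
  have := foldl_eq_seqList (fun k' ω (s' : Party) =>
        s'.onSlot k' (tick pa i ω k' s'.buf s.clock)) ω (range (s.clock + 1))
        (s, ([] : Mail), ([] : List (ℕ × ℕ)))
  grind [smr]

end SmrFeeds

/-! ## The instances of the replication protocol -/

section Instances

def projBc (k : ℕ) (j : Fin n) : Msg Bc Ba → Option (Bc j).Msg
  | .bc k' j' m => if h : k' = k ∧ j' = j then some (h.2 ▸ m) else none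
  | _ => none

def projBa (k : ℕ) (j : Fin n) : Msg Bc Ba → Option Ba.Msg
  | .ba k' j' m => if k' = k ∧ j' = j then some m else none
  | _ => none

variable (Bc Ba) in
def watchBc (k : ℕ) (j : Fin n) : SlotWatch (Bc j) where
  get := fun x => x.bc j
  same := fun x x' => ∃ u, x' = { x with bc := update x.bc j u } ∧
    (x.bc j).inp = u.inp ∧ (x.bc j).out = u.out
  tape := fun ω c => ω (.inl (k, j, c))
  agree := fun ω ω' => ∀ c, c ∉ Set.range (fun c : ℕ => (.inl (k, j, c) : CoinKey n)) → ω c = ω' c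
  proj := projBc k j
  same_get := by simp_all

variable (Bc Ba) in
/-- The watch on the `j`th Byzantine agreement of slot `k`. -/
def watchBa (k : ℕ) (j : Fin n) : SlotWatch Ba where
  get := fun x => x.ba j
  same := fun x x' => ∃ u, x' = { x with ba := update x.ba j u } ∧
    (x.ba j).inp = u.inp ∧ (x.ba j).out = u.out
  tape := fun ω c => ω (.inr (k, j, c))
  agree := fun ω ω' => ∀ c, c ∉ Set.range (fun c : ℕ => (.inr (k, j, c) : CoinKey n)) → ω c = ω' c
  proj := projBa k j
  same_get := by simp_all

section

variable {I O : Type} {P : AsyncProtocol n I O}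
  {W : Watch (SlotState Bc Ba) (Tape Bc Ba) (Msg Bc Ba) P} {i : Fin n} {k : ℕ} {j : Fin n}

theorem Watch.filter_map_eq_nil {α : Type} {f : α → Msg Bc Ba} (h : ∀ a, W.proj (f a) = none)
    (l : List (Fin n × α)) : W.filter (l.map fun y => (y.1, f y.2)) = [] := by
  refine filterMap_eq_nil_iff.2 fun z hz => ?_
  grind

theorem passive_bcStep (hp : ∀ m, W.proj (.bc k j m) = none)
    (ha : ∀ ω ω', W.agree ω ω' → ∀ c, ω (.inl (k, j, c)) = ω' (.inl (k, j, c)))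
    (hget : ∀ x u, W.get { x with bc := update x.bc j u } = W.get x)
    (hsame : ∀ x x', W.same x x' → x.bc j = x'.bc j)
    (hupd : ∀ x x' u, W.same x x' → W.same { x with bc := update x.bc j u }
      { x' with bc := update x'.bc j u }) (e : Option (Finset Tx) ⊕ (Fin n × (Bc j).Msg)) :
    Feeds (L := ℕ × ℕ) W i (quiet fun ω x => x.bcStep i ω k j e) := by
  refine Feeds.of_passive (fun ω x => ⟨hget _ _, W.filter_map_eq_nil hp _⟩) fun ω ω' x x' hag hs => ?_
  simp [quiet, bcStep, funext (ha ω ω' hag), hsame x x' hs]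
  simp_all

theorem passive_baStep (hp : ∀ m, W.proj (.ba k j m) = none)
    (ha : ∀ ω ω', W.agree ω ω' → ∀ c, ω (.inr (k, j, c)) = ω' (.inr (k, j, c)))
    (hget : ∀ x u, W.get { x with ba := update x.ba j u } = W.get x)
    (hsame : ∀ x x', W.same x x' → x.ba j = x'.ba j)
    (hupd : ∀ x x' u, W.same x x' → W.same { x with ba := update x.ba j u }
      { x' with ba := update x'.ba j u }) (e : Bool ⊕ (Fin n × Ba.Msg)) :
    Feeds (L := ℕ × ℕ) W i (quiet fun ω x => x.baStep i ω k j e) := by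
  refine Feeds.of_passive (fun ω x => ⟨hget _ _, W.filter_map_eq_nil hp _⟩) fun ω ω' x x' hag hs => ?_
  simp [quiet, baStep, funext (ha ω ω' hag), hsame x x' hs]
  simp_all

theorem careful_blind {u} (hbc : ∀ j m, W.proj (.bc k j m) = none) (hba : ∀ j m, W.proj (.ba k j m) = none)
    (h_buf : ∀ i b, W.proj (.buf k i b) = none) (h_bla : ∀ m, W.proj (.bla k m) = none)
    (hl : ∀ ω ω', W.agree ω ω' → ∀ j c, ω (.inl (k, j, c)) = ω' (.inl (k, j, c)))
    (hr : ∀ ω ω', W.agree ω ω' → ∀ j c, ω (.inr (k, j, c)) = ω' (.inr (k, j, c))) :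
    Careful (W.blind u) i k where
  bc_out := fun h => by cases h; simp_all
  ba_inp := fun h => by cases h; simp_all
  ba_out := fun h => by cases h; simp_all
  same_with := fun _ _ _ _ _ _ h => by cases h; rfl
  give_bc := fun j v => passive_bcStep (W := W.blind u) (hbc j) (fun ω ω' h => hl ω ω' h j) (fun _ _ => rfl)
    (fun x x' h => by cases h; rfl) (fun x x' u h => by cases h; rfl) _
  give_ba := fun j v => passive_baStep (W := W.blind u) (hba j) (fun ω ω' h => hr ω ω' h j) (fun _ _ => rfl)
    (fun x x' h => by cases h; rfl) (fun x x' u h => by cases h; rfl) _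
  recv_bc := fun j _ _ _ => passive_bcStep (W := W.blind u) (hbc j) (fun ω ω' h => hl ω ω' h j) (fun _ _ => rfl)
    (fun x x' h => by cases h; rfl) (fun x x' u h => by cases h; rfl) _
  recv_ba := fun j _ _ _ => passive_baStep (W := W.blind u) (hba j) (fun ω ω' h => hr ω ω' h j) (fun _ _ => rfl)
    (fun x x' h => by cases h; rfl) (fun x x' u h => by cases h; rfl) _
  proj_buf := h_buf
  proj_bla := h_bla

end

end Instances

section Instances

theorem projBc_self (k j m) : projBc k j (.bc k j m : Msg Bc Ba) = some m := by simp [projBc]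

theorem projBc_ne {k k' j j'} (h : ¬ (k' = k ∧ j' = j)) (m) :
    projBc k j (.bc k' j' m : Msg Bc Ba) = none := by simp [projBc, h]

theorem projBa_self (k j m) : projBa k j (.ba k j m : Msg Bc Ba) = some m := by simp [projBa]

theorem projBa_ne {k k' j j'} (h : ¬ (k' = k ∧ j' = j)) (m) :
    projBa k j (.ba k' j' m : Msg Bc Ba) = none := by simp [projBa, h]

theorem projBc_eq_some {k j} {m : Msg Bc Ba} {m' : (Bc j).Msg}
    (h : projBc k j m = some m') : m = .bc k j m' := by
  cases m with
  | bc k' j' m =>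
    grind [projBc_self, projBc_ne]
  | _ => cases h

theorem projBa_eq_some {k j} {m : Msg Bc Ba} {m' : Ba.Msg}
    (h : projBa k j m = some m') : m = .ba k j m' := by
  cases m with
  | ba k' j' m =>
    grind [projBa_self, projBa_ne]
  | _ => cases h

theorem watchBc_agree_inl {k j ω ω'}
    (h : (watchBc Bc Ba k j).agree ω ω') {k' j'} (hne : ¬ (k' = k ∧ j' = j)) (c) :
    ω (.inl (k', j', c)) = ω' (.inl (k', j', c)) := by
  refine h _ ?_
  grind

theorem watchBc_agree_inr {k j ω ω'}
    (h : (watchBc Bc Ba k j).agree ω ω') (x) : ω (.inr x) = ω' (.inr x) := by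
  refine h _ ?_
  simp_all

theorem watchBa_agree_inr {k j ω ω'}
    (h : (watchBa Bc Ba k j).agree ω ω') {k' j'} (hne : ¬ (k' = k ∧ j' = j)) (c) :
    ω (.inr (k', j', c)) = ω' (.inr (k', j', c)) := by
  refine h _ ?_
  grind

theorem watchBa_agree_inl {k j ω ω'}
    (h : (watchBa Bc Ba k j).agree ω ω') (x) : ω (.inl x) = ω' (.inl x) := by
  refine h _ ?_
  simp_all

theorem filter_bc_self (k j l) : (watchBc Bc Ba k j).filter (l.map fun y => (y.1, .bc k j y.2)) = l := by
  rw [Watch.filter, filterMap_map]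
  conv_rhs => rw [← filterMap_some (l := l)]
  congr 1
  funext y
  change (projBc k j (.bc k j y.2 : Msg Bc Ba)).map _ = _
  rw [projBc_self]
  rfl

theorem filter_ba_self (k j l) : (watchBa Bc Ba k j).filter (l.map fun y => (y.1, .ba k j y.2)) = l := by
  rw [Watch.filter, filterMap_map]
  conv_rhs => rw [← filterMap_some (l := l)]
  congr 1
  funext y
  change (projBa k j (.ba k j y.2 : Msg Bc Ba)).map _ = _
  rw [projBa_self]
  rfl

theorem step_inl_eq_feed {I O : Type} {P : AsyncProtocol n I O} (i)
    (ω : ℕ → Fin (P.coins + 1)) (u : Inst P) (v : I) :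
    u.step i ω (.inl v) = feed i ω u (if u.inp = none then some v else none) := by grind [feed, Inst.step]

theorem feeds_bc_of_ne {i k j j'} (hj : j' ≠ j) (e) :
    Feeds (L := ℕ × ℕ) (watchBc Bc Ba k j) i (quiet fun ω x => x.bcStep i ω k j' e) := by
  refine passive_bcStep (projBc_ne (Ba := Ba) (by tauto))
    (fun ω ω' h => watchBc_agree_inl h (by tauto)) (fun x u => update_of_ne hj.symm _ _) ?_ ?_ _
  · rintro x _ ⟨u, rfl, -⟩
    simp_all
  · rintro x _ w ⟨u, rfl, h1, h2⟩
    exact ⟨u, by simp [update_comm hj], by grind, by grind⟩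

theorem careful_bc (i k j) : Careful (watchBc Bc Ba k j) i k where
  bc_out := by
    rintro x _ ⟨u, rfl, h1, h2⟩ j'
    grind
  ba_inp := by rintro x _ ⟨u, rfl, -⟩ _; rfl
  ba_out := by rintro x _ ⟨u, rfl, -⟩ _; rfl
  same_with := by
    rintro x _ e p b s a c ⟨u, rfl, h1, h2⟩
    exact ⟨u, rfl, h1, h2⟩
  give_bc := by
    intro j' v
    by_cases hj : j' = j
    · subst hj
      refine ⟨fun _ x => if (x.bc j').inp = none then some v else none, fun ω x h => ?_,
        fun ω x => ?_, fun ω ω' x x' ha hs => ?_⟩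
      · grind [watchBc]
      · simpa [watchBc, quiet, bcStep, step_inl_eq_feed] using filter_bc_self _ _ _
      · obtain ⟨u, rfl, h1, h2⟩ := hs
        simp [h1]
        intro hv
        simp [watchBc] at hv
        simp [quiet, bcStep, step_inl_eq_feed, h1]
        refine ⟨⟨(feed i (fun c => ω' (.inl (k, j', c))) u
          (if u.inp = none then some v else none)).1, ?_, ?_, ?_⟩, by rw [hv.2.2]⟩
        · simp_all
        · simpa using hv.1
        · simpa using hv.2.1
    · exact feeds_bc_of_ne hj _
  give_ba := fun j' v => passive_baStep (fun _ => rfl) (fun ω ω' h c => watchBc_agree_inr h _)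
    (fun _ _ => rfl) (by rintro x _ ⟨u, rfl, -⟩; rfl)
    (by rintro x _ w ⟨u, rfl, h1, h2⟩; exact ⟨u, rfl, h1, h2⟩) _
  recv_bc := by
    refine fun j' i' m hm => feeds_bc_of_ne ?_ _
    rintro rfl
    have : projBc k j' (.bc k j' m : Msg Bc Ba) = none := hm
    grind [projBc_self]
  recv_ba := fun j' _ _ _ => passive_baStep (fun _ => rfl) (fun ω ω' h c => watchBc_agree_inr h _)
    (fun _ _ => rfl) (by rintro x _ ⟨u, rfl, -⟩; rfl)
    (by rintro x _ w ⟨u, rfl, h1, h2⟩; exact ⟨u, rfl, h1, h2⟩) _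

theorem feeds_ba_of_ne {i k j j'} (hj : j' ≠ j) (e) :
    Feeds (L := ℕ × ℕ) (watchBa Bc Ba k j) i (quiet fun ω x => x.baStep i ω k j' e) := by
  refine passive_baStep (projBa_ne (Bc := Bc) (by tauto))
    (fun ω ω' h => watchBa_agree_inr h (by tauto)) (fun x u => update_of_ne hj.symm _ _) ?_ ?_ _
  · rintro x _ ⟨u, rfl, -⟩
    simp_all
  · rintro x _ w ⟨u, rfl, h1, h2⟩
    exact ⟨u, by simp [update_comm hj], by grind, by grind⟩

theorem careful_ba (i k j) : Careful (watchBa Bc Ba k j) i k where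
  bc_out := by rintro x _ ⟨u, rfl, -⟩ _; rfl
  ba_inp := by
    rintro x _ ⟨u, rfl, h1, h2⟩ j'
    grind
  ba_out := by
    rintro x _ ⟨u, rfl, h1, h2⟩ j'
    grind
  same_with := by
    rintro x _ e p b s a c ⟨u, rfl, h1, h2⟩
    exact ⟨u, rfl, h1, h2⟩
  give_ba := by
    intro j' v
    by_cases hj : j' = j
    · subst hj
      refine ⟨fun _ x => if (x.ba j').inp = none then some v else none, fun ω x h => ?_,
        fun ω x => ?_, fun ω ω' x x' ha hs => ?_⟩
      · grind [watchBa]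
      · simpa [watchBa, quiet, baStep, step_inl_eq_feed] using filter_ba_self _ _ _
      · obtain ⟨u, rfl, h1, h2⟩ := hs
        simp [h1]
        intro hv
        simp [watchBa] at hv
        simp [quiet, baStep, step_inl_eq_feed, h1]
        refine ⟨⟨(feed i (fun c => ω' (.inr (k, j', c))) u
          (if u.inp = none then some v else none)).1, ?_, ?_, ?_⟩, by rw [hv.2.2]⟩
        · simp_all
        · simpa using hv.1
        · simpa using hv.2.1
    · exact feeds_ba_of_ne hj _
  give_bc := fun j' v => passive_bcStep (fun _ => rfl) (fun ω ω' h c => watchBa_agree_inl h _)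
    (fun _ _ => rfl) (by rintro x _ ⟨u, rfl, -⟩; rfl)
    (by rintro x _ w ⟨u, rfl, h1, h2⟩; exact ⟨u, rfl, h1, h2⟩) _
  recv_ba := by
    refine fun j' i' m hm => feeds_ba_of_ne ?_ _
    rintro rfl
    have : projBa k j' (.ba k j' m : Msg Bc Ba) = none := hm
    grind [projBa_self]
  recv_bc := fun j' _ _ _ => passive_bcStep (fun _ => rfl) (fun ω ω' h c => watchBa_agree_inl h _)
    (fun _ _ => rfl) (by rintro x _ ⟨u, rfl, -⟩; rfl)
    (by rintro x _ w ⟨u, rfl, h1, h2⟩; exact ⟨u, rfl, h1, h2⟩) _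

theorem not_bc_mem_blaSigs (k' m k j σ) : (Sig.bc k j σ : Sig Bc Ba) ∉ blaSigs k' m := by
  cases m <;> simp [blaSigs, voteSigs, pairSigs, certSigs]

theorem not_ba_mem_blaSigs (k' m k j σ) : (Sig.ba k j σ : Sig Bc Ba) ∉ blaSigs k' m := by
  cases m <;> simp [blaSigs, voteSigs, pairSigs, certSigs]

variable (Bc Ba) in
/-- The `j`th broadcast of slot `k` inside the replication protocol. -/
def guestBc (pa : Params) (k : ℕ) (j : Fin n) : Guest (smr pa Bc Ba) (Bc j) where
  inst := ((watchBc Bc Ba k j).atSlot k).get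
  proj := projBc k j
  sig := fun σ => .bc k j σ
  coin := fun c => .inl (k, j, c)
  accepts := fun _ _ => True
  same := ((watchBc Bc Ba k j).atSlot k).same
  faces_coin := fun _ => rfl

variable (Bc Ba) in
/-- The `j`th Byzantine agreement of slot `k` inside the replication protocol. -/
def guestBa (pa : Params) (k : ℕ) (j : Fin n) : Guest (smr pa Bc Ba) Ba where
  inst := ((watchBa Bc Ba k j).atSlot k).get
  proj := projBa k j
  sig := fun σ => .ba k j σ
  coin := fun c => .inr (k, j, c)
  accepts := fun (s : Party) _ => ¬ ((s.slot k).star.isSome ∧ (s.slot k).C1 pa.ts)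
  same := ((watchBa Bc Ba k j).atSlot k).same
  faces_coin := fun _ => rfl

theorem Guest.heard_of_none {In Out I O : Type} {H : Protocol n In Out} {P : AsyncProtocol n I O}
    (G : Guest H P) (i) (ω : H.Tape) (s : H.State) (j) {m : H.Msg}
    (h : G.proj m = none) : G.heard i ω s (.recv j m) = (G.inst s, []) := by simp [heard, h]

theorem Guest.heard_of_some {In Out I O : Type} {H : Protocol n In Out} {P : AsyncProtocol n I O}
    (G : Guest H P) (i) (ω : H.Tape) (s : H.State) (j) {m : H.Msg} {m' : P.Msg}
    (h : G.proj m = some m') : G.heard i ω s (.recv j m) =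
      if G.accepts s m then (G.inst s).step i (G.tape ω) (.inr (j, m')) else (G.inst s, []) := by simp [heard, h]

theorem Watch.atSlot_eq {I O : Type} {P : AsyncProtocol n I O}
    {W : SlotWatch P} {k}
    (hW : ∀ x x', W.same x x' → W.get x = W.get x' → x = x') {s s'}
    (h : (W.atSlot k).same s s') (h' : (W.atSlot k).get s = (W.atSlot k).get s') : s = s' := by
  obtain ⟨h0, h1, h2, h3⟩ := h
  have h5 : s.slot = s'.slot := by
    funext k'
    by_cases hk : k' = k
    · subst hk
      exact hW _ _ h3 h'
    simp_all
  obtain ⟨c, b, sl⟩ := s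
  simp_all

theorem watchBc_eq {k j} (x x') (h : (watchBc Bc Ba k j).same x x') (h' : x.bc j = x'.bc j) : x = x' := by
  obtain ⟨u, rfl, -⟩ := h
  simp at h'
  rw [← h', update_eq_self]

theorem watchBa_eq {k j} (x x') (h : (watchBa Bc Ba k j).same x x') (h' : x.ba j = x'.ba j) : x = x' := by
  obtain ⟨u, rfl, -⟩ := h
  simp at h'
  rw [← h', update_eq_self]

theorem watchBc_step {k j i ω ω' x x' e} (h : (watchBc Bc Ba k j).same x x')
    (hv : Vis ((x.bc j).step i (fun c => ω (.inl (k, j, c))) e)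
      ((x'.bc j).step i (fun c => ω' (.inl (k, j, c))) e)) :
    (watchBc Bc Ba k j).same (x.bcStep i ω k j e).1 (x'.bcStep i ω' k j e).1 ∧
      (x.bcStep i ω k j e).2 = (x'.bcStep i ω' k j e).2 := by
  obtain ⟨u, rfl, h4, h5⟩ := h
  simp at hv
  simp [bcStep]
  refine ⟨⟨(u.step i (fun c => ω' (.inl (k, j, c))) e).1, ?_, ?_, ?_⟩, by rw [hv.2.2]⟩
  · simp_all
  · simpa using hv.1
  · simpa using hv.2.1

theorem watchBa_step {k j i ω ω' x x' e} (h : (watchBa Bc Ba k j).same x x')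
    (hv : Vis ((x.ba j).step i (fun c => ω (.inr (k, j, c))) e)
      ((x'.ba j).step i (fun c => ω' (.inr (k, j, c))) e)) :
    (watchBa Bc Ba k j).same (x.baStep i ω k j e).1 (x'.baStep i ω' k j e).1 ∧
      (x.baStep i ω k j e).2 = (x'.baStep i ω' k j e).2 := by
  obtain ⟨u, rfl, h4, h5⟩ := h
  simp at hv
  simp [baStep]
  refine ⟨⟨(u.step i (fun c => ω' (.inr (k, j, c))) e).1, ?_, ?_, ?_⟩, by rw [hv.2.2]⟩
  · simp_all
  · simpa using hv.1
  · simpa using hv.2.1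

def PState.put (s : Party) (k : ℕ) (x : Slot) : Party := ⟨s.clock, s.buf, update s.slot k x⟩

theorem PState.put_slot_self (s : Party) (k x) : (s.put k x).slot k = x := update_self _ _ _

theorem Watch.atSlot_put {I O : Type} {P : AsyncProtocol n I O} {W : SlotWatch P} {k} {s s' : Party}
    (h : (W.atSlot k).same s s') {x x'} (hx : W.same x x') :
    (W.atSlot k).same (s.put k x) (s'.put k x') := by
  obtain ⟨h0, h1, h2, -⟩ := h
  refine ⟨h0, h1, fun k' hk => ?_, ?_⟩
  · simp [put, update_of_ne hk, h2 k' hk]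
  · simpa [put] using hx

theorem PState.put_bcStep (s : Party) (k i ω)
    (x : Slot) (j) (e : Option (Finset Tx) ⊕ (Fin n × (Bc j).Msg)) :
    ((s.put k (x.bcStep i ω k j e).1).slot k).bc j =
      ((x.bc j).step i (fun c => ω (.inl (k, j, c))) e).1 := by
  rw [put_slot_self]
  exact update_self _ _ _

theorem PState.put_baStep (s : Party) (k i ω) (x : Slot) (j) (e : Bool ⊕ (Fin n × Ba.Msg)) :
    ((s.put k (x.baStep i ω k j e).1).slot k).ba j =
      ((x.ba j).step i (fun c => ω (.inr (k, j, c))) e).1 := by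
  rw [put_slot_self]
  exact update_self _ _ _

theorem PState.onSlot_after (pa i ω) (s : Party) (k) (r : Slot × Mail) (hr : r.1.block = (s.slot k).block) :
    s.onSlot k (fun _ => after pa i ω k r) = (((s.put k r.1).onSlot k fun x => after pa i ω k (x, [])).1,
        r.2 ++ ((s.put k r.1).onSlot k fun x => after pa i ω k (x, [])).2.1,
        ((s.put k r.1).onSlot k fun x => after pa i ω k (x, [])).2.2) := by
  simp only [onSlot_eq, put, update_self, update_idem]
  grind [after_eq]

theorem PState.onSlot_skip (s : Party) (k) {f} (h : f (s.slot k) = (s.slot k, [], [])) :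
    s.onSlot k f = (s, [], []) := by
  rw [onSlot_eq, h, update_eq_self]
  cases (s.slot k).block <;> rfl

theorem PState.onSlot_congr (s : Party) (k) {f g} (h : f (s.slot k) = g (s.slot k)) :
    s.onSlot k f = s.onSlot k g := by grind [onSlot_eq]

theorem watchBc_refl (k j x) : (watchBc Bc Ba k j).same x x := ⟨x.bc j, by simp_all, rfl, rfl⟩

theorem watchBa_refl (k j x) : (watchBa Bc Ba k j).same x x := ⟨x.ba j, by simp_all, rfl, rfl⟩

theorem guestBc_lawful (pa k j) : (guestBc Bc Ba pa k j).Lawful := by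
  let W := watchBc Bc Ba k j
  have hother : ∀ i k', k' ≠ k → Careful (W.blind (new (Bc j) i)) i k' := fun i k' hk =>
    careful_blind (fun j m => projBc_ne (Ba := Ba) (by tauto) m) (fun _ _ => rfl) (fun _ _ => rfl)
      (fun _ => rfl) (fun ω ω' h j c => watchBc_agree_inl h (by tauto) c)
      (fun ω ω' h j c => watchBc_agree_inr h _)
  refine lawful_of_feeds (W := W.atSlot k) rfl rfl rfl rfl (fun _ _ => Iff.rfl)
    ⟨?_, fun _ => rfl, fun _ => rfl, ?_, ?_, fun i => ?_, ?_, ?_, fun _ _ => Iff.rfl⟩ ?_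
  · intro c c' h
    exact (Prod.mk.inj (Prod.mk.inj (Sum.inl.inj h)).2).2
  · intro m m' h σ hσ
    obtain rfl := projBc_eq_some h
    exact ⟨σ, hσ, rfl⟩
  · intro m σ h
    cases m with
    | bc k' j' m =>
      obtain ⟨σ', hσ', he⟩ := h
      cases he
      exact ⟨m, projBc_self (Ba := Ba) k j m, hσ'⟩
    | buf k' i' b => exact absurd (Set.mem_singleton_iff.1 h) (fun he => by cases he)
    | ba k' j' m =>
      obtain ⟨σ', -, he⟩ := h
      cases he
    | bla k' m => exact absurd h (not_bc_mem_blaSigs k' m k j σ)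
  · exact ⟨rfl, rfl, fun _ _ => rfl, watchBc_refl k j _⟩
  · rintro s s' ⟨-, -, h1, h2⟩
    funext k'
    by_cases hk : k' = k
    · rw [hk]
      exact (careful_bc j k j).block h2
    · change (s.slot k').block = (s'.slot k').block
      simp_all
  · exact fun h h' => Watch.atSlot_eq watchBc_eq h h'
  · intro i e
    cases e with
    | input tx => exact splits_of_feeds (fun _ _ => rfl) (feeds_input pa tx)
    | tick => exact splits_of_feeds (fun _ _ => rfl) (feeds_tick (careful_bc i k j) (hother i) pa)
    | leader kl l => exact splits_of_feeds (fun _ _ => rfl) (feeds_leader (careful_bc i k j) (hother i) pa kl l)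
    | recv a m =>
      cases hp : projBc k j m with
      | none =>
        exact splits_of_feeds (fun ω s => heard_of_none _ i ω s a hp)
          (feeds_recv (careful_bc i k j) (hother i) pa hp)
      | some m' =>
        obtain rfl := projBc_eq_some hp
        have hh : ∀ ω s, (guestBc Bc Ba pa k j).heard i ω s (.recv a (.bc k j m')) =
            ((s.slot k).bc j).step i (fun c => ω (.inl (k, j, c))) (.inr (a, m')) := fun ω s =>
          (heard_of_some _ i ω s a hp).trans (if_pos trivial)
        refine ⟨fun ω (s : Party) => (s.put k ((s.slot k).bcStep i ω k j (.inr (a, m'))).1,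
            ((s.slot k).bcStep i ω k j (.inr (a, m'))).2),
          fun ω s => s.onSlot k fun x => after pa i ω k (x, []), ?_, ?_, ?_, ?_⟩
        · exact Feeds.onSlot (u := new (Bc j) i) (careful_bc i k j).block
            (fun _ => (careful_bc i k j).after pa) (fun h => absurd rfl h)
        · intro ω s
          rw [hh]
          exact ⟨put_bcStep _ _ _ _ _ _ _, filter_bc_self _ _ _⟩
        · intro ω ω' s s' ha hs hv
          rw [hh, hh] at hv
          obtain ⟨h1, h2⟩ := watchBc_step hs.2.2.2 hv
          exact ⟨Watch.atSlot_put hs h1, h2⟩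
        · intro ω s
          exact onSlot_after pa i ω s k _ rfl

/-- The party takes part in the Byzantine agreements no more. -/
def PState.DeafTo (pa : Params) (k : ℕ) (s : Party) : Prop := (s.slot k).star.isSome ∧ (s.slot k).C1 pa.ts

def PState.hearBa (pa : Params) (i : Fin n) (k : ℕ) (j : Fin n) (y : Fin n × Ba.Msg)
    (ω : Tape Bc Ba) (s : Party) : Party × Mail :=
  if s.DeafTo pa k then (s, [])
  else (s.put k ((s.slot k).baStep i ω k j (.inr y)).1, ((s.slot k).baStep i ω k j (.inr y)).2)

def PState.afterBa (pa : Params) (i : Fin n) (k : ℕ) (ω : Tape Bc Ba) (s : Party) : Party × Effects Bc Ba :=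
  if s.DeafTo pa k then (s, [], []) else s.onSlot k fun x => after pa i ω k (x, [])

def PState.heardBa (pa : Params) (i : Fin n) (k : ℕ) (j : Fin n) (y : Fin n × Ba.Msg)
    (ω : Tape Bc Ba) (s : Party) : Inst Ba × List (Fin n × Ba.Msg) :=
  if s.DeafTo pa k then ((s.slot k).ba j, [])
  else ((s.slot k).ba j).step i (fun c => ω (.inr (k, j, c))) (.inr y)

theorem PState.hearBa_get (pa i k j y ω) (s : Party) :
    ((s.hearBa pa i k j y ω).1.slot k).ba j = (s.heardBa pa i k j y ω).1 ∧
      (watchBa Bc Ba k j).filter (s.hearBa pa i k j y ω).2 = (s.heardBa pa i k j y ω).2 := by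
  by_cases h : s.DeafTo pa k
  · simp [hearBa, heardBa, if_pos h]
    rfl
  · simpa [hearBa, heardBa, if_neg h] using ⟨put_baStep _ _ _ _ _ _ _, filter_ba_self _ _ _⟩

theorem PState.hearBa_same {pa i k j y ω ω' s s'} (hs : ((watchBa Bc Ba k j).atSlot k).same s s')
    (hd : s.DeafTo pa k ↔ s'.DeafTo pa k)
    (hv : Vis (s.heardBa pa i k j y ω) (s'.heardBa pa i k j y ω')) :
    ((watchBa Bc Ba k j).atSlot k).same (s.hearBa pa i k j y ω).1 (s'.hearBa pa i k j y ω').1 ∧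
      (s.hearBa pa i k j y ω).2 = (s'.hearBa pa i k j y ω').2 := by
  by_cases h : s.DeafTo pa k
  · simp [hearBa]
    simp_all
  · simp [heardBa, if_neg h, if_neg (mt hd.2 h)] at hv
    simp [hearBa]
    obtain ⟨h1, h2⟩ := watchBa_step hs.2.2.2 hv
    grind [Watch.atSlot_put]

theorem PState.recv_ba_eq (pa i k j a) (m : Ba.Msg) (ω) (s : Party) : s.recv pa i ω a (.ba k j m) =
      (((s.hearBa pa i k j (a, m) ω).1.afterBa pa i k ω).1, (s.hearBa pa i k j (a, m) ω).2 ++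
        ((s.hearBa pa i k j (a, m) ω).1.afterBa pa i k ω).2.1,
        ((s.hearBa pa i k j (a, m) ω).1.afterBa pa i k ω).2.2) := by
  by_cases h : s.DeafTo pa k
  · simp [hearBa, afterBa, if_pos h]
    exact onSlot_skip s k (f := fun x => if x.star.isSome ∧ x.C1 pa.ts then (x, [], [])
      else after pa i ω k (x.baStep i ω k j (.inr (a, m)))) (if_pos h)
  · have h' : ¬ (s.put k ((s.slot k).baStep i ω k j (.inr (a, m))).1).DeafTo pa k := by
      simp only [DeafTo, put_slot_self]
      exact h
    have h0 := h
    simp [hearBa, afterBa, if_neg h, if_neg h']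
    exact (onSlot_congr s k (f := fun x => if x.star.isSome ∧ x.C1 pa.ts then (x, [], [])
      else after pa i ω k (x.baStep i ω k j (.inr (a, m))))
      (g := fun _ => after pa i ω k ((s.slot k).baStep i ω k j (.inr (a, m))))
      (if_neg h0)).trans
      (onSlot_after pa i ω s k ((s.slot k).baStep i ω k j (.inr (a, m))) rfl)

theorem Vis.congr {I O : Type} {P : AsyncProtocol n I O} {r r' q q' : Inst P × List (Fin n × P.Msg)}
    (h : Vis r r') (h1 : r = q) (h2 : r' = q') : Vis q q' := by simp_all

theorem guestBa_lawful (pa k j) : (guestBa Bc Ba pa k j).Lawful := by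
  let W := watchBa Bc Ba k j
  have hother : ∀ i k', k' ≠ k → Careful (W.blind (new Ba i)) i k' := fun i k' hk =>
    careful_blind (fun _ _ => rfl) (fun j m => projBa_ne (Bc := Bc) (by tauto) m) (fun _ _ => rfl)
      (fun _ => rfl) (fun ω ω' h j c => watchBa_agree_inl h _)
      (fun ω ω' h j c => watchBa_agree_inr h (by tauto) c)
  have hacc : ∀ {x x'}, W.same x x' → (¬ (x.star.isSome ∧ x.C1 pa.ts) ↔
      ¬ (x'.star.isSome ∧ x'.C1 pa.ts)) := by
    intro x x' h
    rw [C1, C1, C1v_congr ((careful_ba j k j).bc_out h), (careful_ba j k j).star h]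
  refine lawful_of_feeds (W := W.atSlot k) rfl rfl rfl rfl (fun _ _ => Iff.rfl)
    ⟨?_, fun _ => rfl, fun _ => rfl, ?_, ?_, fun i => ?_, ?_, ?_, fun _ h => hacc h.2.2.2⟩ ?_
  · intro c c' h
    exact (Prod.mk.inj (Prod.mk.inj (Sum.inr.inj h)).2).2
  · intro m m' h σ hσ
    obtain rfl := projBa_eq_some h
    exact ⟨σ, hσ, rfl⟩
  · intro m σ h
    cases m with
    | ba k' j' m =>
      obtain ⟨σ', hσ', he⟩ := h
      cases he
      exact ⟨m, projBa_self (Bc := Bc) k j m, hσ'⟩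
    | buf k' i' b => exact absurd (Set.mem_singleton_iff.1 h) (fun he => by cases he)
    | bc k' j' m =>
      obtain ⟨σ', -, he⟩ := h
      cases he
    | bla k' m => exact absurd h (not_ba_mem_blaSigs k' m k j σ)
  · exact ⟨rfl, rfl, fun _ _ => rfl, watchBa_refl k j _⟩
  · rintro s s' ⟨-, -, h1, h2⟩
    funext k'
    by_cases hk : k' = k
    · rw [hk]
      exact (careful_ba j k j).block h2
    · change (s.slot k').block = (s'.slot k').block
      simp_all
  · exact fun h h' => Watch.atSlot_eq watchBa_eq h h'
  · intro i e
    cases e with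
    | input tx => exact splits_of_feeds (fun _ _ => rfl) (feeds_input pa tx)
    | tick =>
      exact splits_of_feeds (fun _ _ => rfl) (feeds_tick (careful_ba i k j) (hother i) pa)
    | leader kl l =>
      exact splits_of_feeds (fun _ _ => rfl) (feeds_leader (careful_ba i k j) (hother i) pa kl l)
    | recv a m =>
      cases hp : projBa k j m with
      | none =>
        exact splits_of_feeds (fun ω s => heard_of_none _ i ω s a hp)
          (feeds_recv (careful_ba i k j) (hother i) pa hp)
      | some m' =>
        obtain rfl := projBa_eq_some hp
        have hh : ∀ ω s, (guestBa Bc Ba pa k j).heard i ω s (.recv a (.ba k j m')) =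
            heardBa pa i k j (a, m') ω s := fun ω s => by
          refine (heard_of_some _ i ω s a hp).trans ?_
          by_cases h : DeafTo pa k s
          · exact (if_neg (not_not.2 h)).trans (if_pos h).symm
          · exact (if_pos h).trans (if_neg h).symm
        refine ⟨hearBa pa i k j (a, m'), afterBa pa i k, ?_, fun ω s => ?_,
          fun ω ω' s s' ha hs hv => ?_, fun ω s => recv_ba_eq pa i k j a m' ω s⟩
        · exact Feeds.ite (p := fun s : Party => s.DeafTo pa k)
            (fun s s' hs => not_iff_not.1 (hacc hs.2.2.2)) Feeds.skip (Feeds.onSlot (u := new Ba i) (careful_ba i k j).block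
            (fun _ => (careful_ba i k j).after pa) (fun h => absurd rfl h))
        · obtain ⟨h1, h2⟩ := hearBa_get pa i k j (a, m') ω s
          exact ⟨h1.trans (congrArg Prod.fst (hh ω s)).symm, h2.trans (congrArg Prod.snd (hh ω s)).symm⟩
        · exact hearBa_same hs (not_iff_not.1 (hacc hs.2.2.2)) (hv.congr (hh ω s) (hh ω' s'))

end Instances

/-! ## The steps of a party, slot by slot -/

section SlotMoves

variable (g : ℕ → Finset Tx → Tape Bc Ba → SlotState Bc Ba → SlotState Bc Ba × Effects Bc Ba)
  (ω : Tape Bc Ba) (s : PState Bc Ba) (l : List ℕ) {Q : SlotState Bc Ba → Prop}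

theorem PState.onSlot_slot (k k' f) :
    (s.onSlot k f).1.slot k' = if k' = k then (f (s.slot k)).1 else s.slot k' := by
  rw [onSlot_eq]
  grind

/-- A tick, slot by slot; `β k` is the buffer when slot `k` is processed. -/
theorem seqList_onSlot (hl : l.Nodup) (s) : ∃ β : ℕ → Finset Tx,
      (∀ k, (seqList (fun k ω (s : Party) => s.onSlot k (g k s.buf ω)) l ω s).1.slot k =
        if k ∈ l then (g k (β k) ω (s.slot k)).1 else s.slot k) ∧
      (seqList (fun k ω (s : Party) => s.onSlot k (g k s.buf ω)) l ω s).2.1 =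
        l.flatMap (fun k => (g k (β k) ω (s.slot k)).2.1) ∧
      (seqList (fun k ω (s : Party) => s.onSlot k (g k s.buf ω)) l ω s).2.2 =
        l.flatMap (fun k => (g k (β k) ω (s.slot k)).2.2) := by
  induction l generalizing s with
  | nil => exact ⟨fun _ => ∅, by simp [seqList], rfl, rfl⟩
  | cons c l ih =>
    obtain ⟨hc, hl⟩ := nodup_cons.1 hl
    obtain ⟨β, h1, h2, h3⟩ := ih hl (s.onSlot c (g c s.buf ω)).1
    have hs : ∀ k ∈ l, (s.onSlot c (g c s.buf ω)).1.slot k = s.slot k := fun k hk => by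
      rw [onSlot_slot, if_neg]
      grind
    have hfm : ∀ {M : Type} (p : Slot × Effects Bc Ba → List M),
        l.flatMap (fun k => p (g k (β k) ω ((s.onSlot c (g c s.buf ω)).1.slot k))) =
          l.flatMap (fun k => p (g k (update β c s.buf k) ω (s.slot k))) := by grind [flatMap_congr]
    refine ⟨update β c s.buf, fun k => ?_, ?_, ?_⟩
    · simp [seqList, seqOp]
      grind [onSlot_slot]
    · simp [seqList, seqOp]
      rw [h2, hfm fun r => r.2.1, onSlot_eq]
    · simp [seqList, seqOp]
      rw [h3, hfm fun r => r.2.2, onSlot_eq]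

def smrStep (pa : Params) (i : Fin n) (ω : Tape Bc Ba) (s : Party)
    (e : Event n Tx (Msg Bc Ba) (ℕ × ℕ)) : Party × Effects Bc Ba :=
  (smr pa Bc Ba).step i ω s e

theorem smrStep_tick (pa i ω) (s : Party) :
    ∃ β : ℕ → Finset Tx, (smrStep pa i ω s .tick).1.clock = s.clock + 1 ∧
      (∀ k, (smrStep pa i ω s .tick).1.slot k = if k ≤ s.clock then
        ((s.slot k).tick pa i ω k (β k) s.clock).1 else s.slot k) ∧
      (smrStep pa i ω s .tick).2.1 = (List.range (s.clock + 1)).flatMap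
        (fun k => ((s.slot k).tick pa i ω k (β k) s.clock).2.1) ∧
      (smrStep pa i ω s .tick).2.2 = (List.range (s.clock + 1)).flatMap
        (fun k => ((s.slot k).tick pa i ω k (β k) s.clock).2.2) := by
  let r := seqList (fun k ω (s' : Party) => s'.onSlot k
    (tick pa i ω k s'.buf s.clock)) (List.range (s.clock + 1)) ω s
  have h0 : smrStep pa i ω s .tick = (({ r.1 with clock := s.clock + 1 } : Party), r.2) := by
    have := foldl_eq_seqList (fun k' ω (s' : Party) =>
        s'.onSlot k' (tick pa i ω k' s'.buf s.clock)) ω (List.range (s.clock + 1))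
        (s, ([] : Mail), ([] : List (ℕ × ℕ)))
    grind [smrStep, smr]
  obtain ⟨β, h1, h2, h3⟩ := seqList_onSlot
    (fun k buf ω x => tick pa i ω k buf s.clock x) ω _ (nodup_range (n := s.clock + 1)) s
  refine ⟨β, by rw [h0], fun k => ?_, by grind, by grind⟩
  rw [h0]
  refine (h1 k).trans ?_
  simp_all

/-- How the state of slot `k` of party `i` can change. -/
inductive SlotMove (pa : Params) (i : Fin n) (k : ℕ) (x : Slot) : Slot → Prop
  | buf (j : Fin n) (b : Finset Tx) (h : x.pair.2.card ≤ pa.ts ∧ j ∉ x.pair.2.image Prod.fst) :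
    SlotMove pa i k x { x with pair := (x.pair.1 ∪ b, insert (j, b) x.pair.2) }
  | recvBla (y : Fin n × BlaMsg n Tx) :
    SlotMove pa i k x { x with bla := { x.bla with log := x.bla.log ++ [y] } }
  | leader (l : ℕ) (p : Fin n) : SlotMove pa i k x { x with bla := (x.bla.onLeader i l p).1 }
  | bc (ω : Tape Bc Ba) (l : Fin n) (y : Fin n × (Bc l).Msg) :
    SlotMove pa i k x (after pa i ω k (x.bcStep i ω k l (.inr y))).1
  | ba (ω : Tape Bc Ba) (l : Fin n) (y : Fin n × Ba.Msg) (h : ¬ (x.star.isSome ∧ x.C1 pa.ts)) :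
    SlotMove pa i k x (after pa i ω k (x.baStep i ω k l (.inr y))).1
  | tick (ω : Tape Bc Ba) (buf : Finset Tx) (τ : ℕ) : SlotMove pa i k x (x.tick pa i ω k buf τ).1

theorem smrStep_slot (pa i ω) (s : Party) (e : Event n Tx (Msg Bc Ba) (ℕ × ℕ)) (k) :
    (smrStep pa i ω s e).1.slot k = s.slot k ∨
      SlotMove pa i k (s.slot k) ((smrStep pa i ω s e).1.slot k) := by
  have honslot : ∀ (k' : ℕ) (f : Slot → Slot × Effects Bc Ba),
      smrStep pa i ω s e = s.onSlot k' f → ((f (s.slot k')).1 = s.slot k' ∨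
        SlotMove pa i k' (s.slot k') (f (s.slot k')).1) →
      (smrStep pa i ω s e).1.slot k = s.slot k ∨
      SlotMove pa i k (s.slot k) ((smrStep pa i ω s e).1.slot k) := by grind [onSlot_slot]
  cases e with
  | input tx => exact .inl rfl
  | recv j m =>
    cases m with
    | buf k' i' b =>
      refine honslot k' (fun x =>
        if i' = j ∧ x.pair.2.card ≤ pa.ts ∧ j ∉ x.pair.2.image Prod.fst then
          ({ x with pair := (x.pair.1 ∪ b, insert (j, b) x.pair.2) }, [], [])
        else (x, [], [])) rfl ?_
      by_cases h : i' = j ∧ (s.slot k').pair.2.card ≤ pa.ts ∧ j ∉ (s.slot k').pair.2.image Prod.fst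
      · rw [if_pos h]
        exact .inr (.buf j b h.2)
      · rw [if_neg h]
        simp_all
    | bla k' m =>
      exact honslot k' (fun x =>
        ({ x with bla := { x.bla with log := x.bla.log ++ [(j, m)] } }, [], [])) rfl (.inr (.recvBla (j, m)))
    | bc k' l m =>
      exact honslot k' (fun x => after pa i ω k' (x.bcStep i ω k' l (.inr (j, m)))) rfl
        (.inr (.bc ω l (j, m)))
    | ba k' l m =>
      refine honslot k' (fun x => if x.star.isSome ∧ x.C1 pa.ts then (x, [], [])
        else after pa i ω k' (x.baStep i ω k' l (.inr (j, m)))) rfl ?_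
      by_cases h : (s.slot k').star.isSome ∧ (s.slot k').C1 pa.ts
      · simp_all
      · rw [if_neg h]
        exact .inr (.ba ω l (j, m) h)
  | tick =>
    obtain ⟨β, -, h, -⟩ := smrStep_tick pa i ω s
    rw [h]
    split_ifs
    · exact .inr (.tick _ _ _)
    simp_all
  | leader kl l =>
    exact honslot kl.1 (fun x => ({ x with bla := (x.bla.onLeader i kl.2 l).1 },
      (x.bla.onLeader i kl.2 l).2.map (fun y => (y.1, .bla kl.1 y.2)), [])) rfl (.inr (.leader kl.2 l))

def slotAt (c : Config SMR) (i : Fin n) (k : ℕ) : Slot := slot (c.state i) k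

def clockAt (c : Config SMR) (i : Fin n) : ℕ := clock (c.state i)

theorem apply_smr (ω : (SMR).Rand) (c : Config SMR) (a : Action SMR) (i) : (c.apply ω a).state i =
      if c.Active ω a i then (smrStep pa i (fun x => ω.1 (i, x)) (c.state i) (c.event ω a).2).1
      else c.state i := apply_state ω c a i

theorem slotAt_apply (ω : (SMR).Rand) (c : Config SMR)
    (a : Action SMR) (i k) : slotAt (c.apply ω a) i k = slotAt c i k ∨
      SlotMove pa i k (slotAt c i k) (slotAt (c.apply ω a) i k) := by
  by_cases h' : c.Active ω a i
  · have h : slotAt (c.apply ω a) i k =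
        (smrStep pa i (fun x => ω.1 (i, x)) (c.state i) (c.event ω a).2).1.slot k :=
      congrArg (fun s : Party => s.slot k) ((apply_smr ω c a i).trans (if_pos h'))
    rw [h]
    exact smrStep_slot pa i (fun x => ω.1 (i, x)) (c.state i) (c.event ω a).2 k
  · exact .inl (congrArg (fun s : Party => s.slot k) ((apply_smr ω c a i).trans (if_neg h')))

theorem slotAt_induction {i k} (h : ∀ x y, SlotMove pa i k x y → Q x → Q y) (A : Adversary SMR)
    (ω : (SMR).Rand) {s t} (hst : s ≤ t)
    (hs : Q (slotAt (cf s) i k)) :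
    Q (slotAt (cf t) i k) := by
  induction t, hst using Nat.le_induction with
  | base => exact hs
  | succ t _ ih =>
    grind [slotAt_apply, Protocol.cfg_succ]

end SlotMoves

/-! ## Invariants of the common subset protocol -/

section SlotInvariants

variable (i : Fin n) (ω : Tape Bc Ba) (k : ℕ)
  {f : SlotState Bc Ba → Fin n → SlotState Bc Ba × List (Fin n × Msg Bc Ba)}
  {Q : SlotState Bc Ba → Prop} {R : Fin n → SlotState Bc Ba → Prop}
  {S : Finset (Finset Tx)} {ts ta : ℕ} {v : Finset Tx}

theorem forAll_induction (h : ∀ y j, Q y → Q (f y j).1) {x} (hx : Q x) : Q (forAll f x).1 := by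
  have : ∀ (l : List (Fin n)) (a : Slot × Mail), Q a.1 →
      Q (l.foldl (fun a j => let r := f a.1 j; (r.1, a.2 ++ r.2)) a).1 := by
    intro l
    induction l with
    | nil => simp_all
    | cons j l ih => simp_all
  exact this _ _ hx

theorem forAll_progress (h : ∀ y j, Q y → Q (f y j).1)
    (hR : ∀ y j, Q y → R j (f y j).1) (hR' : ∀ y j j', Q y → R j y → R j (f y j').1)
    {x} (hx : Q x) (j) : R j (forAll f x).1 := by
  have : ∀ (l : List (Fin n)) (a : Slot × Mail), Q a.1 →
      (j ∈ l ∨ R j a.1) → R j (l.foldl (fun a j => let r := f a.1 j; (r.1, a.2 ++ r.2)) a).1 := by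
    intro l
    induction l with
    | nil => simp_all
    | cons j' l ih =>
      grind
  exact this _ _ hx (.inl (mem_finRange j))

/-- The output set `S` of the common subset protocol is justified by one of the exits. -/
def Justified (pa : Params) (x : Slot) (S : Finset (Finset Tx)) : Prop :=
  (∃ v, x.C1v pa.ts v ∧ S = {v}) ∨ (∃ v, x.C2v pa.ta v ∧ S = {v}) ∨
    (x.C3 pa.ta ∧ ¬ x.C2 pa.ta ∧ S = x.ones.biUnion fun j => (x.bc j).out.toFinset)

structure Later (x y : Slot) : Prop where
  bc_inp : ∀ j v, (x.bc j).inp = some v → (y.bc j).inp = some v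
  bc_out : ∀ j v, (x.bc j).out = some v → (y.bc j).out = some v
  ba_inp : ∀ j v, (x.ba j).inp = some v → (y.ba j).inp = some v
  ba_out : ∀ j v, (x.ba j).out = some v → (y.ba j).out = some v

theorem Later.refl (x : Slot) : Later x x :=
  ⟨fun _ _ h => h, fun _ _ h => h, fun _ _ h => h, fun _ _ h => h⟩

theorem Later.trans {x y z : Slot} (h : Later x y) (h' : Later y z) : Later x z :=
  ⟨fun j v hv => h'.bc_inp j v (h.bc_inp j v hv), fun j v hv => h'.bc_out j v (h.bc_out j v hv),
    fun j v hv => h'.ba_inp j v (h.ba_inp j v hv), fun j v hv => h'.ba_out j v (h.ba_out j v hv)⟩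

theorem later_bcStep (x j e) : Later x (x.bcStep i ω k j e).1 := by
  refine ⟨fun j' v h => ?_, fun j' v h => ?_, fun j' v h => h, fun j' v h => h⟩ <;>
  · simp [bcStep]
    by_cases hj : j' = j
    · subst hj
      rw [update_self]
      first
        | exact step_inp h
        | exact step_out h
    · rwa [update_of_ne hj]

theorem later_baStep (x j e) : Later x (x.baStep i ω k j e).1 := by
  refine ⟨fun j' v h => h, fun j' v h => h, fun j' v h => ?_, fun j' v h => ?_⟩ <;>
  · simp [baStep]
    by_cases hj : j' = j
    · subst hj
      rw [update_self]
      first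
        | exact step_inp h
        | exact step_out h
    · rwa [update_of_ne hj]

namespace Later

variable {x y : SlotState Bc Ba} (h : Later x y)
include h

theorem ones : x.ones ⊆ y.ones := fun j hj => by
  simp only [SlotState.ones, Finset.mem_filter, Finset.mem_univ, true_and] at hj ⊢
  exact h.ba_out j _ hj

theorem out_eq {j} (hj : (x.bc j).out.isSome) : (y.bc j).out = (x.bc j).out := by grind [isSome_iff_exists, Later.bc_out]

theorem ones_eq (hall : ∀ j, (x.ba j).out.isSome) : y.ones = x.ones := by
  ext j
  obtain ⟨v, hv⟩ := isSome_iff_exists.1 (hall j)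
  simp [SlotState.ones, hv, h.ba_out j v hv]

theorem C1v (hv : x.C1v ts v) : y.C1v ts v := by
  refine le_trans hv (card_le_card fun j hj => ?_)
  simp at hj ⊢
  exact h.bc_out j v hj

theorem allOut (hall : ∀ j, (x.ba j).out.isSome) (j) : (y.ba j).out.isSome := by
  obtain ⟨v, hv⟩ := isSome_iff_exists.1 (hall j)
  rw [h.ba_out j v hv]
  rfl

theorem C2v (hv : x.C2v ta v) : y.C2v ta v := by
  obtain ⟨h1, h2, h3⟩ := hv
  refine ⟨by rwa [h.ones_eq h2], h.allOut h2, ?_⟩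
  rw [h.ones_eq h2]
  refine lt_of_lt_of_le h3 (Nat.mul_le_mul_left _ (card_le_card fun j hj => ?_))
  grind [Later.bc_out]

theorem C3 (hv : x.C3 ta) : y.C3 ta := by
  obtain ⟨h1, h2, h3⟩ := hv
  refine ⟨by rwa [h.ones_eq h2], h.allOut h2, fun j hj => ?_⟩
  grind [Later.out_eq, Later.ones_eq]

theorem C2_iff (h3 : x.C3 ta) : y.C2 ta ↔ x.C2 ta := by
  constructor
  · rintro ⟨v, -, -, hv⟩
    refine ⟨v, h3.1, h3.2.1, ?_⟩
    rw [h.ones_eq h3.2.1] at hv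
    convert hv using 5 with j hj
    rw [h.out_eq (h3.2.2 j hj)]
  · rintro ⟨v, hv⟩
    exact ⟨v, h.C2v hv⟩

theorem justified (hS : Justified pa x S) : Justified pa y S := by
  rcases hS with ⟨v, h1, h2⟩ | ⟨v, h1, h2⟩ | ⟨h1, h2, h3⟩
  · exact .inl ⟨v, h.C1v h1, h2⟩
  · exact .inr (.inl ⟨v, h.C2v h1, h2⟩)
  · refine .inr (.inr ⟨h.C3 h1, by rwa [h.C2_iff h1], ?_⟩)
    rw [h3, h.ones_eq h1.2.1]
    exact biUnion_congr rfl fun j hj => by rw [h.out_eq (h1.2.2 j hj)]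

end Later

theorem justified_of_exit {x : Slot} (h : x.exit pa = some S) : Justified pa x S := by
  unfold exit at h
  split_ifs at h with h1 h2 h3
  · exact .inl ⟨_, h1.choose_spec, (some.inj h).symm⟩
  · exact .inr (.inl ⟨_, h2.choose_spec, (some.inj h).symm⟩)
  · exact .inr (.inr ⟨h3, h2, (some.inj h).symm⟩)

theorem isSome_exit_iff {x : Slot} :
    (x.exit pa).isSome ↔ x.C1 pa.ts ∨ x.C2 pa.ta ∨ x.C3 pa.ta := by grind [exit]

structure Core (pa : Params) (x : Slot) : Prop where
  one : ∀ j, (x.ba j).inp = some true → (x.bc j).out.isSome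
  zero : ∀ j, (x.ba j).inp = some false → n - pa.ta ≤ x.ones.card
  just : ∀ S, x.acs = some S → Justified pa x S
  block : x.block = x.acs.map fun S => S.biUnion id

structure Settled (pa : Params) (x : Slot) : Prop where
  ones : ¬ x.C1 pa.ts → ∀ j, (x.bc j).out.isSome → (x.ba j).inp.isSome
  zeros : ¬ x.C1 pa.ts → n - pa.ta ≤ x.ones.card → ∀ j, (x.ba j).inp.isSome
  exit : x.C1 pa.ts ∨ x.C2 pa.ta ∨ x.C3 pa.ta → x.acs.isSome

theorem Core.later {x y : Slot} (hx : Core pa x) (h : Later x y)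
    (hone : ∀ j, (x.ba j).inp ≠ some true → (y.ba j).inp = some true → (y.bc j).out.isSome)
    (hzero : ∀ j, (x.ba j).inp ≠ some false → (y.ba j).inp = some false → n - pa.ta ≤ y.ones.card)
    (hacs : y.acs = x.acs) (hblock : y.block = x.block) : Core pa y := by
  refine ⟨fun j hj => ?_, fun j hj => ?_, fun S hS => ?_, by grind [Core.block]⟩
  · by_cases h' : (x.ba j).inp = some true
    · have := hx.one j h'
      rwa [h.out_eq this]
    simp_all
  · by_cases h' : (x.ba j).inp = some false
    · exact (hx.zero j h').trans (card_le_card h.ones)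
    grind
  grind [Later.justified, Core.just]

theorem baStep_inr_inp (x : Slot) (l y j) : ((x.baStep i ω k l (.inr y)).1.ba j).inp = (x.ba j).inp := by
  simp only [baStep]
  by_cases hj : j = l
  · subst hj
    rw [update_self]
    rfl
  simp_all

theorem baStep_inl_inp (x : Slot) (l) (b : Bool) (j) : ((x.baStep i ω k l (.inl b)).1.ba j).inp =
      if j = l then some ((x.ba j).inp.getD b) else (x.ba j).inp := by
  simp only [baStep]
  by_cases hj : j = l
  · subst hj
    rw [update_self, if_pos rfl, step_inl_inp]
  simp_all

theorem bcStep_inl_inp (x : Slot) (l)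
    (b : Option (Finset Tx)) (j) : ((x.bcStep i ω k l (.inl b)).1.bc j).inp =
      if j = l then some ((x.bc j).inp.getD b) else (x.bc j).inp := by
  simp only [bcStep]
  by_cases hj : j = l
  · subst hj
    rw [update_self, if_pos rfl, step_inl_inp]
  simp_all

structure Frame (x y : Slot) : Prop where
  entered : y.entered = x.entered
  pair : y.pair = x.pair
  bla : y.bla = x.bla
  star : y.star = x.star
  bc : y.bc = x.bc

theorem giveOnes_spec (pa : Params) (i : Fin n) (ω : Tape Bc Ba) (k : ℕ) {x : Slot}
    (hx : Core pa x) : let y := (x.giveOnes pa i ω k).1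
    Core pa y ∧ Later x y ∧ Frame x y ∧ y.acs = x.acs ∧
      (¬ x.C1 pa.ts → ∀ j, (y.bc j).out.isSome → (y.ba j).inp.isSome) := by
  intro y
  by_cases hC : x.C1 pa.ts
  · have : y = x := by simp [y, giveOnes, if_pos hC]
    rw [this]
    exact ⟨hx, .refl x, ⟨rfl, rfl, rfl, rfl, rfl⟩, rfl, fun h => absurd hC h⟩
  · have hy : y = (forAll (fun y j =>
      if (y.bc j).out.isSome ∧ (y.ba j).inp = none then y.baStep i ω k j (.inl true)
      else (y, [])) x).1 := by simp [y, giveOnes, if_neg hC]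
    have hstep : ∀ (y : Slot) j, (Core pa y ∧ Later x y ∧ Frame x y ∧ y.acs = x.acs) →
        let z := (if (y.bc j).out.isSome ∧ (y.ba j).inp = none then y.baStep i ω k j (.inl true)
          else (y, [])).1
        (Core pa z ∧ Later x z ∧ Frame x z ∧ z.acs = x.acs) := by
      intro y j ⟨h1, h2, h3, h4⟩ z
      by_cases hc : (y.bc j).out.isSome ∧ (y.ba j).inp = none
      · have hz : z = (y.baStep i ω k j (.inl true)).1 := by simp [z, if_pos hc]
        have hl := hz ▸ later_baStep _ _ _ _ _ _
        have hinp : ∀ j', (z.ba j').inp = if j' = j then some true else (y.ba j').inp := by grind [baStep_inl_inp]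
        refine ⟨h1.later hl (fun j' h h' => ?_) (fun j' h h' => ?_) (by rw [hz]; rfl)
          (by rw [hz]; rfl), h2.trans hl, ?_, by rwa [hz]⟩
        · rw [hinp] at h'
          split_ifs at h' with hj
          · rw [hz, hj]
            exact hc.1
          simp_all
        · grind
        · rw [hz]
          exact ⟨h3.entered, h3.pair, h3.bla, h3.star, h3.bc⟩
      · have hz : z = y := by simp [z, if_neg hc]
        simp_all
    have h0 := forAll_induction hstep ⟨hx, .refl x, ⟨rfl, rfl, rfl, rfl, rfl⟩, rfl⟩
    rw [← hy] at h0
    refine ⟨h0.1, h0.2.1, h0.2.2.1, h0.2.2.2, fun _ j => ?_⟩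
    rw [hy]
    refine forAll_progress (R := fun j y => (y.bc j).out.isSome → (y.ba j).inp.isSome) hstep
      (fun y j _ => ?_) (fun y j j' _ => ?_) ⟨hx, .refl x, ⟨rfl, rfl, rfl, rfl, rfl⟩, rfl⟩ j
    · by_cases hc : (y.bc j).out.isSome ∧ (y.ba j).inp = none
      · rw [if_pos hc]
        intro _
        rw [baStep_inl_inp, if_pos rfl]
        rfl
      · rw [if_neg hc]
        by_contra h'
        simp_all
    · intro h
      by_cases hc : (y.bc j').out.isSome ∧ (y.ba j').inp = none
      · rw [if_pos hc]
        intro h'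
        obtain ⟨v, hv⟩ := isSome_iff_exists.1 (h h')
        rw [(later_baStep i ω k y j' _).ba_inp j v hv]
        rfl
      · rwa [if_neg hc]

theorem giveZeros_spec (pa : Params) (i : Fin n) (ω : Tape Bc Ba) (k : ℕ) {x : Slot}
    (hx : Core pa x) : let y := (x.giveZeros pa i ω k).1
    Core pa y ∧ Later x y ∧ Frame x y ∧ y.acs = x.acs ∧
      (¬ x.C1 pa.ts → n - pa.ta ≤ y.ones.card → ∀ j, (y.ba j).inp.isSome) := by
  intro y
  by_cases hC : x.C1 pa.ts ∨ x.ones.card < n - pa.ta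
  · have : y = x := by simp [y, giveZeros, if_pos hC]
    rw [this]
    refine ⟨hx, .refl x, ⟨rfl, rfl, rfl, rfl, rfl⟩, rfl, fun h h' => ?_⟩
    grind
  · have hy : y = (forAll (fun y j =>
      if (y.ba j).inp = none then y.baStep i ω k j (.inl false) else (y, [])) x).1 := by simp [y, giveZeros, if_neg hC]
    have hn := not_lt.1 fun h => hC (.inr h)
    have hstep : ∀ (y : Slot) j, (Core pa y ∧ Later x y ∧ Frame x y ∧ y.acs = x.acs) →
        let z := (if (y.ba j).inp = none then y.baStep i ω k j (.inl false) else (y, [])).1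
        (Core pa z ∧ Later x z ∧ Frame x z ∧ z.acs = x.acs) := by
      intro y j ⟨h1, h2, h3, h4⟩ z
      by_cases hc : (y.ba j).inp = none
      · have hz : z = (y.baStep i ω k j (.inl false)).1 := by simp [z, if_pos hc]
        have hl := hz ▸ later_baStep _ _ _ _ _ _
        have hinp : ∀ j', (z.ba j').inp = if j' = j then some false else (y.ba j').inp := by grind [baStep_inl_inp]
        refine ⟨h1.later hl (fun j' h h' => ?_)
          (fun j' h h' => hn.trans (card_le_card (h2.trans hl).ones)) (by rw [hz]; rfl)
          (by rw [hz]; rfl), h2.trans hl, ?_, by rwa [hz]⟩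
        · grind
        · rw [hz]
          exact ⟨h3.entered, h3.pair, h3.bla, h3.star, h3.bc⟩
      · have hz : z = y := by simp [z, if_neg hc]
        simp_all
    have h0 := forAll_induction hstep ⟨hx, .refl x, ⟨rfl, rfl, rfl, rfl, rfl⟩, rfl⟩
    rw [← hy] at h0
    refine ⟨h0.1, h0.2.1, h0.2.2.1, h0.2.2.2, fun _ _ j => ?_⟩
    rw [hy]
    refine forAll_progress (R := fun j y => (y.ba j).inp.isSome) hstep
      (fun y j _ => ?_) (fun y j j' _ h => ?_) ⟨hx, .refl x, ⟨rfl, rfl, rfl, rfl, rfl⟩, rfl⟩ j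
    · by_cases hc : (y.ba j).inp = none
      · rw [if_pos hc, baStep_inl_inp, if_pos rfl]
        rfl
      · rw [if_neg hc]
        exact isSome_iff_ne_none.2 hc
    · by_cases hc : (y.ba j').inp = none
      · grind [isSome_iff_exists, later_baStep, Later.ba_inp]
      simp_all

theorem settle_spec (pa : Params) (i : Fin n) (ω : Tape Bc Ba) (k : ℕ) {x : Slot}
    (hx : Core pa x) : let y := (x.settle pa i ω k).1
    Core pa y ∧ Later x y ∧ Frame x y ∧ Settled pa y ∧ ∀ S, x.acs = some S → y.acs = some S := by
  intro y
  obtain ⟨a1, a2, a3, a4, a5⟩ := giveOnes_spec pa i ω k hx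
  obtain ⟨b1, b2, b3, b4, b5⟩ := giveZeros_spec pa i ω k a1
  set x₁ := (x.giveOnes pa i ω k).1
  set x₂ := (x₁.giveZeros pa i ω k).1
  have hy : y = x₂.leave pa := congrArg Prod.fst (settle_eq pa i ω k x)
  have hC1 : ∀ {z w : Slot}, Frame z w → (w.C1 pa.ts ↔ z.C1 pa.ts) := fun {z w} h => by grind [C1, C1v_congr, Frame.bc]
  have hCy : y.C1 pa.ts ↔ x₂.C1 pa.ts := by rfl
  refine ⟨⟨fun j h => ?_, fun j h => ?_, fun S h => ?_, ?_⟩, ?_, ?_, ⟨fun h j => ?_, fun h => ?_,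
    fun h => ?_⟩, fun S h => ?_⟩
  · exact b1.one j h
  · exact b1.zero j h
  · change (x₂.acs <|> x₂.exit pa) = some S at h
    cases hacs : x₂.acs with
    | some S' =>
      rw [hacs] at h
      exact b1.just S (hacs.trans h)
    | none =>
      rw [hacs] at h
      exact justified_of_exit (pa := pa) (x := x₂) h
  · rfl
  · have := a2.trans b2
    exact ⟨this.bc_inp, this.bc_out, this.ba_inp, this.ba_out⟩
  · exact ⟨b3.entered.trans a3.entered, b3.pair.trans a3.pair, b3.bla.trans a3.bla,
      b3.star.trans a3.star, b3.bc.trans a3.bc⟩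
  · rw [hCy, hC1 b3, hC1 a3] at h
    intro hj
    change (x₂.bc j).out.isSome at hj
    rw [b3.bc] at hj
    obtain ⟨v, hv⟩ := isSome_iff_exists.1 (a5 h j hj)
    change (x₂.ba j).inp.isSome
    grind [Later.ba_inp]
  · rw [hCy, hC1 b3] at h
    exact b5 h
  · change (x₂.acs <|> x₂.exit pa).isSome
    cases hacs : x₂.acs with
    | some S' => rfl
    | none => exact isSome_exit_iff.2 h
  · change (x₂.acs <|> x₂.exit pa) = some S
    simp_all

end SlotInvariants

section SlotInvariant

theorem bcStep_inr_inp (i ω k) (x : Slot) (l y j) :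
    ((x.bcStep i ω k l (.inr y)).1.bc j).inp = (x.bc j).inp := by
  simp only [bcStep]
  by_cases hj : j = l
  · subst hj
    rw [update_self]
    rfl
  simp_all

structure SlotInv (pa : Params) (i : Fin n) (x : Slot) : Prop where
  core : Core pa x
  idle : x.star = none → (∀ j, (x.bc j).inp = none) ∧ (∀ j, (x.ba j).inp = none) ∧ x.acs = none
  begun : ∀ B, x.star = some B → ∀ j, (x.bc j).inp = some (if j = i then some B else none)
  settled : x.star.isSome → Settled pa x

structure Advanced (x y : Slot) : Prop where
  later : Later x y
  star : ∀ B, x.star = some B → y.star = some B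
  acs : ∀ S, x.acs = some S → y.acs = some S
  entered : x.entered = true → y.entered = true
  pair : x.pair.2 ⊆ y.pair.2

theorem Advanced.trans {x y z : Slot} (h : Advanced x y) (h' : Advanced y z) : Advanced x z :=
  ⟨h.later.trans h'.later, fun B hB => h'.star B (h.star B hB), fun B hB => h'.acs B (h.acs B hB),
    fun hB => h'.entered (h.entered hB), h.pair.trans h'.pair⟩

theorem Advanced.refl (x : Slot) : Advanced x x :=
  ⟨.refl x, fun _ h => h, fun _ h => h, fun h => h, subset_rfl⟩

theorem SlotInv.with {x : Slot} (h : SlotInv pa i x) (e : Bool) (p : SPair n Tx) (b : BlaState n Tx) :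
    SlotInv pa i ⟨e, p, b, x.star, x.bc, x.ba, x.acs, x.block⟩ :=
  ⟨⟨h.core.one, h.core.zero, h.core.just, h.core.block⟩, h.idle, h.begun,
    fun hs => ⟨(h.settled hs).ones, (h.settled hs).zeros, (h.settled hs).exit⟩⟩

theorem Advanced.with {x : Slot} {e : Bool} (he : x.entered = true → e = true)
    {p : SPair n Tx} (hp : x.pair.2 ⊆ p.2) (b : BlaState n Tx) :
    Advanced x ⟨e, p, b, x.star, x.bc, x.ba, x.acs, x.block⟩ :=
  ⟨⟨fun _ _ h => h, fun _ _ h => h, fun _ _ h => h, fun _ _ h => h⟩, fun _ h => h, fun _ h => h, he, hp⟩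

structure Side (x y : Slot) : Prop where
  entered : y.entered = x.entered
  pair : y.pair = x.pair
  bla : y.bla = x.bla

theorem slotInv_after (ω) {z : Slot} {m : Mail} (hz : Core pa z)
    (hidle : z.star = none → (∀ j, (z.bc j).inp = none) ∧ (∀ j, (z.ba j).inp = none) ∧ z.acs = none)
    (hbegun : ∀ B, z.star = some B → ∀ j, (z.bc j).inp = some (if j = i then some B else none)) :
    SlotInv pa i (after pa i ω k (z, m)).1 ∧ Advanced z (after pa i ω k (z, m)).1 ∧
      Side z (after pa i ω k (z, m)).1 := by
  by_cases hs : z.star.isSome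
  · simp [SlotState.after, if_pos hs]
    obtain ⟨h1, h2, h3, h4, h5⟩ := settle_spec pa i ω k hz
    refine ⟨⟨h1, fun h => ?_, fun B hB j => ?_, fun _ => h4⟩, ⟨h2, fun B hB => h3.star.trans hB, h5,
      fun h => h3.entered.trans h, by rw [h3.pair]⟩, ⟨h3.entered, h3.pair, h3.bla⟩⟩
    · grind [Frame.star]
    grind [Frame.bc, Frame.star]
  · simpa [SlotState.after, if_neg hs] using ⟨⟨hz, hidle, hbegun, fun h => absurd h hs⟩, .refl z, rfl, rfl, rfl⟩

theorem beginACS_spec (ω) (B : Finset Tx) {x : Slot} (hx : SlotInv pa i x) (hs : x.star = none) :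
    SlotInv pa i (x.beginACS pa i ω k B).1 ∧ Advanced x (x.beginACS pa i ω k B).1 ∧
      Side x (x.beginACS pa i ω k B).1 ∧ (x.beginACS pa i ω k B).1.star = some B := by
  obtain ⟨h1, h2, h3⟩ := hx.idle hs
  let Q : Slot → Prop := fun y => Core pa y ∧ Later x y ∧ y.star = some B ∧ y.acs = none ∧ Side x y ∧
    (∀ j, (y.ba j).inp = none) ∧ ∀ j, (y.bc j).inp = none ∨
      (y.bc j).inp = some (if j = i then some B else none)
  have hQ0 : Q { x with star := some B } := ⟨⟨hx.core.one, hx.core.zero, hx.core.just, hx.core.block⟩,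
      ⟨fun _ _ h => h, fun _ _ h => h, fun _ _ h => h, fun _ _ h => h⟩, rfl, h3, ⟨rfl, rfl, rfl⟩, h2,
      fun j => .inl (h1 j)⟩
  have hQ : ∀ y j, Q y → Q (y.bcStep i ω k j (.inl (if j = i then some B else none))).1 := by
    intro y j ⟨a1, a2, a3, a4, a5, a7, a8⟩
    have hl := later_bcStep i ω k y j (.inl (if j = i then some B else none))
    refine ⟨a1.later hl (fun j' h h' => absurd h' h) (fun j' h h' => absurd h' h) rfl rfl,
      a2.trans hl, a3, a4, ⟨a5.entered, a5.pair, a5.bla⟩, a7, fun j' => ?_⟩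
    rw [bcStep_inl_inp]
    by_cases hj : j' = j
    · grind
    simp_all
  obtain ⟨a1, a2, a3, a4, a5, a7, a8⟩ := forAll_induction hQ hQ0
  have hR : ∀ j, ((forAll (fun y j => y.bcStep i ω k j (.inl (if j = i then some B else none)))
      { x with star := some B }).1.bc j).inp = some (if j = i then some B else none) := fun j => by
    refine forAll_progress (R := fun j y => (y.bc j).inp = some (if j = i then some B else none)) hQ
      (fun y j h => ?_) (fun y j j' h h' => ?_) hQ0 j
    · rw [bcStep_inl_inp, if_pos rfl]
      grind
    grind [later_bcStep, Later.bc_inp]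
  rw [beginACS_eq]
  obtain ⟨b1, b2, b3, b4, b5⟩ := settle_spec pa i ω k a1
  refine ⟨⟨b1, fun h => ?_, fun B' hB j => ?_, fun _ => b4⟩, ⟨a2.trans b2, fun B' hB => ?_,
    fun S hS => ?_, fun h => ?_, ?_⟩, ⟨b3.entered.trans a5.entered, b3.pair.trans a5.pair,
    b3.bla.trans a5.bla⟩, b3.star.trans a3⟩
  · grind [Frame.star]
  · grind [Frame.star, Frame.bc]
  · simp_all
  · simp_all
  · rw [b3.entered, a5.entered, h]
  · rw [b3.pair, a5.pair]

theorem slotInv_new : SlotInv pa i (new i : Slot) :=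
  ⟨⟨fun _ h => (nomatch h), fun _ h => (nomatch h), fun _ h => (nomatch h), rfl⟩,
    fun _ => ⟨fun _ => rfl, fun _ => rfl, rfl⟩, fun _ h => (nomatch h), fun h => (nomatch h)⟩

theorem tickCore_begin {buf τ e pair bla star B}
    (h : (tickCore (Bc := Bc) (Ba := Ba) pa i k buf τ e pair bla star).2.2 = some B) :
    star = none := by
  cases star with
  | none => rfl
  | some b => simp [tickCore] at h

theorem tickCore_entered {buf τ e pair bla star} :
    (tickCore (Bc := Bc) (Ba := Ba) pa i k buf τ e pair bla star).1.1 =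
      if τ = pa.T k then true else e := rfl

theorem tick_spec (ω : Tape Bc Ba) (buf : Finset Tx) (τ : ℕ) {x : Slot} (hx : SlotInv pa i x) :
    let c := tickCore (Bc := Bc) (Ba := Ba) pa i k buf τ x.entered x.pair x.bla x.star
    let y := (x.tick pa i ω k buf τ).1
    SlotInv pa i y ∧ Advanced x y ∧ y.entered = c.1.1 ∧ y.pair = x.pair ∧ y.bla = c.1.2 ∧
      y.star = (c.2.2 <|> x.star) := by
  intro c y
  have h1 := hx.with c.1.1 x.pair c.1.2
  have h2 : Advanced x ⟨c.1.1, x.pair, c.1.2, x.star, x.bc, x.ba, x.acs, x.block⟩ := by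
    refine .with (fun h => ?_) subset_rfl _
    rw [tickCore_entered, h, ite_self]
  have hy : y = (beginOp pa i k c.2.2 ω { x with entered := c.1.1, bla := c.1.2 }).1 :=
    congrArg Prod.fst (tick_eq pa i ω k buf τ x)
  clear_value y
  subst hy
  cases hB : c.2.2 with
  | none => exact ⟨h1, h2, rfl, rfl, rfl, rfl⟩
  | some B =>
    obtain ⟨a1, a2, a3, a4⟩ := beginACS_spec (k := k) ω B h1 (tickCore_begin hB)
    exact ⟨a1, h2.trans a2, a3.entered, a3.pair, a3.bla, a4⟩

theorem SlotMove.spec {x y : Slot} (h : SlotMove pa i k x y) (hx : SlotInv pa i x) :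
    SlotInv pa i y ∧ Advanced x y := by
  cases h with
  | buf j b h =>
    grind [SlotInv.with, Advanced.with]
  | recvBla y => grind [SlotInv.with, Advanced.with]
  | leader l p => grind [SlotInv.with, Advanced.with]
  | bc ω l y =>
    have hl := later_bcStep i ω k x l (.inr y)
    have := slotInv_after (k := k) ω (m := (x.bcStep i ω k l (.inr y)).2)
      (hx.core.later hl (fun j h h' => absurd h' h) (fun j h h' => absurd h' h) rfl rfl)
      (fun h => ⟨fun j => (bcStep_inr_inp _ _ _ _ _ _ _).trans ((hx.idle h).1 j), (hx.idle h).2⟩)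
      (fun B h j => (bcStep_inr_inp _ _ _ _ _ _ _).trans (hx.begun B h j))
    exact ⟨this.1, Advanced.trans ⟨hl, fun _ h => h, fun _ h => h, id, subset_rfl⟩ this.2.1⟩
  | ba ω l y h =>
    have hl := later_baStep i ω k x l (.inr y)
    have := slotInv_after (k := k) ω (m := (x.baStep i ω k l (.inr y)).2)
      (hx.core.later hl (fun j h h' => absurd ((baStep_inr_inp _ _ _ _ _ _ _).symm.trans h') h)
        (fun j h h' => absurd ((baStep_inr_inp _ _ _ _ _ _ _).symm.trans h') h) rfl rfl)
      (fun h => ⟨(hx.idle h).1, fun j => (baStep_inr_inp _ _ _ _ _ _ _).trans ((hx.idle h).2.1 j),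
        (hx.idle h).2.2⟩)
      (fun B h j => hx.begun B h j)
    exact ⟨this.1, Advanced.trans ⟨hl, fun _ h => h, fun _ h => h, id, subset_rfl⟩ this.2.1⟩
  | tick ω buf τ => grind [tick_spec]

variable (A ω)

theorem slotInv (i : Fin n) (k t : ℕ) : SlotInv pa i (slotAt (cf t) i k) :=
  slotAt_induction (Q := SlotInv pa i) (fun _ _ h hx => (h.spec hx).1) A ω t.zero_le slotInv_new

theorem advanced (i : Fin n) (k : ℕ) {s t : ℕ} (h : s ≤ t) :
    Advanced (slotAt (cf s) i k) (slotAt (cf t) i k) :=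
  (slotAt_induction (Q := fun y => SlotInv pa i y ∧ Advanced (slotAt (cf s) i k) y)
    (fun _ _ h hx => ⟨(h.spec hx.1).1, hx.2.trans (h.spec hx.1).2⟩) A ω h
    ⟨slotInv A ω i k s, .refl _⟩).2

end SlotInvariant

section Clocks

theorem smrStep_clock (i ω) (s : Party) {e : Event n Tx (Msg Bc Ba) (ℕ × ℕ)} (he : e ≠ .tick) :
    (smrStep pa i ω s e).1.clock = s.clock := by
  have honslot : ∀ (k' : ℕ) (f : Slot → Slot × Effects Bc Ba),
      (s.onSlot k' f).1.clock = s.clock := fun k' f => by rw [onSlot_eq]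
  cases e with
  | input tx => rfl
  | recv j m => cases m <;> exact honslot _ _
  | tick => simp_all
  | leader kl l => exact honslot _ _

theorem clockAt_apply_tick (ω : (SMR).Rand) (c : Config SMR) (i)
    {S : Finset (Fin n)} (hi : i ∈ S) (hc : i ∉ c.corrupted) :
    clockAt (c.apply ω (.tick S)) i = clockAt c i + 1 := by
  have h : clockAt (c.apply ω (.tick S)) i =
      (smrStep pa i (fun x => ω.1 (i, x)) (c.state i) .tick).1.clock :=
    congrArg clock ((apply_smr ω c (.tick S) i).trans (if_pos ⟨hi, hc⟩))
  obtain ⟨-, h', -⟩ := smrStep_tick pa i (fun x => ω.1 (i, x)) (c.state i)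
  exact h.trans h'

theorem clockAt_apply (ω : (SMR).Rand) (c : Config SMR)
    (a : Action SMR) (i) (h : ∀ S, a = .tick S → i ∉ S) :
    clockAt (c.apply ω a) i = clockAt c i := by
  by_cases h' : c.Active ω a i
  · have h1 : clockAt (c.apply ω a) i =
        (smrStep pa i (fun x => ω.1 (i, x)) (c.state i) (c.event ω a).2).1.clock :=
      congrArg clock ((apply_smr ω c a i).trans (if_pos h'))
    refine h1.trans (smrStep_clock i _ _ fun he => ?_)
    obtain ⟨S, hS, hi⟩ := event_tick h'.1 he
    simp_all
  · exact congrArg clock ((apply_smr ω c a i).trans (if_neg h'))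


theorem clockAt_mono (A ω i) {s t} (h : s ≤ t) :
    clockAt ((smr pa Bc Ba).cfg A ω s) i ≤ clockAt ((smr pa Bc Ba).cfg A ω t) i := by
  induction t, h using Nat.le_induction with
  | base => exact le_rfl
  | succ t _ ih =>
    refine ih.trans ?_
    rw [Protocol.cfg_succ]
    by_cases hc : i ∈ ((smr pa Bc Ba).cfg A ω t).corrupted
    · exact (congrArg PState.clock (Config.apply_state_of_corrupted ω _ hc)).ge
    · by_cases h' : ∃ S, (smr pa Bc Ba).act A ω t = .tick S ∧ i ∈ S
      · obtain ⟨S, h1, h2⟩ := h'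
        rw [h1, clockAt_apply_tick _ _ _ h2 hc]
        omega
      grind [clockAt_apply]

/-- Every clock that does not stop ticks at every time. -/
theorem exists_tick {i} (hi : (SMR).Honest A ω i)
    (h : ∀ N, ∃ t ≥ N, ∃ S, (SMR).act A ω t = .tick S ∧ i ∈ S) (τ) :
    ∃ t S, clockAt (cf t) i = τ ∧ (SMR).act A ω t = .tick S ∧ i ∈ S := by
  have next : ∀ s, ∃ t ≥ s, clockAt (cf t) i =
      clockAt (cf s) i ∧ ∃ S, (SMR).act A ω t = .tick S ∧ i ∈ S := by
    intro s
    have hs := h s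
    have : ∀ t, s ≤ t → t ≤ Nat.find hs → clockAt (cf t) i = clockAt (cf s) i := by
      intro t hst
      induction t, hst using Nat.le_induction with
      | base => omega
      | succ t hst ih =>
        grind [Protocol.cfg_succ, clockAt_apply, Nat.find_min]
    grind
  induction τ with
  | zero =>
    obtain ⟨t, -, h1, S, h2⟩ := next 0
    exact ⟨t, S, h1, h2⟩
  | succ τ ih =>
    obtain ⟨s, S, hs, hS, hiS⟩ := ih
    obtain ⟨t, -, h1, S', h2⟩ := next (s + 1)
    refine ⟨t, S', ?_, h2⟩
    rw [h1, Protocol.cfg_succ, hS, clockAt_apply_tick _ _ _ hiS (hi s), hs]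

def tapeAt (ω : (SMR).Rand) (i : Fin n) : Tape Bc Ba := fun x => ω.1 (i, x)

theorem slotAt_tick {i t S} (ha : (SMR).act A ω t = .tick S) (hi : i ∈ S)
    (hc : i ∉ (cf t).corrupted) : ∃ β : ℕ → Finset Tx, (∀ k ≤ clockAt (cf t) i,
        slotAt (cf (t + 1)) i k = ((slotAt (cf t) i k).tick pa i (tapeAt ω i) k (β k)
            (clockAt (cf t) i)).1) ∧
      ∀ k ≤ clockAt (cf t) i, ∀ x ∈ ((slotAt (cf t) i k).tick pa i (tapeAt ω i) k (β k)
          (clockAt (cf t) i)).2.1,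
        (⟨i, x.1, x.2, (cf t).time + 1⟩ : Packet SMR) ∈ (cf (t + 1)).net := by
  obtain ⟨β, -, h1, h2, -⟩ := smrStep_tick pa i (tapeAt ω i) ((cf t).state i)
  have hact : (cf t).Active ω ((SMR).act A ω t) i := by
    rw [ha]
    exact ⟨hi, hc⟩
  refine ⟨β, fun k hk => ?_, fun k hk x hx => ?_⟩
  · have h : slotAt (cf (t + 1)) i k = (smrStep pa i (tapeAt ω i) ((cf t).state i) .tick).1.slot k := by
      have := congrArg (fun s : Party => s.slot k)
        ((apply_smr ω (cf t) ((SMR).act A ω t) i).trans (if_pos hact))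
      rw [ha] at this
      rwa [Protocol.cfg_succ, ha]
    exact (h.trans (h1 k)).trans (if_pos hk)
  · rw [Protocol.cfg_succ, Config.mem_apply_net]
    refine .inr ⟨i, hact, x, ?_, ?_⟩
    · rw [ha]
      change x ∈ (smrStep pa i (tapeAt ω i) ((cf t).state i) .tick).2.1
      rw [h2]
      exact List.mem_flatMap.2 ⟨k, List.mem_range.2 (Nat.lt_succ_of_le hk), hx⟩
    · rw [ha]
      rfl

theorem slotAt_recv {i j t m} (he : (cf t).event ω ((SMR).act A ω t) = ({i}, .recv j m))
    (hi : i ∉ (cf t).corrupted) (k) :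
    slotAt (cf (t + 1)) i k = (recv pa i (tapeAt ω i) ((cf t).state i) j m).1.slot k := by
  have hact : (cf t).Active ω ((SMR).act A ω t) i := by
    refine ⟨?_, hi⟩
    simp_all
  have := congrArg (fun s : Party => s.slot k)
    ((apply_smr ω (cf t) ((SMR).act A ω t) i).trans (if_pos hact))
  refine this.trans ?_
  rw [he]
  rfl

end Clocks

section Liveness

theorem le_T (hΔ : 0 < pa.Δ) (k) : k ≤ pa.T k := Nat.le_mul_of_pos_left k (by positivity)

theorem tickCore_isSome {i k buf τ e pair bla} (hτ : pa.T k + pa.Δ + pa.κ * pa.Δ ≤ τ) (he : e = true)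
    (hp : pa.ts < pair.2.card) :
    (tickCore (Bc := Bc) (Ba := Ba) pa i k buf τ e pair bla none).2.2.isSome := by
  simp only [tickCore, he, ite_self, hp, hτ, and_self, if_true]
  grind

theorem mem_toAll {M : Type} (m : M) (j : Fin n) : (j, m) ∈ toAll m := mem_map.2 ⟨j, mem_finRange j, rfl⟩

theorem enter (hΔ : 0 < pa.Δ) {i : Fin n} {t k : ℕ} {S : Finset (Fin n)} (hi : i ∉ (cf t).corrupted)
    (h1 : clockAt (cf t) i = pa.T k) (h2 : (SMR).act A ω t = .tick S)
    (h3 : i ∈ S) : (slotAt (cf (t + 1)) i k).entered = true ∧ ∃ b, ∀ j,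
      (⟨i, j, .buf k i b, (cf t).time + 1⟩ : Packet SMR) ∈ (cf (t + 1)).net := by
  obtain ⟨β, h4, h5⟩ := slotAt_tick h2 h3 hi
  have hk := h1 ▸ le_T hΔ k
  refine ⟨?_, β k, fun j => h5 k hk (j, .buf k i (β k)) ?_⟩
  · rw [h4 k hk, (tick_spec _ _ _ (slotInv A ω i k t)).2.2.1, tickCore_entered, if_pos h1]
  · rw [tick_eq]
    dsimp only [tickCore]
    grind [mem_toAll]

/-- A party that receives a signed buffer adds it, unless it has enough of them. -/
theorem pair_of_recv {i j t k b} (h : (cf t).event ω ((SMR).act A ω t) = ({i}, .recv j (.buf k j b)))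
    (hi : i ∉ (cf t).corrupted) :
    j ∈ (slotAt (cf (t + 1)) i k).pair.2.image Prod.fst ∨
      pa.ts < (slotAt (cf (t + 1)) i k).pair.2.card := by
  have h3 : slotAt (cf (t + 1)) i k = if j = j ∧ (slotAt (cf t) i k).pair.2.card ≤ pa.ts ∧
        j ∉ (slotAt (cf t) i k).pair.2.image Prod.fst
      then { slotAt (cf t) i k with
        pair := ((slotAt (cf t) i k).pair.1 ∪ b, insert (j, b) (slotAt (cf t) i k).pair.2) }
      else slotAt (cf t) i k := by
    refine (slotAt_recv h hi k).trans ((onSlot_slot _ k k _).trans ?_)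
    rw [if_pos rfl]
    exact apply_ite Prod.fst _ _ _
  rw [h3]
  split_ifs with h4
  · simp_all
  grind

theorem exists_pair (hΔ : 0 < pa.Δ) {b} (hb : pa.ts + b < n)
    (hA : (SMR).AtMost b A ω) (has : (SMR).Async A ω) {i}
    (hi : (SMR).Honest A ω i) (k) :
    ∃ t, pa.ts < (slotAt (cf t) i k).pair.2.card := by
  have hin : ∀ j, (SMR).Honest A ω j → ∃ t, j ∈ (slotAt (cf t) i k).pair.2.image Prod.fst ∨
      pa.ts < (slotAt (cf t) i k).pair.2.card := by
    intro j hj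
    obtain ⟨t, S, h1, h2, h3⟩ := exists_tick hj (has.2 j hj) (pa.T k)
    obtain ⟨b, h4⟩ := (enter hΔ (hj t) h1 h2 h3).2
    obtain ⟨t', ht'⟩ := has.1.exists_event (h4 i) hi
    exact ⟨t' + 1, pair_of_recv ht' (hi t')⟩
  by_contra! hne
  have hmono : ∀ j s t, s ≤ t → j ∈ (slotAt (cf s) i k).pair.2.image Prod.fst →
      j ∈ (slotAt (cf t) i k).pair.2.image Prod.fst := by
    intro j s t hst hj
    exact image_subset_image (advanced A ω i k hst).pair hj
  choose! T hT using fun j hj => (hin j hj)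
  obtain ⟨M, hM⟩ : ∃ M, ∀ j, T j ≤ M := ⟨univ.sup T, fun j => le_sup (f := T) (mem_univ j)⟩
  have hsub : univ.filter ((SMR).Honest A ω) ⊆
      (slotAt (cf M) i k).pair.2.image Prod.fst := fun j hj => by grind
  have h1 := card_le_card hsub
  have h2 := honest_card hA
  have h3 := hne M
  have h4 := (card_image_le (s := (slotAt (cf M) i k).pair.2) (f := Prod.fst))
  omega

/-- Every honest party begins the common subset protocol. -/
theorem exists_star (hΔ : 0 < pa.Δ) {b} (hb : pa.ts + b < n)
    (hA : (smr pa Bc Ba).AtMost b A ω) (has : (smr pa Bc Ba).Async A ω) {i}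
    (hi : (smr pa Bc Ba).Honest A ω i) (k) :
    ∃ t B, (slotAt ((smr pa Bc Ba).cfg A ω t) i k).star = some B := by
  obtain ⟨t₀, S₀, e1, e2, e3⟩ := exists_tick hi (has.2 i hi) (pa.T k)
  obtain ⟨t₁, h1⟩ : ∃ t₁, (slotAt ((smr pa Bc Ba).cfg A ω t₁) i k).entered = true :=
    ⟨_, (enter hΔ (hi t₀) e1 e2 e3).1⟩
  obtain ⟨t₂, h2⟩ := exists_pair hΔ hb hA has hi k
  obtain ⟨t, S, h3, h4, h5⟩ := exists_tick hi (has.2 i hi) (max (pa.T k + pa.Δ + pa.κ * pa.Δ)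
    (clockAt ((smr pa Bc Ba).cfg A ω (max t₁ t₂)) i))
  obtain ⟨β, h6, -⟩ := slotAt_tick h4 h5 (hi t)
  have hd : pa.T k + pa.Δ + pa.κ * pa.Δ ≤ clockAt ((smr pa Bc Ba).cfg A ω t) i := h3 ▸ le_max_left _ _
  have hk : k ≤ clockAt ((smr pa Bc Ba).cfg A ω t) i := (le_T hΔ k).trans (by omega)
  have ht : max t₁ t₂ ≤ t := by
    by_contra h
    have h7 := clockAt_mono A ω i (Nat.succ_le_of_lt (not_le.1 h))
    rw [Protocol.cfg_succ, h4, clockAt_apply_tick _ _ _ h5 (hi t), h3] at h7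
    omega
  have ha₁ := advanced A ω i k ((le_max_left t₁ t₂).trans ht)
  have ha₂ := advanced A ω i k ((le_max_right t₁ t₂).trans ht)
  cases hs : (slotAt ((smr pa Bc Ba).cfg A ω t) i k).star with
  | some B => grind
  | none =>
    refine ⟨t + 1, isSome_iff_exists.1 ?_⟩
    rw [h6 k hk, (tick_spec _ _ _ (slotInv A ω i k t)).2.2.2.2.2, hs, orElse_eq_orElse]
    have := tickCore_isSome (Bc := Bc) (Ba := Ba) (i := i) (buf := β k) (bla := (slotAt ((smr pa Bc Ba).cfg A ω t) i k).bla)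
      hd (ha₁.entered h1) (h2.trans_le (card_le_card ha₂.pair))
    grind

end Liveness

/-! ## Agreement on the output of the common subset protocol -/

section Agreement

theorem SlotState.C1v_unique {x : Slot} {ts} (hts : 2 * ts < n) {v w : Finset Tx}
    (hv : x.C1v ts v) (hw : x.C1v ts w) : v = w := by
  by_contra hne
  have hd : Disjoint (univ.filter fun j => (x.bc j).out = some v)
      (univ.filter fun j => (x.bc j).out = some w) :=
    disjoint_filter.2 fun j _ h h' => hne (some.inj (h.symm.trans h'))
  have := card_le_univ ((univ.filter fun j => (x.bc j).out = some v) ∪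
    (univ.filter fun j => (x.bc j).out = some w))
  grind [card_union_of_disjoint, Fintype.card_fin, C1v]

theorem SlotState.C2v_unique {x : Slot} {ta} {v w : Finset Tx}
    (hv : x.C2v ta v) (hw : x.C2v ta w) : v = w := by
  by_contra hne
  have hd : Disjoint (x.ones.filter fun j => (x.bc j).out = some v)
      (x.ones.filter fun j => (x.bc j).out = some w) :=
    disjoint_filter.2 fun j _ h h' => hne (some.inj (h.symm.trans h'))
  have := card_le_card (union_subset (filter_subset (fun j => (x.bc j).out = some v) x.ones)
    (filter_subset (fun j => (x.bc j).out = some w) x.ones))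
  rw [card_union_of_disjoint hd] at this
  have h1 := hv.2.2
  have h2 := hw.2.2
  omega

theorem SlotState.C1v_ones {x : Slot} {ts} {v : Finset Tx} (hv : x.C1v ts v) :
    x.ones.card ≤ ts + (x.ones.filter fun j => (x.bc j).out = some v).card := by
  have h1 := card_filter_add_card_filter_not (s := x.ones) fun j => (x.bc j).out = some v
  have h2 := card_filter_add_card_filter_not (s := univ)
    fun j => (x.bc j).out = some v
  rw [card_univ, Fintype.card_fin] at h2
  have h3 := card_le_card (filter_subset_filter (fun j => ¬ (x.bc j).out = some v) (subset_univ x.ones))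
  grind [C1v]

theorem Justified.eq_of_C1v {x : Slot} (hts : pa.ta + 2 * pa.ts < n)
    {S : Finset (Finset Tx)} (h : Justified pa x S) {v : Finset Tx} (hv : x.C1v pa.ts v) :
    S = {v} := by
  have hC2 : n - pa.ta ≤ x.ones.card → (∀ j, (x.ba j).out.isSome) → x.C2v pa.ta v := fun h h' => by
    refine ⟨h, h', ?_⟩
    have := C1v_ones hv
    omega
  rcases h with ⟨w, hw, rfl⟩ | ⟨w, hw, rfl⟩ | ⟨h3, h2, -⟩
  · rw [C1v_unique (by omega) hw hv]
  · rw [C2v_unique hw (hC2 hw.1 hw.2.1)]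
  · exact absurd ⟨v, hC2 h3.1 h3.2.1⟩ h2

theorem Justified.unique {x y : Slot} (hones : x.ones = y.ones)
    (hbc : ∀ j ∈ x.ones, (x.bc j).out = (y.bc j).out) (hx : x.C3 pa.ta) (hy : y.C3 pa.ta)
    (hx' : ¬ x.C1 pa.ts) (hy' : ¬ y.C1 pa.ts) {S T : Finset (Finset Tx)} (hS : Justified pa x S)
    (hT : Justified pa y T) : S = T := by
  have hC2 : ∀ v, x.C2v pa.ta v ↔ y.C2v pa.ta v := fun v => by
    have : (x.ones.filter fun j => (x.bc j).out = some v) =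
        y.ones.filter fun j => (y.bc j).out = some v := by simp_all
    unfold C2v
    rw [this, hones]
    exact and_congr_right fun _ => and_congr_left fun _ => iff_of_true hx.2.1 hy.2.1
  rcases hS with ⟨v, hv, -⟩ | ⟨v, hv, rfl⟩ | ⟨-, h2, rfl⟩
  · exact absurd ⟨v, hv⟩ hx'
  · rcases hT with ⟨w, hw, -⟩ | ⟨w, hw, rfl⟩ | ⟨-, h2, -⟩
    · exact absurd ⟨w, hw⟩ hy'
    · grind [C2v_unique]
    · exact absurd ⟨v, (hC2 v).1 hv⟩ h2
  · rcases hT with ⟨w, hw, -⟩ | ⟨w, hw, rfl⟩ | ⟨-, -, rfl⟩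
    · exact absurd ⟨w, hw⟩ hy'
    · exact absurd ⟨w, (hC2 w).2 hw⟩ h2
    grind

open Filter in
/-- `x i t` is the state of one slot at party `i` at time `t`, and `H i` says that `i` is honest. If
the broadcasts and the Byzantine agreements of the slot do what they should, then the honest parties
agree on the output of the common subset protocol. -/
theorem acs_agreement (hts : pa.ta + 2 * pa.ts < n) {x : Fin n → ℕ → Slot}
    {H : Fin n → Prop} (hinv : ∀ i t, SlotInv pa i (x i t))
    (hadv : ∀ i s t, s ≤ t → Advanced (x i s) (x i t))
    (hstar : ∀ i, H i → ∃ t B, (x i t).star = some B)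
    (hBC : ∀ j, (∀ i v, H i → ¬ ∃ t, ((x i t).bc j).out = some v) ∨
      ∃ v, ∀ i, H i → ∃ t, ((x i t).bc j).out = some v)
    (hAC : ∀ j, (∀ i, H i → ∀ t, ¬ (x i t).C1 pa.ts) → (∀ i, H i → ∃ t v, ((x i t).ba j).inp = some v) →
      ∃ v, ∀ i, H i → ∃ t, ((x i t).ba j).out = some v)
    (hAI : ∀ j q t, H q → ((x q t).ba j).out = some true → ∃ i, H i ∧ ∃ t, ((x i t).ba j).inp = some true)
    {p q : Fin n} (hp : H p) (hq : H q) {t : ℕ} {S : Finset (Finset Tx)}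
    (hS : (x p t).acs = some S) : ∃ s, (x q s).acs = some S := by
  have ev : ∀ {i s} {Q : Slot → Prop}, Q (x i s) →
      (∀ y, Advanced (x i s) y → Q y) → ∀ᶠ t in atTop, Q (x i t) := fun {i s Q} _ h =>
    eventually_atTop.2 ⟨s, fun t ht => h _ (hadv i s t ht)⟩
  have evBc : ∀ {i s j v}, ((x i s).bc j).out = some v →
      ∀ᶠ t in atTop, ((x i t).bc j).out = some v := fun {i s j v} h =>
    ev (Q := fun y => (y.bc j).out = some v) h fun y hy => hy.later.bc_out _ _ h
  have evBa : ∀ {i s j v}, ((x i s).ba j).out = some v →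
      ∀ᶠ t in atTop, ((x i t).ba j).out = some v := fun {i s j v} h =>
    ev (Q := fun y => (y.ba j).out = some v) h fun y hy => hy.later.ba_out _ _ h
  have evStar : ∀ i, H i → ∀ᶠ t in atTop, (x i t).star.isSome := fun i hi => by
    obtain ⟨s, B, h⟩ := hstar i hi
    exact (ev (Q := fun y => y.star = some B) h fun y hy => hy.star _ h).mono fun t h => by rw [h]; rfl
  have hB : ∀ {i i' s j v}, H i → H i' → ((x i s).bc j).out = some v →
      ∀ᶠ t in atTop, ((x i' t).bc j).out = some v := by
    intro i i' s j v hi hi' h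
    rcases hBC j with h' | ⟨w, hw⟩
    · grind
    · obtain ⟨t, ht⟩ := hw i hi
      obtain ⟨r, h1, h2⟩ := ((evBc h).and (evBc ht)).exists
      obtain rfl := some.inj (h1.symm.trans h2)
      grind
  have evJ : ∀ {i s S}, (x i s).acs = some S → ∀ᶠ t in atTop, Justified pa (x i t) S := fun {i s S} h => by
      have := (hinv i s).core.just S h
      exact ev (Q := fun y => Justified pa y S) this fun y hy => hy.later.justified this
  by_cases hC : ∃ i, H i ∧ ∃ t, (x i t).C1 pa.ts
  · obtain ⟨i₀, hi₀, t₀, v, hv⟩ := hC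
    have evC : ∀ i, H i → ∀ᶠ t in atTop, (x i t).C1v pa.ts v := fun i hi => by
      have : ∀ᶠ t in atTop, ∀ j, ((x i₀ t₀).bc j).out = some v → ((x i t).bc j).out = some v := by
        refine eventually_all.2 fun j => ?_
        by_cases h : ((x i₀ t₀).bc j).out = some v
        · exact (hB hi₀ hi h).mono fun t h _ => h
        · exact .of_forall fun t h' => absurd h' h
      refine this.mono fun t h => le_trans hv (card_le_card fun j hj => ?_)
      grind
    have h1 : S = {v} := by
      obtain ⟨r, h1, h2⟩ := ((evC p hp).and (evJ hS)).exists
      exact h2.eq_of_C1v hts h1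
    obtain ⟨s, h2, h3⟩ := ((evC q hq).and (evStar q hq)).exists
    obtain ⟨S', hS'⟩ := isSome_iff_exists.1 (((hinv q s).settled h3).exit (.inl ⟨v, h2⟩))
    exact ⟨s, by rw [hS', h1, ((hinv q s).core.just S' hS').eq_of_C1v hts h2]⟩
  · have hno := fun i hi t h => hC ⟨i, hi, t, h⟩
    obtain ⟨hones, hall⟩ : n - pa.ta ≤ (x p t).ones.card ∧ ∀ j, ((x p t).ba j).out.isSome := by
      rcases (hinv p t).core.just S hS with ⟨v, hv, -⟩ | ⟨v, hv, -⟩ | ⟨h3, -, -⟩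
      · exact absurd ⟨v, hv⟩ (hno p hp t)
      · exact ⟨hv.1, hv.2.1⟩
      · exact ⟨h3.1, h3.2.1⟩
    have h1 : ∀ j ∈ (x p t).ones, ∃ v, ∀ i, H i → ∀ᶠ s in atTop, ((x i s).bc j).out = some v := by
      intro j hj
      obtain ⟨i', hi', s, hs⟩ := hAI j p t hp (Finset.mem_filter.1 hj).2
      obtain ⟨v, hv⟩ := isSome_iff_exists.1 ((hinv i' s).core.one j hs)
      exact ⟨v, fun i hi => hB hi' hi hv⟩
    have h2 : ∀ j, (∀ i, H i → ∃ s, ((x i s).ba j).inp.isSome) → ∀ i, H i →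
        ∀ᶠ s in atTop, ((x i s).ba j).out = ((x p t).ba j).out := by
      intro j hj i hi
      obtain ⟨v, hv⟩ := hAC j hno fun i hi => (hj i hi).imp fun s h => isSome_iff_exists.1 h
      obtain ⟨w, hw⟩ := isSome_iff_exists.1 (hall j)
      obtain ⟨s, hs⟩ := hv p hp
      obtain ⟨r, h1, h2⟩ := ((evBa hw).and (evBa hs)).exists
      obtain ⟨s, hs⟩ := hv i hi
      grind
    have h3 : ∀ i, H i → ∀ᶠ s in atTop, ∀ j ∈ (x p t).ones, ((x i s).ba j).out = some true := by
      refine fun i hi => (Finset.eventually_all _).2 fun j hj => ?_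
      rw [← (Finset.mem_filter.1 hj).2]
      refine h2 j (fun i hi => ?_) i hi
      obtain ⟨v, hv⟩ := h1 j hj
      obtain ⟨s, h4, h5⟩ := ((hv i hi).and (evStar i hi)).exists
      exact ⟨s, ((hinv i s).settled h5).ones (hno i hi s) j (by rw [h4]; rfl)⟩
    have h4 : ∀ i, H i → ∀ᶠ s in atTop, ∀ j, ((x i s).ba j).out = ((x p t).ba j).out := by
      refine fun i hi => eventually_all.2 fun j => h2 j (fun i hi => ?_) i hi
      obtain ⟨s, h4, h5⟩ := ((h3 i hi).and (evStar i hi)).exists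
      refine ⟨s, ((hinv i s).settled h5).zeros (hno i hi s) (hones.trans (card_le_card fun j hj => ?_)) j⟩
      exact mem_filter.2 ⟨mem_univ j, h4 j hj⟩
    choose! val hval using h1
    have h5 : ∀ i, H i → ∀ᶠ s in atTop, (x i s).ones = (x p t).ones ∧ (x i s).C3 pa.ta ∧
        (∀ j ∈ (x p t).ones, ((x i s).bc j).out = some (val j)) ∧ (x i s).acs.isSome := by
      intro i hi
      have : ∀ᶠ s in atTop, ∀ j ∈ (x p t).ones, ((x i s).bc j).out = some (val j) :=
        (Finset.eventually_all _).2 fun j hj => hval j hj i hi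
      filter_upwards [h4 i hi, this, evStar i hi] with s h6 h7 h8
      have h9 := ones_congr h6
      have h10 : (x i s).C3 pa.ta := by
        refine ⟨by rwa [h9], fun j => by grind, fun j hj => ?_⟩
        grind
      exact ⟨h9, h10, h7, ((hinv i s).settled h8).exit (.inr (.inr h10))⟩
    obtain ⟨r, ⟨a1, a2, a3, -⟩, a4⟩ := ((h5 p hp).and (evJ hS)).exists
    obtain ⟨s, b1, b2, b3, b4⟩ := (h5 q hq).exists
    obtain ⟨S', hS'⟩ := isSome_iff_exists.1 b4
    refine ⟨s, hS'.trans (congrArg some ?_)⟩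
    exact Justified.unique (b1.trans a1.symm) (fun j hj => by grind) b2 a2 (hno q hq s) (hno p hp r)
      ((hinv q s).core.just S' hS') a4

end Agreement

section AsyncConsistency

/-- The broadcasts of a slot run as they should, if all honest parties begin the common subset
protocol. -/
theorem rruns_bc {b} (hA : (SMR).AtMost b A ω) (hd : (SMR).EventualDelivery A ω) (k)
    (hstar : ∀ i, (SMR).Honest A ω i → ∃ t B, (slotAt (cf t) i k).star = some B) (j) :
    RRuns b ((guestBc Bc Ba pa k j).cfg A ω) ∧ RSender ((guestBc Bc Ba pa k j).cfg A ω) j := by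
  have hG := guestBc_lawful (Bc := Bc) (Ba := Ba) pa k j
  refine ⟨rruns hG hA hd (fun _ _ _ _ => trivial) fun i hi => ?_, fun i x hx => ?_⟩
  · obtain ⟨t, B, h⟩ := hstar i hi
    exact ⟨t, _, (slotInv A ω i k t).begun B h j⟩
  · obtain ⟨t, ht⟩ := (rbegins_iff hG i x).1 hx
    have ht : ((slotAt (cf t) i k).bc j).inp = some x := ht
    have hinv := slotInv A ω i k t
    cases hs : (slotAt (cf t) i k).star with
    | none =>
      rw [(hinv.idle hs).1 j] at ht
      cases ht
    | some B =>
      rw [hinv.begun B hs j] at ht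
      obtain rfl := some.inj ht
      by_cases h : j = i
      · simp [h]
      · simp [h, Ne.symm h]

theorem bc_out_iff (k j i v) : ROutputs ((guestBc Bc Ba pa k j).cfg A ω) i v ↔
      ∃ t, ((slotAt (cf t) i k).bc j).out = some v :=
  routputs_iff (guestBc_lawful pa k j) i v

def badBc (pa : Params) (A : Adversary (smr pa Bc Ba)) (b k : ℕ) (j : Fin n) : Set (smr pa Bc Ba).Rand :=
  {ω | (RRuns b ((guestBc Bc Ba pa k j).cfg A ω) ∧ RSender ((guestBc Bc Ba pa k j).cfg A ω) j) ∧
    ¬ RConsistent ((guestBc Bc Ba pa k j).cfg A ω)}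

def badBa (pa : Params) (A : Adversary (smr pa Bc Ba)) (b k : ℕ) (j : Fin n) : Set (smr pa Bc Ba).Rand :=
  {ω | RRuns b ((guestBa Bc Ba pa k j).cfg A ω) ∧ ¬ RAgree ((guestBa Bc Ba pa k j).cfg A ω)}

/-- The events in which a Byzantine agreement outputs 1 although no honest party had input 1. -/
def badInput (pa : Params) (A : Adversary (smr pa Bc Ba)) (b k : ℕ)
    (z : Fin n × Fin n × Finset (Fin n)) : Set (smr pa Bc Ba).Rand :=
  {ω | (z.2.2.card ≤ b ∧ z.2.1 ∉ z.2.2) ∧ ∃ t, ((guestBa Bc Ba pa k z.1).cfg A ω t).corrupted ⊆ z.2.2 ∧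
      (instAt ((guestBa Bc Ba pa k z.1).cfg A ω t) z.2.1).out = some true ∧
      ∀ i ∉ z.2.2, (instAt ((guestBa Bc Ba pa k z.1).cfg A ω t) i).inp ≠ some true}

theorem slotConsistent_of_acs {k} (h : ∀ p q, (SMR).Honest A ω p → (SMR).Honest A ω q → ∀ t S,
      (slotAt (cf t) p k).acs = some S → ∃ s, (slotAt (cf s) q k).acs = some S) :
    SlotConsistent SMR A ω k := by
  rintro p B hp ⟨t, ht⟩ q hq
  have ht : (slotAt (cf t) p k).block = some B := ht
  rw [(slotInv A ω p k t).core.block] at ht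
  obtain ⟨S, hS, hB⟩ := map_eq_some_iff.1 ht
  obtain ⟨s, hs⟩ := h p q hp hq t S hS
  refine ⟨s, ?_⟩
  change (slotAt (cf s) q k).block = some B
  rw [(slotInv A ω q k s).core.block, hs, map_some, hB]

theorem slotConsistent_async (hΔ : 0 < pa.Δ) (hle : pa.ta ≤ pa.ts) (hts : pa.ta + 2 * pa.ts < n)
    (hA : (SMR).AtMost pa.ta A ω) (has : (SMR).Async A ω) {k}
    (h1 : ∀ j, ω ∉ badBc pa A pa.ta k j) (h2 : ∀ j, ω ∉ badBa pa A pa.ta k j)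
    (h3 : ∀ z, ω ∉ badInput pa A pa.ta k z) : SlotConsistent SMR A ω k := by
  have hstar : ∀ i, (SMR).Honest A ω i → ∃ t B, (slotAt (cf t) i k).star = some B :=
    fun i hi => exists_star hΔ (by omega) hA has hi k
  refine slotConsistent_of_acs fun p q hp hq t S hS => ?_
  refine acs_agreement (x := fun i t => slotAt (cf t) i k) hts
    (fun i t => slotInv A ω i k t) (fun i s t hst => advanced A ω i k hst) hstar
    (fun j => ?_) (fun j hno hinp => ?_) (fun j q t hq hout => ?_) hp hq hS
  · have hG := guestBc_lawful (Bc := Bc) (Ba := Ba) pa k j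
    have := not_not.1 fun h => h1 j ⟨rruns_bc hA has.1 k hstar j, h⟩
    simpa [RConsistent, RAgree, rhonest_iff hG, bc_out_iff] using this
  · have hG := guestBa_lawful (Bc := Bc) (Ba := Ba) pa k j
    have hr : RRuns pa.ta ((guestBa Bc Ba pa k j).cfg A ω) :=
      rruns hG hA has.1 (fun i hi t _ h => hno i hi t h.2) hinp
    obtain ⟨v, hv⟩ := not_not.1 fun h => h2 j ⟨hr, h⟩
    exact ⟨v, fun i hi => (routputs_iff hG i v).1 (hv i ((rhonest_iff hG i).2 hi))⟩
  · have hG := guestBa_lawful (Bc := Bc) (Ba := Ba) pa k j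
    obtain ⟨t₀, ht₀⟩ := card_honest hA
    by_contra! hne
    refine h3 (j, q, (cf (max t t₀)).corrupted) ⟨⟨hA _, hq _⟩, (n + 1) * max t t₀, ?_, ?_, fun i hi => ?_⟩
    · grind [Sim.corrupted, sim]
    · rw [instAt_cfg hG]
      exact (advanced A ω q k (le_max_left t t₀)).later.ba_out j _ hout
    · rw [instAt_cfg hG]
      exact hne i (ht₀ i fun h => hi ((SMR).corrupted_mono ω A (le_max_right _ _) h)) _

end AsyncConsistency

/-! ## The part of a step that concerns block agreement -/

section BlaSteps

/-- Steps that have nothing to do with block agreement. -/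
structure Mute (x : Slot) (r : Slot × Mail) : Prop where
  entered : r.1.entered = x.entered
  pair : r.1.pair = x.pair
  bla : r.1.bla = x.bla
  star : r.1.star = x.star
  msg : ∀ d k m, (d, Msg.bla k m) ∉ r.2

theorem Mute.trans {x : Slot} {r r' : Slot × Mail}
    (h : Mute x r) (h' : Mute r.1 r') : Mute x (r'.1, r.2 ++ r'.2) :=
  ⟨h'.entered.trans h.entered, h'.pair.trans h.pair, h'.bla.trans h.bla, h'.star.trans h.star, fun d k m hm =>
    (mem_append.1 hm).elim (h.msg d k m) (h'.msg d k m)⟩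

theorem Mute.refl (x : Slot) : Mute x (x, []) := ⟨rfl, rfl, rfl, rfl, fun _ _ _ => not_mem_nil⟩

theorem mute_bcStep (ω) (x : Slot) (j) (e) : Mute x (x.bcStep i ω k j e) :=
  ⟨rfl, rfl, rfl, rfl, fun d k m hm => by simp [bcStep] at hm⟩

theorem mute_baStep (ω) (x : Slot) (j) (e) : Mute x (x.baStep i ω k j e) :=
  ⟨rfl, rfl, rfl, rfl, fun d k m hm => by simp [baStep] at hm⟩

theorem mute_forAll {f : Slot → Fin n → Slot × Mail}
    (h : ∀ y j, Mute y (f y j)) (x) : Mute x (forAll f x) := by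
  have : ∀ (l : List (Fin n)) (a : Slot × Mail), Mute x a →
      Mute x (l.foldl (fun a j => let r := f a.1 j; (r.1, a.2 ++ r.2)) a) := by
    intro l
    induction l with
    | nil => simp_all
    | cons j l ih => exact fun a ha => ih _ (ha.trans (h _ _))
  exact this _ _ (.refl x)

theorem mute_settle (ω) (x : Slot) : Mute x (x.settle pa i ω k) := by
  have h1 : Mute x (x.giveOnes pa i ω k) := by
    rw [giveOnes]
    split_ifs
    · exact .refl x
    · exact mute_forAll (fun y j => by split_ifs; exacts [mute_baStep _ _ _ _, .refl y]) x
  have h2 : ∀ x : Slot, Mute x (x.giveZeros pa i ω k) := by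
    intro x
    rw [giveZeros]
    split_ifs
    · exact .refl x
    · exact mute_forAll (fun y j => by split_ifs; exacts [mute_baStep _ _ _ _, .refl y]) x
  have h3 := h1.trans (h2 _)
  exact ⟨h3.entered, h3.pair, h3.bla, h3.star, h3.msg⟩

theorem mute_after (ω) {x} {r : Slot × Mail} (h : Mute x r) :
    Mute x ((after pa i ω k r).1, (after pa i ω k r).2.1) ∧
      (SlotState.after pa i ω k r).2.2 = [] := by grind [SlotState.after, mute_settle, Mute.trans]

/-- The reaction of block agreement in slot `k` to an event other than a tick. -/
def blaReact (i : Fin n) (k : ℕ) (e : Event n Tx (Msg Bc Ba) (ℕ × ℕ)) (b : BlaState n Tx) :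
    BlaState n Tx × List (Fin n × BlaMsg n Tx) :=
  match e with
  | .recv j (.bla k' m) => if k' = k then ({ b with log := b.log ++ [(j, m)] }, []) else (b, [])
  | .leader kl l => if kl.1 = k then b.onLeader i kl.2 l else (b, [])
  | _ => (b, [])

theorem smrStep_bla (ω) (s : Party) {e : Event n Tx (Msg Bc Ba) (ℕ × ℕ)} (he : e ≠ .tick) (k) :
    ((smrStep pa i ω s e).1.slot k).bla = (blaReact i k e (s.slot k).bla).1 ∧
      ((smrStep pa i ω s e).1.slot k).star = (s.slot k).star ∧
      ((smrStep pa i ω s e).1.slot k).entered = (s.slot k).entered ∧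
      (∀ d m, (d, Msg.bla k m) ∈ (smrStep pa i ω s e).2.1 ↔ (d, m) ∈ (blaReact i k e (s.slot k).bla).2) ∧
      (smrStep pa i ω s e).2.2 = [] := by
  have honslot : ∀ (k' : ℕ) (f : Slot → Slot × Effects Bc Ba),
      smrStep pa i ω s e = s.onSlot k' f → (∀ b, k ≠ k' → blaReact i k e b = (b, [])) →
      (f (s.slot k')).1.star = (s.slot k').star → (f (s.slot k')).1.entered = (s.slot k').entered →
      (f (s.slot k')).1.bla = (blaReact i k' e (s.slot k').bla).1 → (f (s.slot k')).2.2 = [] →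
      (∀ d k₁ m, (d, Msg.bla k₁ m) ∈ (f (s.slot k')).2.1 ↔
        k₁ = k' ∧ (d, m) ∈ (blaReact i k' e (s.slot k').bla).2) →
      ((smrStep pa i ω s e).1.slot k).bla = (blaReact i k e (s.slot k).bla).1 ∧
      ((smrStep pa i ω s e).1.slot k).star = (s.slot k).star ∧
      ((smrStep pa i ω s e).1.slot k).entered = (s.slot k).entered ∧
      (∀ d m, (d, Msg.bla k m) ∈ (smrStep pa i ω s e).2.1 ↔ (d, m) ∈ (blaReact i k e (s.slot k).bla).2) ∧
      (smrStep pa i ω s e).2.2 = [] := by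
    intro k' f h h0 h1 h2 h3 h4 h5
    rw [h, onSlot_slot, onSlot_eq]
    by_cases hk : k = k'
    · simp_all
    simp_all
  have hmute : ∀ (k' : ℕ) (f : Slot → Slot × Effects Bc Ba),
      smrStep pa i ω s e = s.onSlot k' f → (∀ k b, blaReact i k e b = (b, [])) →
      Mute (s.slot k') ((f (s.slot k')).1, (f (s.slot k')).2.1) → (f (s.slot k')).2.2 = [] → _ :=
    fun k' f h h0 h1 h2 => honslot k' f h (fun b _ => h0 k b) h1.star h1.entered
      (by rw [h0]; exact h1.bla) h2 fun d k₁ m => by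
        rw [h0]
        exact ⟨fun h => absurd h (h1.msg d k₁ m), fun h => absurd h.2 not_mem_nil⟩
  cases e with
  | input tx =>
    exact ⟨rfl, rfl, rfl, fun _ _ => ⟨fun h => absurd h not_mem_nil, fun h => absurd h not_mem_nil⟩, rfl⟩
  | recv j m =>
    cases m with
    | buf k' i' b =>
      refine honslot k' (fun x =>
        if i' = j ∧ x.pair.2.card ≤ pa.ts ∧ j ∉ x.pair.2.image Prod.fst then
          ({ x with pair := (x.pair.1 ∪ b, insert (j, b) x.pair.2) }, [], [])
        else (x, [], [])) rfl (fun _ _ => rfl) ?_ ?_ ?_ ?_ fun d k₁ m => ?_ <;> split_ifs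
      all_goals first
        | rfl
        | exact ⟨fun h => absurd h not_mem_nil, fun h => absurd h.2 not_mem_nil⟩
    | bla k' m =>
      refine honslot k' (fun x => ({ x with bla := { x.bla with log := x.bla.log ++ [(j, m)] } }, [], []))
        rfl (fun b hk => if_neg (Ne.symm hk)) rfl rfl ?_ rfl fun d k₁ m' => ?_
      · rw [blaReact, if_pos rfl]
      · rw [blaReact, if_pos rfl]
        grind
    | bc k' l m =>
      exact hmute k' (fun x => after pa i ω k' (x.bcStep i ω k' l (.inr (j, m)))) rfl (fun _ _ => rfl) (mute_after ω (mute_bcStep ω _ l _)).1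
        (mute_after ω (mute_bcStep ω _ l _)).2
    | ba k' l m =>
      refine hmute k' (fun x => if x.star.isSome ∧ x.C1 pa.ts then (x, [], [])
        else after pa i ω k' (x.baStep i ω k' l (.inr (j, m)))) rfl (fun _ _ => rfl) ?_ ?_ <;> split_ifs
      exacts [.refl _, (mute_after ω (mute_baStep ω _ l _)).1, rfl, (mute_after ω (mute_baStep ω _ l _)).2]
  | tick => simp_all
  | leader kl l =>
    refine honslot kl.1 (fun x => ({ x with bla := (x.bla.onLeader i kl.2 l).1 },
      (x.bla.onLeader i kl.2 l).2.map (fun y => (y.1, .bla kl.1 y.2)), [])) rfl (fun b hk => if_neg (Ne.symm hk)) rfl rfl ?_ rfl fun d k₁ m' => ?_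
    · rw [blaReact, if_pos rfl]
    · rw [blaReact, if_pos rfl, List.mem_map]
      grind

def Params.D (pa : Params) (k : ℕ) : ℕ := pa.T k + pa.Δ + pa.κ * pa.Δ

/-- The state of block agreement at a tick, after it was possibly begun. -/
def started (pa : Params) (k τ : ℕ) (x : Slot) : BlaState n Tx :=
  if ((if τ = pa.T k then true else x.entered) = true ∧ pa.ts < x.pair.2.card) ∧
      x.bla.start = none ∧ x.star = none ∧ pa.T k + pa.Δ ≤ τ ∧ τ < pa.D k
  then { x.bla with start := some τ, cur := ⟨0, x.pair, ∅⟩ } else x.bla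

def blaTick (pa : Params) (i : Fin n) (k τ : ℕ) (x : Slot) :
    BlaState n Tx × List (Fin n × BlaMsg n Tx) × List ℕ :=
  (started pa k τ x).tick pa.ts pa.Δ pa.κ (pa.D k) i τ

def tickStar (pa : Params) (i : Fin n) (k τ : ℕ) (x : Slot) : Option (Finset Tx) :=
  match x.star, (blaTick pa i k τ x).1.out.filter fun q => decide (Valid pa.ts q) with
  | some _, _ => none
  | none, some q => some q.1
  | none, none => if ((if τ = pa.T k then true else x.entered) = true ∧ pa.ts < x.pair.2.card) ∧
      pa.D k ≤ τ then some x.pair.1 else none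

theorem mem_tick_bla (ω) (buf : Finset Tx) (τ) (x : Slot) (d k₁) (m : BlaMsg n Tx) : (d, Msg.bla k₁ m) ∈ (x.tick pa i ω k buf τ).2.1 ↔
      k₁ = k ∧ (d, m) ∈ (blaTick pa i k τ x).2.1 := by
  have h : (d, Msg.bla k₁ m) ∉ (beginOp pa i k (tickCore (Bc := Bc) (Ba := Ba) pa i k buf τ x.entered
      x.pair x.bla x.star).2.2 ω { x with
        entered := (tickCore (Bc := Bc) (Ba := Ba) pa i k buf τ x.entered x.pair x.bla x.star).1.1
        bla := (tickCore (Bc := Bc) (Ba := Ba) pa i k buf τ x.entered x.pair x.bla x.star).1.2 }).2 := by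
    rw [beginOp.eq_def]
    split
    · exact ((mute_forAll (fun y j => mute_bcStep ω y j _) _).trans (mute_settle ω _)).msg d k₁ m
    simp_all
  rw [tick_eq]
  rw [List.mem_append, or_iff_left h]
  change (d, Msg.bla k₁ m) ∈ (if τ = pa.T k then toAll (Msg.buf k i buf) else []) ++
    (blaTick pa i k τ x).2.1.map (fun y => (y.1, Msg.bla k y.2)) ↔ _
  rw [List.mem_append, List.mem_map, or_iff_right]
  · grind
  grind [toAll]

theorem mem_tick_requests (ω) (buf : Finset Tx) (τ) (x : Slot)
    (kl : ℕ × ℕ) : kl ∈ (x.tick pa i ω k buf τ).2.2 ↔ kl.1 = k ∧ kl.2 ∈ (blaTick pa i k τ x).2.2 := by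
  rw [tick_eq]
  change kl ∈ (blaTick pa i k τ x).2.2.map (fun l => (k, l)) ↔ _
  grind

end BlaSteps

local notation "now" => slotAt (cfg (smr pa Bc Ba) A ω t) i k
local notation:max "sl" t:max => slotAt (cfg (smr pa Bc Ba) A ω t)
local notation:max "tu" k:max q:max => tickAt (smr pa Bc Ba) A ω (pa.unit k q)

section SyncSteps

/-- The reactions of block agreement between two ticks, with the messages sent. -/
inductive Hears (c : Config SMR) (ω : (SMR).Rand) (i : Fin n) (k : ℕ)
    (b : BlaState n Tx) : BlaState n Tx → List (Fin n × BlaMsg n Tx) → Prop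
  | idle : Hears c ω i k b b []
  | recv (j : Fin n) (m : BlaMsg n Tx) (h : (∃ q ∈ c.net, q.src = j ∧ q.dst = i ∧
      q.msg = (Msg.bla k m : Msg Bc Ba)) ∨ c.Injectable j (Msg.bla k m : Msg Bc Ba)) :
    Hears c ω i k b { b with log := b.log ++ [(j, m)] } []
  | leader (l : ℕ) : Hears c ω i k b (b.onLeader i l (ω.2 (k, l))).1 (b.onLeader i l (ω.2 (k, l))).2

theorem clockAt_eq {Δ} (h : (SMR).Sync Δ A ω) (hi : i ∉ (cf t).corrupted) :
    clockAt (cf t) i = (cf t).time := by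
  induction t with
  | zero => rfl
  | succ t ih =>
    have hi' : i ∉ (cf t).corrupted := fun h => hi ((SMR).corrupted_mono ω A t.le_succ h)
    rw [Protocol.cfg_succ]
    rcases Config.time_apply (ω := ω) (cf t) ((SMR).act A ω t) with ⟨⟨S, hS⟩, h1⟩ | ⟨h1, h2⟩
    · rw [h1, hS, clockAt_apply_tick _ _ _ (by rw [(h.1 t S hS).1]; simp_all) hi', ih hi']
    grind [clockAt_apply]

def stateAt (c : Config SMR) (i : Fin n) : Party := c.state i

variable (A ω) in
def eventAt (t : ℕ) : Event n Tx (Msg Bc Ba) (ℕ × ℕ) := ((cf t).event ω ((SMR).act A ω t)).2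

theorem smr_active (h : (cf t).Active ω ((SMR).act A ω t) i) (k) :
    sl (t + 1) i k = (smrStep pa i (tapeAt ω i) (stateAt (cf t) i) (eventAt A ω t)).1.slot k :=
  congrArg (fun s : Party => s.slot k) ((apply_smr ω _ _ i).trans (if_pos h))

theorem bla_event {e} (he : e ≠ .tick)
    (h : (cf t).event ω ((SMR).act A ω t) = ({i}, e)) (hi : i ∉ (cf t).corrupted) :
    (sl (t + 1) i k).bla = (blaReact i k e (now).bla).1 := by
  have he' : eventAt A ω t = e := congrArg Prod.snd h
  rw [smr_active ⟨by simp_all, hi⟩, he']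
  exact (smrStep_bla (tapeAt ω i) (stateAt (cf t) i) he k).1

variable {Δ : ℕ}

variable (A ω) in
def Emits (i : Fin n) (k t : ℕ) (ms : List (Fin n × BlaMsg n Tx)) (ls : List ℕ) : Prop :=
  (∀ d m s, (⟨i, d, .bla k m, s⟩ : Packet SMR) ∈ (cf (t + 1)).net ↔
    (⟨i, d, .bla k m, s⟩ : Packet SMR) ∈ (cf t).net ∨ s = (cf (t + 1)).time ∧ (d, m) ∈ ms) ∧
  ∀ l, i ∈ (cf (t + 1)).requests (k, l) ↔ i ∈ (cf t).requests (k, l) ∨ l ∈ ls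

theorem emits_of {ms ls} (hi : i ∉ (cf t).corrupted)
    (h1 : ∀ d m, (cf t).Active ω ((SMR).act A ω t) i ∧ (d, Msg.bla k m) ∈
      (smrStep pa i (tapeAt ω i) (stateAt (cf t) i) (eventAt A ω t)).2.1 ↔ (d, m) ∈ ms)
    (h2 : ∀ l, (cf t).Active ω ((SMR).act A ω t) i ∧ (k, l) ∈
      (smrStep pa i (tapeAt ω i) (stateAt (cf t) i) (eventAt A ω t)).2.2 ↔
        l ∈ ls) : Emits A ω i k t ms ls := by
  refine ⟨fun d m s => ?_, fun l => ?_⟩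
  · rw [Protocol.cfg_succ, Config.mem_apply_net, Config.apply_time, ← h1]
    refine or_congr_right ⟨?_, ?_⟩
    · rintro ⟨i', h, ⟨d', m'⟩, hx, heq⟩
      cases heq
      exact ⟨rfl, h, hx⟩
    · rintro ⟨rfl, h, hx⟩
      exact ⟨i, h, (d, .bla k m), hx, rfl⟩
  · rw [← h2]
    exact mem_apply_requests ((SMR).act A ω t) hi (k, l)

theorem slot_step (h : (SMR).Sync Δ A ω) (hi : i ∉ (cf t).corrupted) (k) : ∃ ms ls, Emits A ω i k t ms ls ∧
    ((ls = [] ∧ ((cf (t + 1)).time = (cf t).time ∨ (cf t).time < k ∧ (cf (t + 1)).time = (cf t).time + 1) ∧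
      Hears (cf t) ω i k (sl t i k).bla (sl (t + 1) i k).bla ms ∧
      (sl (t + 1) i k).star = (sl t i k).star ∧
      (sl (t + 1) i k).entered = (sl t i k).entered) ∨
    (t = tk (cf t).time ∧ (cf (t + 1)).time = (cf t).time + 1 ∧ k ≤ (cf t).time ∧
      (sl (t + 1) i k).bla = (blaTick pa i k (cf t).time (sl t i k)).1 ∧
      ms = (blaTick pa i k (cf t).time (sl t i k)).2.1 ∧
      ls = (blaTick pa i k (cf t).time (sl t i k)).2.2 ∧
      (sl (t + 1) i k).star = (tickStar pa i k (cf t).time (sl t i k) <|> (sl t i k).star) ∧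
      (sl (t + 1) i k).entered = if (cf t).time = pa.T k then true else (sl t i k).entered)) := by
  have hnt : ∀ {e : Event n Tx (Msg Bc Ba) (ℕ × ℕ)}, eventAt A ω t = e →
      e ≠ .tick → (cf t).Active ω ((SMR).act A ω t) i →
      (cf (t + 1)).time = (cf t).time := by
    intro e he he' hact
    rw [Protocol.cfg_succ]
    rcases Config.time_apply (ω := ω) (cf t) ((SMR).act A ω t) with ⟨⟨S, hS⟩, -⟩ | h2
    · rw [eventAt, hS] at he
      exact absurd he.symm he'
    omega
  by_cases hact : (cf t).Active ω ((SMR).act A ω t) i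
  · have hst := smr_active hact k
    have hem := fun ms ls => emits_of (k := k) (ms := ms) (ls := ls) hi
    simp only [hact, true_and] at hem
    generalize hE : eventAt A ω t = e at hst hem
    by_cases he : e = .tick
    · subst he
      obtain ⟨S, hS, hiS⟩ := event_tick hact.1 hE
      obtain ⟨β, -, h2, h3, h4⟩ := smrStep_tick pa i (tapeAt ω i) (stateAt (cf t) i)
      have hc : (stateAt (cf t) i).clock = (cf t).time := clockAt_eq h hi
      have htime : (cf (t + 1)).time = (cf t).time + 1 := by
        rw [Protocol.cfg_succ, hS, Config.apply_time]
        rfl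
      rw [hc] at h2 h3 h4
      by_cases hk : k ≤ (cf t).time
      · refine ⟨_, _, hem _ _ (fun d m => ?_) (fun l => ?_), .inr ⟨h.eq_tickAt hS, htime, hk, ?_,
          rfl, rfl, ?_, ?_⟩⟩
        · rw [h3, List.mem_flatMap]
          constructor
          · rintro ⟨k', -, hx⟩
            obtain ⟨rfl, hx⟩ := (mem_tick_bla _ _ _ _ _ _ _).1 hx
            exact hx
          · exact fun hx => ⟨k, List.mem_range.2 (Nat.lt_succ_of_le hk),
              (mem_tick_bla _ _ _ _ _ _ _).2 ⟨rfl, hx⟩⟩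
        · rw [h4, List.mem_flatMap]
          constructor
          · rintro ⟨k', -, hx⟩
            obtain ⟨rfl, hx⟩ := (mem_tick_requests _ _ _ _ _).1 hx
            exact hx
          · exact fun hx => ⟨k, List.mem_range.2 (Nat.lt_succ_of_le hk),
              (mem_tick_requests _ _ _ _ _).2 ⟨rfl, hx⟩⟩
        all_goals rw [hst, h2 k, if_pos hk]
        · exact (tick_spec _ _ _ (slotInv A ω i k t)).2.2.2.2.1
        · exact (tick_spec _ _ _ (slotInv A ω i k t)).2.2.2.2.2
        · exact (tick_spec _ _ _ (slotInv A ω i k t)).2.2.1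
      · have hs : sl (t + 1) i k = sl t i k := hst.trans ((h2 k).trans (if_neg hk))
        refine ⟨[], [], hem _ _ (fun d m => ?_) (fun l => ?_), .inl ⟨rfl, .inr ⟨not_le.1 hk, htime⟩,
          by rw [hs]; exact .idle, by rw [hs], by rw [hs]⟩⟩
        · grind [mem_tick_bla]
        grind [mem_tick_requests]
    · obtain ⟨h1, h2, h3, h4, h5⟩ := smrStep_bla (pa := pa) (tapeAt ω i) (stateAt (cf t) i) he k
      refine ⟨_, [], hem _ _ h4 (fun l => by simp_all), .inl ⟨rfl, .inl (hnt hE he hact), ?_,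
        by rwa [hst], by rwa [hst]⟩⟩
      rw [hst, h1]
      cases e with
      | recv j m =>
        cases m with
        | bla k' m =>
          by_cases hk : k' = k
          · subst hk
            simpa [blaReact] using .recv j m (event_recv hact.1 hE)
          · simpa [blaReact, if_neg hk] using .idle
        | _ => exact .idle
      | leader kl l =>
        by_cases hk : kl.1 = k
        · subst hk
          obtain rfl := (event_leader hact.1 hE).1
          simpa [blaReact] using .leader kl.2
        · simpa [blaReact, if_neg hk] using .idle
      | input tx => exact .idle
      | tick => simp_all
  · have hs : sl (t + 1) i k = sl t i k :=
      congrArg (fun s : Party => s.slot k) ((apply_smr ω _ _ i).trans (if_neg hact))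
    refine ⟨[], [], emits_of hi (by simp [hact]) (by simp [hact]), .inl ⟨rfl, .inl ?_,
      by rw [hs]; exact .idle, by rw [hs], by rw [hs]⟩⟩
    rw [Protocol.cfg_succ]
    rcases Config.time_apply (ω := ω) (cf t) ((SMR).act A ω t) with ⟨⟨S, hS⟩, -⟩ | h2
    · refine absurd ⟨?_, hi⟩ hact
      rw [hS]
      change i ∈ S
      rw [(h.1 t S hS).1]
      simp_all
    omega

end SyncSteps

/-! ## The timeline of block agreement -/

section BlaFacts

variable {n : ℕ} {Tx : Type}

/-- The state without the data that change between two ticks. -/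
def BlaState.core (b : BlaState n Tx) : BlaState n Tx := { b with log := [], known := fun _ => none }

/-- The state at the `q`th time unit of block agreement, after the end of the last iteration. -/
def finAt (s q : ℕ) (b : BlaState n Tx) : BlaState n Tx := if q % 5 = 0 ∧ 0 < q then b.finish s else b

structure Grows (b b' : BlaState n Tx) : Prop where
  log : b.log ⊆ b'.log
  known : ∀ l p, b.known l = some p → b'.known l = some p
  out : ∀ q, b.out = some q → b'.out = some q
  start : ∀ t, b.start = some t → b'.start = some t

theorem Grows.refl (b : BlaState n Tx) : Grows b b :=
  ⟨fun _ h => h, fun _ _ h => h, fun _ h => h, fun _ h => h⟩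

theorem Grows.trans {b b' b'' : BlaState n Tx} (h : Grows b b') (h' : Grows b' b'') : Grows b b'' :=
  ⟨fun _ hx => h'.log (h.log hx), fun l p hl => h'.known l p (h.known l p hl),
    fun q hq => h'.out q (h.out q hq), fun t ht => h'.start t (h.start t ht)⟩

variable (s : ℕ) (b : BlaState n Tx)

theorem finish_frame : (b.finish s).start = b.start ∧ (b.finish s).log = b.log ∧
    (b.finish s).known = b.known ∧ ∀ q, b.out = some q → (b.finish s).out = some q := by grind [BlaState.finish]

theorem finAt_frame (q) : (finAt s q b).start = b.start ∧ (finAt s q b).log = b.log ∧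
    (finAt s q b).known = b.known ∧ ∀ r, b.out = some r → (finAt s q b).out = some r := by grind [finAt, finish_frame]

theorem phase_frame (i k r) : (b.phase s i k r).1.start = b.start ∧
    (b.phase s i k r).1.log = b.log ∧ (b.phase s i k r).1.known = b.known ∧
    (b.phase s i k r).1.out = b.out ∧ (b.phase s i k r).1.cur = b.cur := by
  rcases r with _ | _ | _ | _ | _ | r
  iterate 4 exact ⟨rfl, rfl, rfl, rfl, rfl⟩
  · grind [BlaState.phase]
  · exact ⟨rfl, rfl, rfl, rfl, rfl⟩

variable {s b} {Δ κ deadline t₀ : ℕ} {i : Fin n}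

theorem tick_grows (τ) : Grows b (b.tick s Δ κ deadline i τ).1 ∧
    (b.tick s Δ κ deadline i τ).1.log = b.log ∧ (b.tick s Δ κ deadline i τ).1.known = b.known := by
  have of : ∀ b' : BlaState n Tx, b'.start = b.start ∧ b'.log = b.log ∧ b'.known = b.known ∧
      (∀ r, b.out = some r → b'.out = some r) → Grows b b' ∧ b'.log = b.log ∧ b'.known = b.known :=
    fun b' h => ⟨⟨by simp_all, fun l p hl => by simp_all, h.2.2.2,
      fun t ht => by rw [h.1, ht]⟩, h.2.1, h.2.2.1⟩
  rw [BlaState.tick.eq_def]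
  cases b.start with
  | none => simp_all
  | some t₀ =>
    dsimp only
    by_cases h2 : Δ ∣ τ - t₀ ∧ τ ≤ deadline
    · have h1 : ∀ (p : Prop) [Decidable p], (if p then b.finish s else b).start = b.start ∧
          (if p then b.finish s else b).log = b.log ∧
          (if p then b.finish s else b).known = b.known ∧
          ∀ r, b.out = some r → (if p then b.finish s else b).out = some r := fun p _ => by grind [finish_frame]
      obtain ⟨c1, c2, c3, c4⟩ := h1 ((τ - t₀) / Δ % 5 = 0 ∧ 0 < (τ - t₀) / Δ ∧ (τ - t₀) / Δ ≤ 5 * κ)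
      by_cases h3 : τ < deadline ∧ (τ - t₀) / Δ < 5 * κ
      · grind [phase_frame]
      · grind
    · rw [if_neg h2]
      simp_all

theorem tick_off (τ) (h : ∀ t₀, b.start = some t₀ → ¬ (Δ ∣ τ - t₀ ∧ τ ≤ deadline)) :
    b.tick s Δ κ deadline i τ = (b, [], []) := by
  rw [BlaState.tick]
  split
  · rfl
  · rw [if_neg (h _ ‹_›)]

theorem tick_on {q} (hΔ : 0 < Δ) (hs : b.start = some t₀) (hq : q ≤ κ) :
    b.tick s Δ κ (t₀ + κ * Δ) i (t₀ + q * Δ) =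
      if q < κ then (((finAt s q b).phase s i (q / 5 + 1) (q % 5)).1,
        ((finAt s q b).phase s i (q / 5 + 1) (q % 5)).2.1,
        if ((finAt s q b).phase s i (q / 5 + 1) (q % 5)).2.2 then [q / 5 + 1] else [])
      else (finAt s q b, [], []) := by
  have h1 : (t₀ + q * Δ - t₀) / Δ = q := by simp_all
  have h2 : (q % 5 = 0 ∧ 0 < q ∧ q ≤ 5 * κ) = (q % 5 = 0 ∧ 0 < q) := by
    rw [← and_assoc, eq_iff_iff, and_iff_left]
    omega
  have h3 : (t₀ + q * Δ < t₀ + κ * Δ ∧ q < 5 * κ) = (q < κ) := by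
    rw [Nat.add_lt_add_iff_left, Nat.mul_lt_mul_right hΔ, eq_iff_iff, and_iff_left_iff_imp]
    omega
  have h4 : Δ ∣ t₀ + q * Δ - t₀ ∧ t₀ + q * Δ ≤ t₀ + κ * Δ := ⟨by simp_all,
      Nat.add_le_add_left (Nat.mul_le_mul_right _ hq) _⟩
  simp only [BlaState.tick, hs, if_pos h4, h1, h2, h3]
  rfl

end BlaFacts

section Timeline

theorem started_cases (pa k τ) (x : Slot) : started pa k τ x = x.bla ∨ x.bla.start = none ∧
      started pa k τ x = { x.bla with start := some τ, cur := ⟨0, x.pair, ∅⟩ } := by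
  rw [started]
  by_cases h : ((if τ = pa.T k then true else x.entered) = true ∧ pa.ts < x.pair.2.card) ∧
      x.bla.start = none ∧ x.star = none ∧ pa.T k + pa.Δ ≤ τ ∧ τ < pa.D k
  · simp_all
  simp_all

theorem Hears.grows {c : Config SMR} {b b' : BlaState n Tx}
    {ms : List (Fin n × BlaMsg n Tx)} (h : Hears c ω i k b b' ms) : Grows b b' ∧ b'.core = b.core := by
  cases h with
  | idle => exact ⟨.refl b, rfl⟩
  | recv j m h => exact ⟨⟨subset_append_left _ _, fun _ _ h => h, fun _ h => h, fun _ h => h⟩, rfl⟩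
  | leader l =>
    by_cases h : b.known l = none
    · rw [BlaState.onLeader, if_pos h]
      refine ⟨⟨fun _ h => h, fun l' p hp => ?_, fun _ h => h, fun _ h => h⟩, rfl⟩
      grind
    · rw [BlaState.onLeader, if_neg h]
      exact ⟨.refl b, rfl⟩

theorem nc_of_le (hi : i ∉ (cf t).corrupted) {s} (hst : s ≤ t) : i ∉ (cf s).corrupted :=
  fun h => hi ((SMR).corrupted_mono ω A hst h)

variable (h : (smr pa Bc Ba).Sync pa.Δ A ω)
include h

theorem bla_grows (hi : i ∉ (cf t).corrupted) {s} (hst : s ≤ t) : Grows (sl s i k).bla (sl t i k).bla := by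
  induction t, hst using Nat.le_induction with
  | base => exact .refl _
  | succ t hst ih =>
    have hi' := nc_of_le hi t.le_succ
    refine (ih hi').trans ?_
    obtain ⟨ms, ls, -, ⟨-, -, h1, -⟩ | ⟨-, -, -, h1, -⟩⟩ := slot_step h hi' k
    · exact h1.grows.1
    · rw [h1]
      refine Grows.trans ?_ (tick_grows _).1
      rcases started_cases pa k (cf t).time (sl t i k) with h2 | ⟨h2, h3⟩
      · rw [h2]
        exact .refl _
      · rw [h3]
        exact ⟨fun _ h => h, fun _ _ h => h, fun _ h => h, fun t ht => by simp_all⟩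

theorem known_eq (hi : i ∉ (cf t).corrupted) {l p} (hp : (sl t i k).bla.known l = some p) :
    p = ω.2 (k, l) := by
  induction t with
  | zero => cases hp
  | succ t ih =>
    have hi' := nc_of_le hi t.le_succ
    obtain ⟨ms, ls, -, ⟨-, -, h1, -⟩ | ⟨-, -, -, h1, -⟩⟩ := slot_step h hi' k
    · generalize (sl (t + 1) i k).bla = b' at h1 hp
      cases h1 with
      | idle => simp_all
      | recv j m h => simp_all
      | leader l' =>
        by_cases h0 : (sl t i k).bla.known l' = none
        · rw [BlaState.onLeader, if_pos h0] at hp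
          grind
        · rw [BlaState.onLeader, if_neg h0] at hp
          simp_all
    grind [blaTick, tick_grows, started_cases]

theorem log_of_packet (hi : i ∉ (cf t).corrupted) {j m r s τ}
    (hp : (⟨j, i, .bla k m, s⟩ : Packet SMR) ∈ (cf r).net) (hr : r ≤ tk τ)
    (hs : s + pa.Δ ≤ τ + 1) (ht : tk τ ≤ t) : (j, m) ∈ (now).bla.log := by
  obtain ⟨s, h1, h2⟩ := h.delivered hp hr hs (nc_of_le hi ht)
  refine (bla_grows h hi (Nat.succ_le_of_lt (h1.trans_le ht))).log ?_
  rw [bla_event (e := .recv j (.bla k m)) (fun h => nomatch h) h2 (nc_of_le hi (h1.le.trans ht))]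
  simp [blaReact]

theorem before_start (hi : i ∉ (cf t).corrupted) (ht : (cf t).time ≤ pa.T k + pa.Δ) :
    ((sl t i k).bla.start = none ∧ (sl t i k).bla.out = none ∧
      (sl t i k).bla.called = false ∧ (sl t i k).bla.graded = none) ∧
      (sl t i k).star = none := by
  induction t with
  | zero => exact ⟨⟨rfl, rfl, rfl, rfl⟩, rfl⟩
  | succ t ih =>
    have hi' := nc_of_le hi t.le_succ
    obtain ⟨ms, ls, -, ⟨-, ht', h1, h2, -⟩ | ⟨-, ht', -, h1, -, -, h2, -⟩⟩ := slot_step h hi' k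
    · obtain ⟨⟨a1, a2, a3, a4⟩, a5⟩ := ih hi' (by omega)
      have hc := h1.grows.2
      refine ⟨⟨?_, ?_, ?_, ?_⟩, h2.trans a5⟩
      exacts [(congrArg BlaState.start hc).trans a1, (congrArg BlaState.out hc).trans a2,
        (congrArg BlaState.called hc).trans a3, (congrArg BlaState.graded hc).trans a4]
    · obtain ⟨⟨a1, a2, a3, a4⟩, a5⟩ := ih hi' (by omega)
      have h3 : blaTick pa i k (cf t).time (sl t i k) = ((sl t i k).bla, [], []) := by
        rw [blaTick, started, if_neg (by omega)]
        grind [tick_off]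
      rw [h1, h2, tickStar, h3, a5, a2, filter_none]
      rw [if_neg (by unfold Params.D; omega)]
      simp_all

end Timeline

section Phases

/-- The `q`th time unit of block agreement. -/
def Params.unit (pa : Params) (k q : ℕ) : ℕ := pa.T k + pa.Δ + q * pa.Δ

variable (A ω) in
/-- The state of block agreement after the tick at the `q`th time unit. -/
def post (k : ℕ) (i : Fin n) (q : ℕ) : BlaState n Tx := (sl ((tu k q) + 1) i k).bla

variable (A ω) in
/-- The state of block agreement in the `q`th time unit before the action of that unit. -/
def mid (k : ℕ) (i : Fin n) (q : ℕ) : BlaState n Tx :=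
  finAt pa.ts q (started pa k (pa.unit k q) (sl tu k q i k))

theorem pair_valid (t) : (∀ x ∈ (sl t i k).pair.2, x.2 ⊆ (sl t i k).pair.1) ∧
    ((sl t i k).pair.2.image Prod.fst).card = (sl t i k).pair.2.card := by
  refine (slotAt_induction (k := k) (i := i) (Q := fun x : Slot => SlotInv pa i x ∧
    (∀ y ∈ x.pair.2, y.2 ⊆ x.pair.1) ∧ (x.pair.2.image Prod.fst).card = x.pair.2.card) (fun x y hm hx => ?_)
    A ω t.zero_le ⟨slotInv_new, fun _ h => absurd h (notMem_empty _), rfl⟩).2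
  refine ⟨(hm.spec hx.1).1, ?_⟩
  have h0 : ∀ {y : Slot}, y.pair = x.pair → (∀ z ∈ y.pair.2, z.2 ⊆ y.pair.1) ∧
      (y.pair.2.image Prod.fst).card = y.pair.2.card := fun h => by grind
  cases hm with
  | buf j b h =>
    refine ⟨fun z hz => ?_, ?_⟩
    · rcases mem_insert.1 hz with rfl | hz
      · simp_all
      · exact (hx.2.1 z hz).trans subset_union_left
    · rw [image_insert, card_insert_of_notMem h.2, card_insert_of_notMem, hx.2.2]
      simp_all
  | bc ω l y => exact h0 (mute_after ω (mute_bcStep ω x l _)).1.pair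
  | ba ω l y => exact h0 (mute_after ω (mute_baStep ω x l _)).1.pair
  | tick ω buf τ => grind [tick_spec]
  | _ => exact h0 rfl

variable (h : (smr pa Bc Ba).Sync pa.Δ A ω) (hA : (smr pa Bc Ba).AtMost pa.ts A ω)
  (hts : 2 * pa.ts < n) (hΔ : 0 < pa.Δ) (hκ : 0 < pa.κ)

include h hA hts hΔ in
/-- All honest parties are ready when block agreement begins. -/
theorem ready (hi : i ∉ (cf (tk (pa.T k + pa.Δ))).corrupted) :
    (sl (tk (pa.T k + pa.Δ)) i k).entered = true ∧ Valid pa.ts (sl (tk (pa.T k + pa.Δ)) i k).pair ∧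
      pa.ts < (sl (tk (pa.T k + pa.Δ)) i k).pair.2.card := by
  obtain ⟨h1, h2, h3⟩ := h.time_tickAt (pa.T k)
  have hlt : tk (pa.T k) < tk (pa.T k + pa.Δ) := h.tickAt_lt (Nat.lt_add_of_pos_right hΔ)
  have hent := fun j (hj : j ∉ (cf (tk (pa.T k))).corrupted) =>
    enter hΔ hj ((clockAt_eq h hj).trans h1) h2 (mem_univ j)
  have hcard : pa.ts < (sl (tk (pa.T k + pa.Δ)) i k).pair.2.card := by
    by_contra hne
    have hsub : univ.filter ((SMR).Honest A ω) ⊆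
        (sl (tk (pa.T k + pa.Δ)) i k).pair.2.image Prod.fst := fun j hj => by
      obtain ⟨b, hb⟩ := (hent j ((Finset.mem_filter.1 hj).2 _)).2
      obtain ⟨s, h4, h5⟩ := h.delivered (hb i) hlt (by grind) hi
      have ha := (advanced A ω i k (Nat.succ_le_of_lt h4)).pair
      rcases pair_of_recv h5 (nc_of_le hi h4.le) with h6 | h6
      · grind
      · exact absurd (h6.trans_le (card_le_card ha)) hne
    have h4 := card_le_card hsub
    rw [(pair_valid _).2] at h4
    have := honest_card hA
    omega
  refine ⟨(advanced A ω i k hlt).entered (hent i (nc_of_le hi hlt.le)).1, ⟨?_, (pair_valid _).1⟩, hcard⟩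
  rwa [(pair_valid _).2]

include h in
/-- Between the time units, nothing happens except that messages and leaders become known. -/
theorem window (hi : i ∉ (cf t).corrupted) {q} (hq : tu k q < t)
    (hs : (post A ω k i q).start = some (pa.T k + pa.Δ))
    (hw : ∀ τ, pa.unit k q < τ → τ < (cf t).time → ¬ (pa.Δ ∣ τ - (pa.T k + pa.Δ) ∧ τ ≤ pa.D k)) :
    (sl t i k).bla.core = (post A ω k i q).core := by
  induction t, Nat.succ_le_of_lt hq using Nat.le_induction with
  | base => rfl
  | succ t ht ih =>
    have hi' := nc_of_le hi t.le_succ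
    have hm := time_mono (A := A) (ω := ω) t.le_succ
    have ih := ih hi' ht fun τ h1 h2 => hw τ h1 (h2.trans_le hm)
    refine Eq.trans ?_ ih
    obtain ⟨ms, ls, -, ⟨-, -, h1, -⟩ | ⟨-, h3, -, h1, -⟩⟩ := slot_step h hi' k
    · exact h1.grows.2
    · have hst : (sl t i k).bla.start = some (pa.T k + pa.Δ) := (congrArg BlaState.start ih).trans hs
      grind [started_cases, blaTick, tick_off, Sync.lt_time_iff]

theorem unit_succ (k q) : pa.unit k (q + 1) = pa.unit k q + pa.Δ := by
  unfold Params.unit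
  ring

theorem not_dvd_between {q τ} (h1 : pa.unit k q < τ) (h2 : τ < pa.unit k (q + 1)) :
    ¬ pa.Δ ∣ τ - (pa.T k + pa.Δ) := by
  rintro ⟨c, hc⟩
  have h3 : τ = pa.T k + pa.Δ + c * pa.Δ := by grind [Params.unit]
  subst h3
  have h4 := Nat.lt_of_mul_lt_mul_right (Nat.add_lt_add_iff_left.1 h1)
  have h5 := Nat.lt_of_mul_lt_mul_right (Nat.add_lt_add_iff_left.1 h2)
  omega

include h hΔ in
theorem post_tick {q} (hi : i ∉ (cf (tu k q)).corrupted) :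
    post A ω k i q = (blaTick pa i k (pa.unit k q) (sl tu k q i k)).1 ∧
    Emits A ω i k (tu k q) (blaTick pa i k (pa.unit k q) (sl tu k q i k)).2.1
      (blaTick pa i k (pa.unit k q) (sl tu k q i k)).2.2 := by
  obtain ⟨a1, -, a3⟩ := h.time_tickAt (pa.unit k q)
  obtain ⟨ms, ls, he, ⟨-, h3, -⟩ | ⟨-, -, -, h1, h2, h3, -⟩⟩ := slot_step h hi k
  · grind [le_T, Params.unit]
  · rw [a1] at h1 h2 h3
    exact ⟨h1, h2 ▸ h3 ▸ he⟩

include h hA hts hΔ hκ in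
theorem post_eq {q} (hq : q ≤ pa.κ) (hi : i ∉ (cf (tu k q)).corrupted) :
    (post A ω k i q).start = some (pa.T k + pa.Δ) ∧
    blaTick pa i k (pa.unit k q) (sl tu k q i k) =
      (if q < pa.κ then (((mid A ω k i q).phase pa.ts i (q / 5 + 1) (q % 5)).1,
        ((mid A ω k i q).phase pa.ts i (q / 5 + 1) (q % 5)).2.1,
        if ((mid A ω k i q).phase pa.ts i (q / 5 + 1) (q % 5)).2.2 then [q / 5 + 1] else [])
      else (mid A ω k i q, [], [])) ∧
    post A ω k i q = (blaTick pa i k (pa.unit k q) (sl tu k q i k)).1 := by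
  have h1 := (post_tick h hΔ hi).1
  suffices h2 : (started pa k (pa.unit k q) (sl tu k q i k)).start = some (pa.T k + pa.Δ) by
    have h3 : blaTick pa i k (pa.unit k q) (sl tu k q i k) = _ := tick_on (i := i) (s := pa.ts) hΔ h2 hq
    exact ⟨by rw [h1]; exact (tick_grows _).1.start _ h2, h3, h1⟩
  induction q with
  | zero =>
    have hu : pa.unit k 0 = pa.T k + pa.Δ := by simp [Params.unit]
    rw [hu] at hi ⊢
    obtain ⟨h2, -, h4⟩ := ready h hA hts hΔ hi
    obtain ⟨⟨h5, -⟩, h6⟩ := before_start h hi (k := k) (h.time_tickAt _).1.le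
    rw [started, if_pos]
    refine ⟨⟨by simp_all, h4⟩, h5, h6, le_rfl, ?_⟩
    exact Nat.lt_add_of_pos_right (Nat.mul_pos hκ hΔ)
  | succ q ih =>
    have hlt : tu k q < (tu k (q + 1)) := h.tickAt_lt (by rw [unit_succ]; omega)
    have hi' := nc_of_le hi hlt.le
    have h2 : (post A ω k i q).start = some (pa.T k + pa.Δ) := by
      have h1 := (post_tick h hΔ hi').1
      rw [h1]
      exact (tick_grows _).1.start _ (ih (by omega) hi' h1)
    have h3 := window h hi hlt h2 fun τ h4 h5 h6 =>
      not_dvd_between h4 (by rwa [(h.time_tickAt _).1] at h5) h6.1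
    have h4 := (congrArg BlaState.start h3).trans h2
    rwa [(started_cases pa k _ _).resolve_right fun h => by
      have := h.1.symm.trans h4
      cases this]

end Phases

section Iterations

variable (A ω) in
/-- A synchronous execution with at most `ts` corrupted parties. -/
structure SyncRun : Prop where
  sync : (SMR).Sync pa.Δ A ω
  atMost : (SMR).AtMost pa.ts A ω
  ts : 2 * pa.ts < n
  Δ : 0 < pa.Δ
  κ : 0 < pa.κ

theorem unit_le {q q'} (h : q ≤ q') : pa.unit k q ≤ pa.unit k q' :=
  Nat.add_le_add_left (Nat.mul_le_mul_right _ h) _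

variable (A ω i k) in
theorem mid_log (q) : (mid A ω k i q).log = (sl tu k q i k).bla.log ∧
      (mid A ω k i q).known = (sl tu k q i k).bla.known := by grind [mid, finAt_frame, started_cases]

variable (h : SyncRun A ω)
include h

theorem tk_le {q q'} (hq : q ≤ q') : tu k q ≤ (tu k q') := h.sync.tickAt_le (unit_le hq)

theorem tk_succ (q) : tu k q < (tu k (q + 1)) :=
  h.sync.tickAt_lt (by rw [unit_succ]; exact Nat.lt_add_of_pos_right h.Δ)

theorem post_start {q} (hq : q ≤ pa.κ) (hi : i ∉ (cf (tu k q)).corrupted) :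
    (post A ω k i q).start = some (pa.T k + pa.Δ) :=
  (post_eq h.sync h.atMost h.ts h.Δ h.κ hq hi).1

theorem core_of_unit (hi : i ∉ (cf t).corrupted) {q} (hq : q ≤ pa.κ) (h1 : tu k q < t)
    (h2 : (cf t).time ≤ pa.unit k (q + 1)) :
    (now).bla.core = (post A ω k i q).core :=
  window h.sync hi h1 (post_start h hq (nc_of_le hi h1.le)) fun _ h4 h5 h6 =>
    not_dvd_between h4 (h5.trans_le h2) h6.1

theorem mid_succ {q} (hq : q + 1 ≤ pa.κ) (hi : i ∉ (cf (tu k (q + 1))).corrupted) :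
    (sl tu k (q + 1) i k).bla.core = (post A ω k i q).core ∧
    mid A ω k i (q + 1) = finAt pa.ts (q + 1) (sl tu k (q + 1) i k).bla := by
  have h1 := core_of_unit h hi (by omega : q ≤ pa.κ) (tk_succ h q) (h.sync.time_tickAt _).1.le
  refine ⟨h1, ?_⟩
  rw [mid, (started_cases pa k _ _).resolve_right fun h2 => ?_]
  have h3 := (congrArg BlaState.start h1).trans
    (post_start h (Nat.le_of_succ_le hq) (nc_of_le hi (tk_succ h q).le))
  have := h2.1.symm.trans h3
  cases this

theorem mid_core {q} (hq : q + 1 ≤ pa.κ) (h5 : (q + 1) % 5 ≠ 0) (hi : i ∉ (cf (tu k (q + 1))).corrupted) :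
    (mid A ω k i (q + 1)).core = (post A ω k i q).core := by
  rw [(mid_succ h hq hi).2, finAt, if_neg fun h => h5 h.1]
  grind [mid_succ]

theorem mid_zero (hi : i ∉ (cf (tu k 0)).corrupted) :
    ∃ q, Valid pa.ts q ∧ (mid A ω k i 0).cur = ⟨0, q, ∅⟩ ∧ (mid A ω k i 0).out = none := by
  have hu : pa.unit k 0 = pa.T k + pa.Δ := by simp [Params.unit]
  obtain ⟨⟨h5, h6, -⟩, -⟩ := before_start h.sync hi (k := k) (by rw [(h.sync.time_tickAt _).1, hu])
  have hm : mid A ω k i 0 = started pa k (pa.unit k 0) (sl tu k 0 i k) := by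
    rw [mid, finAt, if_neg fun h => absurd h.2 (lt_irrefl 0)]
  have hs : (mid A ω k i 0).start = some (pa.T k + pa.Δ) := by
    obtain ⟨h1, h2, h3⟩ := post_eq h.sync h.atMost h.ts h.Δ h.κ (Nat.zero_le _) hi
    rwa [h3, h2, if_pos h.κ] at h1
  grind [started_cases, ready, SyncRun.sync, SyncRun.atMost, SyncRun.ts, SyncRun.Δ]

/-- The action at the `r`th time unit of iteration `L + 1`. -/
theorem post_phase {L r} (hr : r < 5) (hq : 5 * L + r < pa.κ) (hi : i ∉ (cf (tu k (5 * L + r))).corrupted) :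
    post A ω k i (5 * L + r) = ((mid A ω k i (5 * L + r)).phase pa.ts i (L + 1) r).1 ∧
      Emits A ω i k (tu k (5 * L + r)) ((mid A ω k i (5 * L + r)).phase pa.ts i (L + 1) r).2.1
        (if ((mid A ω k i (5 * L + r)).phase pa.ts i (L + 1) r).2.2 then [L + 1] else []) := by
  obtain ⟨-, h1, h2⟩ := post_eq h.sync h.atMost h.ts h.Δ h.κ hq.le hi
  have h3 := (post_tick h.sync h.Δ hi).2
  rw [if_pos hq, show (5 * L + r) / 5 = L by omega, show (5 * L + r) % 5 = r by omega] at h1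
  simp_all

theorem post_state {L r} (hr : r < 5) (hq : 5 * L + r < pa.κ) (hi : i ∉ (cf (tu k (5 * L + r))).corrupted) :
    (post A ω k i (5 * L + r)).iter = L + 1 ∧ (post A ω k i (5 * L + r)).cur = (post A ω k i (5 * L)).cur ∧
      ((post A ω k i (5 * L + r)).called = true ↔ 3 ≤ r) ∧
      (r < 4 → (post A ω k i (5 * L + r)).graded = none) ∧
      (2 ≤ r → (post A ω k i (5 * L + r)).prop = (post A ω k i (5 * L + 2)).prop) ∧
      (3 ≤ r → (post A ω k i (5 * L + r)).res = (post A ω k i (5 * L + 3)).res) := by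
  induction r with
  | zero =>
    have hp := (post_phase h hr hq hi).1
    grind [BlaState.phase]
  | succ r ih =>
    have hi' := nc_of_le hi (tk_le h (by omega : 5 * L + r ≤ 5 * L + (r + 1)))
    obtain ⟨a1, a2, a3, a4, a5, a6⟩ := ih (by omega) (by omega) hi'
    have hc := mid_core h (q := 5 * L + r) (by omega) (by omega) hi
    have hc' := hc
    have b1 : (mid A ω k i (5 * L + (r + 1))).iter = (post A ω k i (5 * L + r)).iter :=
      (congrArg BlaState.iter hc' :)
    have b2 : (mid A ω k i (5 * L + (r + 1))).cur = (post A ω k i (5 * L + r)).cur :=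
      (congrArg BlaState.cur hc' :)
    have b3 : (mid A ω k i (5 * L + (r + 1))).called = (post A ω k i (5 * L + r)).called :=
      (congrArg BlaState.called hc' :)
    have b4 : (mid A ω k i (5 * L + (r + 1))).graded = (post A ω k i (5 * L + r)).graded :=
      (congrArg BlaState.graded hc' :)
    have b5 : (mid A ω k i (5 * L + (r + 1))).prop = (post A ω k i (5 * L + r)).prop :=
      (congrArg BlaState.prop hc' :)
    have b6 : (mid A ω k i (5 * L + (r + 1))).res = (post A ω k i (5 * L + r)).res :=
      (congrArg BlaState.res hc' :)
    rw [← b1] at a1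
    rw [← b2] at a2
    rw [← b3] at a3
    rw [← b4] at a4
    rw [← b5] at a5
    have hp := (post_phase h hr hq hi).1
    rcases r with _ | _ | _ | _ | r
    · rw [hp]
      exact ⟨a1, a2, a3.trans (by omega), fun _ => a4 (by omega), fun h => by omega, fun h => by omega⟩
    · refine ⟨?_, ?_, ?_, fun _ => ?_, fun _ => rfl, fun h => by omega⟩ <;> rw [hp]
      exacts [a1, a2, a3.trans (by omega), a4 (by omega)]
    · refine ⟨?_, ?_, ?_, fun _ => ?_, fun _ => ?_, fun _ => rfl⟩ <;> rw [hp]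
      exacts [a1, a2, iff_of_true rfl le_rfl, a4 (by omega), a5 (by omega)]
    · grind [BlaState.phase]
    · omega

/-- Where in the timeline a configuration is. -/
theorem exists_unit (h1 : pa.T k + pa.Δ < (cf t).time) (h2 : (cf t).time ≤ pa.D k) :
    ∃ q < pa.κ, (tu k q) < t ∧ (cf t).time ≤ pa.unit k (q + 1) := by
  obtain ⟨c, hc⟩ := Nat.exists_eq_add_of_lt h1
  have h3 := Nat.div_add_mod c pa.Δ
  have h4 := Nat.mod_lt c h.Δ
  have h5 : pa.unit k (c / pa.Δ) = pa.T k + pa.Δ + pa.Δ * (c / pa.Δ) := by grind [Params.unit]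
  refine ⟨c / pa.Δ, ?_, (h.sync.lt_time_iff _ _).1 ?_, ?_⟩
  · rw [Nat.div_lt_iff_lt_mul h.Δ]
    grind [Params.D]
  · omega
  grind [unit_succ]

theorem tick_cases (hi : i ∉ (cf t).corrupted) (h2 : (cf t).time < pa.D k) :
    (blaTick pa i k (cf t).time now = ((now).bla, [], [])) ∨ ∃ q < pa.κ, (cf t).time = pa.unit k q := by
  rcases lt_trichotomy (cf t).time (pa.T k + pa.Δ) with h1 | h1 | h1
  · rw [blaTick, started, if_neg (by omega)]
    grind [tick_off, before_start, SyncRun.sync]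
  · exact .inr ⟨0, h.κ, by simp [Params.unit, h1]⟩
  · obtain ⟨q, hq, h3, h4⟩ := exists_unit h h1 h2.le
    rcases h4.eq_or_lt with h4 | h4
    · grind [Params.unit, Params.D]
    · left
      have h5 := (congrArg BlaState.start (core_of_unit h hi hq.le h3 h4.le)).trans
        (post_start h hq.le (nc_of_le hi h3.le))
      rw [blaTick, (started_cases pa k _ _).resolve_right fun h => by
        have := h.1.symm.trans h5
        cases this]
      refine tick_off _ fun t₀ ht₀ hd => ?_
      obtain rfl := some.inj (h5.symm.trans ht₀)
      exact not_dvd_between ((h.sync.lt_time_iff _ _).2 h3) h4 hd.1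

end Iterations

/-! ## Signatures of honest parties in block agreement -/

section Sound

variable {G G' : Sig Bc Ba → Prop} {s : ℕ} {b : BlaState n Tx}

/-- All signatures in the state have the property `G`, which signatures on buffers have. -/
structure Sound (G : Sig Bc Ba → Prop) (k : ℕ) (b : BlaState n Tx) : Prop where
  log : ∀ x ∈ b.log, ∀ σ ∈ blaSigs k x.2, G σ
  cur : ∀ σ ∈ certSigs k b.cur.pair b.cur.cert, G σ
  graded : ∀ v, b.graded = some v → ∀ σ ∈ certSigs k v.pair v.cert, G σ

theorem Sound.mono (h : Sound G k b) (hG : ∀ σ, G σ → G' σ) : Sound G' k b :=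
  ⟨fun x hx σ hσ => hG σ (h.log x hx σ hσ), fun σ hσ => hG σ (h.cur σ hσ),
    fun v hv σ hσ => hG σ (h.graded v hv σ hσ)⟩

theorem mem_of_statusOf {l p j v} (h : b.statusOf s l p j = some v) :
    (j, BlaMsg.status l p j v) ∈ b.log ∧ v.Good s := by
  obtain ⟨⟨j', m⟩, hx, h2⟩ := exists_of_findSome?_eq_some h
  grind

theorem mem_of_proposalOf {l p} {m : Proposal n Tx} (h : b.proposalOf s l p = some m) :
    (p, BlaMsg.propose l p m) ∈ b.log ∧ GoodProposal s m := by
  obtain ⟨⟨j', m⟩, hx, h2⟩ := exists_of_findSome?_eq_some h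
  grind

theorem mem_of_notified {l v} (h : b.notified s l = some v) :
    v.k = l ∧ Valid s v.pair ∧ IsCert l v.cert ∧ ∃ j, (j, BlaMsg.notify l v.pair v.cert) ∈ b.log := by
  obtain ⟨⟨j', m⟩, hx, h2⟩ := exists_of_findSome?_eq_some h
  grind

theorem Sound.finAt (h : Sound G k b) (q) : Sound G k (finAt s q b) := by
  rw [NetSMR.finAt, BlaState.finish]
  split_ifs
  · split
    · exact ⟨h.log, h.graded _ ‹_›, h.graded⟩
    · split
      · obtain ⟨-, -, -, j, hj⟩ := mem_of_notified ‹_›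
        exact ⟨h.log, fun σ hσ => h.log _ hj σ (.inr hσ), h.graded⟩
      · exact h
  · exact h

theorem Sound.phase (h : Sound G k b) (hbuf : ∀ q σ, σ ∈ pairSigs k q → G σ) {l r}
    (h0 : r = 0 → ∀ p, G (.status k l p i b.cur))
    (h1 : r = 1 → G (.propose k l i fun j => b.statusOf s l i j))
    (h3 : r = 3 → ∀ q, (b.phase s i l 3).1.leaderPair = some q → G (.commit k b.iter i q)) :
    Sound G k (b.phase s i l r).1 ∧ ∀ x ∈ (b.phase s i l r).2.1, ∀ σ ∈ blaSigs k x.2, G σ := by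
  have hq : ∀ q, (b.leaderPair = some q ∧ r = 4) → ∀ σ ∈ certSigs k q
      ((univ.filter fun j : Fin n => (j, BlaMsg.commit l j q) ∈ b.log).image fun j => (j, l)), G σ := by
    rintro q - σ ⟨x, hx, rfl⟩
    obtain ⟨j, hj, rfl⟩ := Finset.mem_image.1 hx
    exact h.log _ (Finset.mem_filter.1 hj).2 _ (Set.mem_insert _ _)
  rcases r with _ | _ | _ | _ | _ | r
  · refine ⟨⟨h.log, h.cur, fun v hv => nomatch hv⟩, fun x hx σ hσ => ?_⟩
    obtain ⟨p, -, rfl⟩ := mem_map.1 hx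
    rcases hσ with rfl | hσ | hσ
    exacts [h0 rfl p, hbuf _ σ hσ, h.cur σ hσ]
  · refine ⟨h, fun x hx σ hσ => ?_⟩
    simp only [BlaState.phase] at hx
    split_ifs at hx
    · obtain ⟨j, -, rfl⟩ := mem_map.1 hx
      rcases hσ with rfl | ⟨j, v, hv, hσ⟩
      · exact h1 rfl
      · exact h.log _ (mem_of_statusOf hv).1 σ (hσ.imp id id)
    · cases hx
  · refine ⟨⟨h.log, h.cur, h.graded⟩, fun x hx σ hσ => ?_⟩
    obtain ⟨p, -, hx⟩ := mem_flatMap.1 hx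
    split at hx
    · obtain ⟨j, -, rfl⟩ := mem_map.1 hx
      exact h.log _ (mem_of_proposalOf ‹_›).1 σ hσ
    · cases hx
  · refine ⟨⟨h.log, h.cur, h.graded⟩, fun x hx σ hσ => ?_⟩
    simp [BlaState.phase, BlaState.commits] at hx
    split at hx
    · obtain ⟨j, -, rfl⟩ := mem_map.1 hx
      rcases hσ with rfl | hσ
      exacts [h3 rfl _ ‹_›, hbuf _ σ hσ]
    · cases hx
  · simp only [BlaState.phase]
    split
    · simp_all
    · split_ifs
      · refine ⟨⟨h.log, h.cur, fun v hv => ?_⟩, fun x hx σ hσ => ?_⟩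
        · grind
        · obtain ⟨j, -, rfl⟩ := mem_map.1 hx
          exact hσ.elim (hbuf _ σ) (hq _ ⟨‹_›, rfl⟩ σ)
      grind
  · exact ⟨h, fun x hx => nomatch hx⟩

end Sound

section Signatures

variable (A ω) in
/-- The tuple with which party `i` begins iteration `L + 1`. -/
def curAt (k : ℕ) (i : Fin n) (L : ℕ) : Vote n Tx := (post A ω k i (5 * L)).cur

variable (A ω) in
/-- What party `i` proposes in iteration `L + 1`. -/
def propAt (k : ℕ) (i : Fin n) (L : ℕ) : Proposal n Tx := fun j =>
  (mid A ω k i (5 * L + 1)).statusOf pa.ts (L + 1) i j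

variable (A ω) in
/-- The result of the proposal protocol with proposer `p` in iteration `L + 1`. -/
def resAt (k : ℕ) (i : Fin n) (L : ℕ) (p : Fin n) : Option (SPair n Tx) := (post A ω k i (5 * L + 3)).res p

variable (A ω) in
/-- A signature in block agreement of slot `k` is that of a corrupted party, or was made according
to the protocol. -/
def Gen (k t : ℕ) : Sig Bc Ba → Prop
  | .status k' l _ i v => k' = k → i ∈ (cf t).corrupted ∨ ∃ L, l = L + 1 ∧ v = curAt A ω k i L
  | .propose k' l p m => k' = k → p ∈ (cf t).corrupted ∨ ∃ L, l = L + 1 ∧ m = propAt A ω k p L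
  | .commit k' l i q => k' = k → i ∈ (cf t).corrupted ∨ ∃ L, l = L + 1 ∧
      pa.unit k (5 * L + 3) < (cf t).time ∧ resAt A ω k i L (ω.2 (k, L + 1)) = some q
  | _ => True

theorem Gen.mono {s} (hst : s ≤ t) {σ} (h : Gen A ω k s σ) : Gen A ω k t σ := by
  have hc := (SMR).corrupted_mono ω A hst
  have ht := time_mono (A := A) (ω := ω) hst
  cases σ with
  | status => exact fun e => (h e).imp (@hc _) id
  | propose => exact fun e => (h e).imp (@hc _) id
  | commit => exact fun e => (h e).imp (@hc _) fun ⟨L, h1, h2, h3⟩ => ⟨L, h1, h2.trans_le ht, h3⟩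
  | _ => trivial

theorem gen_pairSigs (q) {k'} (σ) (h : σ ∈ pairSigs k' q) : Gen A ω k t σ := by
  obtain ⟨x, -, rfl⟩ := h
  trivial

theorem gen_of_corrupted {σ} (h : σ.signer ∈ (cf t).corrupted) : Gen A ω k t σ := by
  cases σ with
  | status => exact fun _ => .inl h
  | propose => exact fun _ => .inl h
  | commit => exact fun _ => .inl h
  | _ => trivial

theorem gen_of_slot {k'} (hk : k' ≠ k) (m σ) (h : σ ∈ blaSigs k' m) : Gen A ω k t σ := by
  have hc : ∀ q C, σ ∈ certSigs k' q C → Gen A ω k t σ := by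
    rintro q C ⟨x, -, rfl⟩
    exact fun e => absurd e hk
  cases m with
  | status =>
    rcases h with rfl | h | h
    exacts [fun e => absurd e hk, gen_pairSigs _ σ h, hc _ _ h]
  | propose =>
    rcases h with rfl | ⟨j, v, -, rfl | h | h⟩
    exacts [fun e => absurd e hk, fun e => absurd e hk, gen_pairSigs _ σ h, hc _ _ h]
  | commit =>
    rcases h with rfl | h
    exacts [fun e => absurd e hk, gen_pairSigs _ σ h]
  | notify => exact h.elim (gen_pairSigs _ σ) (hc _ _)

theorem leaderPair_of {b : BlaState n Tx} {q : SPair n Tx} (h : b.leaderPair = some q) {p}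
    (hp : ∀ p', b.known b.iter = some p' → p' = p) : b.res p = some q := by
  obtain ⟨p', h1, h2⟩ := bind_eq_some_iff.1 h
  simp_all

theorem sound_mid {q} (hs : Sound (Gen A ω k (tu k q)) k (sl tu k q i k).bla) :
    Sound (Gen A ω k (tu k q)) k (mid A ω k i q) := by
  refine Sound.finAt ?_ _
  rcases started_cases pa k (pa.unit k q) (sl tu k q i k) with h1 | ⟨-, h1⟩
  · rwa [h1]
  · rw [h1]
    exact ⟨hs.log, fun σ ⟨x, hx, _⟩ => absurd hx (notMem_empty x), hs.graded⟩

variable (h : SyncRun A ω)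
include h

theorem post_leaderPair {L} {q : SPair n Tx} (hq : 5 * L + 3 < pa.κ)
    (hi : i ∉ (cf (tu k (5 * L + 3))).corrupted)
    (hl : (post A ω k i (5 * L + 3)).leaderPair = some q) :
    resAt A ω k i L (ω.2 (k, L + 1)) = some q := by
  refine leaderPair_of hl fun p hp => ?_
  rw [(post_state h (by omega) hq hi).1, (post_phase h (by omega) hq hi).1, (phase_frame _ _ _ _ _).2.2.1,
    (mid_log A ω i k _).2] at hp
  exact known_eq h.sync hi hp

/-- All signatures that occur in slot `k` until the deadline of block agreement. -/
theorem gen_all (ht : (cf t).time ≤ pa.D k) :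
    (∀ p ∈ (cf t).net, ∀ σ ∈ (SMR).sigs p.msg, Gen A ω k t σ) ∧
      ∀ i, i ∉ (cf t).corrupted → Sound (Gen A ω k t) k (sl t i k).bla := by
  induction t with
  | zero =>
    exact ⟨fun p hp => (nomatch hp), fun i _ => ⟨fun x hx => (nomatch hx),
      fun σ ⟨x, hx, _⟩ => absurd hx (notMem_empty x), fun v hv => nomatch hv⟩⟩
  | succ t ih =>
    have htm := time_mono (A := A) (ω := ω) t.le_succ
    obtain ⟨ih1, ih2⟩ := ih (htm.trans ht)
    have key : ∀ i, i ∉ (cf t).corrupted → ∃ ms ls, Emits A ω i k t ms ls ∧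
        (∀ x ∈ ms, ∀ σ ∈ blaSigs k x.2, Gen A ω k (t + 1) σ) ∧
        Sound (Gen A ω k (t + 1)) k (sl (t + 1) i k).bla := by
      intro i hi
      have hs := ih2 i hi
      have hs' := hs.mono fun σ => Gen.mono (t := t + 1) t.le_succ
      obtain ⟨ms, ls, he, ⟨-, h1, h2, -⟩ | ⟨h1, h2, -, h3, h4, -⟩⟩ := slot_step h.sync hi k
      · refine ⟨ms, ls, he, ?_⟩
        generalize (sl (t + 1) i k).bla = b' at h2
        cases h2 with
        | idle => simp_all
        | recv j m hm =>
          refine ⟨fun x hx => (not_mem_nil hx).elim, fun x hx σ hσ => ?_, hs'.cur, hs'.graded⟩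
          rcases mem_append.1 hx with hx | hx
          · grind [Sound.log]
          · obtain rfl := List.mem_singleton.1 hx
            refine Gen.mono t.le_succ ?_
            have hσ' := hσ
            rcases hm with ⟨p, hp, -, -, hpm⟩ | ⟨-, hm⟩
            · exact ih1 p hp σ (by rwa [hpm])
            · rcases hm σ hσ' with hm | ⟨p, hp, hm⟩
              exacts [gen_of_corrupted hm, ih1 p hp σ hm]
        | leader l =>
          rw [BlaState.onLeader]
          split_ifs with h3 h4
          · refine ⟨fun x hx σ hσ => ?_, hs'.log, hs'.cur, hs'.graded⟩
            have h5 : pa.T k + pa.Δ < (cf t).time := by grind [before_start, SyncRun.sync]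
            obtain ⟨q, h6, h7, h8⟩ := exists_unit h h5 (htm.trans ht)
            have hc := core_of_unit h hi h6.le h7 h8
            obtain ⟨L, r, hr, rfl⟩ : ∃ L r, r < 5 ∧ q = 5 * L + r := ⟨q / 5, q % 5, by omega, by omega⟩
            obtain ⟨a1, -, a3, -, -, a6⟩ := post_state h hr h6 (nc_of_le hi h7.le)
            have b1 : (sl t i k).bla.iter = (post A ω k i (5 * L + r)).iter :=
              (congrArg BlaState.iter hc :)
            have b2 : (sl t i k).bla.called = (post A ω k i (5 * L + r)).called :=
              (congrArg BlaState.called hc :)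
            have b3 : (sl t i k).bla.res = (post A ω k i (5 * L + r)).res :=
              (congrArg BlaState.res hc :)
            have hr3 := a3.1 (b2.symm.trans h4.1)
            obtain rfl : l = L + 1 := by omega
            simp [BlaState.commits] at hx
            split at hx
            · rename_i q hq
              obtain ⟨j, -, rfl⟩ := mem_map.1 hx
              rcases hσ with rfl | hσ
              · intro _
                refine .inr ⟨L, h4.2, ?_, ?_⟩
                · exact (unit_le (by omega)).trans_lt (((h.sync.lt_time_iff _ _).2 h7).trans_le htm)
                · have := leaderPair_of hq (p := ω.2 (k, L + 1)) fun p' hp => by simp_all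
                  grind [resAt]
              grind [gen_pairSigs]
            · cases hx
          · exact ⟨fun x hx => (not_mem_nil hx).elim, hs'.log, hs'.cur, hs'.graded⟩
          simp_all
      · refine ⟨ms, ls, he, ?_⟩
        rw [h3, h4]
        rcases tick_cases h hi (k := k) (by omega) with h5 | ⟨q, hq, h5⟩
        · grind
        · rw [h5] at h1 h2 ⊢
          subst h1
          have hm := (sound_mid hs).mono fun σ => Gen.mono (t := (tu k q) + 1) (Nat.le_succ _)
          rw [(post_eq h.sync h.atMost h.ts h.Δ h.κ hq.le hi).2.1, if_pos hq]
          obtain ⟨L, r, hr, rfl⟩ : ∃ L r, r < 5 ∧ q = 5 * L + r := ⟨q / 5, q % 5, by omega, by omega⟩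
          rw [show (5 * L + r) / 5 = L by omega, show (5 * L + r) % 5 = r by omega]
          have hpp := (post_phase h hr hq hi).1
          refine (hm.phase (i := i) (l := L + 1) (r := r) (s := pa.ts) (fun q => gen_pairSigs q) ?_ ?_ ?_).symm
          · rintro rfl p -
            refine .inr ⟨L, rfl, ?_⟩
            change _ = (post A ω k i (5 * L + 0)).cur
            rw [hpp]
            rfl
          · rintro rfl -
            exact .inr ⟨L, rfl, rfl⟩
          · rintro rfl q hq' -
            rw [← hpp] at hq'
            have h6 := (post_state h hr hq hi).1
            refine .inr ⟨L, ?_, by omega, post_leaderPair h hq hi hq'⟩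
            rwa [hpp] at h6
    refine ⟨fun p hp σ hσ => ?_, fun i hi => ?_⟩
    · have hp' := hp
      rcases mem_apply_net.1 hp' with hp' | ⟨i, hi, x, -, hx⟩
      · exact Gen.mono t.le_succ (ih1 p hp' σ hσ)
      · obtain ⟨ms, ls, he, h1, -⟩ := key i hi.2
        obtain ⟨d, m⟩ := x
        have hm : p.msg = m := by rw [hx]
        rw [hm] at hσ
        cases m with
        | buf k' i b =>
          obtain rfl := hσ
          trivial
        | bla k' m =>
          by_cases hk : k' = k
          · subst hk
            rw [hx] at hp
            rcases (he.1 d m _).1 hp with hp | hp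
            · exact Gen.mono t.le_succ (ih1 _ hp σ hσ)
            · exact h1 _ hp.2 σ hσ
          · exact gen_of_slot hk m σ hσ
        | bc k' j m =>
          obtain ⟨σ', -, rfl⟩ := hσ
          trivial
        | ba k' j m =>
          obtain ⟨σ', -, rfl⟩ := hσ
          trivial
    · obtain ⟨ms, ls, -, -, h1⟩ := key i (nc_of_le hi t.le_succ)
      exact h1

end Signatures

/-! ## Agreement on the outputs of block agreement -/

section Lock

variable {j g : Fin n} {L : ℕ}

variable (A ω) in
/-- Party `i` is not corrupted before the `q`th time unit of block agreement in slot `k`. -/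
abbrev Free (k q : ℕ) (i : Fin n) : Prop := i ∉ (cf (tu k q)).corrupted

variable (A ω) in
/-- The pair `x` is the result of an honest party for the leader of iteration `L + 1`. -/
def Result (k L : ℕ) (x : SPair n Tx) : Prop :=
  ∃ i, Free A ω k (5 * L + 3) i ∧ resAt A ω k i L (ω.2 (k, L + 1)) = some x

theorem Proposal.best_eq_some {m : Proposal n Tx} {x} (h : m.best = some x) :
    ∃ j v, m j = some v ∧ v.pair = x ∧ ∀ j' v', m j' = some v' → v'.k ≤ v.k := by
  obtain ⟨v, hv, rfl⟩ := map_eq_some_iff.1 h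
  obtain ⟨h1, h2, -⟩ := List.mem_argmax_iff.1 (mem_def.2 hv)
  grind

theorem mid_proposal {q l p} {m : Proposal n Tx} (hm : (mid A ω k i q).proposalOf pa.ts l p = some m) :
    (p, BlaMsg.propose l p m) ∈ (sl tu k q i k).bla.log ∧ GoodProposal pa.ts m := by grind [mid_log, mem_of_proposalOf]

theorem lt_of_unit_lt {q q'} (hq : pa.unit k q < pa.unit k q') : q < q' :=
  not_le.1 fun h' => absurd (unit_le h') (not_le.2 hq)

theorem started_out (τ) (x : Slot) : (started pa k τ x).out = x.bla.out := by grind [started_cases]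

variable (h : SyncRun A ω)
include h

theorem Free.of_le {q q'} (hi : Free A ω k q' i) (hq : q ≤ q') : Free A ω k q i := nc_of_le hi (tk_le h hq)

theorem time_unit (q) : (cf (tu k q)).time = pa.unit k q := (h.sync.time_tickAt _).1

/-- A majority contains an honest party. -/
theorem exists_free {J : Finset (Fin n)} (hJ : n < 2 * J.card) (t) : ∃ j ∈ J, j ∉ (cf t).corrupted := by
  by_contra! hn
  have h1 := (card_le_card fun j hj => hn j hj).trans (h.atMost t)
  have := h.ts
  omega

/-- A message sent at one time unit has arrived at the next one. -/
theorem log_of_emits {q} {ms ls d m} (he : Emits A ω i k (tu k q) ms ls) (hm : (d, m) ∈ ms)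
    (hd : Free A ω k (q + 1) d) : (i, m) ∈ (sl tu k (q + 1) d k).bla.log := by
  refine log_of_packet h.sync hd ((he.1 d m _).2 (.inr ⟨rfl, hm⟩)) (Nat.succ_le_of_lt (tk_succ h q)) ?_ le_rfl
  rw [(h.sync.time_tickAt _).2.2, unit_succ]
  omega

theorem gen_log {q} (hq : q ≤ pa.κ) (hi : Free A ω k q i) {x} (hx : x ∈ (sl tu k q i k).bla.log) :
    ∀ σ ∈ blaSigs k x.2, Gen (Bc := Bc) (Ba := Ba) A ω k (tu k q) σ :=
  ((gen_all h (t := (tu k q)) (by rw [time_unit h]; exact unit_le hq)).2 i hi).log x hx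

/-- The proposal of `p` that is accepted, unless there is another one. -/
theorem resAt_eq (hq : 5 * L + 3 < pa.κ) (hi : Free A ω k (5 * L + 3) i) (p) :
    resAt A ω k i L p = match (mid A ω k i (5 * L + 2)).proposalOf pa.ts (L + 1) p with
      | none => none
      | some m => if ∃ j m', (j, BlaMsg.propose (L + 1) p m') ∈
          (sl tu k (5 * L + 3) i k).bla.log ∧ GoodProposal pa.ts m' ∧ m' ≠ m
        then none else m.best := by
  have hc := mid_core h (q := 5 * L + 2) (by omega) (by omega) hi
  have h1 : (mid A ω k i (5 * L + 3)).prop = (post A ω k i (5 * L + 2)).prop :=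
    (congrArg BlaState.prop hc :)
  rw [resAt, (post_phase h (by omega) hq hi).1, ← (mid_log A ω i k _).1]
  grind [BlaState.phase, post_phase, Free.of_le]

theorem of_resAt (hq : 5 * L + 3 < pa.κ) (hi : Free A ω k (5 * L + 3) i) {p x}
    (hx : resAt A ω k i L p = some x) : ∃ m : Proposal n Tx,
      (mid A ω k i (5 * L + 2)).proposalOf pa.ts (L + 1) p = some m ∧ m.best = some x ∧
      ∀ j m', (j, BlaMsg.propose (L + 1) p m') ∈
        (sl tu k (5 * L + 3) i k).bla.log → GoodProposal pa.ts m' → m' = m := by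
  rw [resAt_eq h hq hi] at hx
  split at hx
  · cases hx
  · split_ifs at hx with h1
    grind

theorem resAt_unique (hq : 5 * L + 3 < pa.κ) (hi : Free A ω k (5 * L + 3) i)
    (hj : Free A ω k (5 * L + 3) j) {p x y}
    (hx : resAt A ω k i L p = some x) (hy : resAt A ω k j L p = some y) : x = y := by
  obtain ⟨m, h1, h2, -⟩ := of_resAt h hq hi hx
  obtain ⟨m', h4, h5, h6⟩ := of_resAt h hq hj hy
  have he := (post_phase h (by omega) (by omega) (hi.of_le h (by omega : 5 * L + 2 ≤ _))).2
  have h7 := log_of_emits h (d := j) (m := .propose (L + 1) p m) he (by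
    refine List.mem_flatMap.2 ⟨p, List.mem_finRange p, ?_⟩
    dsimp only
    rw [h1]
    exact List.mem_map.2 ⟨j, List.mem_finRange j, rfl⟩) hj
  obtain rfl := h6 _ _ h7 (mid_proposal h1).2
  simp_all

theorem Result.unique (hq : 5 * L + 3 < pa.κ) {x y} (hx : Result A ω k L x)
    (hy : Result A ω k L y) : x = y := by
  obtain ⟨i, hi, hx⟩ := hx
  obtain ⟨j, hj, hy⟩ := hy
  grind [resAt_unique]

theorem result_of_cert {x : SPair n Tx} {C : Finset (Fin n × ℕ)}
    (hg : ∀ σ ∈ certSigs k x C, Gen (Bc := Bc) (Ba := Ba) A ω k t σ) (hC : n < 2 * (C.image Prod.fst).card) :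
    ∃ y ∈ C, ∃ L, y.2 = L + 1 ∧ pa.unit k (5 * L + 3) < (cf t).time ∧ Result A ω k L x := by
  obtain ⟨i, hi, hc⟩ := exists_free h hC t
  obtain ⟨y, hy, rfl⟩ := mem_image.1 hi
  obtain ⟨L, h1, h2, h3⟩ := (hg _ ⟨y, hy, rfl⟩ rfl).resolve_left hc
  exact ⟨y, hy, L, h1, h2, y.1, nc_of_le hc ((h.sync.lt_time_iff _ _).1 h2).le, h3⟩

theorem of_graded (hq : 5 * L + 4 < pa.κ) (hi : Free A ω k (5 * L + 4) i) {v}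
    (hv : (post A ω k i (5 * L + 4)).graded = some v) :
    v.k = L + 1 ∧ Valid pa.ts v.pair ∧ IsCert (L + 1) v.cert ∧ Result A ω k L v.pair ∧
      ∃ ms ls, Emits A ω i k (tu k (5 * L + 4)) ms ls ∧
        ∀ d, (d, BlaMsg.notify (L + 1) v.pair v.cert) ∈ ms := by
  obtain ⟨hp, he⟩ := post_phase h (by omega) hq hi
  have hc := mid_core h (q := 5 * L + 3) (by omega) (by omega) hi
  have hi' := hi.of_le h (by omega : 5 * L + 3 ≤ 5 * L + 4)
  obtain ⟨a1, -, -, a4, -, -⟩ := post_state h (by omega : 3 < 5) (by omega) hi'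
  have b1 : (mid A ω k i (5 * L + 4)).iter = L + 1 := (congrArg BlaState.iter hc :).trans a1
  have b4 : (mid A ω k i (5 * L + 4)).graded = none := (congrArg BlaState.graded hc :).trans (a4 (by omega))
  have b6 : (mid A ω k i (5 * L + 4)).res = (post A ω k i (5 * L + 3)).res := (congrArg BlaState.res hc :)
  rw [hp] at hv
  simp [BlaState.phase] at hv
  split at hv
  · simp_all
  · rename_i x hx
    split_ifs at hv with h1
    · cases hv
      refine ⟨rfl, h1.2, ⟨fun y hy => ?_, ?_⟩, ⟨i, hi', ?_⟩, _, _, he, fun d => ?_⟩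
      · grind
      · rw [image_image]
        change n < 2 * (image id _).card
        simp_all
      · rw [resAt, ← b6]
        refine leaderPair_of hx fun p hp => ?_
        rw [b1, (mid_log A ω i k _).2] at hp
        exact known_eq h.sync hi hp
      · simp [BlaState.phase]
        rw [hx]
        dsimp only
        rw [if_pos h1]
        exact List.mem_map.2 ⟨d, List.mem_finRange d, rfl⟩
    simp_all

theorem iteration_end (hq : 5 * L + 5 ≤ pa.κ) (hi : Free A ω k (5 * L + 5) i) :
    mid A ω k i (5 * L + 5) = (sl tu k (5 * L + 5) i k).bla.finish pa.ts ∧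
      (sl tu k (5 * L + 5) i k).bla.iter = L + 1 ∧
      (sl tu k (5 * L + 5) i k).bla.cur = curAt A ω k i L ∧
      (sl tu k (5 * L + 5) i k).bla.graded = (post A ω k i (5 * L + 4)).graded ∧
      (sl tu k (5 * L + 5) i k).bla.out = (post A ω k i (5 * L + 4)).out := by
  obtain ⟨h1, h2⟩ := mid_succ h (q := 5 * L + 4) hq hi
  obtain ⟨a1, a2, -⟩ := post_state h (L := L) (by omega : 4 < 5) (by omega) (hi.of_le h (by omega))
  refine ⟨h2.trans (if_pos ⟨by omega, by omega⟩), ?_, ?_, ?_, ?_⟩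
  exacts [(congrArg BlaState.iter h1 :).trans a1, (congrArg BlaState.cur h1 :).trans a2,
    (congrArg BlaState.graded h1 :), (congrArg BlaState.out h1 :)]

theorem cur_end (hq : 5 * L + 5 ≤ pa.κ) (hi : Free A ω k (5 * L + 5) i) :
    (∃ C, (mid A ω k i (5 * L + 5)).cur.k = L + 1 ∧ Valid pa.ts (mid A ω k i (5 * L + 5)).cur.pair ∧
      (mid A ω k i (5 * L + 5)).cur.cert = C ∧ IsCert (L + 1) C) ∨
    (mid A ω k i (5 * L + 5)).cur = curAt A ω k i L ∧
      ∀ j x C, (j, BlaMsg.notify (L + 1) x C) ∈ (sl tu k (5 * L + 5) i k).bla.log →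
        Valid pa.ts x → IsCert (L + 1) C → False := by
  obtain ⟨h1, h2, h3, h4, -⟩ := iteration_end h hq hi
  rw [h1, BlaState.finish, h2, h4]
  cases hg : (post A ω k i (5 * L + 4)).graded with
  | some v =>
    obtain ⟨a1, a2, a3, -⟩ := of_graded h (by omega) (hi.of_le h (by omega)) hg
    simp_all
  | none =>
    cases hn : (sl tu k (5 * L + 5) i k).bla.notified pa.ts (L + 1) with
    | some v =>
      grind [mem_of_notified]
    | none =>
      refine .inr ⟨h3, fun j x C hx hv hC => ?_⟩
      have := List.findSome?_eq_none_iff.1 hn _ hx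
      simp_all

theorem curAt_eq (hq : 5 * L < pa.κ) (hi : Free A ω k (5 * L) i) :
    curAt A ω k i L = (mid A ω k i (5 * L)).cur := by
  have := (post_phase h (by omega : 0 < 5) hq hi).1
  change (post A ω k i (5 * L + 0)).cur = _
  rw [this]
  rfl

/-- After an honest party had grade 2, all honest parties hold a certificate of that iteration or of
a later one. -/
theorem le_cur (hg : Free A ω k (5 * L + 4) g) {v}
    (hv : (post A ω k g (5 * L + 4)).graded = some v) {L'} (hL : L ≤ L') (hq : 5 * L' + 5 ≤ pa.κ)
    (hi : Free A ω k (5 * L' + 5) i) : L + 1 ≤ (mid A ω k i (5 * L' + 5)).cur.k := by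
  induction L', hL using Nat.le_induction with
  | base =>
    rcases cur_end h hq hi with ⟨C, h1, -⟩ | ⟨-, h1⟩
    · rw [h1]
    · obtain ⟨-, a2, a3, -, ms, ls, he, a4⟩ := of_graded h (by omega) hg hv
      exact (h1 g _ _ (log_of_emits h he (a4 i) hi) a2 a3).elim
  | succ L' hL ih =>
    rcases cur_end h hq hi with ⟨C, h1, -⟩ | ⟨h1, -⟩
    · omega
    grind [curAt_eq, Free.of_le]

/-- After an honest party had grade 2, there are no other results. -/
theorem result_eq (hg : Free A ω k (5 * L + 4) g) {v : Vote n Tx}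
    (hv : (post A ω k g (5 * L + 4)).graded = some v) {L'} (hL : L ≤ L') (hq : 5 * L' + 4 < pa.κ)
    {x : SPair n Tx} (hx : Result A ω k L' x) : x = v.pair := by
  have hR := (of_graded h (by omega) hg hv).2.2.2.1
  induction L' using Nat.strong_induction_on with
  | _ L' ih =>
    rcases hL.eq_or_lt with rfl | hlt
    · exact hx.unique h (by omega) hR
    obtain ⟨i, hi, hx⟩ := hx
    obtain ⟨m, h1, h2, -⟩ := of_resAt h (by omega) hi hx
    obtain ⟨h3, h4⟩ := mid_proposal h1
    have hi2 := hi.of_le h (by omega : 5 * L' + 2 ≤ 5 * L' + 3)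
    have hG := gen_log h (by omega) hi2 h3
    obtain ⟨j, hj, hc⟩ := exists_free h h4.2 (tu k (5 * L' + 2))
    obtain ⟨w, hw⟩ := isSome_iff_exists.1 (Finset.mem_filter.1 hj).2
    obtain ⟨L₁, h5, h6⟩ := (hG _ (.inr ⟨j, w, hw, .inl rfl⟩) rfl).resolve_left hc
    obtain rfl : L' = L₁ := by omega
    obtain ⟨j', u, h7, rfl, h8⟩ := Proposal.best_eq_some h2
    have hj5 : Free A ω k (5 * L') j := Free.of_le h hc (by omega)
    have hk : L + 1 ≤ w.k := by
      rw [h6, curAt_eq h (by omega) hj5]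
      obtain ⟨M, rfl⟩ : ∃ M, L' = M + 1 := ⟨L' - 1, by omega⟩
      exact le_cur h hg hv (by omega) (by omega) hj5
    have hk' := hk.trans (h8 j w hw)
    obtain ⟨-, hgood⟩ := h4.1 j' u h7
    obtain ⟨hge, hmaj⟩ := hgood.resolve_left (by omega)
    obtain ⟨y, hy, L₂, h9, h10, h11⟩ := result_of_cert h
      (fun σ hσ => hG σ (.inr ⟨j', u, h7, .inr (.inr hσ)⟩)) hmaj
    rw [time_unit h] at h10
    have h12 := lt_of_unit_lt h10
    grind

variable (A ω) in
def Decided (k : ℕ) (x : SPair n Tx) : Prop := ∃ L g v, 5 * L + 5 ≤ pa.κ ∧ Free A ω k (5 * L + 4) g ∧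
    (post A ω k g (5 * L + 4)).graded = some v ∧ v.pair = x

theorem Decided.valid {x} (hx : Decided A ω k x) : Valid pa.ts x := by
  obtain ⟨L, g, v, h1, h2, h3, rfl⟩ := hx
  exact (of_graded h (by omega) h2 h3).2.1

theorem Decided.unique {x y} (hx : Decided A ω k x) (hy : Decided A ω k y) : x = y := by
  obtain ⟨L, g, v, h1, h2, h3, rfl⟩ := hx
  obtain ⟨L', g', v', h1', h2', h3', rfl⟩ := hy
  rcases le_total L L' with hL | hL
  · exact (result_eq h h2 h3 hL (by omega) (of_graded h (by omega) h2' h3').2.2.2.1).symm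
  · exact result_eq h h2' h3' hL (by omega) (of_graded h (by omega) h2 h3).2.2.2.1

theorem decided_of_out (hi : i ∉ (cf t).corrupted) {x}
    (hx : (sl t i k).bla.out = some x) : Decided A ω k x := by
  induction t with
  | zero => cases hx
  | succ t ih =>
    have hi' := nc_of_le hi t.le_succ
    obtain ⟨ms, ls, -, ⟨-, -, h1, -⟩ | ⟨h0, -, -, h1, -⟩⟩ := slot_step h.sync hi' k
    · exact ih hi' ((congrArg BlaState.out h1.grows.2 :).symm.trans hx)
    · have hsame : blaTick pa i k (cf t).time (sl t i k) = ((sl t i k).bla, [], []) →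
          Decided A ω k x := fun h2 => by grind
      have hunit : ∀ q ≤ pa.κ, (cf t).time = pa.unit k q → Decided A ω k x := by
        intro q hq h2
        rw [h2] at h0
        subst h0
        change (post A ω k i q).out = some x at hx
        have h3 : (post A ω k i q).out = (mid A ω k i q).out := by
          obtain ⟨-, h3, h4⟩ := post_eq h.sync h.atMost h.ts h.Δ h.κ hq hi'
          rw [h4, h3]
          by_cases h5 : q < pa.κ
          · grind [phase_frame]
          · rw [if_neg h5]
        rw [h3] at hx
        by_cases h5 : q % 5 = 0 ∧ 0 < q
        · obtain ⟨L, rfl⟩ : ∃ L, q = 5 * L + 5 := ⟨q / 5 - 1, by omega⟩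
          obtain ⟨b1, b2, -, b4, b5⟩ := iteration_end h hq hi'
          rw [b1, BlaState.finish, b4] at hx
          cases hg : (post A ω k i (5 * L + 4)).graded with
          | some v =>
            simp only [hg] at hx
            cases ho : (sl tu k (5 * L + 5) i k).bla.out with
            | none =>
              rw [ho] at hx
              exact ⟨L, i, v, hq, Free.of_le h hi' (by omega), hg, some.inj hx⟩
            | some y =>
              grind
          | none =>
            grind
        · rw [mid, finAt, if_neg h5, started_out] at hx
          simp_all
      rcases lt_trichotomy (cf t).time (pa.D k) with h2 | h2 | h2
      · grind [tick_cases]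
      · exact hunit _ le_rfl h2
      · refine hsame ?_
        rw [blaTick, started, if_neg (by omega)]
        grind [tick_off]

end Lock

/-! ## Iterations with an honest leader -/

theorem Protocol.requests_mono {n} {In Out : Type} {P : Protocol n In Out} {A : Adversary P}
    {ω : P.Rand} {s t} (h : s ≤ t) (k : P.LKey) :
    (P.cfg A ω s).requests k ⊆ (P.cfg A ω t).requests k := by
  induction t, h using Nat.le_induction with
  | base => simp_all
  | succ t _ ih =>
    refine ih.trans ?_
    rw [cfg_succ, apply_requests]
    cases P.act A ω t with
    | request i k' =>
      simp [base]
      split_ifs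
      · grind
      simp_all
    | _ => grind [base]

section GoodIteration

variable {j p : Fin n} {L : ℕ}

theorem isSome_findSome? {α β : Type} {l : List α} {f : α → Option β} {a : α} {b : β} (ha : a ∈ l)
    (hf : f a = some b) : ∃ c, l.findSome? f = some c := by grind [isSome_iff_exists, List.findSome?_isSome_iff]

variable (h : SyncRun A ω)
include h

theorem good_mid (hq : 5 * L < pa.κ) (hi : Free A ω k (5 * L) i) :
    (mid A ω k i (5 * L)).cur.Good pa.ts := by
  induction L with
  | zero =>
    obtain ⟨x, h1, h2, -⟩ := mid_zero h hi
    rw [h2]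
    exact ⟨h1, .inl rfl⟩
  | succ L ih =>
    rcases cur_end h (L := L) (by omega) hi with ⟨C, h1, h2, h3, h4⟩ | ⟨h1, -⟩
    · rw [← h3] at h4
      exact ⟨h2, .inr ⟨fun x hx => (h1.trans (h4.1 x hx).symm).le, h4.2⟩⟩
    grind [curAt_eq, Free.of_le]

theorem honest_majority : n < 2 * (univ.filter ((SMR).Honest A ω)).card := by
  have h1 := honest_card h.atMost
  have h2 := h.ts
  omega

theorem goodProposal_propAt (hq : 5 * L + 1 < pa.κ) (hp : Free A ω k (5 * L + 1) p) :
    GoodProposal pa.ts (propAt A ω k p L) := by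
  refine ⟨fun j v hv => (mem_of_statusOf hv).2, (honest_majority h).trans_le ?_⟩
  refine Nat.mul_le_mul_left 2 (card_le_card fun j hj => ?_)
  have hj' : Free A ω k (5 * L + 0) j := (Finset.mem_filter.1 hj).2 _
  refine mem_filter.2 ⟨mem_univ j, isSome_iff_exists.2 ?_⟩
  have h1 := log_of_emits h (post_phase h (by omega) (by omega) hj').2
    (List.mem_map.2 ⟨p, List.mem_finRange p, rfl⟩) hp
  rw [← (mid_log A ω p k _).1] at h1
  exact isSome_findSome? h1 (if_pos ⟨rfl, rfl, rfl, rfl, good_mid h (by omega) hj'⟩)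

/-- The result is the same for everybody if the proposer is honest. -/
theorem resAt_of_free (hq : 5 * L + 3 < pa.κ) (hp : Free A ω k (5 * L + 3) p) :
    ∃ x, Valid pa.ts x ∧ ∀ i, Free A ω k (5 * L + 3) i → resAt A ω k i L p = some x := by
  have hp1 := hp.of_le h (by omega : 5 * L + 1 ≤ 5 * L + 3)
  have hg := goodProposal_propAt h (by omega) hp1
  have hne : ∃ x, (propAt A ω k p L).best = some x := by
    cases hb : (propAt A ω k p L).best with
    | some x => simp_all
    | none =>
      obtain ⟨j, hj⟩ := card_pos.1 (Nat.pos_of_mul_pos_left (n.zero_le.trans_lt hg.2))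
      rw [Proposal.best, map_eq_none_iff, List.argmax_eq_none] at hb
      simp_all
  obtain ⟨x, hx⟩ := hne
  refine ⟨x, ?_, fun i hi => ?_⟩
  · obtain ⟨j, v, h1, rfl, -⟩ := Proposal.best_eq_some hx
    exact (hg.1 j v h1).1
  · have huniq : ∀ q ≤ 5 * L + 3, ∀ j m, (j, BlaMsg.propose (L + 1) p m) ∈
        (sl tu k q i k).bla.log → m = propAt A ω k p L := by
      intro q hq' j m hm
      obtain ⟨L₁, h1, h2⟩ := (gen_log h (by omega) (hi.of_le h hq') hm _ (.inl rfl) rfl).resolve_left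
        (hp.of_le h hq')
      simp_all
    have h1 := log_of_emits h (d := i) (m := .propose (L + 1) p (propAt A ω k p L))
      (post_phase h (by omega) (by omega) hp1).2 (by
        have h2 : ((mid A ω k p (5 * L + 1)).phase pa.ts p (L + 1) 1).2.1 =
            toAll (.propose (L + 1) p (propAt A ω k p L)) := if_pos hg
        rw [h2]
        exact List.mem_map.2 ⟨i, List.mem_finRange i, rfl⟩) (hi.of_le h (by omega))
    rw [← (mid_log A ω i k _).1] at h1
    obtain ⟨m, hm⟩ : ∃ m, (mid A ω k i (5 * L + 2)).proposalOf pa.ts (L + 1) p = some m :=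
      isSome_findSome? h1 (if_pos ⟨rfl, rfl, rfl, hg⟩)
    obtain rfl := huniq _ (by omega) _ _ (mid_proposal hm).1
    rw [resAt_eq h hq hi, hm]
    grind

/-- The leader becomes known within one tick. -/
theorem known_leader (hq : 5 * L + 3 < pa.κ) (hi : i ∉ (cf (tk (pa.unit k (5 * L + 3) + 1))).corrupted) :
    (sl (tk (pa.unit k (5 * L + 3) + 1)) i k).bla.known (L + 1) = some (ω.2 (k, L + 1)) := by
  have hlt : tu k (5 * L + 3) < tk (pa.unit k (5 * L + 3) + 1) := h.sync.tickAt_lt (Nat.lt_succ_self _)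
  have hreq : n < 2 * ((cf (tk (pa.unit k (5 * L + 3) + 1))).requests (k, L + 1)).card := by
    refine (honest_majority h).trans_le (Nat.mul_le_mul_left 2 (card_le_card fun j hj => ?_))
    have h1 := ((post_phase h (L := L) (k := k) (by omega : 3 < 5) hq ((Finset.mem_filter.1 hj).2 _)).2.2
      (L + 1)).2 (.inr ?_)
    · exact requests_mono (Nat.succ_le_of_lt hlt) _ h1
    · simp [BlaState.phase]
  have hled := ((h.sync.1 _ _ (h.sync.time_tickAt _).2.1).2.2 i (k, L + 1) hi (by
    unfold leader
    simp_all))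
  obtain ⟨s, h1, h2⟩ := exists_event_of_led hled
  refine (bla_grows h.sync hi (Nat.succ_le_of_lt h1)).known _ _ ?_
  have h3 : (sl (s + 1) i k).bla = ((sl s i k).bla.onLeader i (L + 1) (ω.2 (k, L + 1))).1 :=
    (bla_event (e := .leader (k, L + 1) (ω.2 (k, L + 1))) (fun h => nomatch h) h2
      (nc_of_le hi h1.le)).trans (congrArg Prod.fst (if_pos rfl))
  rw [h3, BlaState.onLeader]
  by_cases h4 : (sl s i k).bla.known (L + 1) = none
  · simp_all
  · rw [if_neg h4]
    obtain ⟨p, hp⟩ := ne_none_iff_exists'.1 h4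
    exact hp.trans (congrArg some (known_eq h.sync (nc_of_le hi h1.le) hp))

/-- Commit messages are sent when the leader is known. -/
theorem commit_sent (hq : 5 * L + 3 < pa.κ) {x} (hi : i ∉ (cf t).corrupted)
    (h1 : tu k (5 * L + 3) < t) (h2 : (cf t).time ≤ pa.unit k (5 * L + 3) + 1)
    (hk : (sl t i k).bla.known (L + 1) = some p) (hx : resAt A ω k i L p = some x) (d) :
    (⟨i, d, .bla k (.commit (L + 1) i x), pa.unit k (5 * L + 3) + 1⟩ : Packet SMR) ∈ (cf t).net := by
  induction t, Nat.succ_le_of_lt h1 using Nat.le_induction with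
  | base =>
    have hi' := nc_of_le hi (Nat.le_succ _)
    obtain ⟨hp, he⟩ := post_phase h (by omega : 3 < 5) hq hi'
    refine (he.1 d _ _).2 (.inr ⟨(h.sync.time_tickAt _).2.2.symm, ?_⟩)
    have a1 := (post_state h (by omega : 3 < 5) hq hi').1
    change (post A ω k i (5 * L + 3)).known (L + 1) = some p at hk
    rw [resAt] at hx
    have h3 : (post A ω k i (5 * L + 3)).leaderPair = some x := by grind [BlaState.leaderPair]
    rw [hp] at h3 a1
    change (d, _) ∈ ((mid A ω k i (5 * L + 3)).phase pa.ts i (L + 1) 3).1.commits i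
    rw [BlaState.commits, h3, a1]
    exact List.mem_map.2 ⟨d, List.mem_finRange d, rfl⟩
  | succ t ht ih =>
    have hi' := nc_of_le hi t.le_succ
    have hgt := (h.sync.lt_time_iff _ _).2 (Nat.lt_of_succ_le ht)
    have hm := time_mono (A := A) (ω := ω) t.le_succ
    have ih := ih hi' ht (hm.trans h2)
    obtain ⟨ms, ls, he, ⟨-, -, h3, -⟩ | ⟨-, h3, -⟩⟩ := slot_step h.sync hi' k
    · by_cases hk' : (sl t i k).bla.known (L + 1) = some p
      · exact (he.1 d _ _).2 (.inl (ih hk'))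
      · refine (he.1 d _ _).2 (.inr ⟨le_antisymm (hgt.trans_le hm) h2, ?_⟩)
        generalize (sl (t + 1) i k).bla = b' at h3 hk
        cases h3 with
        | idle => simp_all
        | recv j m => simp_all
        | leader l =>
          have hc := core_of_unit h hi' hq.le (Nat.lt_of_succ_le ht)
            ((hm.trans h2).trans ((Nat.add_le_add_left h.Δ _).trans (unit_succ k (5 * L + 3)).ge))
          obtain ⟨a1, -, a3, -⟩ := post_state h (by omega : 3 < 5) hq (nc_of_le hi' (Nat.lt_of_succ_le ht).le)
          have b1 : (sl t i k).bla.iter = L + 1 := (congrArg BlaState.iter hc :).trans a1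
          have b2 : (sl t i k).bla.called = true := (congrArg BlaState.called hc :).trans (a3.2 le_rfl)
          have b3 : (sl t i k).bla.res = (post A ω k i (5 * L + 3)).res := (congrArg BlaState.res hc :)
          rw [BlaState.onLeader] at hk ⊢
          by_cases h4 : (sl t i k).bla.known l = none
          · rw [if_pos h4] at hk ⊢
            by_cases hl : L + 1 = l
            · subst hl
              dsimp only at hk ⊢
              rw [if_pos ⟨b2, b1⟩, BlaState.commits, BlaState.leaderPair]
              dsimp only
              rw [b1, hk, b3, bind_some]
              rw [resAt] at hx
              rw [hx]
              exact List.mem_map.2 ⟨d, List.mem_finRange d, rfl⟩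
            simp_all
          simp_all
    · omega

/-- If the leader is honest, everybody has grade 2. -/
theorem graded_of_free (hq : 5 * L + 4 < pa.κ) (hp : Free A ω k (5 * L + 3) (ω.2 (k, L + 1)))
    (hi : Free A ω k (5 * L + 4) i) : ∃ v, (post A ω k i (5 * L + 4)).graded = some v := by
  obtain ⟨x, hv, hx⟩ := resAt_of_free h (by omega) hp
  have hu : pa.unit k (5 * L + 4) = pa.unit k (5 * L + 3) + pa.Δ := unit_succ k (5 * L + 3)
  have hle : pa.unit k (5 * L + 3) + 1 ≤ pa.unit k (5 * L + 4) := hu ▸ Nat.add_le_add_left h.Δ _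
  have hle' := h.sync.tickAt_le hle
  have hlt : tu k (5 * L + 3) < tk (pa.unit k (5 * L + 3) + 1) := h.sync.tickAt_lt (Nat.lt_succ_self _)
  have hc := mid_core h (q := 5 * L + 3) (by omega) (by omega) hi
  have b1 : (mid A ω k i (5 * L + 4)).iter = L + 1 := (congrArg BlaState.iter hc :).trans
    (post_state h (by omega : 3 < 5) (by omega) (hi.of_le h (by omega))).1
  have b6 : (mid A ω k i (5 * L + 4)).res = (post A ω k i (5 * L + 3)).res := (congrArg BlaState.res hc :)
  have hk : (mid A ω k i (5 * L + 4)).known (L + 1) = some (ω.2 (k, L + 1)) := by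
    rw [(mid_log A ω i k _).2]
    exact (bla_grows h.sync hi hle').known _ _ (known_leader h (by omega) (nc_of_le hi hle'))
  have hlp : (mid A ω k i (5 * L + 4)).leaderPair = some x := by
    rw [BlaState.leaderPair, b1, hk, b6]
    exact hx i (hi.of_le h (by omega))
  have hmaj : n < 2 * (univ.filter fun j : Fin n =>
      (j, BlaMsg.commit (L + 1) j x) ∈ (mid A ω k i (5 * L + 4)).log).card := by
    refine (honest_majority h).trans_le (Nat.mul_le_mul_left 2 (card_le_card fun j hj => ?_))
    have hj := (Finset.mem_filter.1 hj).2
    refine Finset.mem_filter.2 ⟨mem_univ j, ?_⟩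
    rw [(mid_log A ω i k _).1]
    refine log_of_packet h.sync hi (commit_sent h (by omega) (hj _) hlt (h.sync.time_tickAt _).1.le
      (known_leader h (by omega) (hj _)) (hx j (hj _)) i) hle' ?_ le_rfl
    omega
  rw [(post_phase h (by omega) hq hi).1]
  simp [BlaState.phase]
  simp_all

theorem out_of_free (hq : 5 * L + 5 ≤ pa.κ) (hp : Free A ω k (5 * L + 3) (ω.2 (k, L + 1)))
    (hi : Free A ω k (5 * L + 5) i) : ∃ x, (mid A ω k i (5 * L + 5)).out = some x := by
  obtain ⟨v, hv⟩ := graded_of_free h (by omega) hp (hi.of_le h (by omega : 5 * L + 4 ≤ _))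
  obtain ⟨h1, -, -, h4, -⟩ := iteration_end h hq hi
  grind [BlaState.finish]

/-- If some iteration has an honest leader, the inputs to the common subset protocol agree. -/
theorem star_of_free (hq : 5 * L + 5 ≤ pa.κ) (hp : Free A ω k (5 * L + 3) (ω.2 (k, L + 1)))
    (hi : i ∉ (cf t).corrupted) {B} (hB : (sl t i k).star = some B) :
    ∃ x, Decided A ω k x ∧ x.1 = B := by
  induction t with
  | zero => cases hB
  | succ t ih =>
    have hi' := nc_of_le hi t.le_succ
    obtain ⟨ms, ls, -, ⟨-, -, -, h1, -⟩ | ⟨h0, -, -, h1, -, -, h2, -⟩⟩ := slot_step h.sync hi' k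
    · simp_all
    · have hout : ∀ {x}, (blaTick pa i k (cf t).time (sl t i k)).1.out = some x →
          Decided A ω k x := fun {x} hx => decided_of_out h hi (by grind)
      rw [h2, tickStar] at hB
      cases hst : (sl t i k).star with
      | some B' =>
        grind
      | none =>
        rw [hst] at hB
        cases ho : (blaTick pa i k (cf t).time (sl t i k)).1.out with
        | some x =>
          grind [Decided.valid]
        | none =>
          rw [ho, filter_none] at hB
          dsimp only at hB
          by_cases h3 : pa.D k ≤ (cf t).time
          · exfalso
            have hle : pa.unit k (5 * L + 5) ≤ (cf t).time := (unit_le hq).trans h3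
            have hle' : tu k (5 * L + 5) ≤ t := by
              rw [h0]
              exact h.sync.tickAt_le hle
            have hfree := nc_of_le hi' hle'
            obtain ⟨x, hx⟩ := out_of_free h hq hp hfree
            have h4 : (post A ω k i (5 * L + 5)).out = some x := by
              obtain ⟨-, h5, h6⟩ := post_eq h.sync h.atMost h.ts h.Δ h.κ hq hfree
              rw [h6, h5]
              by_cases h7 : 5 * L + 5 < pa.κ
              · rw [if_pos h7]
                exact (phase_frame _ _ _ _ _).2.2.2.1.trans hx
              · rwa [if_neg h7]
            have h5 := (bla_grows h.sync hi (Nat.succ_le_succ hle')).out x h4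
            grind
          · rw [if_neg fun h => h3 h.2] at hB
            cases hB

end GoodIteration

/-! ## Consistency in synchronous executions -/

section SyncConsistency

variable {j p : Fin n} {L : ℕ}

def badValid (pa : Params) (A : Adversary (smr pa Bc Ba)) (b k : ℕ) (j : Fin n) : Set (smr pa Bc Ba).Rand :=
  {ω | (RRuns b ((guestBc Bc Ba pa k j).cfg A ω) ∧ RSender ((guestBc Bc Ba pa k j).cfg A ω) j) ∧
    ¬ RValid ((guestBc Bc Ba pa k j).cfg A ω) j}

variable (h : SyncRun A ω)
include h

open Filter in
theorem slotConsistent_sync (hts : pa.ta + 2 * pa.ts < n) (hq : 5 * L + 5 ≤ pa.κ)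
    (hp : Free A ω k (5 * L + 3) (ω.2 (k, L + 1))) (hv : ∀ j, ω ∉ badValid pa A pa.ts k j) :
    SlotConsistent SMR A ω k := by
  have has := h.sync.async
  have hs2 := h.ts
  have hstar : ∀ i, (SMR).Honest A ω i → ∃ t B, (sl t i k).star = some B :=
    fun i hi => exists_star h.Δ (by omega) h.atMost has hi k
  refine slotConsistent_of_acs fun p q hp' hq' t S hS => ?_
  obtain ⟨t₀, B, ht₀⟩ := hstar p hp'
  obtain ⟨x, hx, rfl⟩ := star_of_free h hq hp (hp' t₀) ht₀
  have hsame : ∀ i, (SMR).Honest A ω i → ∃ t, (sl t i k).star = some x.1 := by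
    intro i hi
    obtain ⟨t, B, ht⟩ := hstar i hi
    obtain ⟨y, hy, rfl⟩ := star_of_free h hq hp (hi t) ht
    grind [Decided.unique]
  have hout : ∀ i j, (SMR).Honest A ω i → (SMR).Honest A ω j →
      ∀ᶠ t in atTop, ((sl t i k).bc j).out = some x.1 := by
    intro i j hi hj
    have hG := guestBc_lawful (Bc := Bc) (Ba := Ba) pa k j
    have h1 := not_not.1 fun h' => hv j ⟨rruns_bc h.atMost has.1 k hstar j, h'⟩
    obtain ⟨t, ht⟩ := hsame j hj
    obtain ⟨s, hs⟩ := (bc_out_iff k j i x.1).1 (h1 x.1 ((rhonest_iff hG j).2 hj)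
      ((rbegins_iff hG j _).2 ⟨t, ((slotInv A ω j k t).begun x.1 ht j).trans
        (congrArg some (if_pos rfl))⟩) i ((rhonest_iff hG i).2 hi))
    exact eventually_atTop.2 ⟨s, fun t hst => (advanced A ω i k hst).later.bc_out _ _ hs⟩
  have evC : ∀ i, (SMR).Honest A ω i → ∀ᶠ t in atTop, (sl t i k).C1v pa.ts x.1 := by
    intro i hi
    have : ∀ᶠ t in atTop, ∀ j, (SMR).Honest A ω j → ((sl t i k).bc j).out = some x.1 := by
      refine eventually_all.2 fun j => ?_
      by_cases hj : (SMR).Honest A ω j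
      · simp_all
      simp_all
    refine this.mono fun t h' => ?_
    have h1 := honest_card h.atMost
    have h2 := card_le_card (monotone_filter_right univ fun j _ => h' j)
    grind [C1v]
  obtain ⟨r, h1, h2⟩ := ((evC p hp').and (eventually_ge_atTop t)).exists
  have h3 := (advanced A ω p k h2).later.justified ((slotInv A ω p k t).core.just S hS)
  obtain rfl := h3.eq_of_C1v hts h1
  obtain ⟨s, hs⟩ := hsame q hq'
  obtain ⟨u, h4, h5⟩ := ((evC q hq').and (eventually_ge_atTop s)).exists
  have h6 : (sl u q k).star.isSome := by
    rw [(advanced A ω q k h5).star _ hs]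
    rfl
  obtain ⟨S', hS'⟩ := isSome_iff_exists.1 (((slotInv A ω q k u).settled h6).exit (.inl ⟨_, h4⟩))
  exact ⟨u, by rw [hS', ((slotInv A ω q k u).core.just S' hS').eq_of_C1v hts h4]⟩

/-- When honest parties call the leader election. -/
theorem of_request (hi : i ∉ (cf t).corrupted) (ht : (cf t).time ≤ pa.D k) {l}
    (hr : i ∈ (cf t).requests (k, l)) : ∃ L, l = L + 1 ∧ (tu k (5 * L + 3)) < t := by
  induction t with
  | zero => exact absurd hr (notMem_empty i)
  | succ t ih =>
    have hi' := nc_of_le hi t.le_succ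
    have htm := time_mono (A := A) (ω := ω) t.le_succ
    obtain ⟨ms, ls, he, h1⟩ := slot_step h.sync hi' k
    rcases (he.2 l).1 hr with hr | hm
    · exact (ih hi' (htm.trans ht) hr).imp fun L h => ⟨h.1, h.2.trans t.lt_succ_self⟩
    · obtain ⟨h1, -⟩ | ⟨h1, h2, -, -, -, h3, -⟩ := h1
      · simp_all
      · rcases tick_cases h hi' (k := k) (by omega) with h4 | ⟨q, hq, h4⟩
        · grind
        · rw [h4] at h1 h3
          subst h1
          rw [h3, (post_eq h.sync h.atMost h.ts h.Δ h.κ hq.le hi').2.1, if_pos hq] at hm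
          dsimp only at hm
          split_ifs at hm with h5
          · refine ⟨q / 5, List.mem_singleton.1 hm, ?_⟩
            have h6 : q % 5 = 3 := by
              by_contra hne
              have := Nat.mod_lt q (by omega : 5 > 0)
              generalize q % 5 = r at *
              rcases r with _ | _ | _ | _ | _ | r
              · cases h5
              · cases h5
              · cases h5
              · omega
              · grind [BlaState.phase]
              · omega
            rw [show 5 * (q / 5) + 3 = q by omega]
            omega
          · cases hm

/-- Before the leader of an iteration is elected, no majority has asked for this or a later one. -/
theorem requests_le (hq : 5 * L + 3 ≤ pa.κ) (ht : t ≤ (tu k (5 * L + 3))) {l} (hl : L < l) :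
    2 * ((cf t).requests (k, l)).card ≤ n := by
  have h1 : (cf t).requests (k, l) ⊆ (cf t).corrupted := by
    intro i hr
    by_contra hi
    obtain ⟨L', rfl, h2⟩ := of_request h hi (((time_mono ht).trans
      (h.sync.time_tickAt _).1.le).trans (unit_le hq)) hr
    exact absurd ((tk_le h (by omega : 5 * L + 3 ≤ 5 * L' + 3)).trans_lt (h2.trans_le ht)) (lt_irrefl _)
  have h2 := (card_le_card h1).trans (h.atMost t)
  have := h.ts
  omega

end SyncConsistency

end Replication

section Negligibility

/-- Probabilities that are bounded by a negligible function. -/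
def Rare {ι : ℕ → Type} (f : ∀ κ, ι κ → ENNReal) : Prop :=
  ∃ ε, Negligible ε ∧ ∀ κ x, f κ x ≤ ENNReal.ofReal (ε κ)

theorem Negligible.abs {ε} (h : Negligible ε) : Negligible fun κ => |ε κ| := by
  intro m
  have := (h m).abs
  simp_all

theorem Rare.add {ι : ℕ → Type} {f g : ∀ κ, ι κ → ENNReal} (hf : Rare f) (hg : Rare g) :
    Rare fun κ x => f κ x + g κ x := by
  obtain ⟨ε, h1, h2⟩ := hf
  obtain ⟨δ, h3, h4⟩ := hg
  refine ⟨_, h1.abs.add h3.abs, fun κ x => (add_le_add (h2 κ x) (h4 κ x)).trans ?_⟩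
  exact le_trans (add_le_add (ENNReal.ofReal_le_ofReal (le_abs_self _))
    (ENNReal.ofReal_le_ofReal (le_abs_self _))) ((ENNReal.ofReal_add (abs_nonneg _) (abs_nonneg _)).ge)

theorem Rare.sum {ι : ℕ → Type} {J : Type*} [Fintype J] {f : J → ∀ κ, ι κ → ENNReal}
    (hf : ∀ j, Rare (f j)) : Rare fun κ x => ∑ j, f j κ x := by
  have : ∀ s : Finset J, Rare fun κ x => ∑ j ∈ s, f j κ x := by
    intro s
    induction s using Finset.induction_on with
    | empty => exact ⟨0, Asymptotics.superpolynomialDecay_zero _ _, fun κ x => by simp⟩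
    | insert j s hj ih => simpa [Finset.sum_insert hj] using (hf j).add ih
  exact this _

end Negligibility

section AsyncProbability

variable {n : ℕ} [NeZero n] {Tx : Type} {ta ts : ℕ}
  {Bc : ℕ → Fin n → AsyncProtocol n (Option (Finset Tx)) (Finset Tx)}
  {Ba : ℕ → AsyncProtocol n Bool Bool}

variable (Bc Ba ta ts) in
structure Game (κ : ℕ) : Type where
  Δ : ℕ
  pos : 0 < Δ
  adv : Adversary (smr ⟨ta, ts, κ, Δ⟩ (Bc κ) (Ba κ))
  slot : ℕ

abbrev Game.law {κ : ℕ} (x : Game ta ts Bc Ba κ) : Measure (smr ⟨ta, ts, κ, x.Δ⟩ (Bc κ) (Ba κ)).Rand :=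
  (smr ⟨ta, ts, κ, x.Δ⟩ (Bc κ) (Ba κ)).law

theorem rare_badBc {b} (h : BcastConsistent b Bc) (j) :
    Rare fun κ (x : Game ta ts Bc Ba κ) => x.law (badBc _ x.adv b x.slot j) := by
  obtain ⟨ε, h1, h2⟩ := h
  exact ⟨ε, h1, fun κ x => law_bcast_consistent (guestBc_lawful _ _ j) (local_smr _) x.adv (h2 κ j)⟩

theorem rare_badBa {b} (h : BAConsistent b Ba) (j) :
    Rare fun κ (x : Game ta ts Bc Ba κ) => x.law (badBa _ x.adv b x.slot j) := by
  obtain ⟨ε, h1, h2⟩ := h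
  exact ⟨ε, h1, fun κ x => law_ba_consistent (guestBa_lawful _ _ j) (local_smr _) x.adv (h2 κ)⟩

theorem rare_badInput {b} (h : BAValid b Ba) (z) :
    Rare fun κ (x : Game ta ts Bc Ba κ) => x.law (badInput _ x.adv b x.slot z) := by
  obtain ⟨ε, h1, h2⟩ := h
  refine ⟨ε, h1, fun κ x => ?_⟩
  by_cases hz : z.2.2.card ≤ b ∧ z.2.1 ∉ z.2.2
  · exact (measure_mono fun ω hω => hω.2).trans
      (law_ba_input (guestBa_lawful _ _ z.1) (local_smr _) x.adv (h2 κ) hz.1 hz.2)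
  · refine (measure_mono_null (fun ω hω => hz hω.1) measure_empty).trans_le zero_le

theorem consistentAsync (hle : ta ≤ ts) (hts : ta + 2 * ts < n) (hBc : BcastConsistent ta Bc)
    (hBa : BASecure ta Ba) :
    ConsistentAsync ta (fun κ Δ => smr ⟨ta, ts, κ, Δ⟩ (Bc κ) (Ba κ)) := by
  have h := ((Rare.sum fun j => rare_badBc (ta := ta) (ts := ts) (Ba := Ba) hBc j).add
    (Rare.sum fun j => rare_badBa (ta := ta) (ts := ts) (Bc := Bc) hBa.2.1 j)).add
    (Rare.sum fun z => rare_badInput (ta := ta) (ts := ts) (Bc := Bc) hBa.1 z)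
  obtain ⟨ε, h1, h2⟩ := h
  refine ⟨ε, h1, fun κ Δ hΔ A k => le_trans ?_ (h2 κ ⟨Δ, hΔ, A, k⟩)⟩
  refine (measure_mono (t := ((⋃ j, badBc _ A ta k j) ∪ ⋃ j, badBa _ A ta k j) ∪
    ⋃ z, badInput _ A ta k z) fun ω hω => ?_).trans ((measure_union_le _ _).trans
      (add_le_add ((measure_union_le _ _).trans (add_le_add (measure_iUnion_fintype_le _ _)
        (measure_iUnion_fintype_le _ _))) (measure_iUnion_fintype_le _ _)))
  by_contra hn
  simp at hn
  grind [slotConsistent_async]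

end AsyncProbability

section SyncProbability

theorem negligible_half_pow : Negligible fun κ => (1 / 2) ^ (κ / 5) := by
  intro m
  have h1 := (tendsto_pow_const_mul_const_pow_of_lt_one m (r := 1 / 2) (by norm_num) (by norm_num)).comp
    ((Filter.tendsto_add_atTop_nat 1).comp (Nat.tendsto_div_const_atTop (by norm_num : 5 ≠ 0)))
  have h2 := h1.const_mul (5 ^ m * 2)
  rw [mul_zero] at h2
  refine squeeze_zero (fun κ => by positivity) (fun κ => ?_) h2
  have h3 : (κ : ℝ) ≤ 5 * ((κ / 5 + 1 : ℕ) : ℝ) := by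
    exact_mod_cast (by omega : κ ≤ 5 * (κ / 5 + 1))
  refine (mul_le_mul_of_nonneg_right (pow_le_pow_left₀ (Nat.cast_nonneg κ) h3 m) (by positivity)).trans ?_
  simp only [comp_apply]
  exact le_of_eq (by ring)

variable {n : ℕ} [NeZero n] {Tx : Type} {ta ts : ℕ}
  {Bc : ℕ → Fin n → AsyncProtocol n (Option (Finset Tx)) (Finset Tx)}
  {Ba : ℕ → AsyncProtocol n Bool Bool}

theorem rare_badValid {b} (h : BcastValid b Bc) (j) :
    Rare fun κ (x : Game ta ts Bc Ba κ) => x.law (badValid _ x.adv b x.slot j) := by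
  obtain ⟨ε, h1, h2⟩ := h
  exact ⟨ε, h1, fun κ x => law_bcast_valid (guestBc_lawful _ _ j) (local_smr _) x.adv (h2 κ j)⟩

/-- The event that a corrupted party is elected in every iteration of block agreement. -/
def badLeaders {κ : ℕ} (x : Game ta ts Bc Ba κ) : Set (smr ⟨ta, ts, κ, x.Δ⟩ (Bc κ) (Ba κ)).Rand :=
  {ω | ∀ L < κ / 5, ω.2 (x.slot, L + 1) ∈ caught x.adv (fun l => (x.slot, l + 1)) ts
    (Params.unit ⟨ta, ts, κ, x.Δ⟩ x.slot (5 * L + 3)) L ω}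

theorem rare_badLeaders (hts : 2 * ts ≤ n) :
    Rare fun κ (x : Game ta ts Bc Ba κ) => x.law (badLeaders x) := by
  refine ⟨_, negligible_half_pow, fun κ x => (law_caught_le (local_smr _) x.adv
    (fun l l' h => Nat.succ_injective (Prod.ext_iff.1 h).2) hts _ _).trans_eq ?_⟩
  rw [ENNReal.ofReal_pow (by norm_num), ENNReal.ofReal_div_of_pos two_pos]
  simp

theorem slotConsistent_of_leader {κ} (x) (hts : ta + 2 * ts < n) (h2 : 2 * ts < n) {ω}
    (hA : (smr ⟨ta, ts, κ, x.Δ⟩ (Bc κ) (Ba κ)).AtMost ts x.adv ω)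
    (hs : (smr ⟨ta, ts, κ, x.Δ⟩ (Bc κ) (Ba κ)).Sync x.Δ x.adv ω) (hl : ω ∉ badLeaders x)
    (hv : ∀ j, ω ∉ badValid _ x.adv ts x.slot j) :
    SlotConsistent (smr ⟨ta, ts, κ, x.Δ⟩ (Bc κ) (Ba κ)) x.adv ω x.slot := by
  simp only [badLeaders, Set.mem_ofPred_eq, not_forall] at hl
  obtain ⟨L, hL, hl⟩ := hl
  have hrun : SyncRun x.adv ω := ⟨hs, hA, h2, x.pos, show 0 < κ by omega⟩
  refine slotConsistent_sync hrun hts (L := L) (show 5 * L + 5 ≤ κ by omega) ?_ hv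
  rwa [hs.caught_eq hA fun s hs' l hl' => requests_le hrun (show 5 * L + 3 ≤ κ by omega) hs'
    (Nat.lt_succ_of_le hl')] at hl

theorem consistentSync (hts : ta + 2 * ts < n) (hBc : BcastValid ts Bc) :
    ConsistentSync ts (fun κ Δ => smr ⟨ta, ts, κ, Δ⟩ (Bc κ) (Ba κ)) := by
  obtain ⟨ε, h1, h2⟩ := (Rare.sum fun j => rare_badValid (ta := ta) (ts := ts) (Ba := Ba) hBc j).add
    (rare_badLeaders (ta := ta) (ts := ts) (Bc := Bc) (Ba := Ba) (by omega))
  refine ⟨ε, h1, fun κ Δ hΔ A k => le_trans ?_ (h2 κ ⟨Δ, hΔ, A, k⟩)⟩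
  refine (measure_mono (t := (⋃ j, badValid _ A ts k j) ∪
    badLeaders (⟨Δ, hΔ, A, k⟩ : Game ta ts Bc Ba κ)) fun ω hω => ?_).trans ((measure_union_le _ _).trans
      (add_le_add (measure_iUnion_fintype_le _ _) le_rfl))
  by_contra hn
  simp at hn
  exact hω.2.2 (slotConsistent_of_leader (⟨Δ, hΔ, A, k⟩ : Game ta ts Bc Ba κ) hts (by omega) hω.1
    hω.2.1 hn.2 hn.1)

end SyncProbability

end

end NetSMR

theorem mainTheorem1 (n : ℕ) [NeZero n] (ta ts : ℕ) (hle : ta ≤ ts) (hta : 3 * ta < n)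
    (hts : ta + 2 * ts < n) (Tx : Type)
    (ABA : ℕ → NetSMR.AsyncProtocol n Bool Bool) (hABA : NetSMR.BASecure ta ABA) :
    (∀ Bcast : ℕ → Fin n → NetSMR.AsyncProtocol n (Option (Finset Tx)) (Finset Tx),
      NetSMR.BcastValid ts Bcast → NetSMR.BcastConsistent ta Bcast →
        NetSMR.ConsistentAsync ta (fun κ Δ => NetSMR.smr ⟨ta, ts, κ, Δ⟩ (Bcast κ) (ABA κ)) ∧
        NetSMR.ConsistentSync ts (fun κ Δ => NetSMR.smr ⟨ta, ts, κ, Δ⟩ (Bcast κ) (ABA κ))) ∧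
    NetSMR.ConsistentAsync ta
      (fun κ Δ => NetSMR.smr ⟨ta, ts, κ, Δ⟩ (NetSMR.bracha n (Finset Tx) ts) (ABA κ)) ∧
    NetSMR.ConsistentSync ts
      (fun κ Δ => NetSMR.smr ⟨ta, ts, κ, Δ⟩ (NetSMR.bracha n (Finset Tx) ts) (ABA κ)) := by
  have hB := NetSMR.bracha_bcastConsistent (V := Finset Tx) hle hts
  have hV := NetSMR.bracha_bcastValid (V := Finset Tx) (ts := ts) (n := n) (by omega)
  exact ⟨fun Bcast hv hc => ⟨NetSMR.consistentAsync hle hts hc hABA, NetSMR.consistentSync hts hv⟩,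
    NetSMR.consistentAsync hle hts hB hABA, NetSMR.consistentSync hts hV⟩
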